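/- Let $\Gamma$ be an elementary vinyl graph of level $n$: a closed, upward oriented, trivalent plane graph, obtained by closing up (around an annulus) a vertical stack of slabs consisting of vertical strands and at most one split or merge vertex, with edges labelled by $\ell\colon E(\Gamma)\to\{1,2\}$ such that the thick edge at each vertex is labelled by the sum of the two other labels; $n$ is the sum of the labels at a fixed height. For a split vertex $v$ let $e^l(v),e^r(v)$ be its left and right departing edges. Let $R$ be $\mathbb{Z}$, $\mathbb{Q}$ or $\mathbb{F}_p$ with $p$ prime. Put $\mathscr{D}_R(\Gamma)=\bigotimes_{e\in E(\Gamma)}R[x_1,\dots,x_{\ell(e)}]^{S_{\ell(e)}}$. A decorated graph $\Gamma^d$ is a pure tensor of homogeneous symmetric polynomials $d(e)$. A coloring $c$ assigns to each edge $e$ a set $c(e)\subseteq\{1,\dots,n\}$ of cardinality $\ell(e)$, such that at each vertex the set on the thick edge is the union of the two others, and the sets at each height have union $\{1,\dots,n\}$. Let $$\langle\Gamma^d\rangle_\infty=\sum_{c}\frac{\prod_{e}d(e)\big((x_i)_{i\in c(e)}\big)}{\prod_{v\text{ split}}\ \prod_{i\in c(e^l(v)),\,j\in c(e^r(v))}(x_i-x_j)},$$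 which is a polynomial in $x_1,\dots,x_n$, and let $\langle\Gamma^d\rangle_1$ be its value at $(0,\dots,0)$. Extend these linearly to $\mathscr{D}_R(\Gamma)$, and let $\mathscr{S}_1(\Gamma;R)$ be the quotient of $\mathscr{D}_R(\Gamma)$ by the submodule of all $y$ with $\langle y\cdot\Gamma^d\rangle_1=0$ for every decorated graph $\Gamma^d$. It is graded by $\deg(\Gamma^d)=2\sum_e\deg d(e)-t_\Gamma$, where $t_\Gamma=\sum_{v\text{ split}}\ell(e^l(v))\,\ell(e^r(v))$. The d.u.r. set $\mathit{DUR}(\Gamma)$ consists of the decorated graphs $\Gamma^d$ for which $d(e^r(v))$ is, for every split vertex $v$, the Schur polynomial $s_\lambda$ in $a$ variables of some Young diagram $\lambda$ in the set $T(a,b)$ of diagrams with at most $a=\ell(e^r(v))$ columns and at most $b=\ell(e^l(v))$ rows (with the convention that a row of $i$ boxes gives $e_i$), and $d(e)=1$ on all other edges. Then: 1. $\mathit{DUR}(\Gamma)$ is a homogeneous basis of the graded $R$-module $\mathscr{S}_1(\Gamma;R)$ for $R=\mathbb{Z}$ and for $R=\mathbb{Q}$, and also for $R=\mathbb{F}_p$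 if $p>n$. 2. For every prime $p$, $\mathit{DUR}(\Gamma)$ is a homogeneous basis of the graded $\mathbb{F}_p$-module $\mathbb{F}_p\otimes_{\mathbb{Z}}\mathscr{S}_1(\Gamma;\mathbb{Z})$, the state space over $\mathbb{F}_p$ obtained from the integral one by reduction modulo $p$. -/

import Mathlib

open scoped TensorProduct

noncomputable section

namespace Vinyl

/-! ### Vinyl graphs -/

/-- An elementary horizontal slab of a labelled open vinyl graph, oriented upwards. `straight A`
consists of vertical strands labelled by `A`. In `split A B a b` there are vertical strands `A` to
the left and `B` to the right of one split vertex, at which a strand labelled `a + b` coming from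
below divides into a left strand labelled `a` and a right strand labelled `b`. `merge A B a b` is
the upside-down version of it. -/
inductive Piece : Type
  | straight (A : List ℕ+)
  | split (A B : List ℕ+) (a b : ℕ+)
  | merge (A B : List ℕ+) (a b : ℕ+)

namespace Piece

/-- The labels of the strands at the bottom of a slab, from left to right. -/
def bottom : Piece → List ℕ+
  | straight A => A
  | split A B a b => A ++ (a + b) :: B
  | merge A B a b => A ++ a :: b :: B

/-- The labels of the strands at the top of a slab, from left to right. -/
def top : Piece → List ℕ+
  | straight A => A
  | split A B a b => A ++ a :: b :: B
  | merge A B a b => A ++ (a + b) :: B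

/-- Does the slab contain a split vertex? -/
def isSplit : Piece → Bool
  | split _ _ _ _ => true
  | _ => false

/-- Does the slab contain a merge vertex? -/
def isMerge : Piece → Bool
  | merge _ _ _ _ => true
  | _ => false

/-- The number of vertical strands to the left of the vertex, if there is a vertex. -/
def pos : Piece → ℕ
  | straight _ => 0
  | split A _ _ _ => A.length
  | merge A _ _ _ => A.length

/-- `p.IsStrand j k`: the `j`-th point at the bottom of `p` and the `k`-th point at the top of `p`
(counted from the left, starting with `0`) are joined by a vertical strand of `p`. -/
def IsStrand : Piece → ℕ → ℕ → Prop
  | straight _, j, k => k = j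
  | split A _ _ _, j, k => (j < A.length ∧ k = j) ∨ (A.length < j ∧ k = j + 1)
  | merge A _ _ _, j, k => (j < A.length ∧ k = j) ∨ (A.length + 1 < j ∧ k + 1 = j)

theorem getElem?_of_isStrand {p : Piece} {j k : ℕ} (h : p.IsStrand j k) :
    p.bottom[j]? = p.top[k]? := by
  cases p with
  | straight A => simp only [IsStrand] at h; subst h; rfl
  | split A B a b =>
    rcases h with ⟨h, rfl⟩ | ⟨h, rfl⟩
    · simp [bottom, top, List.getElem?_append_left h]
    · obtain ⟨m, rfl⟩ := Nat.exists_eq_add_of_lt h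
      have e1 : A.length + m + 1 - A.length = m + 1 := by omega
      have e2 : A.length + m + 1 + 1 - A.length = m + 2 := by omega
      rw [bottom, top, List.getElem?_append_right (by omega),
        List.getElem?_append_right (by omega), e1, e2]
      simp
  | merge A B a b =>
    rcases h with ⟨h, rfl⟩ | ⟨h, h'⟩
    · simp [bottom, top, List.getElem?_append_left h]
    · obtain ⟨m, rfl⟩ := Nat.exists_eq_add_of_lt h
      obtain rfl : k = A.length + m + 1 := by omega
      have e1 : A.length + 1 + m + 1 - A.length = m + 2 := by omega
      have e2 : A.length + m + 1 - A.length = m + 1 := by omega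
      rw [bottom, top, List.getElem?_append_right (by omega),
        List.getElem?_append_right (by omega), e1, e2]
      simp

theorem pos_lt_bottom_of_isSplit {p : Piece} (h : p.isSplit = true) :
    p.pos < p.bottom.length := by
  cases p <;> simp_all [isSplit, pos, bottom]

theorem pos_succ_lt_top_of_isSplit {p : Piece} (h : p.isSplit = true) :
    p.pos + 1 < p.top.length := by
  cases p <;> simp_all [isSplit, pos, top]

theorem pos_succ_lt_bottom_of_isMerge {p : Piece} (h : p.isMerge = true) :
    p.pos + 1 < p.bottom.length := by
  cases p <;> simp_all [isMerge, pos, bottom]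

theorem pos_lt_top_of_isMerge {p : Piece} (h : p.isMerge = true) :
    p.pos < p.top.length := by
  cases p <;> simp_all [isMerge, pos, top]

end Piece

/-- A (closed) vinyl graph: a nonempty, cyclically ordered finite sequence of slabs, each glued on
top of the previous one, where the top of the last slab is joined to the bottom of the first one by
the closing strands (addition in `Fin (n + 1)` is cyclic). -/
structure VinylGraph : Type where
  n : ℕ
  piece : Fin (n + 1) → Piece
  glue : ∀ i, (piece i).top = (piece (i + 1)).bottom

namespace VinylGraph

variable (Γ : VinylGraph)

/-- The intersection points of the graph with the bottom lines of the slabs. -/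
def Point : Type := (i : Fin (Γ.n + 1)) × Fin (Γ.piece i).bottom.length

/-- `q` is the upper end and `p` is the lower end of a vertical strand of a slab. -/
def Joined (p q : Γ.Point) : Prop :=
  q.1 = p.1 + 1 ∧ (Γ.piece p.1).IsStrand p.2 q.2

/-- The edges (including closed circles without vertices): classes of points under the equivalence
relation generated by being joined by a strand. -/
def Edge : Type := Quot Γ.Joined

/-- The edge through the `j`-th point of the bottom line of slab `i`. -/
def edgeAt (i : Fin (Γ.n + 1)) (j : ℕ) (h : j < (Γ.piece i).bottom.length) : Γ.Edge :=
  Quot.mk _ ⟨i, ⟨j, h⟩⟩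

/-- The edge through the `j`-th point of the top line of slab `i`. -/
def edgeAbove (i : Fin (Γ.n + 1)) (j : ℕ) (h : j < (Γ.piece i).top.length) : Γ.Edge :=
  Γ.edgeAt (i + 1) j (by rw [← Γ.glue i]; exact h)

theorem label_eq_of_joined (p q : Γ.Point) (h : Γ.Joined p q) :
    (Γ.piece p.1).bottom.get p.2 = (Γ.piece q.1).bottom.get q.2 := by
  obtain ⟨i, j⟩ := p
  obtain ⟨i', k⟩ := q
  obtain ⟨rfl, h⟩ := h
  have := Piece.getElem?_of_isStrand h
  simp only [Γ.glue i] at this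
  rw [List.getElem?_eq_getElem j.2, List.getElem?_eq_getElem k.2] at this
  simpa using this

/-- The label of an edge. -/
def label : Γ.Edge → ℕ :=
  Quot.lift (fun p => ((Γ.piece p.1).bottom.get p.2 : ℕ))
    (fun p q h => by rw [Γ.label_eq_of_joined p q h])

/-- An elementary vinyl graph: all labels are `1` or `2`. -/
def IsElementary : Prop := ∀ e : Γ.Edge, Γ.label e = 1 ∨ Γ.label e = 2

/-- The level: the sum of the labels at a fixed height. -/
def level : ℕ := ((Γ.piece 0).bottom.map (fun a => (a : ℕ))).sum

instance : Finite Γ.Point :=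
  inferInstanceAs (Finite ((i : Fin (Γ.n + 1)) × Fin (Γ.piece i).bottom.length))

instance : Finite Γ.Edge := inferInstanceAs (Finite (Quot Γ.Joined))

instance : Fintype Γ.Edge := Fintype.ofFinite _

/-- The split vertices. -/
abbrev SplitVertex : Type := {i : Fin (Γ.n + 1) // (Γ.piece i).isSplit = true}

/-- The merge vertices. -/
abbrev MergeVertex : Type := {i : Fin (Γ.n + 1) // (Γ.piece i).isMerge = true}

variable {Γ}

/-- The edge arriving at a split vertex from below. -/
def SplitVertex.lower (v : Γ.SplitVertex) : Γ.Edge :=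
  Γ.edgeAt v.1 (Γ.piece v.1).pos (Piece.pos_lt_bottom_of_isSplit v.2)

/-- The edge departing from a split vertex on the left. -/
def SplitVertex.left (v : Γ.SplitVertex) : Γ.Edge :=
  Γ.edgeAbove v.1 (Γ.piece v.1).pos
    (lt_trans (Nat.lt_succ_self _) (Piece.pos_succ_lt_top_of_isSplit v.2))

/-- The edge departing from a split vertex on the right. -/
def SplitVertex.right (v : Γ.SplitVertex) : Γ.Edge :=
  Γ.edgeAbove v.1 ((Γ.piece v.1).pos + 1) (Piece.pos_succ_lt_top_of_isSplit v.2)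

/-- The edge arriving at a merge vertex on the left. -/
def MergeVertex.left (v : Γ.MergeVertex) : Γ.Edge :=
  Γ.edgeAt v.1 (Γ.piece v.1).pos
    (lt_trans (Nat.lt_succ_self _) (Piece.pos_succ_lt_bottom_of_isMerge v.2))

/-- The edge arriving at a merge vertex on the right. -/
def MergeVertex.right (v : Γ.MergeVertex) : Γ.Edge :=
  Γ.edgeAt v.1 ((Γ.piece v.1).pos + 1) (Piece.pos_succ_lt_bottom_of_isMerge v.2)

/-- The edge departing from a merge vertex. -/
def MergeVertex.upper (v : Γ.MergeVertex) : Γ.Edge :=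
  Γ.edgeAbove v.1 (Γ.piece v.1).pos (Piece.pos_lt_top_of_isMerge v.2)

variable (Γ)

/-- The sum over the split vertices of the products of the labels of the two departing edges. -/
def splitDegree : ℕ := ∑ v : Γ.SplitVertex, Γ.label v.left * Γ.label v.right

/-! ### Colorings -/

/-- Colorings of the edges by sets of pigments in `{1, …, level}`. -/
structure IsColoring (c : Γ.Edge → Finset (Fin Γ.level)) : Prop where
  card : ∀ e, (c e).card = Γ.label e
  split : ∀ v : Γ.SplitVertex, c v.lower = c v.left ∪ c v.right
  merge : ∀ v : Γ.MergeVertex, c v.upper = c v.left ∪ c v.right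
  height : ∀ i, (Finset.univ.biUnion fun j : Fin (Γ.piece i).bottom.length =>
    c (Γ.edgeAt i j j.2)) = Finset.univ

/-- The type of colorings. -/
abbrev Coloring : Type := {c : Γ.Edge → Finset (Fin Γ.level) // Γ.IsColoring c}

instance : Fintype Γ.Coloring := Fintype.ofFinite _

end VinylGraph

/-! ### Decorations and the evaluation -/

/-- Symmetric polynomials over `R` in `a` variables. -/
abbrev SymPoly (R : Type*) [CommRing R] (a : ℕ) : Type _ :=
  MvPolynomial.symmetricSubalgebra (Fin a) R

namespace VinylGraph

variable (R : Type*) [CommRing R] (Γ : VinylGraph)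

/-- A choice of a symmetric polynomial in `ℓ(e)` variables on each edge `e`. -/
abbrev PreDecoration : Type _ := (e : Γ.Edge) → SymPoly R (Γ.label e)

variable {R Γ} in
/-- A decoration: the symmetric polynomials on the edges are homogeneous. -/
def IsDecoration (d : Γ.PreDecoration R) : Prop :=
  ∀ e, ∃ m, (d e : MvPolynomial (Fin (Γ.label e)) R).IsHomogeneous m

variable {R Γ} in
/-- The degree of the decorated graph `Γ^d`. -/
def degree (d : Γ.PreDecoration R) : ℤ :=
  2 * ∑ e, ((d e : MvPolynomial (Fin (Γ.label e)) R).totalDegree : ℤ) - Γ.splitDegree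

/-- The algebra `𝒟(Γ)` of decorated graphs: the tensor product over the edges `e` of the rings of
symmetric polynomials in `ℓ(e)` variables. -/
def DecoratedSpace : Type _ := ⨂[R] e : Γ.Edge, SymPoly R (Γ.label e)

instance : CommRing (Γ.DecoratedSpace R) :=
  inferInstanceAs (CommRing (⨂[R] e : Γ.Edge, SymPoly R (Γ.label e)))

instance : Algebra R (Γ.DecoratedSpace R) :=
  inferInstanceAs (Algebra R (⨂[R] e : Γ.Edge, SymPoly R (Γ.label e)))

variable {R Γ} in
/-- The decorated graph `Γ^d`, as an element of `𝒟(Γ)`: the pure tensor of the decorations. -/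
def decorated (d : Γ.PreDecoration R) : Γ.DecoratedSpace R :=
  PiTensorProduct.tprod R d

/-- Decorations on the same edge get multiplied. -/
theorem decorated_mul (d d' : Γ.PreDecoration R) :
    decorated d * decorated d' = decorated (d * d') :=
  PiTensorProduct.tprod_mul_tprod d d'

/-- The decorated graphs span `𝒟(Γ)`. -/
theorem span_decorated :
    Submodule.span R (Set.range (decorated (R := R) (Γ := Γ))) = ⊤ :=
  PiTensorProduct.span_tprod_eq_top

variable {Γ} in
/-- Substitution of the variables with indices in `c(e)` in the polynomials on the edge `e`. -/
def Coloring.subst (c : Γ.Coloring) (e : Γ.Edge) :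
    SymPoly R (Γ.label e) →ₗ[R] MvPolynomial (Fin Γ.level) R :=
  ((MvPolynomial.rename ((c.1 e).orderEmbOfFin (c.2.card e))).comp
    (MvPolynomial.symmetricSubalgebra (Fin (Γ.label e)) R).val).toLinearMap

variable {Γ} in
/-- `P(Γ^d, c)`, the product over the edges of the substituted decorations, as a linear map. -/
def Coloring.P (c : Γ.Coloring) : Γ.DecoratedSpace R →ₗ[R] MvPolynomial (Fin Γ.level) R :=
  PiTensorProduct.lift
    ((MultilinearMap.mkPiAlgebra R Γ.Edge (MvPolynomial (Fin Γ.level) R)).compLinearMap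
      (c.subst R))

variable {Γ} in
/-- `Q(Γ, c)`, the product over the split vertices of the differences of the variables on the left
and on the right departing edge. -/
def Coloring.Q (c : Γ.Coloring) : MvPolynomial (Fin Γ.level) R :=
  ∏ v : Γ.SplitVertex, ∏ i ∈ c.1 v.left, ∏ j ∈ c.1 v.right,
    (MvPolynomial.X i - MvPolynomial.X j)

theorem Coloring.P_tprod (c : Γ.Coloring) (d : Γ.PreDecoration R) :
    c.P R (decorated d) = ∏ e, MvPolynomial.rename
      ((c.1 e).orderEmbOfFin (c.2.card e)) (d e : MvPolynomial (Fin (Γ.label e)) R) := by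
  exact (PiTensorProduct.lift.tprod d).trans rfl

/-- The field of rational functions over `R` in `level` variables. -/
abbrev RatFun : Type _ := FractionRing (MvPolynomial (Fin Γ.level) R)

variable [IsDomain R]

/-- The `∞`-evaluation, extended linearly to `𝒟(Γ)`. -/
def evalInfty : Γ.DecoratedSpace R →ₗ[R] Γ.RatFun R :=
  ∑ c : Γ.Coloring,
    LinearMap.mulRight R (algebraMap (MvPolynomial (Fin Γ.level) R) (Γ.RatFun R) (c.Q R))⁻¹ ∘ₗ
      (IsScalarTower.toAlgHom R (MvPolynomial (Fin Γ.level) R) (Γ.RatFun R)).toLinearMap ∘ₗ c.P R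

theorem evalInfty_apply (y : Γ.DecoratedSpace R) :
    Γ.evalInfty R y = ∑ c : Γ.Coloring,
      algebraMap (MvPolynomial (Fin Γ.level) R) (Γ.RatFun R) (c.P R y) /
        algebraMap (MvPolynomial (Fin Γ.level) R) (Γ.RatFun R) (c.Q R) := by
  simp [evalInfty, div_eq_mul_inv]

variable {R Γ} in
/-- The `1`-evaluation of `y` is `r`: the `∞`-evaluation of `y` is a polynomial, and its value at
`(0, …, 0)` is `r`. -/
def HasEvalOne (y : Γ.DecoratedSpace R) (r : R) : Prop :=
  ∃ p : MvPolynomial (Fin Γ.level) R,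
    algebraMap (MvPolynomial (Fin Γ.level) R) (Γ.RatFun R) p = Γ.evalInfty R y ∧
      MvPolynomial.eval (fun _ => 0) p = r

/-- The intersection over all decorated graphs `Γ^d` of the kernels of the pairings `(·, Γ^d)₁`,
where `(y, z)₁` is the `1`-evaluation of `y * z`. -/
def radical : Submodule R (Γ.DecoratedSpace R) where
  carrier := {y | ∀ d : Γ.PreDecoration R, IsDecoration d →
    HasEvalOne (y * decorated d) 0}
  zero_mem' := fun d _ => ⟨0, by simp, by simp⟩
  add_mem' := by
    intro y z hy hz d hd
    obtain ⟨p, hp, hp'⟩ := hy d hd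
    obtain ⟨q, hq, hq'⟩ := hz d hd
    exact ⟨p + q, by rw [map_add, hp, hq, add_mul, map_add], by rw [map_add, hp', hq', add_zero]⟩
  smul_mem' := by
    intro r y hy d hd
    obtain ⟨p, hp, hp'⟩ := hy d hd
    refine ⟨r • p, ?_, ?_⟩
    · rw [smul_mul_assoc, (Γ.evalInfty R).map_smul, ← hp]
      exact map_smul (IsScalarTower.toAlgHom R (MvPolynomial (Fin Γ.level) R) (Γ.RatFun R)) r p
    · rw [MvPolynomial.smul_eval, hp', mul_zero]

/-- The state space `𝒮₁(Γ)` over `R`. -/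
abbrev StateSpace : Type _ := Γ.DecoratedSpace R ⧸ Γ.radical R

variable {R Γ} in
/-- The class of the decorated graph `Γ^d` in `𝒮₁(Γ)`. -/
def graphClass (d : Γ.PreDecoration R) : Γ.StateSpace R :=
  (Γ.radical R).mkQ (decorated d)

/-- The homogeneous part of degree `k` of `𝒮₁(Γ)`. -/
def gradedPart (k : ℤ) : Submodule R (Γ.StateSpace R) :=
  Submodule.span R (graphClass '' {d : Γ.PreDecoration R | IsDecoration d ∧ degree d = k})

end VinylGraph

/-! ### Schur polynomials and the d.u.r. set -/

/-- `T(a, b)`: the Young diagrams with at most `a` columns and at most `b` rows. -/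
def diagrams (a b : ℕ) : Set YoungDiagram := {μ | μ.rowLen 0 ≤ a ∧ μ.colLen 0 ≤ b}

/-- Fillings of `μ` with entries in `{1, …, a}`, strictly increasing along the rows and weakly
increasing down the columns. -/
def IsFilling {a : ℕ} (μ : YoungDiagram) (T : μ.cells → Fin a) : Prop :=
  (∀ x y : μ.cells, x.1.1 = y.1.1 → x.1.2 < y.1.2 → T x < T y) ∧
    ∀ x y : μ.cells, x.1.2 = y.1.2 → x.1.1 < y.1.1 → T x ≤ T y

open Classical in
/-- The Schur polynomial of `μ` in `a` variables, as a sum over tableaux. The convention is the one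
in which a single row of `i` boxes gives the elementary symmetric polynomial `e_i` and a single
column of `i` boxes gives the complete one, so diagrams with at most `a` columns have nonzero
Schur polynomials in `a` variables. -/
def schur (R : Type*) [CommRing R] (a : ℕ) (μ : YoungDiagram) : MvPolynomial (Fin a) R :=
  ∑ T : {T : μ.cells → Fin a // IsFilling μ T}, ∏ x : μ.cells, MvPolynomial.X (T.1 x)

namespace VinylGraph

/-- The d.u.r. set: decorations by Schur polynomials of diagrams in `T(a, b)` on the right departing
edges of the split vertices, where `a` and `b` are the labels of the right and of the left departing
edge, and by `1` on all the other edges. -/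
def DUR (R : Type*) [CommRing R] (Γ : VinylGraph) : Set (Γ.PreDecoration R) :=
  {d | (∀ v : Γ.SplitVertex, ∃ μ ∈ diagrams (Γ.label v.right) (Γ.label v.left),
      (d v.right : MvPolynomial (Fin (Γ.label v.right)) R) = schur R (Γ.label v.right) μ) ∧
    ∀ e : Γ.Edge, (∀ v : Γ.SplitVertex, e ≠ v.right) → d e = 1}

end VinylGraph

/-- The family `v`, whose members are assigned the degrees `deg`, is a basis of the module `M`, and
for each `k` its members of degree `k` span the homogeneous part `𝒢 k`. -/
structure IsHomogeneousBasis {R M ι : Type*} [CommRing R] [AddCommGroup M] [Module R M]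
    (𝒢 : ℤ → Submodule R M) (deg : ι → ℤ) (v : ι → M) : Prop where
  linearIndependent : LinearIndependent R v
  span_eq_top : Submodule.span R (Set.range v) = ⊤
  span_degree_eq : ∀ k, Submodule.span R (v '' {i | deg i = k}) = 𝒢 k

namespace VinylGraph

/-- The d.u.r. set is a homogeneous basis of `𝒮₁(Γ)` over `R`. -/
def IsDURGraph (R : Type*) [CommRing R] [IsDomain R] (Γ : VinylGraph) : Prop :=
  IsHomogeneousBasis (Γ.gradedPart R) (fun d : Γ.DUR R => degree d.1)
    (fun d : Γ.DUR R => graphClass d.1)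

end VinylGraph

end Vinyl

end

/-! A coloring is lifted to closed paths of orderings: at every height a permutation puts the n
pigments into n slots, a thick strand occupying two neighbouring slots. A merge followed by a split
becomes a divided difference operator `dum` on functions on the symmetric group, and the evaluation
becomes the trace of a cyclic product of such operators, weighted by the decorations. The radical of
the pairing turns into `rad`, the largest ideal inside the set of elements whose trace is a
polynomial without constant term. The central claim is `GoodWord`: for a cyclic word of dumbbells,
the squarefree monomials in the variables at their right upper ends form a basis modulo this ideal.

Divided differences satisfy the nilHecke relations, and `GoodWord` propagates along them. Rotations
and far commutations only rename variables. Doubling a letter adjoins a root of a quadratic equation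
on which the form is hyperbolic, so the basis doubles (`goodWord_digon`). For neighbouring letters i
and j, the forms of i j i and of j i j are orthogonal sums of one common form and, up to sign, of
the form of the word with the single letter i, respectively j; therefore i j i, i and j together
yield j i j (`goodWord_braid`). In this way every cyclic word reduces to words without repeated
letters (`MoveClosed.of_nodup`).

For those, only constant paths contribute, and the trace is the symmetrization of f / ∏ (x_i -
x_{i+1}). Its radical is the common kernel of the functionals `phi T`, where T runs through the sets
of letters of the word (`mem_rad_phi_iff`), and the values of these functionals on the squarefree
monomials form a triangular matrix with diagonal entries ±1 (`good_phi`). All that is needed of R is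
that it is a domain in which n! does not vanish; nothing is divided by n!, so the integers are
allowed.

For a graph, each split vertex and each thick strand at the top of a slab gets a dumbbell.
Multiplying by the right variables of the thick dumbbells recovers the evaluation up to sign
(`form_prod_rightVar`), and `good_descend` strips these auxiliary decorations off. In the elementary
case the d.u.r. decorations are exactly 1 or x on the right edges (`exists_schur_iff`), and the
radical is homogeneous (`mem_rad_evalKer_of_sum_mem`), which gives the graded statement. The
reduction modulo p of the integral state space is handled by base change. -/

noncomputable section

namespace Vinyl

/-! ### Divided difference operators and the nilHecke relations. -/

namespace NilHecke

open Equiv Matrix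

variable {n : ℕ} {K : Type*} [Field K] (X : Fin n → K)

/-- Matrices whose rows and columns are indexed by the orderings of the pigments. -/
abbrev Mat (n : ℕ) (K : Type*) : Type _ := Matrix (Perm (Fin n)) (Perm (Fin n)) K

/-- Multiplication by the variable of the `j`-th slot. -/
def pos (j : Fin n) : Mat n K := Matrix.diagonal fun σ => X (σ j)

/-- The dumbbell on the slots `a` and `b`: a merge vertex followed by a split vertex. -/
def dum (a b : Fin n) : Mat n K := Matrix.of fun σ τ =>
  if τ = σ ∨ τ = σ * swap a b then (X (τ a) - X (τ b))⁻¹ else 0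

theorem pos_mulVec (j : Fin n) (v : Perm (Fin n) → K) (σ : Perm (Fin n)) :
    (pos X j *ᵥ v) σ = X (σ j) * v σ := by
  simp [pos, Matrix.mulVec_diagonal]

/-- Row σ has entries only at σ and at its product with the swap, and they are opposite because the
exchange changes the sign of the difference. So the matrix acts as a divided difference. -/
theorem dum_mulVec {a b : Fin n} (hab : a ≠ b) (v : Perm (Fin n) → K) (σ : Perm (Fin n)) :
    (dum X a b *ᵥ v) σ = (X (σ a) - X (σ b))⁻¹ * (v σ - v (σ * swap a b)) := by
  have hne : σ ≠ σ * swap a b := by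
    intro h
    have : swap a b = 1 := by simpa using h.symm
    exact hab (swap_eq_one_iff.mp this)
  have h1 : ∀ τ, dum X a b σ τ * v τ =
      (if τ = σ then (X (σ a) - X (σ b))⁻¹ * v σ else 0) +
      (if τ = σ * swap a b then -((X (σ a) - X (σ b))⁻¹ * v (σ * swap a b)) else 0) := by
    intro τ
    by_cases h : τ = σ
    · subst h
      simp [dum, hne]
    · by_cases h' : τ = σ * swap a b
      · subst h'
        simp only [dum, Matrix.of_apply, or_true, if_true, if_neg h, Perm.mul_apply,
          swap_apply_left, swap_apply_right, zero_add]
        rw [← neg_sub (X (σ a)), inv_neg, neg_mul]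
      · simp [dum, h, h']
  rw [Matrix.mulVec, dotProduct, Finset.sum_congr rfl fun τ _ => h1 τ, Finset.sum_add_distrib]
  simp
  ring

theorem ext_mulVec {A B : Mat n K} (h : ∀ v σ, (A *ᵥ v) σ = (B *ᵥ v) σ) : A = B :=
  Matrix.ext_of_mulVec_single fun _ => funext fun σ => h _ σ

theorem pos_dum_of_ne {a b j : Fin n} (hab : a ≠ b) (ha : j ≠ a) (hb : j ≠ b) :
    pos X j * dum X a b = dum X a b * pos X j := by
  apply ext_mulVec
  intro v σ
  simp only [← Matrix.mulVec_mulVec, pos_mulVec, dum_mulVec X hab, Perm.mul_apply,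
    swap_apply_of_ne_of_ne ha hb]
  ring

variable {X}
-- The twisted Leibniz rule for divided differences; injectivity of the values X makes the
-- denominators cancel.
theorem pos_dum_left (hX : Function.Injective X) {a b : Fin n} (hab : a ≠ b) :
    pos X a * dum X a b = dum X a b * pos X b + 1 := by
  apply ext_mulVec
  intro v σ
  have h : X (σ a) - X (σ b) ≠ 0 := sub_ne_zero.mpr fun h => hab (σ.injective (hX h))
  simp only [Matrix.add_mulVec, ← Matrix.mulVec_mulVec, pos_mulVec, dum_mulVec X hab,
    Perm.mul_apply, swap_apply_right, Pi.add_apply, Matrix.one_mulVec]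
  field_simp
  ring

theorem dum_pos_left (hX : Function.Injective X) {a b : Fin n} (hab : a ≠ b) :
    dum X a b * pos X a = pos X b * dum X a b + 1 := by
  apply ext_mulVec
  intro v σ
  have h : X (σ a) - X (σ b) ≠ 0 := sub_ne_zero.mpr fun h => hab (σ.injective (hX h))
  simp only [Matrix.add_mulVec, ← Matrix.mulVec_mulVec, pos_mulVec, dum_mulVec X hab,
    Perm.mul_apply, swap_apply_left, Pi.add_apply, Matrix.one_mulVec]
  field_simp
  ring

/-- A divided difference is invariant under the swap, so a second one annihilates it. -/
theorem dum_sq {a b : Fin n} (hab : a ≠ b) : dum X a b * dum X a b = 0 := by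
  apply ext_mulVec
  intro v σ
  simp only [← Matrix.mulVec_mulVec, dum_mulVec X hab, Perm.mul_apply, swap_apply_left,
    swap_apply_right, mul_assoc, Equiv.swap_mul_self, mul_one, Matrix.zero_mulVec, Pi.zero_apply]
  have h2 : X (σ b) - X (σ a) = -(X (σ a) - X (σ b)) := by ring
  rw [h2, inv_neg]
  ring

/-- This sandwich, together with its mirror image below, supplies the nonzero values of the forms in
the digon and braid moves. -/
theorem dum_pos_dum (hX : Function.Injective X) {a b : Fin n} (hab : a ≠ b) :
    dum X a b * pos X b * dum X a b = -dum X a b := by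
  have h : dum X a b * pos X b = pos X a * dum X a b - 1 := by
    rw [pos_dum_left hX hab]; simp
  rw [h, sub_mul, mul_assoc, dum_sq hab]
  simp

theorem dum_pos_dum' (hX : Function.Injective X) {a b : Fin n} (hab : a ≠ b) :
    dum X a b * pos X a * dum X a b = dum X a b := by
  rw [dum_pos_left hX hab, add_mul, mul_assoc, dum_sq hab]
  simp

theorem dum_comm {a b c d : Fin n} (hab : a ≠ b) (hcd : c ≠ d) (hac : a ≠ c) (had : a ≠ d)
    (hbc : b ≠ c) (hbd : b ≠ d) : dum X a b * dum X c d = dum X c d * dum X a b := by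
  apply ext_mulVec
  intro v σ
  have hs : swap a b * swap c d = swap c d * swap a b := by
    apply Equiv.ext
    intro x
    simp only [Perm.mul_apply, swap_apply_def]
    split_ifs <;> simp_all
  simp only [← Matrix.mulVec_mulVec, dum_mulVec X hab, dum_mulVec X hcd, Perm.mul_apply,
    swap_apply_of_ne_of_ne hac.symm hbc.symm, swap_apply_of_ne_of_ne had.symm hbd.symm,
    swap_apply_of_ne_of_ne hac had, swap_apply_of_ne_of_ne hbc hbd, mul_assoc, hs]
  ring

/-- On both sides the value at σ involves only the six permutations obtained from σ by permuting
three slots. Once the longest element is written in one way, this is an identity of rational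
functions in three variables. -/
theorem dum_braid (hX : Function.Injective X) {a b c : Fin n} (hab : a ≠ b) (hbc : b ≠ c) (hac : a ≠ c) :
    dum X a b * dum X b c * dum X a b = dum X b c * dum X a b * dum X b c := by
  apply ext_mulVec
  intro v σ
  have h1 : X (σ a) - X (σ b) ≠ 0 := sub_ne_zero.mpr fun h => hab (σ.injective (hX h))
  have h2 : X (σ b) - X (σ c) ≠ 0 := sub_ne_zero.mpr fun h => hbc (σ.injective (hX h))
  have h3 : X (σ a) - X (σ c) ≠ 0 := sub_ne_zero.mpr fun h => hac (σ.injective (hX h))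
  have h1' : X (σ b) - X (σ a) ≠ 0 := sub_ne_zero.mpr fun h => hab (σ.injective (hX h.symm))
  have h2' : X (σ c) - X (σ b) ≠ 0 := sub_ne_zero.mpr fun h => hbc (σ.injective (hX h.symm))
  have h3' : X (σ c) - X (σ a) ≠ 0 := sub_ne_zero.mpr fun h => hac (σ.injective (hX h.symm))
  have hs : swap a b * (swap b c * swap a b) = swap b c * (swap a b * swap b c) := by
    have e1 := Equiv.swap_mul_swap_mul_swap (x := c) (y := b) (z := a) hbc.symm hac.symm
    have e2 := Equiv.swap_mul_swap_mul_swap (x := a) (y := b) (z := c) hab hac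
    rw [Equiv.swap_comm b a, Equiv.swap_comm c b, mul_assoc] at e1
    rw [mul_assoc] at e2
    rw [e1, e2, Equiv.swap_comm]
  simp only [← Matrix.mulVec_mulVec, dum_mulVec X hab, dum_mulVec X hbc, Perm.mul_apply,
    swap_apply_left, swap_apply_right, swap_apply_of_ne_of_ne hac.symm hbc.symm,
    swap_apply_of_ne_of_ne hab hac, mul_assoc, Equiv.swap_mul_self, mul_one, hs]
  generalize X (σ a) = A at *
  generalize X (σ b) = B at *
  generalize X (σ c) = C at *
  generalize v σ = v0
  generalize v (σ * swap a b) = v1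
  generalize v (σ * swap b c) = v2
  generalize v (σ * (swap a b * swap b c)) = v3
  generalize v (σ * (swap b c * swap a b)) = v4
  generalize v (σ * (swap b c * (swap a b * swap b c))) = v5
  have e1 : B - A = -(A - B) := by ring
  have e2 : C - B = -(B - C) := by ring
  simp only [e1, e2, inv_neg]
  field_simp
  ring

end NilHecke

end Vinyl

end

noncomputable section

namespace Vinyl

/-! ### Radicals of trace forms and families inducing bases of the quotients -/

section Radical

variable {R A P V : Type*} [CommRing R] [CommRing A] [Algebra R A] [CommRing P] [Algebra R P]
  [AddCommGroup V] [Module R V]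

/-- The largest ideal contained in the submodule `N`. -/
def rad (N : Submodule R A) : Ideal A where
  carrier := {y | ∀ z, z * y ∈ N}
  zero_mem' := fun z => by simp
  add_mem' := fun {x y} hx hy z => by rw [mul_add]; exact N.add_mem (hx z) (hy z)
  smul_mem' := fun a y hy z => by rw [smul_eq_mul, ← mul_assoc]; exact hy _

theorem mem_of_mem_rad {N : Submodule R A} {y : A} (h : y ∈ rad N) : y ∈ N := by
  simpa using h 1

theorem mem_iff_of_sub_mem_rad {N : Submodule R A} {y z : A} (h : y - z ∈ rad N) :
    y ∈ N ↔ z ∈ N :=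
  ⟨fun hy => by simpa using N.sub_mem hy (mem_of_mem_rad h),
    fun hz => by simpa using N.add_mem (mem_of_mem_rad h) hz⟩

theorem mem_rad_iff_of_sub_mem {N : Submodule R A} {y z : A} (h : y - z ∈ rad N) :
    y ∈ rad N ↔ z ∈ rad N :=
  ⟨fun hy => by simpa using (rad N).sub_mem hy h, fun hz => by simpa using (rad N).add_mem h hz⟩

/-- The linear map `l` induces a bijection onto the quotient by the radical of `N`. -/
structure Good (N : Submodule R A) (l : V →ₗ[R] A) : Prop where
  inj : ∀ v, l v ∈ rad N → v = 0
  surj : ∀ y, ∃ v, y - l v ∈ rad N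

/-- Testing membership in the radical against all of the larger algebra is the same as testing
against the image of f, since every element agrees with one of the image modulo the radical. -/
theorem mem_rad_map_iff {N : Submodule R A} {NP : Submodule R P} (f : P →ₐ[R] A)
    (h : ∀ p, f p ∈ N ↔ p ∈ NP) (hs : ∀ a, ∃ p, a - f p ∈ rad N) (p : P) :
    f p ∈ rad N ↔ p ∈ rad NP := by
  constructor
  · intro hp z
    rw [← h, map_mul]
    exact hp _
  · intro hp z
    obtain ⟨q, hq⟩ := hs z
    have h1 : z * f p - f (q * p) ∈ rad N := by
      rw [map_mul, ← sub_mul]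
      exact (rad N).mul_mem_right _ hq
    rw [mem_iff_of_sub_mem_rad h1, h]
    exact hp q

/-- The hypotheses say that f induces an isomorphism of the quotients by the radicals which matches
the two families. All renamings of variables go through this. -/
theorem good_transfer {N : Submodule R A} {NP : Submodule R P} (f : P →ₐ[R] A)
    (h : ∀ p, f p ∈ N ↔ p ∈ NP) (hs : ∀ a, ∃ p, a - f p ∈ rad N)
    {l : V →ₗ[R] A} {lP : V →ₗ[R] P} (hl : ∀ v, l v - f (lP v) ∈ rad N) :
    Good N l ↔ Good NP lP := by
  have key := mem_rad_map_iff f h hs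
  constructor
  · intro hg
    refine ⟨fun v hv => hg.inj v ?_, fun y => ?_⟩
    · rw [mem_rad_iff_of_sub_mem (hl v), key]
      exact hv
    · obtain ⟨v, hv⟩ := hg.surj (f y)
      refine ⟨v, ?_⟩
      rw [← key, map_sub]
      simpa using (rad N).add_mem hv (hl v)
  · intro hg
    refine ⟨fun v hv => hg.inj v ?_, fun y => ?_⟩
    · rw [mem_rad_iff_of_sub_mem (hl v), key] at hv
      exact hv
    · obtain ⟨p, hp⟩ := hs y
      obtain ⟨v, hv⟩ := hg.surj p
      refine ⟨v, ?_⟩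
      rw [← key, map_sub] at hv
      have := (rad N).sub_mem ((rad N).add_mem hp hv) (hl v)
      convert this using 1
      ring

/-- The map `(v, w) ↦ l v + r * l w`. -/
def dbl (r : A) (l : V →ₗ[R] A) : V × V →ₗ[R] A := l.coprod (LinearMap.mulLeft R r ∘ₗ l)

@[simp] theorem dbl_apply (r : A) (l : V →ₗ[R] A) (v : V × V) :
    dbl r l v = l v.1 + r * l v.2 := rfl

theorem good_comp_equiv {V' : Type*} [AddCommGroup V'] [Module R V'] {N : Submodule R A}
    {l : V →ₗ[R] A} {l' : V' →ₗ[R] A} (e : V ≃ₗ[R] V') (h : ∀ v, l v = l' (e v)) :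
    Good N l ↔ Good N l' := by
  constructor
  · intro hg
    refine ⟨fun v hv => ?_, fun y => ?_⟩
    · have := hg.inj (e.symm v) (by rwa [h, e.apply_symm_apply])
      simpa using this
    · obtain ⟨v, hv⟩ := hg.surj y
      exact ⟨e v, by rwa [← h]⟩
  · intro hg
    refine ⟨fun v hv => ?_, fun y => ?_⟩
    · have := hg.inj (e v) (by rwa [← h])
      simpa using this
    · obtain ⟨v, hv⟩ := hg.surj y
      exact ⟨e.symm v, by rwa [h, e.apply_symm_apply]⟩

theorem dbl_equiv {V' : Type*} [AddCommGroup V'] [Module R V']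
    {l : V →ₗ[R] A} {l' : V' →ₗ[R] A} (e : V ≃ₗ[R] V') (h : ∀ v, l v = l' (e v)) (r : A)
    (v : V × V) : dbl r l v = dbl r l' (e.prodCongr e v) := by
  simp [h]

theorem dbl_sub_mem {I : Ideal A} {r r' : A} {l l' : V →ₗ[R] A} (hr : r - r' ∈ I)
    (hl : ∀ v, l v - l' v ∈ I) (v : V × V) : dbl r l v - dbl r' l' v ∈ I := by
  have h1 := I.add_mem (hl v.1) (I.add_mem (I.mul_mem_left r (hl v.2))
    (I.mul_mem_right (l' v.2) hr))
  convert h1 using 1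
  simp only [dbl_apply]
  ring

theorem dbl_dbl_sub_mem {I : Ideal A} {r r' s s' : A} {l l' : V →ₗ[R] A} (hr : r - r' ∈ I)
    (hs : s - s' ∈ I) (hl : ∀ v, l v - l' v ∈ I) (v : (V × V) × V × V) :
    dbl r (dbl s l) v - (dbl s' l' v.1 + r' * dbl s' l' v.2) ∈ I :=
  dbl_sub_mem hr (dbl_sub_mem hs hl) v

theorem dbl_dbl_sub_mem' {I : Ideal A} {r s a b c : A} {l : V →ₗ[R] A} (ha : s - a ∈ I)
    (hb : r - b ∈ I) (hc : r * s - c ∈ I) (v : (V × V) × V × V) :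
    dbl r (dbl s l) v - (l v.1.1 + a * l v.1.2 + b * l v.2.1 + c * l v.2.2) ∈ I := by
  convert I.add_mem (I.add_mem (I.mul_mem_right (l v.1.2) ha) (I.mul_mem_right (l v.2.1) hb))
    (I.mul_mem_right (l v.2.2) hc) using 1
  simp only [dbl_apply]
  ring

/-- A quadratic extension on which the form is hyperbolic. -/
theorem good_dbl_iff {N : Submodule R A} {Ns : Submodule R P} (f : P →ₐ[R] A) (r : A) (e e' : P)
    (h0 : ∀ p, f p ∈ N) (h1 : ∀ p, r * f p ∈ N ↔ p ∈ Ns)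
    (hr : r * r - (r * f e - f e') ∈ rad N)
    (hs : ∀ a, ∃ p q, a - (f p + r * f q) ∈ rad N) {l : V →ₗ[R] P} {l' : V × V →ₗ[R] A}
    (hl : ∀ v, l' v - (f (l v.1) + r * f (l v.2)) ∈ rad N) :
    Good N l' ↔ Good Ns l := by
  -- Modulo the radical r satisfies r² = e r - e', which gives the product of two elements p + r q.
  -- Membership in N only sees the coefficient of r.
  have mulrule : ∀ p q p' q', (f p + r * f q) * (f p' + r * f q') -
      (f (p * p' - e' * q * q') + r * f (p * q' + p' * q + e * q * q')) ∈ rad N := by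
    intro p q p' q'
    have := (rad N).mul_mem_right (f q * f q') hr
    convert this using 1
    simp only [map_sub, map_add, map_mul]
    ring
  have memN : ∀ p q, f p + r * f q ∈ N ↔ q ∈ Ns := by
    intro p q
    rw [N.add_mem_iff_right (h0 p), h1]
  have key : ∀ p q, f p + r * f q ∈ rad N ↔ p ∈ rad Ns ∧ q ∈ rad Ns := by
    intro p q
    constructor
    · intro h
      -- Multiplying p + r q by z tests q; multiplying it by r z tests p + e q. Together they show
      -- that both coordinates are in the smaller radical.
      have hq : q ∈ rad Ns := by
        intro z
        have := h (f z + r * f 0)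
        rw [mem_iff_of_sub_mem_rad (mulrule z 0 p q), memN] at this
        simpa using this
      refine ⟨fun z => ?_, hq⟩
      have := h (f 0 + r * f z)
      rw [mem_iff_of_sub_mem_rad (mulrule 0 z p q), memN] at this
      have h2 := Ns.sub_mem this (hq (e * z))
      convert h2 using 1
      ring
    · rintro ⟨hp, hq⟩ z
      obtain ⟨p', q', h'⟩ := hs z
      have h2 : z * (f p + r * f q) - (f p' + r * f q') * (f p + r * f q) ∈ rad N := by
        rw [← sub_mul]
        exact (rad N).mul_mem_right _ h'
      rw [mem_iff_of_sub_mem_rad h2, mem_iff_of_sub_mem_rad (mulrule _ _ _ _), memN]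
      have := Ns.add_mem (hq (p' + e * q')) (hp q')
      convert this using 1
      ring
  constructor
  · intro hg
    refine ⟨fun v hv => ?_, fun y => ?_⟩
    · have := hg.inj (v, 0) (by
        rw [mem_rad_iff_of_sub_mem (hl _), key]
        exact ⟨hv, by simp⟩)
      simpa using this
    · obtain ⟨v, hv⟩ := hg.surj (f y)
      have := (rad N).add_mem hv (hl v)
      have h2 : f (y - l v.1) + r * f (0 - l v.2) ∈ rad N := by
        convert this using 1
        simp only [map_sub, map_zero]
        ring
      exact ⟨v.1, ((key _ _).1 h2).1⟩
  · intro hg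
    refine ⟨fun v hv => ?_, fun y => ?_⟩
    · rw [mem_rad_iff_of_sub_mem (hl _), key] at hv
      exact Prod.ext (hg.inj _ hv.1) (hg.inj _ hv.2)
    · obtain ⟨p, q, h⟩ := hs y
      obtain ⟨v, hv⟩ := hg.surj p
      obtain ⟨w, hw⟩ := hg.surj q
      have h2 := (key _ _).2 ⟨hv, hw⟩
      refine ⟨(v, w), ?_⟩
      have := (rad N).sub_mem ((rad N).add_mem h h2) (hl (v, w))
      convert this using 1
      simp only [map_sub]
      ring

/-- A quadratic extension on which the form is an orthogonal sum of two forms. -/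
theorem mem_rad_orthogonal {N : Submodule R A} {Ns NE : Submodule R P} (f : P →ₐ[R] A) (η : A)
    (h0 : ∀ p, f p ∈ N ↔ p ∈ NE) (h1 : ∀ p, η * f p ∈ N) (h2 : ∀ p, η * η * f p ∈ N ↔ p ∈ Ns)
    (hs : ∀ a, ∃ p q, a - (f p + η * f q) ∈ rad N) (p q : P) :
    f p + η * f q ∈ rad N ↔ p ∈ rad NE ∧ q ∈ rad Ns := by
  -- The mixed terms lie in N by `h1`, so the pairing is diagonal: one form on the first
  -- coordinates, the other on the second ones.
  have memN : ∀ p q p' q', (f p' + η * f q') * (f p + η * f q) - (f (p' * p) + η * η * f (q' * q))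
      ∈ N := by
    intro p q p' q'
    have := h1 (p' * q + q' * p)
    convert this using 1
    simp only [map_add, map_mul]
    ring
  constructor
  · intro h
    constructor
    · intro z
      have h3 := N.sub_mem (h (f z + η * f 0)) (memN p q z 0)
      rw [← h0]
      simpa using h3
    · intro z
      have h3 := N.sub_mem (h (f 0 + η * f z)) (memN p q 0 z)
      rw [← h2]
      simpa using h3
  · rintro ⟨hp, hq⟩ z
    obtain ⟨p', q', h'⟩ := hs z
    have h3 : z * (f p + η * f q) - (f p' + η * f q') * (f p + η * f q) ∈ rad N := by
      rw [← sub_mul]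
      exact (rad N).mul_mem_right _ h'
    rw [mem_iff_of_sub_mem_rad h3]
    have h4 := N.add_mem (memN p q p' q')
      (N.add_mem ((h0 _).2 (hp p')) ((h2 _).2 (hq q')))
    simpa using h4

/-- The passage from one side of the braid relation to the other one. -/
theorem good_braid {A' : Type*} [CommRing A'] [Algebra R A']
    {N : Submodule R A} {N' : Submodule R A'} {NE Ns Nt : Submodule R P}
    (f : P →ₐ[R] A) (f' : P →ₐ[R] A') (η : A) (η' : A') (o2 o3 q : P)
    (h0 : ∀ p, f p ∈ N ↔ p ∈ NE) (h1 : ∀ p, η * f p ∈ N) (h2 : ∀ p, η * η * f p ∈ N ↔ p ∈ Ns)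
    (hs : ∀ a, ∃ p q, a - (f p + η * f q) ∈ rad N)
    (h0' : ∀ p, f' p ∈ N' ↔ p ∈ NE) (h1' : ∀ p, η' * f' p ∈ N')
    (h2' : ∀ p, η' * η' * f' p ∈ N' ↔ p ∈ Nt)
    (hs' : ∀ a, ∃ p q, a - (f' p + η' * f' q) ∈ rad N')
    {l : V →ₗ[R] P} {L : ((V × V) × V × V) × ((V × V) × V × V) →ₗ[R] A}
    {L' : ((V × V) × V × V) × ((V × V) × V × V) →ₗ[R] A'}
    (hL : ∀ v, L v - (f (dbl o3 (dbl o2 l) v.1) + (η + f o3) * f (dbl o3 (dbl o2 l) v.2)) ∈ rad N)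
    (hL' : ∀ v, L' v - (f' (dbl o3 l v.1.1) + (f' (o2 + o3 + q) - η') * f' (dbl o3 l v.1.2) +
      (η' - f' q) * f' (dbl o3 l v.2.1) + f' (o2 * o3) * f' (dbl o3 l v.2.2)) ∈ rad N')
    (hg : Good N L) (hgs : Good Ns (dbl o2 l)) (hgt : Good Nt (dbl o3 l)) : Good N' L' := by
  have key := mem_rad_orthogonal f η h0 h1 h2 hs
  have key' := mem_rad_orthogonal f' η' h0' h1' h2' hs'
  -- The first word determines the common form: for it {1, o3, o3²} times the family `dbl o2 l` is a
  -- basis. In the coordinates α, β, γ, δ of L the `NE` component is α + o3 (β + γ) + o3² δ and the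
  -- `Ns` component is γ + o3 δ. Since `dbl o2 l` is a basis for `Ns`, γ can be adjusted to δ so
  -- that the second component vanishes.
  have hE : Good NE (((dbl o2 l).coprod
      ((LinearMap.mulLeft R o3 ∘ₗ dbl o2 l).coprod (LinearMap.mulLeft R (o3 * o3) ∘ₗ dbl o2 l)))) := by
    constructor
    · rintro ⟨α, ζ, δ⟩ hv
      obtain ⟨γ, hγ⟩ := hgs.surj (-(o3 * dbl o2 l δ))
      have h3 : f (dbl o2 l α + o3 * dbl o2 l ζ + o3 * o3 * dbl o2 l δ) +
          η * f (dbl o2 l γ + o3 * dbl o2 l δ) ∈ rad N := by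
        rw [key]
        constructor
        · convert hv using 1
          simp only [LinearMap.coprod_apply, LinearMap.coe_comp, Function.comp_apply,
            LinearMap.mulLeft_apply]
          ring
        · have := (rad Ns).neg_mem hγ
          convert this using 1
          ring
      have h4 := hg.inj ((α, ζ - γ), (γ, δ)) (by
        rw [mem_rad_iff_of_sub_mem (hL _)]
        convert h3 using 1
        rw [dbl_apply o3, dbl_apply o3]
        simp only [map_sub, map_add, map_mul]
        ring)
      simp only [Prod.mk_eq_zero] at h4
      obtain ⟨⟨h5, h6⟩, h7, h8⟩ := h4
      rw [h7, sub_zero] at h6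
      rw [h5, h6, h8]
      rfl
    · intro y
      obtain ⟨v, hv⟩ := hg.surj (f y)
      refine ⟨(v.1.1, v.1.2 + v.2.1, v.2.2), ?_⟩
      have h3 := (rad N).add_mem hv (hL v)
      have h4 : f (y - (dbl o2 l v.1.1 + o3 * (dbl o2 l v.1.2 + dbl o2 l v.2.1) +
          o3 * o3 * dbl o2 l v.2.2)) +
          η * f (-(dbl o2 l v.2.1 + o3 * dbl o2 l v.2.2)) ∈ rad N := by
        convert h3 using 1
        rw [dbl_apply o3, dbl_apply o3]
        simp only [map_sub, map_add, map_mul, map_neg]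
        ring
      have h5 := ((key _ _).1 h4).1
      convert h5 using 1
      simp only [LinearMap.coprod_apply, LinearMap.coe_comp, Function.comp_apply,
        LinearMap.mulLeft_apply, map_add]
      ring
  -- Splits L' into its two orthogonal components; the one along η' depends only on the difference
  -- of the two middle coordinates.
  have hL'' : ∀ v, L' v - (f' (dbl o3 l v.1.1 + (o2 + o3) * dbl o3 l v.1.2 +
      o2 * o3 * dbl o3 l v.2.2 - q * (dbl o3 l (v.2.1 - v.1.2))) +
      η' * f' (dbl o3 l (v.2.1 - v.1.2))) ∈ rad N' := by
    intro v
    convert hL' v using 1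
    simp only [map_sub, map_add, map_mul]
    ring
  -- The first component, up to the term with q, is rewritten in the basis of `hE`. The change of
  -- coordinates is unitriangular, and `v0`, `v2`, `v3` invert it in the surjectivity argument.
  have expand : ∀ v0 v2 v3 : V × V, dbl o3 l v0 + (o2 + o3) * dbl o3 l v2 + o2 * o3 * dbl o3 l v3 =
      ((dbl o2 l).coprod ((LinearMap.mulLeft R o3 ∘ₗ dbl o2 l).coprod
        (LinearMap.mulLeft R (o3 * o3) ∘ₗ dbl o2 l)))
        ((v0.1, v2.1), (v0.2 + v2.1, v2.2 + v3.1), (v2.2, v3.2)) := by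
    intro v0 v2 v3
    simp only [LinearMap.coprod_apply, LinearMap.coe_comp, Function.comp_apply,
      LinearMap.mulLeft_apply, map_add, dbl_apply]
    ring
  constructor
  · rintro ⟨⟨v0, v2⟩, ⟨v1, v3⟩⟩ hv
    rw [mem_rad_iff_of_sub_mem (hL'' _), key'] at hv
    obtain ⟨hv, hv'⟩ := hv
    have h3 := hgt.inj _ hv'
    simp only at h3 hv
    rw [h3, map_zero, mul_zero, sub_zero, expand] at hv
    have h4 := hE.inj _ hv
    simp only [Prod.mk_eq_zero] at h4
    obtain ⟨⟨h5, h6⟩, ⟨h7, h8⟩, h9, h10⟩ := h4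
    rw [h6, add_zero] at h7
    rw [h9, zero_add] at h8
    have e0 : v0 = 0 := Prod.ext h5 h7
    have e2 : v2 = 0 := Prod.ext h6 h9
    have e3 : v3 = 0 := Prod.ext h8 h10
    rw [e2, sub_zero] at h3
    rw [e0, e2, e3, h3]
    rfl
  · intro y
    obtain ⟨p, q', hpq⟩ := hs' y
    obtain ⟨u, hu⟩ := hgt.surj q'
    obtain ⟨w, hw⟩ := hE.surj (p + q * dbl o3 l u)
    let v0 : V × V := (w.1.1, w.2.1.1 - w.1.2)
    let v2 : V × V := (w.1.2, w.2.2.1)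
    let v3 : V × V := (w.2.1.2 - w.2.2.1, w.2.2.2)
    refine ⟨((v0, v2), (u + v2, v3)), ?_⟩
    have h3 : f' (p + q * dbl o3 l u -
        (dbl o3 l v0 + (o2 + o3) * dbl o3 l v2 + o2 * o3 * dbl o3 l v3)) +
        η' * f' (q' - dbl o3 l u) ∈ rad N' := by
      rw [key', expand]
      refine ⟨?_, hu⟩
      convert hw using 4
      simp [v0, v2, v3]
    have h4 := (rad N').sub_mem ((rad N').add_mem hpq h3) (hL'' ((v0, v2), (u + v2, v3)))
    convert h4 using 1
    simp only [map_sub, map_add, map_mul, add_sub_cancel_right]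
    ring

end Radical

/-! ### Families of squarefree monomials -/

section Squarefree

variable {R A P H : Type*} [CommRing R] [CommRing A] [Algebra R A] [CommRing P] [Algebra R P]

/-- The linear map attached to the family of the products of the `ρ h`, `h ∈ S`, for `S ⊆ D`. -/
def lam (D : Finset H) (ρ : H → A) : (D.powerset → R) →ₗ[R] A :=
  Fintype.linearCombination R (fun S : D.powerset => ∏ h ∈ S.1, ρ h)

theorem lam_apply (D : Finset H) (ρ : H → A) (v : D.powerset → R) :
    lam D ρ v = ∑ S : D.powerset, v S • ∏ h ∈ S.1, ρ h := by
  simp [lam, Fintype.linearCombination_apply]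

theorem lam_restrict (D : Finset H) (ρ : H → A) (v : Finset H → R) :
    lam D ρ (fun S : D.powerset => v S.1) = ∑ S ∈ D.powerset, v S • ∏ h ∈ S, ρ h := by
  rw [lam_apply]
  exact Finset.sum_coe_sort D.powerset (fun S => v S • ∏ h ∈ S, ρ h)

theorem map_lam (f : P →ₐ[R] A) (D : Finset H) (ρ : H → P) (v : D.powerset → R) :
    f (lam D ρ v) = lam D (fun h => f (ρ h)) v := by
  simp [lam_apply, map_sum, map_prod]

theorem lam_sub_mem {I : Ideal A} (D : Finset H) {ρ ρ' : H → A} (h : ∀ i ∈ D, ρ i - ρ' i ∈ I)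
    (v : D.powerset → R) : lam D ρ v - lam D ρ' v ∈ I := by
  rw [← Ideal.Quotient.eq, lam_apply, lam_apply, map_sum, map_sum]
  refine Finset.sum_congr rfl fun S _ => ?_
  rw [Algebra.smul_def, Algebra.smul_def, map_mul, map_mul, map_prod, map_prod]
  congr 1
  refine Finset.prod_congr rfl fun i hi => ?_
  rw [Ideal.Quotient.eq]
  exact h i (Finset.mem_powerset.1 S.2 hi)

theorem good_lam_iff {N : Submodule R A} {D : Finset H} {ρ : H → A} :
    Good N (lam (R := R) D ρ) ↔
      (∀ v : Finset H → R, ∑ S ∈ D.powerset, v S • ∏ h ∈ S, ρ h ∈ rad N → ∀ S ⊆ D, v S = 0) ∧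
      ∀ y, ∃ v : Finset H → R, y - ∑ S ∈ D.powerset, v S • ∏ h ∈ S, ρ h ∈ rad N := by
  classical
  have ext : ∀ v : D.powerset → R, ∃ w : Finset H → R, v = fun S => w S.1 := by
    intro v
    refine ⟨fun S => if h : S ∈ D.powerset then v ⟨S, h⟩ else 0, ?_⟩
    funext S
    simp [S.2]
  constructor
  · intro h
    constructor
    · intro v hv S hS
      rw [← lam_restrict] at hv
      have := h.inj _ hv
      exact congrFun this ⟨S, Finset.mem_powerset.2 hS⟩
    · intro y
      obtain ⟨v, hv⟩ := h.surj y
      obtain ⟨w, rfl⟩ := ext v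
      exact ⟨w, by rwa [← lam_restrict]⟩
  · rintro ⟨h1, h2⟩
    constructor
    · intro v hv
      obtain ⟨w, rfl⟩ := ext v
      rw [lam_restrict] at hv
      funext S
      exact h1 w hv S.1 (Finset.mem_powerset.1 S.2)
    · intro y
      obtain ⟨v, hv⟩ := h2 y
      exact ⟨fun S => v S.1, by rwa [lam_restrict]⟩

/-- A subset of `insert i D` either avoids i or is a subset of D with i added, so each new letter
doubles the coefficient space. -/
theorem exists_equiv_lam_insert [DecidableEq H] {D : Finset H} {i : H} (hi : i ∉ D) :
    ∃ e : ((insert i D).powerset → R) ≃ₗ[R] (D.powerset → R) × (D.powerset → R),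
      ∀ (ρ : H → A) v, lam (insert i D) ρ v = dbl (ρ i) (lam D ρ) (e v) := by
  have hm : ∀ S : D.powerset, S.1 ∈ (insert i D).powerset := fun S => Finset.mem_powerset.2
    ((Finset.mem_powerset.1 S.2).trans (Finset.subset_insert _ _))
  have hm' : ∀ S : D.powerset, insert i S.1 ∈ (insert i D).powerset := fun S =>
    Finset.mem_powerset.2 (Finset.insert_subset_insert _ (Finset.mem_powerset.1 S.2))
  let g : ((insert i D).powerset → R) →ₗ[R] (D.powerset → R) × (D.powerset → R) :=
    { toFun := fun v => (fun S => v ⟨S.1, hm S⟩, fun S => v ⟨insert i S.1, hm' S⟩)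
      map_add' := fun _ _ => rfl
      map_smul' := fun _ _ => rfl }
  have hg : Function.Bijective g := by
    constructor
    · intro v w hvw
      funext S
      by_cases hiS : i ∈ S.1
      · have h4 : S.1.erase i ∈ D.powerset := by
          rw [Finset.mem_powerset, ← Finset.subset_insert_iff]
          exact Finset.mem_powerset.1 S.2
        have := congrFun (congrArg Prod.snd hvw) ⟨_, h4⟩
        simpa [g, Finset.insert_erase hiS] using this
      · have h4 : S.1 ∈ D.powerset := by
          rw [Finset.mem_powerset]
          exact (Finset.subset_insert_iff_of_notMem hiS).1 (Finset.mem_powerset.1 S.2)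
        exact congrFun (congrArg Prod.fst hvw) ⟨_, h4⟩
    · intro w
      refine ⟨fun S => if h : S.1 ∈ D.powerset then w.1 ⟨S.1, h⟩ else
        if h' : S.1.erase i ∈ D.powerset then w.2 ⟨S.1.erase i, h'⟩ else 0, ?_⟩
      refine Prod.ext (funext fun S => ?_) (funext fun S => ?_)
      · simp only [g, LinearMap.coe_mk, AddHom.coe_mk, S.2, dif_pos]
      · have h1 : insert i S.1 ∉ D.powerset := fun h =>
          hi (Finset.mem_powerset.1 h (Finset.mem_insert_self _ _))
        have h2 : (insert i S.1).erase i = S.1 :=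
          Finset.erase_insert fun h => hi (Finset.mem_powerset.1 S.2 h)
        simp only [g, LinearMap.coe_mk, AddHom.coe_mk, dif_neg h1, h2, S.2, dif_pos]
  refine ⟨LinearEquiv.ofBijective g hg, fun ρ v => ?_⟩
  obtain ⟨w, rfl⟩ : ∃ w : Finset H → R, v = fun S => w S.1 := by
    refine ⟨fun S => if h : S ∈ (insert i D).powerset then v ⟨S, h⟩ else 0, ?_⟩
    funext S
    simp only [S.2, dif_pos]
  have h3 : LinearEquiv.ofBijective g hg (fun S => w S.1) =
      (fun S => w S.1, fun S => w (insert i S.1)) := rfl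
  rw [h3, lam_restrict, Finset.sum_powerset_insert hi, dbl_apply, lam_restrict,
    lam_restrict D ρ (fun S => w (insert i S)), Finset.mul_sum]
  congr 1
  refine Finset.sum_congr rfl fun S hS => ?_
  rw [Finset.prod_insert fun h => hi (Finset.mem_powerset.1 hS h), mul_smul_comm]

theorem good_lam_insert [DecidableEq H] {N : Submodule R A} {D : Finset H} {ρ : H → A} {i : H}
    (hi : i ∉ D) : Good N (lam (R := R) (insert i D) ρ) ↔ Good N (dbl (ρ i) (lam (R := R) D ρ)) := by
  obtain ⟨e, he⟩ := exists_equiv_lam_insert (R := R) (A := A) hi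
  exact good_comp_equiv e (he ρ)

theorem good_lam_insert_insert [DecidableEq H] {N : Submodule R A} {D : Finset H} {ρ : H → A}
    {i j : H} (hj : j ∉ D) (hi : i ∉ insert j D) :
    Good N (lam (R := R) (insert i (insert j D)) ρ) ↔
      Good N (dbl (ρ i) (dbl (ρ j) (lam (R := R) D ρ))) := by
  obtain ⟨e, he⟩ := exists_equiv_lam_insert (R := R) (A := A) hj
  rw [good_lam_insert hi]
  exact good_comp_equiv (e.prodCongr e) (dbl_equiv e (he ρ) _)

theorem good_lam_insert_insert_insert [DecidableEq H] {N : Submodule R A} {D : Finset H}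
    {ρ : H → A} {i j k : H} (hk : k ∉ D) (hj : j ∉ insert k D)
    (hi : i ∉ insert j (insert k D)) :
    Good N (lam (R := R) (insert i (insert j (insert k D))) ρ) ↔
      Good N (dbl (ρ i) (dbl (ρ j) (dbl (ρ k) (lam (R := R) D ρ)))) := by
  obtain ⟨e, he⟩ := exists_equiv_lam_insert (R := R) (A := A) hk
  rw [good_lam_insert_insert hj hi]
  exact good_comp_equiv ((e.prodCongr e).prodCongr (e.prodCongr e))
    (dbl_equiv (e.prodCongr e) (dbl_equiv e (he ρ) _) _)

theorem good_lam_map {H' : Type*} {N : Submodule R A} {D : Finset H} {ρ : H' → A} (φ : H ↪ H') :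
    Good N (lam (R := R) (D.map φ) ρ) ↔ Good N (lam (R := R) D (fun h => ρ (φ h))) := by
  let g : D.powerset → (D.map φ).powerset := fun S =>
    ⟨S.1.map φ, Finset.mem_powerset.2 (Finset.map_subset_map.2 (Finset.mem_powerset.1 S.2))⟩
  have hg : Function.Bijective g := by
    constructor
    · intro S S' h
      exact Subtype.ext (Finset.map_injective φ (congrArg Subtype.val h))
    · rintro ⟨S, hS⟩
      obtain ⟨S', hS', rfl⟩ := Finset.subset_map_iff.1 (Finset.mem_powerset.1 hS)
      exact ⟨⟨S', Finset.mem_powerset.2 hS'⟩, rfl⟩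
  refine good_comp_equiv (LinearEquiv.funCongrLeft R R (Equiv.ofBijective g hg)) fun v => ?_
  rw [lam_apply, lam_apply, ← (Equiv.ofBijective g hg).sum_comp]
  refine Finset.sum_congr rfl fun S _ => ?_
  simp [g, LinearEquiv.funCongrLeft_apply]

end Squarefree

end Vinyl

end

noncomputable section

namespace Vinyl

namespace NilHecke

open Equiv Matrix

/-! ### Cyclic products of matrices -/

section Cyclic

variable {H : Type*} [Fintype H] [DecidableEq H] (nxt : Perm H) {n : ℕ} {K : Type*} [Field K]
  (X : Fin n → K)

/-- The sum of `F` over the closed paths, weighted by the products of the matrix entries. -/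
def cyc (m : H → Mat n K) (F : (H → Perm (Fin n)) → K) : K :=
  ∑ c : H → Perm (Fin n), (∏ h, m h (c h) (c (nxt h))) * F c

variable {nxt} (m : H → Mat n K) (h : H) (F : (H → Perm (Fin n)) → K)

/-- Isolates the slab h: the remaining factor does not depend on its matrix, so the cyclic product
is linear in each slab. -/
theorem cyc_update (A : Mat n K) : cyc nxt (Function.update m h A) F =
    ∑ c : H → Perm (Fin n), A (c h) (c (nxt h)) *
      ((∏ g ∈ Finset.univ.erase h, m g (c g) (c (nxt g))) * F c) := by
  refine Finset.sum_congr rfl fun c _ => ?_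
  rw [← Finset.mul_prod_erase _ _ (Finset.mem_univ h), Function.update_self, mul_assoc]
  congr 2
  refine Finset.prod_congr rfl fun g hg => ?_
  rw [Function.update_of_ne (Finset.ne_of_mem_erase hg)]

theorem cyc_eq_sum_erase : cyc nxt m F =
    ∑ c : H → Perm (Fin n), m h (c h) (c (nxt h)) *
      ((∏ g ∈ Finset.univ.erase h, m g (c g) (c (nxt g))) * F c) := by
  rw [← cyc_update, Function.update_eq_self]

/-- A variable at the height h can be absorbed into the matrix of the slab above that height. -/
theorem cyc_pos_left (j : Fin n) : cyc nxt m (fun c => X (c h j) * F c) =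
    cyc nxt (Function.update m h (pos X j * m h)) F := by
  rw [cyc_update, cyc_eq_sum_erase m h]
  refine Finset.sum_congr rfl fun c _ => ?_
  rw [pos, Matrix.diagonal_mul]
  ring

theorem cyc_pos_right (j : Fin n) : cyc nxt m (fun c => X (c (nxt h) j) * F c) =
    cyc nxt (Function.update m h (m h * pos X j)) F := by
  rw [cyc_update, cyc_eq_sum_erase m h]
  refine Finset.sum_congr rfl fun c _ => ?_
  rw [pos, Matrix.mul_diagonal]
  ring

theorem cyc_slab_add (A B : Mat n K) : cyc nxt (Function.update m h (A + B)) F =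
    cyc nxt (Function.update m h A) F + cyc nxt (Function.update m h B) F := by
  simp only [cyc_update, Matrix.add_apply, add_mul, Finset.sum_add_distrib]

theorem cyc_slab_neg (A : Mat n K) : cyc nxt (Function.update m h (-A)) F =
    -cyc nxt (Function.update m h A) F := by
  simp only [cyc_update, Matrix.neg_apply, neg_mul, Finset.sum_neg_distrib]

theorem cyc_slab_zero : cyc nxt (Function.update m h 0) F = 0 := by
  simp [cyc_update]

theorem cyc_slab_sub (A B : Mat n K) : cyc nxt (Function.update m h (A - B)) F =
    cyc nxt (Function.update m h A) F - cyc nxt (Function.update m h B) F := by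
  rw [sub_eq_add_neg, cyc_slab_add, cyc_slab_neg, sub_eq_add_neg]

variable {m h F}

/-- If F does not look at the height p, summation over the permutation there is the matrix product
of the two adjacent slabs. An identity matrix is left behind, so that the number of slabs stays the
same. -/
theorem cyc_contract {p : H} (hp : nxt h = p) (hne : p ≠ h)
    (hF : ∀ c σ, F (Function.update c p σ) = F c) : cyc nxt m F =
      cyc nxt (Function.update (Function.update m h (m h * m p)) p 1) F := by
  have hp' : nxt p ≠ p := fun e => hne (nxt.injective (e.trans hp.symm))
  have key : ∀ m : H → Mat n K, cyc nxt m F = ∑ d : {j // j ≠ p} → Perm (Fin n),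
      (m h * m p) (d ⟨h, hne.symm⟩) (d ⟨nxt p, hp'⟩) *
      ((∏ g ∈ (Finset.univ.erase h).erase p,
        m g ((Equiv.funSplitAt p _).symm (1, d) g)
          ((Equiv.funSplitAt p _).symm (1, d) (nxt g))) *
        F ((Equiv.funSplitAt p _).symm (1, d))) := by
    intro m
    rw [cyc, ← (Equiv.funSplitAt p (Perm (Fin n))).symm.sum_comp, Fintype.sum_prod_type,
      Finset.sum_comm]
    refine Finset.sum_congr rfl fun d _ => ?_
    have upd : ∀ σ, (Equiv.funSplitAt p (Perm (Fin n))).symm (σ, d) =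
        Function.update ((Equiv.funSplitAt p _).symm (1, d)) p σ := by
      intro σ
      funext g
      by_cases hg : g = p
      · subst hg
        simp
      · rw [Function.update_of_ne hg]
        simp [hg]
    rw [Matrix.mul_apply, Finset.sum_mul]
    refine Finset.sum_congr rfl fun σ _ => ?_
    rw [← Finset.mul_prod_erase _ _ (Finset.mem_univ h),
      ← Finset.mul_prod_erase _ _ (Finset.mem_erase.2 ⟨hne, Finset.mem_univ p⟩), upd, hF, hp,
      Function.update_self, Function.update_of_ne hne.symm, Function.update_of_ne hp']
    have e1 : (Equiv.funSplitAt p (Perm (Fin n))).symm (1, d) h = d ⟨h, hne.symm⟩ := by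
      simp [hne.symm]
    have e2 : (Equiv.funSplitAt p (Perm (Fin n))).symm (1, d) (nxt p) = d ⟨nxt p, hp'⟩ := by
      simp [hp']
    rw [e1, e2]
    have e3 : ∀ g ∈ (Finset.univ.erase h).erase p,
        m g (Function.update ((Equiv.funSplitAt p _).symm (1, d)) p σ g)
          (Function.update ((Equiv.funSplitAt p _).symm (1, d)) p σ (nxt g)) =
        m g ((Equiv.funSplitAt p _).symm (1, d) g)
          ((Equiv.funSplitAt p _).symm (1, d) (nxt g)) := by
      intro g hg
      simp only [Finset.mem_erase, Finset.mem_univ, and_true] at hg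
      rw [Function.update_of_ne hg.1,
        Function.update_of_ne (fun e => hg.2 (nxt.injective (e.trans hp.symm)))]
    rw [Finset.prod_congr rfl e3]
    ring
  rw [key, key]
  refine Finset.sum_congr rfl fun d _ => ?_
  rw [Function.update_self, Function.update_of_ne hne.symm, Function.update_self, mul_one]
  congr 2
  refine Finset.prod_congr rfl fun g hg => ?_
  simp only [Finset.mem_erase, Finset.mem_univ, and_true] at hg
  rw [Function.update_of_ne hg.1, Function.update_of_ne hg.2]

/-- Lets a relation between products of two adjacent matrices act inside a cyclic product, on
functions that ignore the height in between. -/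
theorem cyc_congr_two {m' : H → Mat n K} {p : H} (hp : nxt h = p) (hne : p ≠ h)
    (hF : ∀ c σ, F (Function.update c p σ) = F c) (hm : ∀ g, g ≠ h → g ≠ p → m g = m' g)
    (hmm : m h * m p = m' h * m' p) : cyc nxt m F = cyc nxt m' F := by
  rw [cyc_contract (m := m) hp hne hF, cyc_contract (m := m') hp hne hF, hmm]
  congr 1
  funext g
  by_cases h1 : g = p
  · subst h1; simp
  · by_cases h2 : g = h
    · subst h2; simp [h1]
    · simp [h1, h2, hm g h2 h1]

theorem cyc_contract_three {p q : H} (hp : nxt h = p) (hq : nxt p = q) (hne : p ≠ h) (hqh : q ≠ h)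
    (hFp : ∀ c σ, F (Function.update c p σ) = F c) (hFq : ∀ c σ, F (Function.update c q σ) = F c) :
    cyc nxt m F = cyc nxt (Function.update (Function.update (Function.update m p 1) q 1) h
      (m h * m p * m q)) F := by
  have hqp : q ≠ p := fun e => hne (nxt.injective (hq.trans (e.trans hp.symm)))
  rw [cyc_contract (m := m) hq hqp hFq, cyc_contract hp hne hFp]
  congr 1
  funext g
  by_cases h1 : g = p
  · subst h1; simp [hne, hqp.symm]
  · by_cases h2 : g = h
    · subst h2; simp [h1, hqh.symm, hqp.symm, mul_assoc]
    · by_cases h3 : g = q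
      · subst h3; simp [h1, h2]
      · simp [h1, h2, h3]

theorem cyc_congr_three {m' : H → Mat n K} {p q : H} (hp : nxt h = p) (hq : nxt p = q)
    (hne : p ≠ h) (hqh : q ≠ h)
    (hFp : ∀ c σ, F (Function.update c p σ) = F c) (hFq : ∀ c σ, F (Function.update c q σ) = F c)
    (hm : ∀ g, g ≠ h → g ≠ p → g ≠ q → m g = m' g)
    (hmm : m h * m p * m q = m' h * m' p * m' q) : cyc nxt m F = cyc nxt m' F := by
  rw [cyc_contract_three (m := m) hp hq hne hqh hFp hFq,
    cyc_contract_three (m := m') hp hq hne hqh hFp hFq, hmm]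
  congr 1
  funext g
  by_cases h2 : g = h
  · subst h2; simp
  · by_cases h1 : g = p
    · subst h1
      by_cases h3 : g = q
      · subst h3; simp [h2]
      · simp [h2, h3]
    · by_cases h3 : g = q
      · subst h3; simp [h2]
      · simp [h1, h2, h3, hm g h2 h1 h3]

end Cyclic

/-! ### The trace form of a cyclic product of matrices -/

section Form

variable {H : Type*} {n : ℕ} (R : Type*) [CommRing R] {K : Type*} [Field K] [Algebra R K]
  (X : Fin n → K)

/-- The variable of the `j`-th slot at height `h`. -/
abbrev var (h : H) (j : Fin n) : MvPolynomial (H × Fin n) R := MvPolynomial.X (h, j)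

/-- Evaluation along a path. -/
def evp (c : H → Perm (Fin n)) : MvPolynomial (H × Fin n) R →ₐ[R] K :=
  MvPolynomial.aeval fun q => X (c q.1 q.2)

@[simp] theorem evp_X (c : H → Perm (Fin n)) (q : H × Fin n) :
    evp R X c (MvPolynomial.X q) = X (c q.1 q.2) := by
  simp [evp]

/-- Substitution of heights. -/
def subHeight {H' : Type*} (g : H → H') :
    MvPolynomial (H × Fin n) R →ₐ[R] MvPolynomial (H' × Fin n) R :=
  MvPolynomial.rename (Prod.map g id)

@[simp] theorem subHeight_X {H' : Type*} (g : H → H') (q : H × Fin n) :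
    subHeight R g (MvPolynomial.X q) = MvPolynomial.X (g q.1, q.2) := by
  simp [subHeight, Prod.map]

theorem evp_subHeight {H' : Type*} (g : H → H') (c : H' → Perm (Fin n))
    (y : MvPolynomial (H × Fin n) R) : evp R X c (subHeight R g y) = evp R X (c ∘ g) y := by
  rw [evp, subHeight, MvPolynomial.aeval_rename]
  rfl

variable [Fintype H] [DecidableEq H] (nxt : Perm H)

/-- The trace form. -/
def form (m : H → Mat n K) : MvPolynomial (H × Fin n) R →ₗ[R] K where
  toFun y := cyc nxt m fun c => evp R X c y
  map_add' y z := by simp [cyc, mul_add, Finset.sum_add_distrib]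
  map_smul' r y := by simp [cyc, Finset.smul_sum]

theorem form_apply (m : H → Mat n K) (y : MvPolynomial (H × Fin n) R) :
    form R X nxt m y = cyc nxt m fun c => evp R X c y := rfl

variable {R} {X} {nxt}

theorem form_reindex {H' : Type*} [Fintype H'] [DecidableEq H'] {nxt' : Perm H'} (φ : H ≃ H')
    (hφ : ∀ h, nxt' (φ h) = φ (nxt h)) (m : H' → Mat n K) (y : MvPolynomial (H × Fin n) R) :
    form R X nxt' m (subHeight R φ y) = form R X nxt (fun h => m (φ h)) y := by
  rw [form_apply, form_apply, cyc, cyc,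
    ← (Equiv.arrowCongr φ (Equiv.refl (Perm (Fin n)))).sum_comp]
  refine Finset.sum_congr rfl fun c _ => ?_
  rw [evp_subHeight, ← φ.prod_comp]
  have e : (Equiv.arrowCongr φ (Equiv.refl (Perm (Fin n)))) c ∘ φ = c := by
    funext h
    simp
  rw [e]
  congr 1
  refine Finset.prod_congr rfl fun h _ => ?_
  rw [hφ]
  simp

/-- The polynomials whose value under the trace form lies in `𝔪`. -/
def ker (𝔪 : Submodule R K) (X : Fin n → K) (nxt : Perm H) (m : H → Mat n K) :
    Submodule R (MvPolynomial (H × Fin n) R) :=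
  𝔪.comap (form R X nxt m)

variable {𝔪 : Submodule R K} {m : H → Mat n K}

theorem mem_ker {y : MvPolynomial (H × Fin n) R} :
    y ∈ ker 𝔪 X nxt m ↔ form R X nxt m y ∈ 𝔪 := Iff.rfl

/-- All multiples of y vanish on the paths of nonzero weight too, so every summand of the trace is
zero. The congruences between variables below all come from this. -/
theorem mem_rad_ker_of_forall {y : MvPolynomial (H × Fin n) R}
    (hy : ∀ c, (∀ h, m h (c h) (c (nxt h)) ≠ 0) → evp R X c y = 0) :
    y ∈ rad (ker 𝔪 X nxt m) := by
  intro z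
  rw [mem_ker, form_apply, cyc, Finset.sum_eq_zero]
  · exact 𝔪.zero_mem
  · intro c _
    by_cases h : ∀ h, m h (c h) (c (nxt h)) ≠ 0
    · rw [map_mul, hy c h, mul_zero, mul_zero]
    · push Not at h
      obtain ⟨h, hh⟩ := h
      rw [Finset.prod_eq_zero (Finset.mem_univ h) hh, zero_mul]

end Form

/-- An induction principle: a polynomial ring is a sum `B + r B` modulo an ideal as soon as this
contains the variables and the square of `r`. -/
theorem exists_sub_mem_of_generators {R σ P : Type*} [CommRing R] [CommRing P] [Algebra R P]
    {I : Ideal (MvPolynomial σ R)} (f : P →ₐ[R] MvPolynomial σ R) (r : MvPolynomial σ R)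
    (hX : ∀ s, ∃ p q, MvPolynomial.X s - (f p + r * f q) ∈ I)
    (hr : ∃ e e', r * r - (r * f e - f e') ∈ I) (a : MvPolynomial σ R) :
    ∃ p q, a - (f p + r * f q) ∈ I := by
  obtain ⟨e, e', he⟩ := hr
  induction a using MvPolynomial.induction_on with
  | C x => exact ⟨algebraMap R P x, 0, by simp [← MvPolynomial.algebraMap_eq]⟩
  | add a b ha hb =>
    obtain ⟨p, q, h⟩ := ha
    obtain ⟨p', q', h'⟩ := hb
    refine ⟨p + p', q + q', ?_⟩
    convert I.add_mem h h' using 1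
    simp only [map_add]
    ring
  | mul_X a s ha =>
    obtain ⟨p, q, h⟩ := ha
    obtain ⟨p', q', h'⟩ := hX s
    refine ⟨p * p' - e' * q * q', p * q' + p' * q + e * q * q', ?_⟩
    have h1 := I.mul_mem_right (MvPolynomial.X s) h
    have h2 := I.mul_mem_left (f p + r * f q) h'
    have h3 := I.mul_mem_left (f q * f q') he
    convert I.add_mem (I.add_mem h1 h2) h3 using 1
    simp only [map_add, map_sub, map_mul]
    ring

end NilHecke

end Vinyl

end

noncomputable section

namespace Vinyl

namespace NilHecke

open Equiv Matrix

/-! ### Words of dumbbells -/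

/-- The letters: pairs of neighbouring slots. -/
abbrev Letter (n : ℕ) : Type := Fin (n - 1)

namespace Letter

variable {n : ℕ}

/-- The left slot of a letter. -/
def lo (i : Letter n) : Fin n := ⟨i.1, by omega⟩

/-- The right slot of a letter. -/
def hi (i : Letter n) : Fin n := ⟨i.1 + 1, by omega⟩

theorem lo_ne_hi (i : Letter n) : i.lo ≠ i.hi := by
  simp [lo, hi, Fin.ext_iff]

end Letter

/-- The slots touched by a slab. -/
def slots {n : ℕ} : Option (Letter n) → Finset (Fin n)
  | none => ∅
  | some i => {i.lo, i.hi}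

section Words

variable {n : ℕ} {K : Type*} [Field K] (X : Fin n → K)

/-- The matrix of a slab. -/
def mat : Option (Letter n) → Mat n K
  | none => 1
  | some i => dum X i.lo i.hi

variable {X}

theorem eq_of_mat_ne_zero {o : Option (Letter n)} {σ τ : Perm (Fin n)} (h : mat X o σ τ ≠ 0)
    {j : Fin n} (hj : j ∉ slots o) : τ j = σ j := by
  cases o with
  | none =>
    by_cases e : σ = τ
    · rw [e]
    · exact absurd (Matrix.one_apply_ne e) h
  | some i =>
    have h1 : τ = σ ∨ τ = σ * Equiv.swap i.lo i.hi := by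
      by_contra h2
      exact h (by simp only [mat, dum, Matrix.of_apply, if_neg h2])
    simp only [slots, Finset.mem_insert, Finset.mem_singleton, not_or] at hj
    rcases h1 with rfl | rfl
    · rfl
    · rw [Perm.mul_apply, swap_apply_of_ne_of_ne hj.1 hj.2]

theorem eq_or_of_mat_ne_zero {i : Letter n} {σ τ : Perm (Fin n)} (h : mat X (some i) σ τ ≠ 0) :
    (τ i.lo = σ i.lo ∧ τ i.hi = σ i.hi) ∨ (τ i.lo = σ i.hi ∧ τ i.hi = σ i.lo) := by
  have h1 : τ = σ ∨ τ = σ * Equiv.swap i.lo i.hi := by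
    by_contra h2
    exact h (by simp only [mat, dum, Matrix.of_apply, if_neg h2])
  rcases h1 with rfl | rfl
  · exact Or.inl ⟨rfl, rfl⟩
  · exact Or.inr (by simp)

theorem mat_comm {o o' : Option (Letter n)} (h : Disjoint (slots o) (slots o')) :
    mat X o * mat X o' = mat X o' * mat X o := by
  cases o with
  | none => simp [mat]
  | some i =>
    cases o' with
    | none => simp [mat]
    | some j =>
      simp only [slots, Finset.disjoint_insert_left, Finset.mem_insert, Finset.mem_singleton,
        Finset.disjoint_singleton_left, not_or] at h
      exact dum_comm i.lo_ne_hi j.lo_ne_hi h.1.1 h.1.2 h.2.1 h.2.2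

variable {R : Type*} [CommRing R] [Algebra R K] {H : Type*} [Fintype H] [DecidableEq H]
  {nxt : Perm H} {𝔪 : Submodule R K}

/-- The slabs of a word that contain a dumbbell. -/
def wordSupp (w : H → Option (Letter n)) : Finset H := Finset.univ.filter fun h => (w h).isSome

omit [DecidableEq H] in
theorem mem_wordSupp {w : H → Option (Letter n)} {h : H} : h ∈ wordSupp w ↔ (w h).isSome := by
  simp [wordSupp]

variable (R nxt) in
/-- The decoration of the right upper end of the dumbbells of a word. -/
def wordDeco (w : H → Option (Letter n)) (h : H) : MvPolynomial (H × Fin n) R :=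
  (w h).elim 1 fun i => var R (nxt h) i.hi

omit [Fintype H] [DecidableEq H] in
theorem wordDeco_some {w : H → Option (Letter n)} {h : H} {i : Letter n} (hi : w h = some i) :
    wordDeco R nxt w h = var R (nxt h) i.hi := by
  simp [wordDeco, hi]

variable (X nxt 𝔪) in
/-- The radical ideal of a word. -/
def wordRad (w : H → Option (Letter n)) : Ideal (MvPolynomial (H × Fin n) R) :=
  rad (ker 𝔪 X nxt fun h => mat X (w h))

variable (X nxt 𝔪) in
/-- The squarefree monomials in the decorations of the right upper ends of the dumbbells form a
basis modulo the radical. -/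
def GoodWord (w : H → Option (Letter n)) : Prop :=
  Good (ker 𝔪 X nxt fun h => mat X (w h)) (lam (R := R) (wordSupp w) (wordDeco R nxt w))

theorem mem_wordRad {w : H → Option (Letter n)} {y : MvPolynomial (H × Fin n) R}
    (hy : ∀ c, (∀ h, mat X (w h) (c h) (c (nxt h)) ≠ 0) → evp R X c y = 0) :
    y ∈ wordRad X nxt 𝔪 w :=
  mem_rad_ker_of_forall hy

/-- A slot that the slab does not touch carries the same pigment below and above it. -/
theorem var_sub_mem {w : H → Option (Letter n)} {h p : H} (hp : nxt h = p) {j : Fin n}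
    (hj : j ∉ slots (w h)) : var R h j - var R p j ∈ wordRad X nxt 𝔪 w := by
  subst hp
  refine mem_wordRad fun c hc => ?_
  simp [eq_of_mat_ne_zero (hc h) hj]

/-- A dumbbell may exchange its two pigments, so only their symmetric functions pass through it. -/
theorem var_add_mem {w : H → Option (Letter n)} {h p : H} (hp : nxt h = p) {i : Letter n}
    (hi : w h = some i) : var R h i.lo + var R h i.hi - (var R p i.lo + var R p i.hi) ∈
      wordRad X nxt 𝔪 w := by
  subst hp
  refine mem_wordRad fun c hc => ?_
  have h1 := hc h
  rw [hi] at h1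
  rcases eq_or_of_mat_ne_zero h1 with ⟨h2, h3⟩ | ⟨h2, h3⟩
  · simp [h2, h3]
  · simp [h2, h3, add_comm]

theorem var_mul_mem {w : H → Option (Letter n)} {h p : H} (hp : nxt h = p) {i : Letter n}
    (hi : w h = some i) : var R h i.lo * var R h i.hi - var R p i.lo * var R p i.hi ∈
      wordRad X nxt 𝔪 w := by
  subst hp
  refine mem_wordRad fun c hc => ?_
  have h1 := hc h
  rw [hi] at h1
  rcases eq_or_of_mat_ne_zero h1 with ⟨h2, h3⟩ | ⟨h2, h3⟩
  · simp [h2, h3]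
  · simp [h2, h3, mul_comm]

theorem goodWord_reindex {H' : Type*} [Fintype H'] [DecidableEq H'] {nxt' : Perm H'} (φ : H ≃ H')
    (hφ : ∀ h, nxt' (φ h) = φ (nxt h)) (w : H' → Option (Letter n)) :
    GoodWord (R := R) X nxt' 𝔪 w ↔ GoodWord X nxt 𝔪 (fun h => w (φ h)) := by
  have hsupp : wordSupp w = (wordSupp fun h => w (φ h)).map φ.toEmbedding := by
    ext h
    simp only [Finset.mem_map_equiv, mem_wordSupp, apply_symm_apply]
  unfold GoodWord
  rw [hsupp, good_lam_map, Equiv.coe_toEmbedding]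
  refine good_transfer (subHeight R φ) (fun y => ?_) (fun a => ?_) (fun v => ?_)
  · rw [mem_ker, mem_ker, form_reindex φ hφ]
  · refine ⟨subHeight R φ.symm a, ?_⟩
    have : subHeight R φ (subHeight R φ.symm a) = a := by
      simp only [subHeight, MvPolynomial.rename_rename]
      have : Prod.map φ id ∘ Prod.map φ.symm (id : Fin n → Fin n) = id := by
        funext q; simp [Prod.map]
      rw [this, MvPolynomial.rename_id_apply]
    rw [this, sub_self]
    exact zero_mem _
  · rw [map_lam]
    refine lam_sub_mem _ (fun h hh => ?_) _
    rw [mem_wordSupp, Option.isSome_iff_exists] at hh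
    obtain ⟨i, hi⟩ := hh
    rw [wordDeco_some (w := w) hi, wordDeco_some (w := fun h => w (φ h)) hi, subHeight_X, hφ, sub_self]
    exact zero_mem _

/-- Moving all variables at height `p` to the height above. -/
def lift1 (nxt : Perm H) (p : H) : H → H := Function.update id p (nxt p)

omit [Fintype H] in
theorem lift1_update {p : H} (hp : nxt p ≠ p) (c : H → Perm (Fin n)) (σ : Perm (Fin n)) :
    Function.update c p σ ∘ lift1 nxt p = c ∘ lift1 nxt p := by
  funext g
  by_cases hg : g = p
  · subst hg; simp [lift1, hp]
  · simp [lift1, hg]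

/-- A path of nonzero weight is constant across an empty slab. -/
theorem sub_subHeight_mem {w : H → Option (Letter n)} {p : H} (hw : w p = none)
    (y : MvPolynomial (H × Fin n) R) :
    y - subHeight R (lift1 nxt p) y ∈ wordRad X nxt 𝔪 w := by
  refine mem_wordRad fun c hc => ?_
  have h1 := hc p
  rw [hw] at h1
  have h2 : c ∘ lift1 nxt p = c := by
    funext g
    by_cases hg : g = p
    · subst hg
      simp only [Function.comp_apply, lift1, Function.update_self]
      by_contra e
      exact h1 (Matrix.one_apply_ne (Ne.symm e))
    · simp [lift1, hg]
  rw [map_sub, evp_subHeight, h2, sub_self]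

omit [Fintype H] in
theorem evp_lift1_update {p : H} (hp : nxt p ≠ p) (y : MvPolynomial (H × Fin n) R)
    (c : H → Perm (Fin n)) (σ : Perm (Fin n)) :
    evp R X (Function.update c p σ) (subHeight R (lift1 nxt p) y) =
      evp R X c (subHeight R (lift1 nxt p) y) := by
  rw [evp_subHeight, evp_subHeight, lift1_update hp]

/-! ### Commuting slabs -/

theorem form_eq_of_comm {w w' : H → Option (Letter n)} {h p : H} (hp : nxt h = p) (hne : p ≠ h)
    (hw : ∀ g, g ≠ h → g ≠ p → w g = w' g) (hh : w' h = w p) (hpp : w' p = w h)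
    (hd : Disjoint (slots (w h)) (slots (w p))) (y : MvPolynomial (H × Fin n) R) :
    form R X nxt (fun g => mat X (w g)) (subHeight R (lift1 nxt p) y) =
      form R X nxt (fun g => mat X (w' g)) (subHeight R (lift1 nxt p) y) := by
  have hp' : nxt p ≠ p := fun e => hne (nxt.injective (e.trans hp.symm))
  refine cyc_congr_two hp hne (fun c σ => evp_lift1_update hp' y c σ) (fun g h1 h2 => ?_) ?_
  · simp only [hw g h1 h2]
  · simp only [hh, hpp]
    exact mat_comm hd

/-- A slot at the height p is untouched by at least one of the two slabs around p, so its variable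
moves up or down, away from p. -/
theorem exists_sub_mem_of_comm {w : H → Option (Letter n)} {h p : H} (hp : nxt h = p) (hne : p ≠ h)
    (hd : Disjoint (slots (w h)) (slots (w p))) (a : MvPolynomial (H × Fin n) R) :
    ∃ y, a - subHeight R (lift1 nxt p) y ∈ wordRad X nxt 𝔪 w := by
  have hp' : nxt p ≠ p := fun e => hne (nxt.injective (e.trans hp.symm))
  -- The degenerate generator 0 makes the induction principle for quadratic extensions applicable.
  suffices h : ∃ y z : MvPolynomial (H × Fin n) R, a - (subHeight R (lift1 nxt p) y +
      0 * subHeight R (lift1 nxt p) z) ∈ wordRad X nxt 𝔪 w by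
    simpa using h
  refine exists_sub_mem_of_generators _ _ (fun s => ?_) ⟨0, 0, by simp⟩ a
  · obtain ⟨g, j⟩ := s
    by_cases hg : g = p
    · subst hg
      by_cases hj : j ∈ slots (w h)
      · refine ⟨var R g j, 0, ?_⟩
        have h1 : j ∉ slots (w g) := Finset.disjoint_left.1 hd hj
        simpa [lift1] using var_sub_mem (𝔪 := 𝔪) (X := X) (R := R) (rfl : nxt g = nxt g) h1
      · refine ⟨var R h j, 0, ?_⟩
        have := neg_mem (var_sub_mem (𝔪 := 𝔪) (X := X) (R := R) hp hj)
        simpa [lift1, hne.symm] using this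
    · exact ⟨var R g j, 0, by simp [lift1, hg]⟩

/-- On polynomials that ignore the middle height the two words have the same trace, and modulo the
radicals every polynomial is of this kind. So the quotients coincide, with the same family up to
exchanging the two positions. -/
theorem goodWord_comm {w w' : H → Option (Letter n)} {h p : H} (hp : nxt h = p) (hne : p ≠ h)
    (hw : ∀ g, g ≠ h → g ≠ p → w g = w' g) (hh : w' h = w p) (hpp : w' p = w h)
    (hd : Disjoint (slots (w h)) (slots (w p))) (hg : GoodWord (R := R) X nxt 𝔪 w) :
    GoodWord (R := R) X nxt 𝔪 w' := by
  have hp' : nxt p ≠ p := fun e => hne (nxt.injective (e.trans hp.symm))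
  have hd' : Disjoint (slots (w' h)) (slots (w' p)) := by rw [hh, hpp]; exact hd.symm
  have hsupp : wordSupp w' = (wordSupp w).map (Equiv.swap h p).toEmbedding := by
    ext g
    simp only [Finset.mem_map_equiv, mem_wordSupp, symm_swap]
    by_cases h1 : g = h
    · subst h1; rw [swap_apply_left, hh]
    · by_cases h2 : g = p
      · subst h2; rw [swap_apply_right, hpp]
      · rw [swap_apply_of_ne_of_ne h1 h2, hw g h1 h2]
  -- The upper end of the lower dumbbell is at height p; as the other dumbbell is disjoint from it,
  -- its variable may be read one height higher.
  let ρ : H → MvPolynomial (H × Fin n) R := fun g =>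
    (w g).elim 1 fun i => var R (if g = h then nxt p else nxt g) i.hi
  have hρ : ∀ g i, w g = some i → subHeight R (lift1 nxt p) (ρ g) =
      var R (if g = h then nxt p else nxt g) i.hi := by
    intro g i hi
    simp only [ρ, hi, Option.elim_some, subHeight_X]
    congr 2
    split_ifs with h1
    · simp [lift1, hp']
    · have : nxt g ≠ p := fun e => h1 (nxt.injective (e.trans hp.symm))
      simp [lift1, this]
  have e1 : Good ((ker 𝔪 X nxt fun g => mat X (w g)).comap
      (subHeight R (lift1 nxt p)).toLinearMap) (lam (R := R) (wordSupp w) ρ) := by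
    refine (good_transfer (subHeight R (lift1 nxt p)) (fun y => Iff.rfl)
      (exists_sub_mem_of_comm hp hne hd) (fun v => ?_)).1 hg
    rw [map_lam]
    refine lam_sub_mem _ (fun g hg => ?_) _
    rw [mem_wordSupp, Option.isSome_iff_exists] at hg
    obtain ⟨i, hi⟩ := hg
    rw [wordDeco_some hi, hρ g i hi]
    split_ifs with h1
    · subst h1
      have h2 : i.hi ∉ slots (w p) := Finset.disjoint_left.1 hd (by simp [hi, slots])
      rw [hp]
      exact var_sub_mem rfl h2
    · rw [sub_self]; exact zero_mem _
  unfold GoodWord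
  rw [hsupp, good_lam_map, Equiv.coe_toEmbedding]
  refine (good_transfer (subHeight R (lift1 nxt p)) (fun y => ?_)
      (exists_sub_mem_of_comm hp hne hd') (fun v => ?_)).2 e1
  · rw [mem_ker, ← form_eq_of_comm hp hne hw hh hpp hd]
    rfl
  · rw [map_lam]
    refine lam_sub_mem _ (fun g hg => ?_) _
    rw [mem_wordSupp, Option.isSome_iff_exists] at hg
    obtain ⟨i, hi⟩ := hg
    rw [hρ g i hi]
    by_cases h1 : g = h
    · subst h1
      rw [swap_apply_left, wordDeco_some (hpp.trans hi), if_pos rfl, sub_self]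
      exact zero_mem _
    · rw [if_neg h1]
      by_cases h2 : g = p
      · subst h2
        rw [swap_apply_right, wordDeco_some (hh.trans hi), hp]
        have h2 : i.hi ∉ slots (w' g) := by
          rw [hpp]
          exact Finset.disjoint_right.1 hd (by simp [hi, slots])
        exact var_sub_mem rfl h2
      · rw [swap_apply_of_ne_of_ne h1 h2, wordDeco_some ((hw g h1 h2).symm.trans hi), sub_self]
        exact zero_mem _

/-! ### Two equal dumbbells -/

/-- Let B be the polynomials that ignore the middle height and r the right variable there. The trace
vanishes on B since `dum` squares to zero, and on r B it is minus the trace of the word with one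
copy of the letter. So the form is hyperbolic over B. -/
theorem goodWord_digon {w w' : H → Option (Letter n)} {h p : H} (hp : nxt h = p) (hne : p ≠ h)
    (hw : ∀ g, g ≠ h → g ≠ p → w g = w' g) {i : Letter n} (hh : w h = some i) (hpi : w p = some i)
    (hh' : w' h = some i) (hp' : w' p = none) (hg : GoodWord (R := R) X nxt 𝔪 w')
    (hX : Function.Injective X) :
    GoodWord (R := R) X nxt 𝔪 w := by
  have hpp : nxt p ≠ p := fun e => hne (nxt.injective (e.trans hp.symm))
  set D := ((wordSupp w).erase h).erase p with hD
  have hD' : D = (wordSupp w').erase h := by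
    ext g
    simp only [hD, Finset.mem_erase, mem_wordSupp]
    by_cases h2 : g = p
    · subst h2; simp [hp']
    · by_cases h1 : g = h
      · simp [h1]
      · simp [h1, h2, hw g h1 h2]
  have hsupp : wordSupp w = insert h (insert p D) := by
    rw [hD, Finset.insert_erase, Finset.insert_erase]
    · simp [mem_wordSupp, hh]
    · simp [mem_wordSupp, hpi, hne]
  have hsupp' : wordSupp w' = insert h D := by
    rw [hD', Finset.insert_erase]
    simp [mem_wordSupp, hh']
  have hpD : p ∉ D := by simp [hD]
  have hhD : h ∉ D := by simp [hD]
  have hhpD : h ∉ insert p D := by simp [hhD, hne.symm]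
  have hlift : subHeight R (lift1 nxt p) (var R p i.hi) = var R (nxt p) i.hi := by simp [lift1]
  unfold GoodWord at hg ⊢
  rw [hsupp', good_lam_insert hhD, wordDeco_some hh', hp] at hg
  rw [hsupp, good_lam_insert_insert hpD hhpD, wordDeco_some hh, wordDeco_some hpi, hp]
  -- The generator satisfies r² = (sum) r - (product) with the symmetric functions of the two slots;
  -- `lift1` moves these functions above the second dumbbell.
  refine (good_dbl_iff (subHeight R (lift1 nxt p)) (var R p i.hi)
    (var R p i.lo + var R p i.hi) (var R p i.lo * var R p i.hi)
    (fun y => ?_) (fun y => ?_) ?_ (fun a => ?_) (fun v => ?_)).2 hg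
  · rw [mem_ker]
    have h0 : form R X nxt (fun g => mat X (w g)) (subHeight R (lift1 nxt p) y) =
        cyc nxt (Function.update (fun g => mat X (w g)) h 0)
          (fun c => evp R X c (subHeight R (lift1 nxt p) y)) := by
      refine cyc_congr_two hp hne (fun c σ => evp_lift1_update hpp y c σ) (fun g h1 _ => ?_) ?_
      · simp [h1]
      · simp [hh, hpi, mat, dum_sq i.lo_ne_hi]
    rw [h0, cyc_slab_zero]
    exact zero_mem _
  · have h1 : form R X nxt (fun g => mat X (w g))
        (var R p i.hi * subHeight R (lift1 nxt p) y) =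
        -form R X nxt (fun g => mat X (w' g)) (subHeight R (lift1 nxt p) y) := by
      simp only [form_apply, map_mul, evp_X]
      have h2 := cyc_pos_left (X := X) (nxt := nxt) (fun g => mat X (w g)) p
        (fun c => evp R X c (subHeight R (lift1 nxt p) y)) i.hi
      rw [h2]
      have h3 := cyc_slab_neg (nxt := nxt) (fun g => mat X (w' g)) h
        (fun c => evp R X c (subHeight R (lift1 nxt p) y)) (mat X (w' h))
      rw [Function.update_eq_self] at h3
      rw [← h3]
      refine cyc_congr_two hp hne (fun c σ => evp_lift1_update hpp y c σ) (fun g h1 h2 => ?_) ?_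
      · simp [h1, h2, hw g h1 h2]
      · simp only [Function.update_self, Function.update_of_ne hne.symm,
          Function.update_of_ne hne, hh, hh', hp', hpi, mat, ← mul_assoc,
          dum_pos_dum hX i.lo_ne_hi, mul_one]
    rw [mem_ker, mem_ker, h1, neg_mem_iff]
    have h2 := mem_iff_of_sub_mem_rad (sub_subHeight_mem (𝔪 := 𝔪) (X := X) (nxt := nxt) hp' y)
    exact h2.symm
  · change _ ∈ wordRad X nxt 𝔪 w
    have h1 := (wordRad X nxt 𝔪 w).mul_mem_left (var R p i.hi) (var_add_mem rfl hpi)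
    have h2 := var_mul_mem (𝔪 := 𝔪) (X := X) (R := R) (rfl : nxt p = nxt p) hpi
    have h3 := (wordRad X nxt 𝔪 w).sub_mem h1 h2
    convert h3 using 1
    simp only [map_add, map_mul, subHeight_X, lift1, Function.update_self]
    ring
  · refine exists_sub_mem_of_generators (I := wordRad X nxt 𝔪 w) _ _ (fun s => ?_)
      ⟨var R p i.lo + var R p i.hi, var R p i.lo * var R p i.hi, ?_⟩ a
    · obtain ⟨g, j⟩ := s
      by_cases hgp : g = p
      · subst hgp
        by_cases h1 : j = i.hi
        · subst h1
          exact ⟨0, 1, by simp⟩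
        · by_cases h2 : j = i.lo
          · subst h2
            refine ⟨var R g i.lo + var R g i.hi, -1, ?_⟩
            have h3 := var_add_mem (𝔪 := 𝔪) (X := X) (R := R) (rfl : nxt g = nxt g) hpi
            convert h3 using 1
            simp only [map_add, subHeight_X, lift1, Function.update_self, map_neg, map_one]
            ring
          · refine ⟨var R g j, 0, ?_⟩
            have h3 := var_sub_mem (𝔪 := 𝔪) (X := X) (R := R) (w := w) (rfl : nxt g = nxt g)
              (j := j) (by simp [hpi, slots, h1, h2])
            convert h3 using 1
            simp [lift1]
      · exact ⟨var R g j, 0, by simp [lift1, hgp]⟩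
    · have h1 := (wordRad X nxt 𝔪 w).mul_mem_left (var R p i.hi) (var_add_mem rfl hpi)
      have h2 := var_mul_mem (𝔪 := 𝔪) (X := X) (R := R) (rfl : nxt p = nxt p) hpi
      have h3 := (wordRad X nxt 𝔪 w).sub_mem h1 h2
      convert h3 using 1
      simp only [map_add, map_mul, subHeight_X, lift1, Function.update_self]
      ring
  · have h1 : ∀ v : D.powerset → R, subHeight R (lift1 nxt p) (lam D (wordDeco R nxt w') v) =
        lam D (wordDeco R nxt w) v := by
      intro v
      rw [map_lam, lam_apply, lam_apply]
      refine Finset.sum_congr rfl fun S _ => ?_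
      congr 1
      refine Finset.prod_congr rfl fun g hgS => ?_
      have hgD := Finset.mem_powerset.1 S.2 hgS
      have h1 : g ≠ p := fun e => hpD (e ▸ hgD)
      have h2 : g ≠ h := fun e => hhD (e ▸ hgD)
      simp only [hD, Finset.mem_erase, mem_wordSupp, Option.isSome_iff_exists] at hgD
      obtain ⟨-, -, k, hk⟩ := hgD
      have h3 : nxt g ≠ p := fun e => h2 (nxt.injective (e.trans hp.symm))
      rw [wordDeco_some hk, wordDeco_some ((hw g h2 h1).symm.trans hk), subHeight_X]
      simp [lift1, h3]
    simp only [dbl_apply, map_add, map_mul, hlift, h1, sub_self]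
    exact zero_mem _

end Words

end NilHecke

end Vinyl

end

noncomputable section

namespace Vinyl

namespace NilHecke

open Equiv Matrix

/-! ### The braid relation -/

section Braid

variable {n : ℕ} {K : Type*} [Field K] {X : Fin n → K} {R : Type*} [CommRing R] [Algebra R K]
  {H : Type*} [Fintype H] [DecidableEq H] {nxt : Perm H} {𝔪 : Submodule R K}

/-- Moving all variables at the heights `p` and `q` to the height `o`. -/
def lift2 (p q o : H) : H → H := Function.update (Function.update id p o) q o

omit [Fintype H] in
theorem lift2_of_ne {p q o g : H} (hp : g ≠ p) (hq : g ≠ q) : lift2 p q o g = g := by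
  simp [lift2, hp, hq]

omit [Fintype H] in
theorem lift2_ne {p q o : H} (hop : o ≠ p) (hoq : o ≠ q) (g : H) :
    lift2 p q o g ≠ p ∧ lift2 p q o g ≠ q := by
  by_cases hq : g = q
  · subst hq; simp [lift2, hop, hoq]
  · by_cases hp : g = p
    · subst hp; simp [lift2, hq, hop, hoq]
    · rw [lift2_of_ne hp hq]; exact ⟨hp, hq⟩

omit [Fintype H] in
theorem evp_lift2_update {p q o : H} (hop : o ≠ p) (hoq : o ≠ q) (y : MvPolynomial (H × Fin n) R)
    (c : H → Perm (Fin n)) (σ : Perm (Fin n)) :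
    evp R X (Function.update c p σ) (subHeight R (lift2 p q o) y) =
        evp R X c (subHeight R (lift2 p q o) y) ∧
      evp R X (Function.update c q σ) (subHeight R (lift2 p q o) y) =
        evp R X c (subHeight R (lift2 p q o) y) := by
  constructor
  · rw [evp_subHeight, evp_subHeight]
    congr 2
    funext g
    exact Function.update_of_ne (lift2_ne hop hoq g).1 _ _
  · rw [evp_subHeight, evp_subHeight]
    congr 2
    funext g
    exact Function.update_of_ne (lift2_ne hop hoq g).2 _ _

theorem sub_subHeight_lift2_mem {w : H → Option (Letter n)} {p q o : H} (hq : nxt p = q)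
    (ho : nxt q = o) (hwp : w p = none) (hwq : w q = none) (y : MvPolynomial (H × Fin n) R) :
    y - subHeight R (lift2 p q o) y ∈ wordRad X nxt 𝔪 w := by
  refine mem_wordRad fun c hc => ?_
  have key : ∀ g, w g = none → c g = c (nxt g) := by
    intro g hg
    have h1 := hc g
    rw [hg] at h1
    by_contra e
    exact h1 (Matrix.one_apply_ne e)
  have h2 : c ∘ lift2 p q o = c := by
    funext g
    by_cases hgq : g = q
    · subst hgq
      simp [lift2, key g hwq, ho]
    · by_cases hgp : g = p
      · subst hgp
        simp [lift2, hgq, key g hwp, hq, key q hwq, ho]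
      · rw [Function.comp_apply, lift2_of_ne hgp hgq]
  rw [map_sub, evp_subHeight, h2, sub_self]

/-- By the twisted Leibniz rule, multiplication by the left variable below minus the right variable
above deletes the dumbbell. -/
theorem form_sub_mul (hX : Function.Injective X) {m : H → Mat n K} {p q : H} (hq : nxt p = q)
    {j : Letter n} (hm : m p = mat X (some j)) (z : MvPolynomial (H × Fin n) R) :
    form R X nxt m ((var R p j.lo - var R q j.hi) * z) =
      form R X nxt (Function.update m p 1) z := by
  subst hq
  simp only [form_apply]
  have h1 : (fun c : H → Perm (Fin n) => evp R X c ((var R p j.lo - var R (nxt p) j.hi) * z)) =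
      fun c => X (c p j.lo) * evp R X c z - X (c (nxt p) j.hi) * evp R X c z := by
    funext c
    simp [sub_mul]
  have h2 : ∀ F G : (H → Perm (Fin n)) → K, cyc nxt m (fun c => F c - G c) =
      cyc nxt m F - cyc nxt m G := by
    intro F G
    simp [cyc, mul_sub]
  rw [h1, h2, cyc_pos_left, cyc_pos_right, ← cyc_slab_sub, hm]
  congr 2
  simp only [mat]
  rw [pos_dum_left hX j.lo_ne_hi, add_sub_cancel_left]

/-- The first factor deletes the dumbbell, and the second one is then a difference of two variables
at the same place. -/
theorem form_sub_mul_mul (hX : Function.Injective X) {m : H → Mat n K} {p q : H} (hq : nxt p = q)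
    {j : Letter n} (hm : m p = mat X (some j)) (z : MvPolynomial (H × Fin n) R) :
    form R X nxt m ((var R p j.lo - var R q j.hi) * (var R p j.lo - var R q j.hi) * z) =
      form R X nxt (Function.update m p (pos X j.lo - pos X j.hi)) z := by
  rw [mul_assoc, form_sub_mul hX hq hm]
  subst hq
  simp only [form_apply]
  have h1 : (fun c : H → Perm (Fin n) => evp R X c ((var R p j.lo - var R (nxt p) j.hi) * z)) =
      fun c => X (c p j.lo) * evp R X c z - X (c (nxt p) j.hi) * evp R X c z := by
    funext c
    simp [sub_mul]
  have h2 : ∀ F G : (H → Perm (Fin n)) → K,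
      cyc nxt (Function.update m p 1) (fun c => F c - G c) =
        cyc nxt (Function.update m p 1) F - cyc nxt (Function.update m p 1) G := by
    intro F G
    simp [cyc, mul_sub]
  rw [h1, h2, cyc_pos_left, cyc_pos_right, ← cyc_slab_sub]
  simp

/-- The two relevant identities for a word `k j k` with neighbouring letters `k` and `j`. -/
theorem braid_form_mem (hX : Function.Injective X) {w ws : H → Option (Letter n)} {h p q o : H}
    (hp : nxt h = p) (hq : nxt p = q) (ho : nxt q = o) (hph : p ≠ h) (hqh : q ≠ h)
    (hw : ∀ g, g ≠ h → g ≠ p → g ≠ q → w g = ws g) {k j : Letter n}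
    (hwh : w h = some k) (hwp : w p = some j) (hwq : w q = some k)
    (hsh : ws h = some k) (hsp : ws p = none) (hsq : ws q = none)
    (hkj : dum X k.lo k.hi * (pos X j.lo - pos X j.hi) * dum X k.lo k.hi = -dum X k.lo k.hi)
    (y : MvPolynomial (H × Fin n) R) :
    (var R p j.lo - var R q j.hi) * subHeight R (lift2 p q o) y ∈
        ker 𝔪 X nxt (fun g => mat X (w g)) ∧
      ((var R p j.lo - var R q j.hi) * (var R p j.lo - var R q j.hi) *
        subHeight R (lift2 p q o) y ∈ ker 𝔪 X nxt (fun g => mat X (w g)) ↔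
          y ∈ ker 𝔪 X nxt (fun g => mat X (ws g))) := by
  have hqp : q ≠ p := fun e => hph (nxt.injective (hq.trans (e.trans hp.symm)))
  have hop : o ≠ p := fun e => hqh (nxt.injective (ho.trans (e.trans hp.symm)))
  have hoq : o ≠ q := fun e => hqp (nxt.injective (ho.trans (e.trans hq.symm)))
  have hF := evp_lift2_update (X := X) hop hoq y
  have hmp : (fun g => mat X (w g)) p = mat X (some j) := by simp only [hwp]
  constructor
  · rw [mem_ker, form_sub_mul hX hq hmp]
    have h0 : form R X nxt (Function.update (fun g => mat X (w g)) p 1)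
        (subHeight R (lift2 p q o) y) = cyc nxt (Function.update (fun g => mat X (w g)) h 0)
        fun c => evp R X c (subHeight R (lift2 p q o) y) := by
      refine cyc_congr_three hp hq hph hqh (fun c σ => (hF c σ).1) (fun c σ => (hF c σ).2)
        (fun g h1 h2 _ => by simp [h1, h2]) ?_
      simp [hph.symm, hqp, hwh, hwq, mat, dum_sq k.lo_ne_hi]
    rw [h0, cyc_slab_zero]
    exact zero_mem _
  · rw [mem_ker, form_sub_mul_mul hX hq hmp]
    have h1 : form R X nxt (Function.update (fun g => mat X (w g)) p (pos X j.lo - pos X j.hi))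
        (subHeight R (lift2 p q o) y) =
        -form R X nxt (fun g => mat X (ws g)) (subHeight R (lift2 p q o) y) := by
      have h3 := cyc_slab_neg (nxt := nxt) (fun g => mat X (ws g)) h
          (fun c => evp R X c (subHeight R (lift2 p q o) y)) (mat X (ws h))
      rw [Function.update_eq_self] at h3
      rw [form_apply, form_apply, ← h3]
      refine cyc_congr_three hp hq hph hqh (fun c σ => (hF c σ).1) (fun c σ => (hF c σ).2)
        (fun g h1 h2 h3 => by simp [h1, h2, hw g h1 h2 h3]) ?_
      simp only [Function.update_self, Function.update_of_ne hph.symm,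
        Function.update_of_ne hph, Function.update_of_ne hqh, Function.update_of_ne hqp, hwh, hwq,
        hsh, hsp, hsq, mat, mul_one, hkj]
    rw [h1, neg_mem_iff, ← mem_ker (𝔪 := 𝔪)]
    exact (mem_iff_of_sub_mem_rad
      (sub_subHeight_lift2_mem (𝔪 := 𝔪) (X := X) hq ho hsp hsq y)).symm

/-- The polynomial ring of a word `k j k` is generated by two elements over the polynomials that do
not involve the two inner heights. -/
theorem braid_generators {w : H → Option (Letter n)} {h p q o : H}
    (hp : nxt h = p) (hq : nxt p = q) (ho : nxt q = o) (hph : p ≠ h) (hqh : q ≠ h) {k j : Letter n}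
    (hwh : w h = some k) (hwp : w p = some j) (hwq : w q = some k)
    (hkj : k.lo ∉ slots (some j) ∨ k.hi ∉ slots (some j)) (a : MvPolynomial (H × Fin n) R) :
    ∃ y z, a - (subHeight R (lift2 p q o) y + var R p k.hi * subHeight R (lift2 p q o) z) ∈
      wordRad X nxt 𝔪 w := by
  set I := wordRad (R := R) X nxt 𝔪 w
  have hqp : q ≠ p := fun e => hph (nxt.injective (hq.trans (e.trans hp.symm)))
  have hop : o ≠ p := fun e => hqh (nxt.injective (ho.trans (e.trans hp.symm)))
  have hoq : o ≠ q := fun e => hqp (nxt.injective (ho.trans (e.trans hq.symm)))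
  have fh : ∀ x : Fin n, subHeight R (lift2 p q o) (var R h x) = var R h x := fun x => by
    simp [lift2_of_ne hph.symm hqh.symm]
  have fo : ∀ x : Fin n, subHeight R (lift2 p q o) (var R o x) = var R o x := fun x => by
    simp [lift2_of_ne hop hoq]
  have a1 : var R h k.lo + var R h k.hi - (var R p k.lo + var R p k.hi) ∈ I := var_add_mem hp hwh
  have a2 : var R q k.lo + var R q k.hi - (var R o k.lo + var R o k.hi) ∈ I := var_add_mem ho hwq
  have a3 : var R h k.lo * var R h k.hi - var R p k.lo * var R p k.hi ∈ I := var_mul_mem hp hwh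
  have bh : ∀ x, x ∉ slots (some k) → var R h x - var R p x ∈ I := fun x hx =>
    var_sub_mem hp (by rwa [hwh])
  have bq : ∀ x, x ∉ slots (some k) → var R q x - var R o x ∈ I := fun x hx =>
    var_sub_mem ho (by rwa [hwq])
  have bp : ∀ x, x ∉ slots (some j) → var R p x - var R q x ∈ I := fun x hx =>
    var_sub_mem hq (by rwa [hwp])
  refine exists_sub_mem_of_generators (I := I) _ _ (fun s => ?_)
    ⟨var R h k.lo + var R h k.hi, var R h k.lo * var R h k.hi, ?_⟩ a
  · obtain ⟨g, x⟩ := s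
    by_cases hgp : g = p
    · rw [hgp]
      by_cases h1 : x = k.hi
      · exact ⟨0, 1, by simp [h1]⟩
      · by_cases h2 : x = k.lo
        · refine ⟨var R h k.lo + var R h k.hi, -1, ?_⟩
          rw [map_add, fh, fh, h2, map_neg, map_one]
          convert I.neg_mem a1 using 1
          ring
        · refine ⟨var R h x, 0, ?_⟩
          rw [fh, map_zero, mul_zero, add_zero]
          convert I.neg_mem (bh x (by simp [slots, h1, h2])) using 1
          ring
    · by_cases hgq : g = q
      · rw [hgq]
        by_cases h1 : x ∈ slots (some k)
        · have two : ∃ y z, (var R q k.lo - (subHeight R (lift2 p q o) y +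
              var R p k.hi * subHeight R (lift2 p q o) z) ∈ I) := by
            rcases hkj with hj | hj
            · refine ⟨var R h k.lo + var R h k.hi, -1, ?_⟩
              rw [map_add, fh, fh, map_neg, map_one]
              convert I.neg_mem (I.add_mem a1 (bp _ hj)) using 1
              ring
            · refine ⟨var R o k.lo + var R o k.hi, -1, ?_⟩
              rw [map_add, fo, fo, map_neg, map_one]
              convert I.add_mem a2 (bp _ hj) using 1
              ring
          by_cases h2 : x = k.lo
          · rw [h2]; exact two
          · have h3 : x = k.hi := by
              simp only [slots, Finset.mem_insert, Finset.mem_singleton] at h1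
              tauto
            obtain ⟨y, z, hyz⟩ := two
            refine ⟨var R o k.lo + var R o k.hi - y, -z, ?_⟩
            rw [map_sub, map_add, fo, fo, map_neg, h3]
            convert I.sub_mem a2 hyz using 1
            ring
        · refine ⟨var R o x, 0, ?_⟩
          rw [fo, map_zero, mul_zero, add_zero]
          exact bq x h1
      · exact ⟨var R g x, 0, by simp [lift2_of_ne hgp hgq]⟩
  · rw [map_add, map_mul, fh, fh]
    convert I.add_mem (I.mul_mem_left (-var R p k.hi) a1) a3 using 1
    ring

-- By the braid relation both words have the same trace on the ring B of polynomials ignoring the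
-- two inner heights. Each polynomial ring is B + η B modulo its radical, where η deletes the middle
-- dumbbell. Then η B is orthogonal to B because two equal dumbbells meet, and η² gives minus the
-- trace of the word with a single letter. This is the situation of `good_braid`.
set_option maxHeartbeats 1000000 in
theorem goodWord_braid (hX : Function.Injective X) {w w' ws wt : H → Option (Letter n)}
    {h p q : H} (hp : nxt h = p) (hq : nxt p = q) (hph : p ≠ h) (hqh : q ≠ h)
    (hw : ∀ g, g ≠ h → g ≠ p → g ≠ q → w g = w' g ∧ ws g = w' g ∧ wt g = w' g)
    {i j : Letter n} (hij : j.1 = i.1 + 1)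
    (hh : w h = some i ∧ w p = some j ∧ w q = some i)
    (hh' : w' h = some j ∧ w' p = some i ∧ w' q = some j)
    (hs : ws h = some i ∧ ws p = none ∧ ws q = none)
    (ht : wt h = some j ∧ wt p = none ∧ wt q = none)
    (hg : GoodWord (R := R) X nxt 𝔪 w) (hgs : GoodWord (R := R) X nxt 𝔪 ws)
    (hgt : GoodWord (R := R) X nxt 𝔪 wt) : GoodWord (R := R) X nxt 𝔪 w' := by
  obtain ⟨hh, hhp, hhq⟩ := hh
  obtain ⟨hh', hhp', hhq'⟩ := hh'
  obtain ⟨hsh, hsp, hsq⟩ := hs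
  obtain ⟨hth, htp, htq⟩ := ht
  obtain ⟨o, ho⟩ : ∃ o, nxt q = o := ⟨_, rfl⟩
  have hqp : q ≠ p := fun e => hph (nxt.injective (hq.trans (e.trans hp.symm)))
  have hop : o ≠ p := fun e => hqh (nxt.injective (ho.trans (e.trans hp.symm)))
  have hoq : o ≠ q := fun e => hqp (nxt.injective (ho.trans (e.trans hq.symm)))
  have hlo : j.lo = i.hi := by simp [Letter.lo, Letter.hi, hij]
  have hac : i.lo ≠ j.hi := by
    simp only [Letter.lo, Letter.hi, ne_eq, Fin.mk.injEq]
    omega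
  have hbc : i.hi ≠ j.hi := by rw [← hlo]; exact j.lo_ne_hi
  have hlos : i.lo ∉ slots (some j) := by
    simp [slots, hlo, hac, i.lo_ne_hi]
  have hhis : j.hi ∉ slots (some i) := by
    simp [slots, hac.symm, hbc.symm]
  -- the common letters
  set D := (((wordSupp w').erase h).erase p).erase q with hD
  have hmemD : ∀ g, g ∈ D ↔ g ≠ q ∧ g ≠ p ∧ g ≠ h ∧ (w' g).isSome := by
    intro g; simp [hD, mem_wordSupp]
  have hqD : q ∉ D := by simp [hD]
  have hpD : p ∉ insert q D := by simp [hD, hqp.symm]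
  have hhD : h ∉ insert p (insert q D) := by simp [hD, hph.symm, hqh.symm]
  have hhD' : h ∉ D := by simp [hD]
  have supp3 : ∀ v : H → Option (Letter n), (∀ g, g ≠ h → g ≠ p → g ≠ q → v g = w' g) →
      (v h).isSome → (v p).isSome → (v q).isSome → wordSupp v = insert h (insert p (insert q D)) := by
    intro v hv h1 h2 h3
    ext g
    simp only [mem_wordSupp, Finset.mem_insert, hmemD]
    by_cases e1 : g = h
    · simp [e1, h1]
    · by_cases e2 : g = p
      · simp [e2, h2]
      · by_cases e3 : g = q
        · simp [e3, h3]
        · simp [e1, e2, e3, hv g e1 e2 e3]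
  have supp1 : ∀ v : H → Option (Letter n), (∀ g, g ≠ h → g ≠ p → g ≠ q → v g = w' g) →
      (v h).isSome → v p = none → v q = none → wordSupp v = insert h D := by
    intro v hv h1 h2 h3
    ext g
    simp only [mem_wordSupp, Finset.mem_insert, hmemD]
    by_cases e1 : g = h
    · simp [e1, h1]
    · by_cases e2 : g = p
      · simp [e2, h2, hph]
      · by_cases e3 : g = q
        · simp [e3, h3, hqh]
        · simp [e1, e2, e3, hv g e1 e2 e3]
  have lamD : ∀ v : H → Option (Letter n), (∀ g, g ≠ h → g ≠ p → g ≠ q → v g = w' g) →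
      lam (R := R) D (wordDeco R nxt v) = lam (R := R) D (wordDeco R nxt w') := by
    intro v hv
    refine LinearMap.ext fun u => ?_
    rw [lam_apply, lam_apply]
    refine Finset.sum_congr rfl fun S _ => ?_
    congr 1
    refine Finset.prod_congr rfl fun g hgS => ?_
    have h1 := (hmemD g).1 (Finset.mem_powerset.1 S.2 hgS)
    simp [wordDeco, hv g h1.2.2.1 h1.2.1 h1.1]
  unfold GoodWord at hg hgs hgt ⊢
  rw [supp3 w (fun g h1 h2 h3 => (hw g h1 h2 h3).1) (by simp [hh]) (by simp [hhp]) (by simp [hhq]),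
    good_lam_insert_insert_insert hqD hpD hhD, wordDeco_some hh, wordDeco_some hhp,
    wordDeco_some hhq, hp, hq, ho, lamD w (fun g h1 h2 h3 => (hw g h1 h2 h3).1)] at hg
  rw [supp3 w' (fun g h1 h2 h3 => rfl) (by simp [hh']) (by simp [hhp']) (by simp [hhq']),
    good_lam_insert_insert_insert hqD hpD hhD, wordDeco_some hh', wordDeco_some hhp',
    wordDeco_some hhq', hp, hq, ho]
  rw [supp1 ws (fun g h1 h2 h3 => (hw g h1 h2 h3).2.1) (by simp [hsh]) hsp hsq,
    good_lam_insert hhD', wordDeco_some hsh, hp,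
    lamD ws (fun g h1 h2 h3 => (hw g h1 h2 h3).2.1)] at hgs
  rw [supp1 wt (fun g h1 h2 h3 => (hw g h1 h2 h3).2.2) (by simp [hth]) htp htq,
    good_lam_insert hhD', wordDeco_some hth, hp,
    lamD wt (fun g h1 h2 h3 => (hw g h1 h2 h3).2.2)] at hgt
  set l := lam (R := R) D (wordDeco R nxt w') with hl
  set f := subHeight (n := n) R (lift2 p q o) with hf
  have fl : ∀ v, f (l v) = l v := by
    intro v
    rw [hl, map_lam, lam_apply, lam_apply]
    refine Finset.sum_congr rfl fun S _ => ?_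
    congr 1
    refine Finset.prod_congr rfl fun g hgS => ?_
    have h1 := (hmemD g).1 (Finset.mem_powerset.1 S.2 hgS)
    obtain ⟨e1, e2, e3, e4⟩ := h1
    rw [Option.isSome_iff_exists] at e4
    obtain ⟨k, hk⟩ := e4
    rw [wordDeco_some hk, hf, subHeight_X, lift2_of_ne]
    · exact fun e => e3 (nxt.injective (e.trans hp.symm))
    · exact fun e => e2 (nxt.injective (e.trans hq.symm))
  have fo : ∀ x : Fin n, f (var R o x) = var R o x := fun x => by
    simp [hf, lift2_of_ne hop hoq]
  have fp : ∀ x : Fin n, f (var R p x) = var R o x := fun x => by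
    simp [hf, lift2, hqp.symm]
  have fh : ∀ x : Fin n, f (var R h x) = var R h x := fun x => by
    simp [hf, lift2_of_ne hph.symm hqh.symm]
  -- Between two copies of the outer letter, the variable of the shared slot leaves one copy up to
  -- sign, and the variable of the other slot commutes out and leaves a square, which is zero. For
  -- both words the total sign is negative.
  have hb := braid_form_mem (𝔪 := 𝔪) (R := R) hX (ws := ws) hp hq ho hph hqh
    (fun g h1 h2 h3 => by rw [(hw g h1 h2 h3).1, (hw g h1 h2 h3).2.1]) hh hhp hhq hsh hsp hsq (by
      rw [mul_sub, sub_mul, hlo, dum_pos_dum hX i.lo_ne_hi,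
        ← pos_dum_of_ne X i.lo_ne_hi hac.symm hbc.symm, mul_assoc, dum_sq i.lo_ne_hi, mul_zero,
        sub_zero])
  have hb' := braid_form_mem (𝔪 := 𝔪) (R := R) hX (ws := wt) hp hq ho hph hqh
    (fun g h1 h2 h3 => by rw [(hw g h1 h2 h3).2.2]) hh' hhp' hhq' hth htp htq (by
      rw [mul_sub, sub_mul, ← hlo, dum_pos_dum' hX j.lo_ne_hi,
        ← pos_dum_of_ne X j.lo_ne_hi (hlo ▸ i.lo_ne_hi) hac, mul_assoc, dum_sq j.lo_ne_hi,
        mul_zero, zero_sub])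
  rw [hlo] at hb
  -- congruences for `w`
  have r1 : var R q j.hi - var R o j.hi ∈ wordRad X nxt 𝔪 w := var_sub_mem ho (by rwa [hhq])
  -- congruences for `w'`
  set I' := wordRad (R := R) X nxt 𝔪 w'
  have s1 : var R h i.lo - var R p i.lo ∈ I' := var_sub_mem hp (by rwa [hh'])
  have s2 : var R q j.lo + var R q j.hi - (var R o j.lo + var R o j.hi) ∈ I' :=
    var_add_mem ho hhq'
  have s3 : var R q j.lo * var R q j.hi - var R o j.lo * var R o j.hi ∈ I' :=
    var_mul_mem ho hhq'
  have s4 : var R p j.hi - var R q j.hi ∈ I' := var_sub_mem hq (by rwa [hhp'])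
  rw [hlo] at s2 s3
  -- The correction with x_{p, j.hi} ≡ η' - t: it collects the variables outside the inner heights
  -- after the symmetric sum of j has been moved up to o.
  let t : MvPolynomial (H × Fin n) R := var R h i.lo - var R o i.hi - var R o j.hi
  have ft : f t = t := by simp only [t, map_sub, fo, fh]
  have c1 : var R p j.hi - ((var R p i.lo - var R q i.hi) - t) ∈ I' := by
    convert I'.add_mem (I'.add_mem s1 s2) s4 using 1
    simp only [t]
    ring
  -- The elements o2 and o3 are variables at the height p, which f sends to the height o. The common
  -- form `NE` is the pullback along f of the kernel of the first word.
  refine good_braid (NE := (ker 𝔪 X nxt fun g => mat X (w g)).comap f.toLinearMap) f f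
    (var R p i.hi - var R q j.hi) (var R p i.lo - var R q i.hi) (var R p i.hi) (var R p j.hi) t
    (fun y => Iff.rfl) (fun y => (hb y).1) (fun y => (hb y).2) (fun a => ?_) (fun y => ?_)
    (fun y => (hb' y).1) (fun y => (hb' y).2) (fun a => ?_) (fun v => ?_) (fun v => ?_) hg hgs hgt
  · obtain ⟨y, z, hyz⟩ := braid_generators (𝔪 := 𝔪) (X := X) hp hq ho hph hqh hh hhp hhq
      (Or.inl hlos) a
    refine ⟨y + var R p j.hi * z, z, ?_⟩
    change _ ∈ wordRad X nxt 𝔪 w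
    rw [map_add, map_mul, fp]
    convert Ideal.add_mem _ hyz (Ideal.mul_mem_right (f z) _ r1) using 1
    ring
  · have h1 : form R X nxt (fun g => mat X (w' g)) (f y) =
        form R X nxt (fun g => mat X (w g)) (f y) := by
      have hF := evp_lift2_update (X := X) hop hoq y
      refine cyc_congr_three hp hq hph hqh (fun c σ => (hF c σ).1) (fun c σ => (hF c σ).2)
        (fun g h1 h2 h3 => by rw [(hw g h1 h2 h3).1]) ?_
      simp only [hh, hhp, hhq, hh', hhp', hhq', mat, hlo]
      exact (dum_braid hX i.lo_ne_hi hbc hac).symm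
    rw [mem_ker, h1]
    rfl
  · obtain ⟨y, z, hyz⟩ := braid_generators (𝔪 := 𝔪) (X := X) hp hq ho hph hqh hh' hhp' hhq'
      (Or.inr hhis) a
    refine ⟨y - t * z, z, ?_⟩
    change _ ∈ I'
    rw [map_sub, map_mul, ft]
    convert Ideal.add_mem _ hyz (Ideal.mul_mem_right (f z) _ c1) using 1
    ring
  · have h1 : ∀ u, f (dbl (var R p j.hi) (dbl (var R p i.hi) l) u) =
        dbl (var R o j.hi) (dbl (var R o i.hi) l) u := by
      intro u
      simp only [dbl_apply, map_add, map_mul, fp, fl]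
    rw [h1, h1]
    refine dbl_dbl_sub_mem (I := wordRad X nxt 𝔪 w) ?_ r1 (fun u => ?_) v
    · rw [fp]
      convert r1 using 1
      ring
    · rw [sub_self]; exact zero_mem _
  · have h1 : ∀ u, f (dbl (var R p j.hi) l u) = dbl (var R o j.hi) l u := by
      intro u
      simp only [dbl_apply, map_add, map_mul, fp, fl]
    rw [h1, h1, h1, h1]
    refine dbl_dbl_sub_mem' (I := I') ?_ ?_ ?_ v
    · rw [map_add, map_add, fp, fp, ft]
      convert I'.neg_mem s1 using 1
      simp only [t]
      ring
    · rw [ft]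
      exact c1
    · rw [map_mul, fp, fp]
      convert I'.add_mem (I'.mul_mem_right (var R q i.hi) s4) s3 using 1
      ring

end Braid

end NilHecke

end Vinyl

end

noncomputable section

namespace Vinyl

/-! ### Reduction of words to words without repetitions -/

/-- Properties of cyclic words that are compatible with the relations of the nil Coxeter monoid. -/
structure MoveClosed {m : ℕ} (Q : List (Fin m) → Prop) : Prop where
  rot : ∀ u v, Q (u ++ v) → Q (v ++ u)
  comm : ∀ i j u, i.1 + 1 < j.1 ∨ j.1 + 1 < i.1 → Q (i :: j :: u) → Q (j :: i :: u)
  digon : ∀ i u, Q (i :: u) → Q (i :: i :: u)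
  braid : ∀ i j u, j.1 = i.1 + 1 → Q (i :: j :: i :: u) → Q (i :: u) → Q (j :: u) →
    Q (j :: i :: j :: u)

theorem exists_first {α : Type*} (P : α → Prop) [DecidablePred P] :
    ∀ l : List α, 1 ≤ l.countP P → ∃ a x b, l = a ++ x :: b ∧ P x ∧ ∀ z ∈ a, ¬P z
  | [], h => by simp at h
  | y :: l, h => by
    by_cases hy : P y
    · exact ⟨[], y, l, rfl, hy, by simp⟩
    · rw [List.countP_cons_of_neg (by simpa using hy)] at h
      obtain ⟨a, x, b, rfl, hx, ha⟩ := exists_first P l h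
      refine ⟨y :: a, x, b, rfl, hx, ?_⟩
      simpa [hy] using ha

namespace MoveClosed

variable {m : ℕ} {Q : List (Fin m) → Prop} (hQ : MoveClosed Q)
include hQ

theorem comm_iff (a : List (Fin m)) {i j : Fin m} (b : List (Fin m))
    (h : i.1 + 1 < j.1 ∨ j.1 + 1 < i.1) : Q (a ++ i :: j :: b) ↔ Q (a ++ j :: i :: b) := by
  have key : ∀ {i j : Fin m}, (i.1 + 1 < j.1 ∨ j.1 + 1 < i.1) → Q (a ++ i :: j :: b) →
      Q (a ++ j :: i :: b) := fun {i j} h h1 =>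
    hQ.rot (j :: i :: b) a (hQ.comm i j (b ++ a) h (hQ.rot a (i :: j :: b) h1))
  exact ⟨key h, key h.symm⟩

/-- A letter commutes past a stretch all of whose letters differ from it by at least two. -/
theorem move_iff (i : Fin m) (u : List (Fin m)) (hu : ∀ x ∈ u, x.1 + 1 < i.1 ∨ i.1 + 1 < x.1) :
    ∀ a b : List (Fin m), Q (a ++ u ++ i :: b) ↔ Q (a ++ i :: (u ++ b)) := by
  induction u with
  | nil => intro a b; simp
  | cons x t ih =>
    intro a b
    have h1 := ih (fun z hz => hu z (List.mem_cons_of_mem _ hz)) (a ++ [x]) b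
    have h2 := hQ.comm_iff a (t ++ b) (hu x List.mem_cons_self)
    simp only [List.append_assoc, List.cons_append, List.nil_append] at h1 h2 ⊢
    rw [h1, h2]

theorem move_block_iff (u y : List (Fin m))
    (hu : ∀ x ∈ u, ∀ i ∈ y, x.1 + 1 < i.1 ∨ i.1 + 1 < x.1) :
    ∀ a b : List (Fin m), Q (a ++ u ++ y ++ b) ↔ Q (a ++ y ++ u ++ b) := by
  induction y with
  | nil => intro a b; simp
  | cons i t ih =>
    intro a b
    have h1 := hQ.move_iff i u (fun x hx => hu x hx i List.mem_cons_self) a (t ++ b)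
    have h2 := ih (fun x hx j hj => hu x hx j (List.mem_cons_of_mem _ hj)) (a ++ [i]) b
    simp only [List.append_assoc, List.cons_append, List.nil_append] at h1 h2 ⊢
    rw [h1, h2]

/-- Given all shorter words, a stretch with letters below J may be assumed to contain its top letter
J - 1 at most once. The outer induction is on J, the inner one on the number of occurrences of the
top letter. -/
theorem linearize {N : ℕ} (IH : ∀ u, u.length < N → Q u) (J : ℕ) :
    ∀ u y : List (Fin m), u.length + y.length = N → (∀ x ∈ u, x.1 < J) →
      (∀ u' : List (Fin m), (∀ x ∈ u', x.1 < J) → u'.length = u.length →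
        u'.countP (fun x => x.1 + 1 = J) ≤ 1 → Q (u' ++ y)) → Q (u ++ y) := by
  induction J with
  | zero =>
    intro u y _ hu h
    exact h u hu rfl (by
      rw [List.countP_eq_zero.2]
      · omega
      · intro x _; simp)
  | succ J ihJ =>
    suffices H : ∀ t, ∀ u y : List (Fin m), u.length + y.length = N → (∀ x ∈ u, x.1 < J + 1) →
        u.countP (fun x => x.1 + 1 = J + 1) ≤ t →
        (∀ u' : List (Fin m), (∀ x ∈ u', x.1 < J + 1) → u'.length = u.length →
          u'.countP (fun x => x.1 + 1 = J + 1) ≤ 1 → Q (u' ++ y)) → Q (u ++ y) from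
      fun u y h1 h2 h3 => H _ u y h1 h2 le_rfl h3
    intro t
    induction t with
    | zero => intro u y _ hu ht h; exact h u hu rfl (by omega)
    | succ t iht =>
      intro u y hN hu ht h
      by_cases hc : u.countP (fun x => x.1 + 1 = J + 1) ≤ 1
      · exact h u hu rfl hc
      · obtain ⟨a, p, w, rfl, hp, ha⟩ := exists_first (fun x : Fin m => x.1 + 1 = J + 1) u (by omega)
        have ha0 : a.countP (fun x => x.1 + 1 = J + 1) = 0 := by
          rw [List.countP_eq_zero]; simpa using ha
        rw [List.countP_append, ha0, List.countP_cons_of_pos (by simpa using hp)] at hc ht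
        obtain ⟨v, q, b, rfl, hq, hv⟩ := exists_first (fun x : Fin m => x.1 + 1 = J + 1) w (by omega)
        have hv0 : v.countP (fun x => x.1 + 1 = J + 1) = 0 := by
          rw [List.countP_eq_zero]; simpa using hv
        obtain rfl : q = p := Fin.ext (by omega)
        rw [List.countP_append, hv0, List.countP_cons_of_pos (by simpa using hq)] at hc ht
        have hvJ : ∀ x ∈ v, x.1 < J := by
          intro x hx
          have h1 := hu x (by simp [hx])
          have h2 := hv x hx
          omega
        have hqJ : q.1 = J := by omega
        -- Rotation puts the stretch between the first two occurrences of the top letter in front,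
        -- so that it can be treated by the induction on J.
        have key : Q (v ++ (q :: (b ++ y ++ a ++ [q]))) := by
          refine ihJ v _ ?_ hvJ fun v' hv' hlen hcount => ?_
          · simp only [List.length_append, List.length_cons, List.length_nil] at hN ⊢
            omega
          -- If the neighbour of the top letter is absent, the top letter commutes with the whole
          -- stretch, and the two copies meet in a digon.
          · by_cases h0 : v'.countP (fun x => x.1 + 1 = J) = 0
            · rw [List.countP_eq_zero] at h0
              have h1 : Q (q :: q :: (v' ++ (b ++ y ++ a))) := by
                refine hQ.digon _ _ (IH _ ?_)
                simp only [List.length_append, List.length_cons] at hN ⊢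
                omega
              have h2 := (hQ.move_iff q v' (fun x hx => by
                have h3 := hv' x hx
                have h4 := h0 x hx
                simp only [decide_eq_true_eq] at h4
                omega) [q] (b ++ y ++ a)).2 h1
              have h3 := hQ.rot [q] (v' ++ q :: (b ++ y ++ a))
                (by simpa only [List.append_assoc, List.cons_append, List.nil_append] using h2)
              simpa only [List.append_assoc, List.cons_append, List.nil_append] using h3
            · obtain ⟨c, s, d, rfl, hs, hcs⟩ := exists_first (fun x : Fin m => x.1 + 1 = J) v' (by omega)
              have hc0 : c.countP (fun x => x.1 + 1 = J) = 0 := by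
                rw [List.countP_eq_zero]; simpa using hcs
              rw [List.countP_append, hc0, List.countP_cons_of_pos (by simpa using hs)] at hcount
              have hd0 : d.countP (fun x => x.1 + 1 = J) = 0 := by omega
              rw [List.countP_eq_zero] at hd0
              have farc : ∀ x ∈ c, x.1 + 1 < q.1 ∨ q.1 + 1 < x.1 := fun x hx => by
                have h3 := hv' x (by simp [hx])
                have h4 := hcs x hx
                omega
              have fard : ∀ x ∈ d, x.1 + 1 < q.1 ∨ q.1 + 1 < x.1 := fun x hx => by
                have h3 := hv' x (by simp [hx])
                have h4 := hd0 x hx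
                simp only [decide_eq_true_eq] at h4
                omega
              have hlen' : c.length + (d.length + 1) = v.length := by
                simpa using hlen
              -- With exactly one neighbour s the two copies close up to q s q. The word with s q s
              -- instead has one top letter fewer, and the two words with a single letter are
              -- shorter.
              have h1 : Q (q :: s :: q :: (d ++ b ++ y ++ a ++ c)) := by
                refine hQ.braid s q _ (by omega) ?_ (IH _ ?_) (IH _ ?_)
                · have h2 : Q ((a ++ c ++ s :: q :: s :: (d ++ b)) ++ y) := by
                    refine iht _ _ ?_ ?_ ?_ fun u' hu' hl hcnt => h u' hu' ?_ hcnt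
                    · simp only [List.length_append, List.length_cons] at hN ⊢
                      omega
                    · intro x hx
                      simp only [List.mem_append, List.mem_cons] at hx
                      have hvx := fun hx => hv' x hx
                      have hux := fun hx => hu x hx
                      simp only [List.mem_append, List.mem_cons] at hvx hux
                      rcases hx with (hx | hx) | rfl | rfl | rfl | hx | hx
                      · exact hux (Or.inl hx)
                      · exact (hvx (Or.inl hx)).trans (Nat.lt_succ_self _)
                      · omega
                      · omega
                      · omega
                      · exact (hvx (Or.inr (Or.inr hx))).trans (Nat.lt_succ_self _)
                      · exact hux (Or.inr (Or.inr (Or.inr (Or.inr hx))))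
                    · have hsJ : ¬(s.1 + 1 = J + 1) := by omega
                      have hcJ : c.countP (fun x => x.1 + 1 = J + 1) = 0 := by
                        rw [List.countP_eq_zero]
                        intro x hx
                        have := hv' x (by simp [hx])
                        simp only [decide_eq_true_eq]
                        omega
                      have hdJ : d.countP (fun x => x.1 + 1 = J + 1) = 0 := by
                        rw [List.countP_eq_zero]
                        intro x hx
                        have := hv' x (by simp [hx])
                        simp only [decide_eq_true_eq]
                        omega
                      rw [List.countP_append, List.countP_append, ha0, hcJ,
                        List.countP_cons_of_neg (by simpa using hsJ),
                        List.countP_cons_of_pos (by simpa using hq),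
                        List.countP_cons_of_neg (by simpa using hsJ), List.countP_append, hdJ]
                      omega
                    · rw [hl]
                      simp only [List.length_append, List.length_cons]
                      omega
                  have h3 := hQ.rot (a ++ c) (s :: q :: s :: (d ++ b) ++ y)
                    (by simpa only [List.append_assoc, List.cons_append] using h2)
                  simpa only [List.append_assoc, List.cons_append] using h3
                · simp only [List.length_append, List.length_cons] at hN ⊢
                  omega
                · simp only [List.length_append, List.length_cons] at hN ⊢
                  omega
              have h2 := (hQ.move_iff q d fard [q, s] (b ++ y ++ a ++ c)).2
                (by simpa only [List.append_assoc, List.cons_append, List.nil_append] using h1)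
              have h3 := hQ.rot ([q, s] ++ d ++ q :: (b ++ y ++ a)) c
                (by simpa only [List.append_assoc, List.cons_append, List.nil_append] using h2)
              have h4 := (hQ.move_iff q c farc [] (s :: (d ++ q :: (b ++ y ++ a)))).1
                (by simpa only [List.append_assoc, List.cons_append, List.nil_append] using h3)
              have h5 := hQ.rot [q] (c ++ (s :: (d ++ q :: (b ++ y ++ a))))
                (by simpa only [List.append_assoc, List.cons_append, List.nil_append] using h4)
              simpa only [List.append_assoc, List.cons_append, List.nil_append] using h5
        have h1 := hQ.rot (v ++ (q :: (b ++ y))) (a ++ [q])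
          (by simpa only [List.append_assoc, List.cons_append, List.nil_append] using key)
        simpa only [List.append_assoc, List.cons_append, List.nil_append] using h1

/-- Induction on the length. For a fixed length the word is split as u y, where y has no repetition
and its letters are at least J, while those of u are below J. The top letter of u is made unique and
then transferred to y, until u is empty. -/
theorem of_nodup (base : ∀ u : List (Fin m), u.Nodup → Q u) (u : List (Fin m)) : Q u := by
  suffices H : ∀ N, ∀ u : List (Fin m), u.length < N → Q u from H _ u (Nat.lt_succ_self _)
  intro N
  induction N with
  | zero => intro u hu; exact absurd hu (Nat.not_lt_zero _)
  | succ N IH =>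
    have C : ∀ J, ∀ u y : List (Fin m), u.length + y.length = N → (∀ x ∈ u, x.1 < J) → y.Nodup →
        (∀ x ∈ y, J ≤ x.1) → Q (u ++ y) := by
      intro J
      induction J with
      | zero =>
        intro u y _ hu hy _
        obtain rfl : u = [] := List.eq_nil_iff_forall_not_mem.2 fun x hx =>
          absurd (hu x hx) (Nat.not_lt_zero _)
        exact base y hy
      | succ J ihJ =>
        intro u y hN hu hy hyJ
        refine hQ.linearize IH (J + 1) u y hN hu fun u' hu' hlen hcount => ?_
        by_cases h0 : u'.countP (fun x => x.1 + 1 = J + 1) = 0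
        · rw [List.countP_eq_zero] at h0
          refine ihJ u' y (by omega) (fun x hx => ?_) hy fun x hx => (Nat.le_succ _).trans (hyJ x hx)
          have h1 := hu' x hx
          have h2 := h0 x hx
          simp only [decide_eq_true_eq] at h2
          omega
        · obtain ⟨c, s, d, rfl, hs, hcs⟩ :=
            exists_first (fun x : Fin m => x.1 + 1 = J + 1) u' (by omega)
          rw [List.countP_append, List.countP_cons_of_pos (by simpa using hs)] at hcount
          have hd0 : d.countP (fun x => x.1 + 1 = J + 1) = 0 := by omega
          rw [List.countP_eq_zero] at hd0
          have hcJ : ∀ x ∈ c, x.1 < J := fun x hx => by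
            have h1 := hu' x (by simp [hx])
            have h2 := hcs x hx
            omega
          have hdJ : ∀ x ∈ d, x.1 < J := fun x hx => by
            have h1 := hu' x (by simp [hx])
            have h2 := hd0 x hx
            simp only [decide_eq_true_eq] at h2
            omega
          -- In the cyclic word c s d y the block d commutes with y, as their letters differ by at
          -- least two. After a rotation the word is d c s y, and s joins y.
          have h1 : Q ((d ++ c) ++ (s :: y)) := by
            refine ihJ _ _ ?_ ?_ ?_ ?_
            · simp only [List.length_append, List.length_cons] at hlen ⊢
              omega
            · intro x hx
              rcases List.mem_append.1 hx with h | h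
              · exact hdJ x h
              · exact hcJ x h
            · rw [List.nodup_cons]
              refine ⟨fun h => ?_, hy⟩
              have := hyJ s h
              omega
            · intro x hx
              rcases List.mem_cons.1 hx with rfl | h
              · omega
              · exact (Nat.le_succ _).trans (hyJ x h)
          have h2 := hQ.rot d (c ++ s :: y) (by simpa only [List.append_assoc] using h1)
          have h3 := (hQ.move_block_iff d y (fun x hx i hi => Or.inl (by
            have h3 := hdJ x hx
            have h4 := hyJ i hi
            omega)) (c ++ [s]) []).2 (by simpa only [List.append_assoc, List.cons_append,
              List.nil_append, List.append_nil] using h2)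
          simpa only [List.append_assoc, List.cons_append, List.nil_append, List.append_nil] using h3
    intro u hu
    rcases Nat.lt_succ_iff_lt_or_eq.1 hu with h | h
    · exact IH u h
    · have := C m u [] (by simpa using h) (fun x _ => x.2) List.nodup_nil (by simp)
      simpa using this

end MoveClosed

end Vinyl

end

noncomputable section

namespace Vinyl

/-! ### Words with empty slabs -/

section Padding

variable {L : Type*} {P : List (Option L) → Prop} (hrot : ∀ a l, P (a :: l) → P (l ++ [a]))
  (hslide : ∀ x l, P (x :: none :: l) ↔ P (none :: x :: l))

include hrot in
theorem rotate_append (a b : List (Option L)) : P (a ++ b) → P (b ++ a) := by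
  induction a generalizing b with
  | nil => simp
  | cons x t ih =>
    intro h
    have h1 := ih (b ++ [x]) (by simpa using hrot x (t ++ b) h)
    simpa using h1

include hrot hslide

theorem slide_iff (a b : List (Option L)) (x : Option L) :
    P (a ++ x :: none :: b) ↔ P (a ++ none :: x :: b) :=
  ⟨fun h => rotate_append hrot _ _ ((hslide x (b ++ a)).1 (rotate_append hrot _ _ h)),
    fun h => rotate_append hrot _ _ ((hslide x (b ++ a)).2 (rotate_append hrot _ _ h))⟩

theorem slide_append_iff (s : List (Option L)) : ∀ a b : List (Option L),
    P (a ++ s ++ none :: b) ↔ P (a ++ none :: (s ++ b)) := by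
  induction s with
  | nil => intro a b; simp
  | cons x t ih =>
    intro a b
    have h1 := ih (a ++ [x]) b
    have h2 := slide_iff hrot hslide a (t ++ b) x
    simp only [List.append_assoc, List.cons_append, List.nil_append] at h1 h2 ⊢
    rw [h1, h2]

/-- Empty slabs slide to the end, so P depends on a list only through its nonempty slabs and its
length. -/
theorem normalize_iff (l : List (Option L)) : ∃ r, ∀ a,
    P (a ++ l) ↔ P (a ++ (l.reduceOption.map some ++ List.replicate r none)) := by
  induction l with
  | nil => exact ⟨0, fun a => by simp⟩
  | cons x t ih =>
    obtain ⟨r, ih⟩ := ih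
    cases x with
    | none =>
      refine ⟨r + 1, fun a => ?_⟩
      have h1 := ih (a ++ [none])
      have h2 := slide_append_iff hrot hslide (t.reduceOption.map some) a (List.replicate r none)
      rw [List.reduceOption_cons_of_none, List.replicate_succ]
      simp only [List.append_assoc, List.cons_append, List.nil_append] at h1 h2 ⊢
      rw [h1, h2]
    | some i =>
      refine ⟨r, fun a => ?_⟩
      have h1 := ih (a ++ [some i])
      rw [List.reduceOption_cons_of_some]
      simp only [List.append_assoc, List.cons_append, List.nil_append, List.map_cons] at h1 ⊢
      rw [h1]

end Padding

namespace NilHecke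

open Equiv Matrix

/-! ### Good words as lists of slabs of fixed length. -/

section Padded

variable {n : ℕ} {K : Type*} [Field K] {X : Fin n → K} {R : Type*} [CommRing R] [Algebra R K]
  {𝔪 : Submodule R K}

/-- Going up by one slab in a cyclic arrangement of slabs. -/
abbrev up (k : ℕ) : Perm (Fin (k + 1)) := Equiv.addRight 1

variable (X 𝔪) in
/-- `GoodWord` for words given as lists. -/
def GoodList (k : ℕ) (l : List (Option (Letter n))) : Prop :=
  ∀ w : Fin (k + 1) → Option (Letter n), List.ofFn w = l → GoodWord (R := R) X (up k) 𝔪 w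

theorem GoodList.of_ofFn {k : ℕ} {w : Fin (k + 1) → Option (Letter n)}
    (h : GoodList X 𝔪 k (List.ofFn w)) : GoodWord (R := R) X (up k) 𝔪 w := h w rfl

theorem GoodList.rotate {k : ℕ} {a : Option (Letter n)} {l : List (Option (Letter n))}
    (h : GoodList X 𝔪 k (a :: l)) : GoodList X 𝔪 k (l ++ [a]) := by
  intro w hw
  have hlen : l.length = k := by
    have := congrArg List.length hw
    simpa using this.symm
  have h1 : List.ofFn (fun i => w ((up k).symm i)) = a :: l := by
    have hl : ∀ i : Fin k, l[i.1]? = some (w i.castSucc) := by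
      intro i
      have h2 : (l ++ [a])[i.1]? = some (w i.castSucc) := by
        rw [← hw, List.getElem?_ofFn, dif_pos (by omega)]
        rfl
      rwa [List.getElem?_append_left (by omega)] at h2
    have ha : w (Fin.last k) = a := by
      have h2 : (l ++ [a])[k]? = some (w (Fin.last k)) := by
        rw [← hw, List.getElem?_ofFn]
        simp [Fin.last]
      rw [List.getElem?_append_right (by omega)] at h2
      simpa [hlen] using h2.symm
    rw [List.ofFn_succ]
    congr 1
    · rw [← ha]
      congr 1
      rw [Equiv.symm_apply_eq]
      simp
    · apply List.ext_getElem?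
      intro i
      by_cases hi : i < k
      · have h2 := hl ⟨i, hi⟩
        simp only at h2
        rw [List.getElem?_ofFn, dif_pos hi, h2]
        congr 2
        rw [Equiv.symm_apply_eq]
        simp [Fin.ext_iff, Fin.val_add, Nat.mod_eq_of_lt (Nat.succ_lt_succ hi)]
      · rw [List.getElem?_eq_none (by simpa using hi), List.getElem?_eq_none (by omega)]
  have h2 := h _ h1
  rw [goodWord_reindex (nxt := up k) (up k) (fun _ => rfl)] at h2
  simpa only [symm_apply_apply] using h2

theorem GoodList.swap {k : ℕ} {x y : Option (Letter n)} {l : List (Option (Letter n))}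
    (hd : Disjoint (slots x) (slots y)) (h : GoodList X 𝔪 k (x :: y :: l)) :
    GoodList X 𝔪 k (y :: x :: l) := by
  intro w hw
  obtain _ | k := k
  · simp at hw
  rw [List.ofFn_succ, List.ofFn_succ] at hw
  simp only [List.cons.injEq] at hw
  obtain ⟨h0, h1, hl⟩ := hw
  have hg := h (Fin.cons x (Fin.cons y fun i => w i.succ.succ)) (by
    rw [List.ofFn_succ, List.ofFn_succ]
    simpa using hl)
  refine goodWord_comm (h := 0) (p := 1) (by simp) (by simp) (fun g hg0 hg1 => ?_) ?_ ?_ ?_ hg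
  · obtain ⟨i, rfl⟩ := Fin.exists_succ_eq.2 hg0
    have hi : i ≠ 0 := by rintro rfl; exact hg1 rfl
    obtain ⟨i, rfl⟩ := Fin.exists_succ_eq.2 hi
    rfl
  · exact h0
  · exact h1
  · exact hd

theorem GoodList.digon (hX : Function.Injective X) {k : ℕ} {i : Letter n}
    {l : List (Option (Letter n))} (h : GoodList X 𝔪 k (some i :: none :: l)) :
    GoodList X 𝔪 k (some i :: some i :: l) := by
  intro w hw
  obtain _ | k := k
  · simp at hw
  rw [List.ofFn_succ, List.ofFn_succ] at hw
  simp only [List.cons.injEq] at hw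
  obtain ⟨h0, h1, hl⟩ := hw
  have hg := h (Fin.cons (some i) (Fin.cons none fun i => w i.succ.succ)) (by
    rw [List.ofFn_succ, List.ofFn_succ]
    simpa using hl)
  refine goodWord_digon (h := 0) (p := 1) (by simp) (by simp) (fun g hg0 hg1 => ?_) h0 h1 rfl rfl
    hg hX
  obtain ⟨i, rfl⟩ := Fin.exists_succ_eq.2 hg0
  have hi : i ≠ 0 := by rintro rfl; exact hg1 rfl
  obtain ⟨i, rfl⟩ := Fin.exists_succ_eq.2 hi
  rfl

theorem GoodList.braid (hX : Function.Injective X) {k : ℕ} {i j : Letter n} (hij : j.1 = i.1 + 1)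
    {l : List (Option (Letter n))} (h : GoodList X 𝔪 k (some i :: some j :: some i :: l))
    (hi : GoodList X 𝔪 k (some i :: none :: none :: l))
    (hj : GoodList X 𝔪 k (some j :: none :: none :: l)) :
    GoodList X 𝔪 k (some j :: some i :: some j :: l) := by
  intro w hw
  obtain _ | _ | k := k
  · simp at hw
  · simp at hw
  rw [List.ofFn_succ, List.ofFn_succ, List.ofFn_succ] at hw
  simp only [List.cons.injEq] at hw
  obtain ⟨h0, h1, h2, hl⟩ := hw
  have mk : ∀ x y z : Option (Letter n), List.ofFn (Fin.cons x (Fin.cons y (Fin.cons z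
      fun i => w i.succ.succ.succ)) : Fin (k + 3) → Option (Letter n)) = x :: y :: z :: l := by
    intro x y z
    rw [List.ofFn_succ, List.ofFn_succ, List.ofFn_succ, ← hl]
    rfl
  refine goodWord_braid hX (h := 0) (p := 1) (q := 2) (by simp) ?_ (by simp) ?_
    (fun g hg0 hg1 hg2 => ?_) hij ⟨rfl, rfl, rfl⟩ ⟨h0, h1, h2⟩ ⟨rfl, rfl, rfl⟩ ⟨rfl, rfl, rfl⟩
    (h _ (mk _ _ _)) (hi _ (mk _ _ _)) (hj _ (mk _ _ _))
  · simp [Fin.ext_iff, Fin.val_add]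
  · simp only [ne_eq, Fin.ext_iff, Fin.val_two, Fin.val_zero]
    omega
  · obtain ⟨i, rfl⟩ := Fin.exists_succ_eq.2 hg0
    have hi : i ≠ 0 := by rintro rfl; exact hg1 rfl
    obtain ⟨i, rfl⟩ := Fin.exists_succ_eq.2 hi
    have hi : i ≠ 0 := by rintro rfl; exact hg2 rfl
    obtain ⟨i, rfl⟩ := Fin.exists_succ_eq.2 hi
    exact ⟨rfl, rfl, rfl⟩

/-- The moves of the nil Coxeter monoid shorten words while the number of slabs is fixed, so missing
letters are padded by empty slabs. -/
theorem goodWord_of_nodup (hX : Function.Injective X) {k : ℕ}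
    (base : ∀ w : Fin (k + 1) → Option (Letter n), (List.ofFn w).reduceOption.Nodup →
      GoodWord (R := R) X (up k) 𝔪 w) (w : Fin (k + 1) → Option (Letter n)) :
    GoodWord (R := R) X (up k) 𝔪 w := by
  have hrot : ∀ a l, GoodList X 𝔪 k (a :: l) → GoodList X 𝔪 k (l ++ [a]) :=
    fun a l h => h.rotate
  have hslide : ∀ x l, GoodList X 𝔪 k (x :: none :: l) ↔ GoodList X 𝔪 k (none :: x :: l) :=
    fun x l => ⟨fun h => h.swap (by simp [slots]), fun h => h.swap (by simp [slots])⟩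
  have norm := normalize_iff hrot hslide
  -- Goodness of all paddings of u; it is vacuous for paddings whose length is not k + 1.
  let Q : List (Letter n) → Prop := fun u => ∀ l, l.reduceOption = u → GoodList X 𝔪 k l
  have red : ∀ (u : List (Letter n)) r,
      (u.map some ++ List.replicate r none).reduceOption = u := by
    intro u r
    rw [List.reduceOption_append, List.reduceOption_replicate_none, List.append_nil]
    simp [List.reduceOption]
  have red' : ∀ (u : List (Letter n)) r s, (u.map some ++ List.replicate r none ++ s).reduceOption
      = u ++ s.reduceOption := by
    intro u r s
    rw [List.reduceOption_append, red]
  have hQ : MoveClosed Q := by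
    constructor
    · intro u v h l hl
      obtain ⟨r, hr⟩ := norm l
      have hr := hr []
      rw [List.nil_append, List.nil_append, hl] at hr
      rw [hr, List.map_append, List.append_assoc]
      refine rotate_append hrot _ _ (h _ ?_)
      have h3 := red v 0
      rw [List.replicate_zero, List.append_nil] at h3
      rw [red' u r (v.map some), h3]
    · intro i j u hij h l hl
      obtain ⟨r, hr⟩ := norm l
      have hr := hr []
      rw [List.nil_append, List.nil_append, hl] at hr
      rw [hr]
      refine GoodList.swap ?_ (h (some i :: some j :: (u.map some ++ List.replicate r none)) ?_)
      · simp only [slots, Finset.disjoint_insert_left, Finset.mem_insert, Finset.mem_singleton,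
          Finset.disjoint_singleton_left, not_or, Letter.lo, Letter.hi, Fin.mk.injEq]
        omega
      · rw [List.reduceOption_cons_of_some, List.reduceOption_cons_of_some, red]
    · intro i u h l hl
      obtain ⟨r, hr⟩ := norm l
      have hr := hr []
      rw [List.nil_append, List.nil_append, hl] at hr
      rw [hr]
      refine GoodList.digon hX (h (some i :: none :: (u.map some ++ List.replicate r none)) ?_)
      rw [List.reduceOption_cons_of_some, List.reduceOption_cons_of_none, red]
    · intro i j u hij h hi hj l hl
      obtain ⟨r, hr⟩ := norm l
      have hr := hr []
      rw [List.nil_append, List.nil_append, hl] at hr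
      rw [hr]
      refine GoodList.braid hX hij (h (some i :: some j :: some i ::
        (u.map some ++ List.replicate r none)) ?_)
        (hi (some i :: none :: none :: (u.map some ++ List.replicate r none)) ?_)
        (hj (some j :: none :: none :: (u.map some ++ List.replicate r none)) ?_)
      · simp only [List.reduceOption_cons_of_some, red]
      · simp only [List.reduceOption_cons_of_some, List.reduceOption_cons_of_none, red]
      · simp only [List.reduceOption_cons_of_some, List.reduceOption_cons_of_none, red]
  refine GoodList.of_ofFn (hQ.of_nodup (fun u hu l hl w hw => base w ?_) _ _ rfl)
  rw [hw, hl]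
  exact hu

end Padded

end NilHecke

end Vinyl

end

noncomputable section

namespace Vinyl

namespace NilHecke

open Equiv

/-! ### Symmetrization over block permutations -/

section Blocks

variable {n : ℕ}

/-- The permutations of the slots that preserve the blocks formed by the letters in `J`. -/
def blockPerms (J : Finset (Letter n)) : Finset (Perm (Fin n)) :=
  Finset.univ.filter fun σ => ∀ i ∉ J, ∀ j, σ j ≤ i.lo ↔ j ≤ i.lo

theorem mem_blockPerms {J : Finset (Letter n)} {σ : Perm (Fin n)} :
    σ ∈ blockPerms J ↔ ∀ i ∉ J, ∀ j, σ j ≤ i.lo ↔ j ≤ i.lo := by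
  simp [blockPerms]

/-- The block permutations as a subgroup. -/
def blockSubgroup (J : Finset (Letter n)) : Subgroup (Perm (Fin n)) where
  carrier := {σ | ∀ i ∉ J, ∀ j, σ j ≤ i.lo ↔ j ≤ i.lo}
  one_mem' := fun _ _ _ => Iff.rfl
  mul_mem' := fun {σ τ} hσ hτ i hi j => by
    rw [Perm.mul_apply]
    exact (hσ i hi _).trans (hτ i hi j)
  inv_mem' := fun {σ} hσ i hi j => by
    have := hσ i hi (σ⁻¹ j)
    rw [show σ (σ⁻¹ j) = j from σ.apply_symm_apply j] at this
    exact this.symm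

theorem mem_blockPerms_iff {J : Finset (Letter n)} {σ : Perm (Fin n)} :
    σ ∈ blockPerms J ↔ σ ∈ blockSubgroup J := mem_blockPerms

theorem blockPerms_mono {T J : Finset (Letter n)} (h : T ⊆ J) : blockPerms T ⊆ blockPerms J :=
  fun _ hσ => mem_blockPerms.2 fun i hi => mem_blockPerms.1 hσ i fun hT => hi (h hT)

theorem blockPerms_univ : blockPerms (Finset.univ : Finset (Letter n)) = Finset.univ := by
  ext σ; simp [mem_blockPerms]

/-- Lagrange's theorem. Hence the orders of all block groups are nonzero in R as soon as n! is. -/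
theorem card_blockPerms_dvd (J : Finset (Letter n)) : (blockPerms J).card ∣ n.factorial := by
  have h1 : (blockPerms J).card = Nat.card (blockSubgroup J) :=
    (Nat.subtype_card _ fun _ => mem_blockPerms_iff).symm
  rw [h1]
  have h2 := Subgroup.card_subgroup_dvd_card (blockSubgroup J)
  rwa [Nat.card_eq_fintype_card (α := Perm (Fin n)), Fintype.card_perm, Fintype.card_fin] at h2

theorem sum_blockPerms_mul_right {M : Type*} [AddCommMonoid M] {J : Finset (Letter n)}
    {τ : Perm (Fin n)} (hτ : τ ∈ blockPerms J) (g : Perm (Fin n) → M) :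
    ∑ σ ∈ blockPerms J, g (σ * τ) = ∑ σ ∈ blockPerms J, g σ := by
  refine Finset.sum_equiv (Equiv.mulRight τ) (fun σ => ?_) fun σ _ => rfl
  rw [mem_blockPerms_iff] at hτ
  rw [mem_blockPerms_iff, mem_blockPerms_iff, Equiv.coe_mulRight, Subgroup.mul_mem_cancel_right _ hτ]

theorem sum_blockPerms_mul_left {M : Type*} [AddCommMonoid M] {J : Finset (Letter n)}
    {τ : Perm (Fin n)} (hτ : τ ∈ blockPerms J) (g : Perm (Fin n) → M) :
    ∑ σ ∈ blockPerms J, g (τ * σ) = ∑ σ ∈ blockPerms J, g σ := by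
  refine Finset.sum_equiv (Equiv.mulLeft τ) (fun σ => ?_) fun σ _ => rfl
  rw [mem_blockPerms_iff] at hτ
  rw [mem_blockPerms_iff, mem_blockPerms_iff, Equiv.coe_mulLeft, Subgroup.mul_mem_cancel_left _ hτ]

/-- The pairs of slots in a common block. -/
def blockPairs (J : Finset (Letter n)) : Finset (Fin n × Fin n) :=
  Finset.univ.filter fun q => q.1 < q.2 ∧ ∀ i : Letter n, q.1 ≤ i.lo → i.lo < q.2 → i ∈ J

/-- The pairs of slots in different blocks. -/
def crossPairs (J : Finset (Letter n)) : Finset (Fin n × Fin n) :=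
  Finset.univ.filter fun q => q.1 < q.2 ∧ ∃ i : Letter n, q.1 ≤ i.lo ∧ i.lo < q.2 ∧ i ∉ J

theorem mem_blockPairs {J : Finset (Letter n)} {q : Fin n × Fin n} : q ∈ blockPairs J ↔
    q.1 < q.2 ∧ ∀ i : Letter n, q.1 ≤ i.lo → i.lo < q.2 → i ∈ J := by
  simp [blockPairs]

theorem mem_crossPairs {J : Finset (Letter n)} {q : Fin n × Fin n} : q ∈ crossPairs J ↔
    q.1 < q.2 ∧ ∃ i : Letter n, q.1 ≤ i.lo ∧ i.lo < q.2 ∧ i ∉ J := by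
  simp [crossPairs]

theorem swap_mem_blockPerms {J : Finset (Letter n)} {q : Fin n × Fin n} (hq : q ∈ blockPairs J) :
    Equiv.swap q.1 q.2 ∈ blockPerms J := by
  rw [mem_blockPairs] at hq
  rw [mem_blockPerms]
  intro i hi j
  have h : i.lo < q.1 ∨ q.2 ≤ i.lo := by
    by_contra h
    push Not at h
    exact hi (hq.2 i h.1 h.2)
  rcases eq_or_ne j q.1 with rfl | h1
  · rw [swap_apply_left]
    have := hq.1
    constructor <;> intro h' <;> rcases h with h | h <;> order
  · rcases eq_or_ne j q.2 with rfl | h2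
    · rw [swap_apply_right]
      have := hq.1
      constructor <;> intro h' <;> rcases h with h | h <;> order
    · rw [swap_apply_of_ne_of_ne h1 h2]

theorem letter_mem_blockPairs {J : Finset (Letter n)} {i : Letter n} (hi : i ∈ J) :
    (i.lo, i.hi) ∈ blockPairs J := by
  rw [mem_blockPairs]
  constructor
  · simp [Letter.lo, Letter.hi, Fin.lt_def]
  · intro k h1 h2
    simp only [Letter.lo, Letter.hi, Fin.lt_def, Fin.le_def] at h1 h2
    obtain rfl : k = i := Fin.ext (by omega)
    exact hi

end Blocks

/-! ### Alternating polynomials and divisibility by products of differences. -/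

section Alternants

variable {n : ℕ} {R : Type*} [CommRing R]

/-- The product of the differences of the variables with indices in a set of pairs. -/
def rootProd (R : Type*) [CommRing R] (s : Finset (Fin n × Fin n)) : MvPolynomial (Fin n) R :=
  ∏ q ∈ s, (MvPolynomial.X q.1 - MvPolynomial.X q.2)

/-- The antisymmetrization over the block permutations. -/
def alt (J : Finset (Letter n)) (g : MvPolynomial (Fin n) R) : MvPolynomial (Fin n) R :=
  ∑ σ ∈ blockPerms J, ((Perm.sign σ : ℤ) : MvPolynomial (Fin n) R) * MvPolynomial.rename σ g

theorem sign_mul_self' (A : Type*) [Ring A] (σ : Perm (Fin n)) :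
    ((Perm.sign σ : ℤ) : A) * ((Perm.sign σ : ℤ) : A) = 1 := by
  rcases Int.units_eq_one_or (Perm.sign σ) with h | h <;> simp [h]

theorem rename_alt {J : Finset (Letter n)} {τ : Perm (Fin n)} (hτ : τ ∈ blockPerms J)
    (g : MvPolynomial (Fin n) R) : MvPolynomial.rename τ (alt J g) =
      ((Perm.sign τ : ℤ) : MvPolynomial (Fin n) R) * alt J g := by
  have h1 : alt J g = ∑ σ ∈ blockPerms J, ((Perm.sign (τ * σ) : ℤ) : MvPolynomial (Fin n) R) *
      MvPolynomial.rename (τ * σ) g :=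
    (sum_blockPerms_mul_left hτ fun σ => ((Perm.sign σ : ℤ) : MvPolynomial (Fin n) R) *
      MvPolynomial.rename σ g).symm
  conv_rhs => rw [h1]
  rw [alt, map_sum, Finset.mul_sum]
  refine Finset.sum_congr rfl fun σ _ => ?_
  rw [map_mul, map_intCast, MvPolynomial.rename_rename, Perm.sign_mul, Units.val_mul, Int.cast_mul,
    ← mul_assoc, ← mul_assoc, sign_mul_self', one_mul]
  rfl

/-- With the variables negated, the differences come with the orientation x_i - x_j for i < j. -/
theorem rootProd_lt : rootProd R (Finset.univ.filter fun q : Fin n × Fin n => q.1 < q.2) =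
    (Matrix.vandermonde fun i : Fin n => -(MvPolynomial.X i : MvPolynomial (Fin n) R)).det := by
  rw [Matrix.det_vandermonde, rootProd,
    Finset.prod_finset_product _ Finset.univ (fun i => Finset.Ioi i) (by simp)]
  refine Finset.prod_congr rfl fun i _ => Finset.prod_congr rfl fun j _ => ?_
  ring

theorem rename_rootProd_lt (σ : Perm (Fin n)) :
    MvPolynomial.rename σ (rootProd R (Finset.univ.filter fun q : Fin n × Fin n => q.1 < q.2)) =
      ((Perm.sign σ : ℤ) : MvPolynomial (Fin n) R) *
        rootProd R (Finset.univ.filter fun q : Fin n × Fin n => q.1 < q.2) := by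
  rw [rootProd_lt, AlgHom.map_det, ← Matrix.det_permute]
  congr 1
  ext i j
  simp [Matrix.vandermonde_apply]

theorem rename_rootProd_cross {J : Finset (Letter n)} {σ : Perm (Fin n)} (hσ : σ ∈ blockPerms J) :
    MvPolynomial.rename σ (rootProd R (crossPairs J)) = rootProd R (crossPairs J) := by
  have key : ∀ τ ∈ blockPerms J, ∀ q ∈ crossPairs J, (τ q.1, τ q.2) ∈ crossPairs J := by
    intro τ hτ q hq
    rw [mem_crossPairs] at hq ⊢
    obtain ⟨-, i, h2, h3, h4⟩ := hq
    have h5 := (mem_blockPerms.1 hτ i h4 q.1).2 h2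
    have h6 := (mem_blockPerms.1 hτ i h4 q.2).not.2 (not_le.2 h3)
    rw [not_le] at h6
    exact ⟨h5.trans_lt h6, i, h5, h6, h4⟩
  have hσ' : σ⁻¹ ∈ blockPerms J := by
    rw [mem_blockPerms_iff] at hσ ⊢
    exact inv_mem hσ
  rw [rootProd, map_prod]
  refine Finset.prod_bij' (fun q _ => (σ q.1, σ q.2)) (fun q _ => (σ⁻¹ q.1, σ⁻¹ q.2))
    (fun q hq => key σ hσ q hq) (fun q hq => key _ hσ' q hq) ?_ ?_ ?_
  · intro q _; simp
  · intro q _; simp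
  · intro q _; simp

variable [IsDomain R]

theorem X_sub_X_ne_zero {q : Fin n × Fin n} (hq : q.1 ≠ q.2) :
    (MvPolynomial.X q.1 - MvPolynomial.X q.2 : MvPolynomial (Fin n) R) ≠ 0 :=
  sub_ne_zero.2 fun h => hq (MvPolynomial.X_injective h)

theorem rootProd_ne_zero {s : Finset (Fin n × Fin n)} (hs : ∀ q ∈ s, q.1 < q.2) :
    rootProd R s ≠ 0 :=
  Finset.prod_ne_zero_iff.2 fun q hq => X_sub_X_ne_zero (hs q hq).ne

/-- The full Vandermonde product changes by the sign, and its factor over pairs from different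
blocks is invariant; cancelling this factor leaves the block part. -/
theorem rename_rootProd_block {J : Finset (Letter n)} {σ : Perm (Fin n)} (hσ : σ ∈ blockPerms J) :
    MvPolynomial.rename σ (rootProd R (blockPairs J)) =
      ((Perm.sign σ : ℤ) : MvPolynomial (Fin n) R) * rootProd R (blockPairs J) := by
  have hne : rootProd R (crossPairs J) ≠ 0 := rootProd_ne_zero fun q hq => (mem_crossPairs.1 hq).1
  have hsplit : rootProd R (Finset.univ.filter fun q : Fin n × Fin n => q.1 < q.2) =
      rootProd R (blockPairs J) * rootProd R (crossPairs J) := by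
    rw [rootProd, rootProd, rootProd, ← Finset.prod_union]
    · refine Finset.prod_congr ?_ fun _ _ => rfl
      ext q
      simp only [Finset.mem_filter, Finset.mem_univ, true_and, Finset.mem_union, mem_blockPairs,
        mem_crossPairs]
      by_cases h : ∀ i : Letter n, q.1 ≤ i.lo → i.lo < q.2 → i ∈ J
      · exact ⟨fun h1 => Or.inl ⟨h1, h⟩, fun h1 => h1.elim And.left And.left⟩
      · push Not at h
        exact ⟨fun h1 => Or.inr ⟨h1, h⟩, fun h1 => h1.elim And.left And.left⟩
    · rw [Finset.disjoint_left]
      intro q h1 h2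
      rw [mem_blockPairs] at h1
      rw [mem_crossPairs] at h2
      obtain ⟨-, i, h3, h4, h5⟩ := h2
      exact h5 (h1.2 i h3 h4)
  have h := rename_rootProd_lt (R := R) σ
  rw [hsplit, map_mul, rename_rootProd_cross hσ, ← mul_assoc] at h
  exact mul_right_cancel₀ hne h

/-- Identification of the variables `a` and `b`. -/
def collapse (R : Type*) [CommRing R] (a b : Fin n) :
    MvPolynomial (Fin n) R →ₐ[R] MvPolynomial (Fin n) R :=
  MvPolynomial.aeval (Function.update MvPolynomial.X b (MvPolynomial.X a))

-- Modulo x_a - x_b the identification of the two variables is the identity, so a polynomial that it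
-- kills is divisible.
omit [IsDomain R] in
theorem X_sub_X_dvd_iff {a b : Fin n} (hab : a ≠ b) (p : MvPolynomial (Fin n) R) :
    (MvPolynomial.X a - MvPolynomial.X b) ∣ p ↔ collapse R a b p = 0 := by
  constructor
  · rintro ⟨q, rfl⟩
    simp [collapse, hab]
  · intro h
    have h1 : (Ideal.Quotient.mkₐ R (Ideal.span {(MvPolynomial.X a - MvPolynomial.X b :
        MvPolynomial (Fin n) R)})).comp (collapse R a b) = Ideal.Quotient.mkₐ R _ := by
      apply MvPolynomial.algHom_ext
      intro j
      by_cases hj : j = b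
      · subst hj
        simp only [AlgHom.comp_apply, collapse, MvPolynomial.aeval_X, Function.update_self,
          Ideal.Quotient.mkₐ_eq_mk]
        rw [Ideal.Quotient.eq]
        exact Ideal.mem_span_singleton_self _
      · simp [collapse, hj]
    have h2 := DFunLike.congr_fun h1 p
    rw [AlgHom.comp_apply, h, map_zero] at h2
    rw [← Ideal.mem_span_singleton, ← Ideal.Quotient.eq_zero_iff_mem]
    exact h2.symm

/-- The differences are split off one at a time: identifying the two variables of one pair does not
kill the difference of any other pair with increasing entries. -/
theorem rootProd_dvd {p : MvPolynomial (Fin n) R} (s : Finset (Fin n × Fin n))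
    (hs : ∀ q ∈ s, q.1 < q.2) (hp : ∀ q ∈ s, collapse R q.1 q.2 p = 0) : rootProd R s ∣ p := by
  induction s using Finset.induction_on with
  | empty => simp [rootProd]
  | insert q s hq ih =>
    obtain ⟨r, hr⟩ := ih (fun x hx => hs x (Finset.mem_insert_of_mem hx))
      (fun x hx => hp x (Finset.mem_insert_of_mem hx))
    have hq12 := hs q (Finset.mem_insert_self _ _)
    have h1 := hp q (Finset.mem_insert_self _ _)
    rw [hr, map_mul, mul_eq_zero] at h1
    rcases h1 with h1 | h1
    · exfalso
      rw [rootProd, map_prod, Finset.prod_eq_zero_iff] at h1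
      obtain ⟨x, hx, h1⟩ := h1
      have hx12 := hs x (Finset.mem_insert_of_mem hx)
      rw [map_sub, sub_eq_zero] at h1
      simp only [collapse, MvPolynomial.aeval_X, Function.update_apply] at h1
      have hne : x ≠ q := fun e => hq (e ▸ hx)
      split_ifs at h1 with h2 h3 h3
      · exact absurd (h2.trans h3.symm) hx12.ne
      · have h4 := MvPolynomial.X_injective h1
        rw [h2, ← h4] at hx12
        exact absurd hx12 hq12.asymm
      · have h4 := MvPolynomial.X_injective h1
        exact hne (Prod.ext h4 h3)
      · exact hx12.ne (MvPolynomial.X_injective h1)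
    · rw [← X_sub_X_dvd_iff hq12.ne] at h1
      obtain ⟨r', rfl⟩ := h1
      refine ⟨r', ?_⟩
      rw [hr, rootProd, rootProd, Finset.prod_insert hq]
      ring

/-- An alternating polynomial equals its negative after two variables of a block are identified. It
then vanishes, because a pair of slots forces n ≥ 2, so 2 divides n! and is nonzero in R. -/
theorem rootProd_dvd_alt (h2 : (n.factorial : R) ≠ 0) (J : Finset (Letter n))
    (g : MvPolynomial (Fin n) R) : rootProd R (blockPairs J) ∣ alt J g := by
  refine rootProd_dvd _ (fun q hq => (mem_blockPairs.1 hq).1) fun q hq => ?_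
  have hlt := (mem_blockPairs.1 hq).1
  have h3 : (2 : R) ≠ 0 := by
    intro h
    refine h2 ?_
    have h4 : 2 ∣ n.factorial := Nat.dvd_factorial (by norm_num) (by omega)
    obtain ⟨m, hm⟩ := h4
    rw [hm, Nat.cast_mul, Nat.cast_ofNat, h, zero_mul]
  have h4 := congrArg (collapse R q.1 q.2) (rename_alt (swap_mem_blockPerms hq) g)
  have h5 : (collapse R q.1 q.2).comp (MvPolynomial.rename (Equiv.swap q.1 q.2)) =
      collapse R q.1 q.2 := by
    apply MvPolynomial.algHom_ext
    intro j
    simp only [AlgHom.comp_apply, MvPolynomial.rename_X, collapse, MvPolynomial.aeval_X]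
    by_cases h1 : j = q.1
    · rw [h1, swap_apply_left]
      simp [hlt.ne]
    · by_cases h2 : j = q.2
      · rw [h2, swap_apply_right]
        simp [hlt.ne]
      · rw [swap_apply_of_ne_of_ne h1 h2]
  rw [← AlgHom.comp_apply, h5, Perm.sign_swap hlt.ne] at h4
  have h6 : (2 : MvPolynomial (Fin n) R) * collapse R q.1 q.2 (alt J g) = 0 := by
    have h7 : collapse R q.1 q.2 (alt J g) = -collapse R q.1 q.2 (alt J g) := by simpa using h4
    linear_combination h7
  rcases mul_eq_zero.1 h6 with h7 | h7
  · exfalso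
    apply h3
    have : (MvPolynomial.C (2 : R) : MvPolynomial (Fin n) R) = 0 := by rw [map_ofNat]; exact h7
    exact MvPolynomial.C_eq_zero.1 this
  · exact h7

end Alternants

end NilHecke

end Vinyl

end

noncomputable section

namespace Vinyl

namespace NilHecke

open Equiv

/-! ### The symmetrization of f / ∏ (x_i - x_{i+1}) and its radical. -/

section Phi

variable {n : ℕ} {R : Type*} [CommRing R] [IsDomain R] (hn : (n.factorial : R) ≠ 0)

/-- The pairs of slots of the letters in `T`. -/
def letterPairs (T : Finset (Letter n)) : Finset (Fin n × Fin n) := T.image fun i => (i.lo, i.hi)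

theorem prod_letterPairs {M : Type*} [CommMonoid M] (T : Finset (Letter n))
    (g : Fin n × Fin n → M) : ∏ q ∈ letterPairs T, g q = ∏ i ∈ T, g (i.lo, i.hi) := by
  refine Finset.prod_image fun i _ j _ h => Fin.ext ?_
  have := congrArg (fun q : Fin n × Fin n => q.1.1) h
  exact this

theorem letterPairs_subset {T J : Finset (Letter n)} (h : T ⊆ J) : letterPairs T ⊆ blockPairs J := by
  intro q hq
  obtain ⟨i, hi, rfl⟩ := Finset.mem_image.1 hq
  exact letter_mem_blockPairs (h hi)

include hn in
theorem exists_symm (T J : Finset (Letter n)) (f : MvPolynomial (Fin n) R) :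
    ∃ P, alt J (f * rootProd R (blockPairs J \ letterPairs T)) = rootProd R (blockPairs J) * P :=
  rootProd_dvd_alt hn J _

/-- The polynomial `∑ σ(f / ∏ (x_i - x_{i+1}))`, where `σ` runs through the block permutations for
`J` and `i` through `T`. -/
def symm (T J : Finset (Letter n)) (f : MvPolynomial (Fin n) R) : MvPolynomial (Fin n) R :=
  (exists_symm hn T J f).choose

/-- The working description of `symm` at points with distinct coordinates. Identities between
symmetrizations are then checked at the generic point. -/
theorem aeval_symm {T J : Finset (Letter n)} (hT : T ⊆ J) (f : MvPolynomial (Fin n) R) {F : Type*}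
    [Field F] [Algebra R F] {x : Fin n → F} (hx : Function.Injective x) :
    MvPolynomial.aeval x (symm hn T J f) = ∑ σ ∈ blockPerms J,
      MvPolynomial.aeval (fun j => x (σ j)) f / ∏ i ∈ T, (x (σ i.lo) - x (σ i.hi)) := by
  have spec := (exists_symm hn T J f).choose_spec
  change _ = _ * symm hn T J f at spec
  have hne : ∀ (s : Finset (Fin n × Fin n)) (y : Fin n → F), Function.Injective y →
      (∀ q ∈ s, q.1 < q.2) → MvPolynomial.aeval y (rootProd R s) ≠ 0 := by
    intro s y hy hs
    rw [rootProd, map_prod]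
    refine Finset.prod_ne_zero_iff.2 fun q hq => ?_
    rw [map_sub, MvPolynomial.aeval_X, MvPolynomial.aeval_X]
    exact sub_ne_zero.2 fun h => (hs q hq).ne (hy h)
  have hb : ∀ q ∈ blockPairs J, q.1 < q.2 := fun q hq => (mem_blockPairs.1 hq).1
  have h0 := hne _ x hx hb
  have h1 := congrArg (MvPolynomial.aeval x) spec
  rw [map_mul] at h1
  rw [← mul_right_inj' h0, ← h1, alt, map_sum, Finset.mul_sum]
  refine Finset.sum_congr rfl fun σ hσ => ?_
  have hxσ : Function.Injective fun j => x (σ j) := hx.comp σ.injective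
  have h2 := congrArg (MvPolynomial.aeval x) (rename_rootProd_block (R := R) hσ)
  rw [map_mul, map_intCast, MvPolynomial.aeval_rename] at h2
  rw [map_mul, map_intCast, MvPolynomial.aeval_rename, map_mul]
  change MvPolynomial.aeval (fun j => x (σ j)) _ = _ at h2
  change _ * (MvPolynomial.aeval (fun j => x (σ j)) _ * MvPolynomial.aeval (fun j => x (σ j)) _) = _
  have h3 : MvPolynomial.aeval (fun j => x (σ j)) (rootProd R (blockPairs J)) =
      MvPolynomial.aeval (fun j => x (σ j)) (rootProd R (blockPairs J \ letterPairs T)) *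
        ∏ i ∈ T, (x (σ i.lo) - x (σ i.hi)) := by
    rw [rootProd, ← Finset.prod_sdiff (letterPairs_subset hT), map_mul, prod_letterPairs, map_prod]
    simp [rootProd]
  have h4 : ∏ i ∈ T, (x (σ i.lo) - x (σ i.hi)) ≠ 0 := by
    refine Finset.prod_ne_zero_iff.2 fun i _ => sub_ne_zero.2 fun h => ?_
    exact i.lo_ne_hi (hxσ h)
  have h5 := sign_mul_self' F σ
  rw [h3] at h2
  rw [mul_div_assoc', eq_div_iff h4]
  linear_combination ((Perm.sign σ : ℤ) : F) * MvPolynomial.aeval (fun j => x (σ j)) f * h2 +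
    MvPolynomial.aeval (fun j => x (σ j)) f * MvPolynomial.aeval x (rootProd R (blockPairs J)) * h5

/-- The generic point. -/
def gen (R : Type*) [CommRing R] [IsDomain R] (j : Fin n) :
    FractionRing (MvPolynomial (Fin n) R) :=
  algebraMap (MvPolynomial (Fin n) R) _ (MvPolynomial.X j)

theorem gen_injective : Function.Injective (gen (n := n) R) := fun _ _ h =>
  MvPolynomial.X_injective (IsFractionRing.injective (MvPolynomial (Fin n) R) _ h)

theorem aeval_gen (p : MvPolynomial (Fin n) R) : MvPolynomial.aeval (gen (n := n) R) p =
    algebraMap (MvPolynomial (Fin n) R) (FractionRing (MvPolynomial (Fin n) R)) p := by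
  have : MvPolynomial.aeval (gen (n := n) R) =
      IsScalarTower.toAlgHom R (MvPolynomial (Fin n) R)
        (FractionRing (MvPolynomial (Fin n) R)) := by
    apply MvPolynomial.algHom_ext
    intro j
    simp [gen]
  rw [this]
  rfl

theorem eq_of_aeval_gen {p q : MvPolynomial (Fin n) R}
    (h : MvPolynomial.aeval (gen (n := n) R) p = MvPolynomial.aeval (gen R) q) : p = q := by
  rw [aeval_gen, aeval_gen] at h
  exact IsFractionRing.injective _ _ h

theorem symm_add {T J : Finset (Letter n)} (hT : T ⊆ J) (f g : MvPolynomial (Fin n) R) :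
    symm hn T J (f + g) = symm hn T J f + symm hn T J g := by
  apply eq_of_aeval_gen
  rw [map_add, aeval_symm hn hT _ gen_injective, aeval_symm hn hT _ gen_injective,
    aeval_symm hn hT _ gen_injective, ← Finset.sum_add_distrib]
  refine Finset.sum_congr rfl fun σ _ => ?_
  rw [map_add, add_div]

/-- Multiplication by an invariant polynomial. -/
theorem symm_mul {T J : Finset (Letter n)} (hT : T ⊆ J) (f g : MvPolynomial (Fin n) R)
    (hg : ∀ σ ∈ blockPerms J, MvPolynomial.rename σ g = g) :
    symm hn T J (g * f) = g * symm hn T J f := by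
  apply eq_of_aeval_gen
  rw [map_mul, aeval_symm hn hT _ gen_injective, aeval_symm hn hT _ gen_injective, Finset.mul_sum]
  refine Finset.sum_congr rfl fun σ hσ => ?_
  have h1 := MvPolynomial.aeval_rename (R := R) σ (gen (n := n) R) g
  rw [hg σ hσ] at h1
  rw [map_mul, mul_div_assoc, h1]
  rfl

/-- Multiplication by differences cancels denominators, so the functionals for subsets of T are
obtained from the one for T. -/
theorem symm_mul_root {T J : Finset (Letter n)} (hT : T ⊆ J) {S : Finset (Letter n)} (hS : S ⊆ T)
    (f : MvPolynomial (Fin n) R) :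
    symm hn T J (f * ∏ i ∈ T \ S, (MvPolynomial.X i.lo - MvPolynomial.X i.hi)) =
      symm hn S J f := by
  apply eq_of_aeval_gen
  rw [aeval_symm hn hT _ gen_injective, aeval_symm hn (hS.trans hT) _ gen_injective]
  refine Finset.sum_congr rfl fun σ _ => ?_
  have hne : ∏ i ∈ T, (gen (n := n) R (σ i.lo) - gen R (σ i.hi)) ≠ 0 :=
    Finset.prod_ne_zero_iff.2 fun i _ => sub_ne_zero.2 fun h =>
      i.lo_ne_hi (σ.injective (gen_injective h))
  have hne' : ∏ i ∈ S, (gen (n := n) R (σ i.lo) - gen R (σ i.hi)) ≠ 0 :=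
    Finset.prod_ne_zero_iff.2 fun i _ => sub_ne_zero.2 fun h =>
      i.lo_ne_hi (σ.injective (gen_injective h))
  rw [div_eq_div_iff hne hne', map_mul, map_prod, ← Finset.prod_sdiff hS]
  simp only [map_sub, MvPolynomial.aeval_X]
  ring

/-- Symmetrization in stages. -/
theorem card_mul_symm {T J : Finset (Letter n)} (hT : T ⊆ J) (f : MvPolynomial (Fin n) R) :
    ((blockPerms T).card : MvPolynomial (Fin n) R) * symm hn T J f =
      ∑ σ ∈ blockPerms J, MvPolynomial.rename σ (symm hn T T f) := by
  apply eq_of_aeval_gen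
  rw [map_mul, map_natCast, aeval_symm hn hT _ gen_injective, map_sum]
  have h1 : ∀ σ : Perm (Fin n), MvPolynomial.aeval (gen (n := n) R)
      (MvPolynomial.rename σ (symm hn T T f)) = ∑ τ ∈ blockPerms T,
        MvPolynomial.aeval (fun j => gen R ((σ * τ) j)) f /
          ∏ i ∈ T, (gen R ((σ * τ) i.lo) - gen R ((σ * τ) i.hi)) := by
    intro σ
    rw [MvPolynomial.aeval_rename, aeval_symm hn subset_rfl _ (gen_injective.comp σ.injective)]
    rfl
  rw [Finset.sum_congr rfl fun σ _ => h1 σ, Finset.sum_comm,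
    Finset.sum_congr rfl fun τ hτ => sum_blockPerms_mul_right (blockPerms_mono hT hτ)
      (fun ρ => MvPolynomial.aeval (fun j => gen R (ρ j)) f /
        ∏ i ∈ T, (gen R (ρ i.lo) - gen R (ρ i.hi))), Finset.sum_const, nsmul_eq_mul]

/-- The constant coefficient of the symmetrization. -/
def phi (T : Finset (Letter n)) : MvPolynomial (Fin n) R →ₗ[R] R where
  toFun f := MvPolynomial.constantCoeff (symm hn T T f)
  map_add' f g := by rw [symm_add hn subset_rfl, map_add]
  map_smul' r f := by
    rw [MvPolynomial.smul_eq_C_mul, symm_mul hn subset_rfl _ _ (by simp), map_mul,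
      MvPolynomial.constantCoeff_C]
    rfl

/-- Renaming variables keeps the constant coefficient, so in the symmetrization by stages all
summands contribute equally. Thus enlarging the group only changes a nonzero factor. -/
theorem card_mul_constantCoeff_symm {T J : Finset (Letter n)} (hT : T ⊆ J)
    (f : MvPolynomial (Fin n) R) : ((blockPerms T).card : R) *
      MvPolynomial.constantCoeff (symm hn T J f) = (blockPerms J).card * phi hn T f := by
  have h := congrArg MvPolynomial.constantCoeff (card_mul_symm hn hT f)
  rw [map_mul, map_natCast, map_sum] at h
  rw [h]
  simp only [MvPolynomial.constantCoeff_rename, Finset.sum_const, nsmul_eq_mul]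
  rfl

omit [IsDomain R] in
include hn in
theorem card_blockPerms_ne_zero (J : Finset (Letter n)) : ((blockPerms J).card : R) ≠ 0 := by
  intro h
  obtain ⟨m, hm⟩ := card_blockPerms_dvd J
  rw [hm, Nat.cast_mul, h, zero_mul] at hn
  exact hn rfl

theorem constantCoeff_symm_eq_zero_iff {T J : Finset (Letter n)} (hT : T ⊆ J)
    (f : MvPolynomial (Fin n) R) :
    MvPolynomial.constantCoeff (symm hn T J f) = 0 ↔ phi hn T f = 0 := by
  have h := card_mul_constantCoeff_symm hn hT f
  constructor
  · intro h0
    rw [h0, mul_zero] at h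
    exact (mul_eq_zero.1 h.symm).resolve_left (card_blockPerms_ne_zero hn J)
  · intro h0
    rw [h0, mul_zero] at h
    exact (mul_eq_zero.1 h).resolve_left (card_blockPerms_ne_zero hn T)

theorem phi_mul_root {S T : Finset (Letter n)} (hS : S ⊆ T) (f : MvPolynomial (Fin n) R) :
    phi hn T (f * ∏ i ∈ T \ S, (MvPolynomial.X i.lo - MvPolynomial.X i.hi)) = 0 ↔
      phi hn S f = 0 := by
  rw [← constantCoeff_symm_eq_zero_iff hn hS, ← symm_mul_root hn subset_rfl hS]
  rfl

-- The difference telescopes into differences for neighbouring slots.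
omit [IsDomain R] in
theorem X_sub_X_mem_of_block {J : Finset (Letter n)} {I : Ideal (MvPolynomial (Fin n) R)}
    (hI : ∀ i ∈ J, (MvPolynomial.X i.lo - MvPolynomial.X i.hi : MvPolynomial (Fin n) R) ∈ I)
    {a b : Fin n} (hab : a ≤ b) (h : ∀ i : Letter n, a ≤ i.lo → i.lo < b → i ∈ J) :
    (MvPolynomial.X a - MvPolynomial.X b : MvPolynomial (Fin n) R) ∈ I := by
  obtain ⟨d, hd⟩ := Nat.exists_eq_add_of_le (Fin.le_def.1 hab)
  induction d generalizing b with
  | zero =>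
    obtain rfl : a = b := Fin.ext (by omega)
    rw [sub_self]
    exact zero_mem _
  | succ d ih =>
    have hlt : a.1 + d + 1 < n := by have := b.2; omega
    let i : Letter n := ⟨a.1 + d, by omega⟩
    have hib : i.hi = b := Fin.ext (by simp only [Letter.hi, i]; omega)
    have h1 := ih (b := i.lo) (by simp [Letter.lo, i, Fin.le_def]) (fun k hk hk' => h k hk
      (hk'.trans (by rw [← hib]; simp [Letter.lo, Letter.hi, Fin.lt_def]))) (by simp [Letter.lo, i])
    have h2 := hI i (h i (by simp [Letter.lo, i, Fin.le_def])
      (by rw [← hib]; simp [Letter.lo, Letter.hi, Fin.lt_def]))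
    rw [hib] at h2
    have := I.add_mem h1 h2
    simpa using this

/-- Multiplying by roots shows the necessity. Conversely, by induction on J, f times any x_i -
x_{i+1} lies in the radical. So all variables of a block act on f in the same way, and a variable
can be replaced by its orbit sum, which is invariant without constant term and hence pairs to zero.
-/
theorem mem_rad_phi_iff {J : Finset (Letter n)} (f : MvPolynomial (Fin n) R) :
    f ∈ rad (LinearMap.ker (phi hn J)) ↔ ∀ T ⊆ J, phi hn T f = 0 := by
  constructor
  · intro hf T hT
    have := hf (∏ i ∈ J \ T, (MvPolynomial.X i.lo - MvPolynomial.X i.hi))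
    rw [mul_comm, LinearMap.mem_ker, phi_mul_root hn hT] at this
    exact this
  · induction J using Finset.strongInduction generalizing f with
    | H J ih =>
      intro hf
      have hroot : ∀ i ∈ J, f * (MvPolynomial.X i.lo - MvPolynomial.X i.hi) ∈
          rad (LinearMap.ker (phi hn J)) := by
        intro i hi z
        have hs : J.erase i ⊂ J := Finset.erase_ssubset hi
        have h1 := ih _ hs f (fun T hT => hf T (hT.trans hs.1)) z
        rw [LinearMap.mem_ker, ← phi_mul_root hn hs.1] at h1
        rw [LinearMap.mem_ker, ← mul_assoc]
        have h2 : J \ J.erase i = {i} := by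
          ext k
          simp only [Finset.mem_sdiff, Finset.mem_erase, Finset.mem_singleton]
          constructor
          · rintro ⟨h3, h4⟩
            by_contra h5
            exact h4 ⟨h5, h3⟩
          · rintro rfl
            exact ⟨hi, fun h => h.1 rfl⟩
        rwa [h2, Finset.prod_singleton] at h1
      intro z
      rw [LinearMap.mem_ker]
      induction z using MvPolynomial.induction_on with
      | C r => rw [← MvPolynomial.smul_eq_C_mul, map_smul, hf J subset_rfl, smul_zero]
      | add p q hp hq => rw [add_mul, map_add, hp, hq, add_zero]
      | mul_X z j _ =>
        -- An invariant factor comes out of the symmetrization, and this one has constant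
        -- coefficient zero.
        have hinv : phi hn J ((∑ σ ∈ blockPerms J, MvPolynomial.X (σ j)) * (z * f)) = 0 := by
          change MvPolynomial.constantCoeff (symm hn J J _) = 0
          rw [symm_mul hn subset_rfl, map_mul, map_sum]
          · simp
          · intro τ hτ
            rw [map_sum]
            simp only [MvPolynomial.rename_X]
            exact sum_blockPerms_mul_left hτ fun σ => MvPolynomial.X (σ j)
        have hdiff : ∀ σ ∈ blockPerms J,
            phi hn J ((MvPolynomial.X j - MvPolynomial.X (σ j)) * (z * f)) = 0 := by
          intro σ hσ
          -- The colon ideal collects the multipliers that send f into the radical; it contains the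
          -- roots of J, hence all differences within blocks.
          have hI : ∀ i ∈ J, (MvPolynomial.X i.lo - MvPolynomial.X i.hi :
              MvPolynomial (Fin n) R) ∈ (rad (LinearMap.ker (phi hn J))).colon {f} := by
            intro i hi
            rw [Submodule.mem_colon_singleton, smul_eq_mul, mul_comm]
            exact hroot i hi
          have hmem : (MvPolynomial.X j - MvPolynomial.X (σ j) : MvPolynomial (Fin n) R) ∈
              (rad (LinearMap.ker (phi hn J))).colon {f} := by
            rcases le_total j (σ j) with h | h
            · refine X_sub_X_mem_of_block hI h fun i h1 h2 => ?_
              by_contra h3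
              exact absurd ((mem_blockPerms.1 hσ i h3 j).2 h1) (not_le.2 h2)
            · have := X_sub_X_mem_of_block hI h fun i h1 h2 => ?_
              · have h4 := neg_mem this
                rwa [neg_sub] at h4
              · by_contra h3
                exact absurd ((mem_blockPerms.1 hσ i h3 j).1 h1) (not_le.2 h2)
          rw [Submodule.mem_colon_singleton, smul_eq_mul] at hmem
          have := hmem z
          rw [LinearMap.mem_ker] at this
          rw [← this]
          congr 1
          ring
        -- The group order times x_j is the orbit sum plus differences within the block; the order
        -- is nonzero in the domain R, so it cancels without being inverted.
        have hcard : ((blockPerms J).card : R) * phi hn J (z * MvPolynomial.X j * f) = 0 := by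
          rw [← smul_eq_mul, ← map_smul, MvPolynomial.smul_eq_C_mul, map_natCast]
          have : ((blockPerms J).card : MvPolynomial (Fin n) R) * (z * MvPolynomial.X j * f) =
              (∑ σ ∈ blockPerms J, MvPolynomial.X (σ j)) * (z * f) +
              ∑ σ ∈ blockPerms J, (MvPolynomial.X j - MvPolynomial.X (σ j)) * (z * f) := by
            rw [← Finset.sum_mul, Finset.sum_sub_distrib, Finset.sum_const, nsmul_eq_mul]
            ring
          rw [this, map_add, hinv, map_sum, Finset.sum_eq_zero hdiff, add_zero]
        exact (mul_eq_zero.1 hcard).resolve_left (card_blockPerms_ne_zero hn J)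

end Phi

end NilHecke

end Vinyl

end

noncomputable section

namespace Vinyl

/-! ### Words without repetitions -/

/-- Only a weight on the indices is needed instead of an order. For injectivity one looks at a
coefficient of maximal weight; for surjectivity the equations are solved from the highest weight
downwards. -/
theorem triangular_system {ι R : Type*} [Fintype ι] [CommRing R] (M : ι → ι → R) (μ : ι → ℕ)
    (hd : ∀ i, IsUnit (M i i)) (ht : ∀ i j, i ≠ j → M i j ≠ 0 → μ i < μ j) :
    (∀ v : ι → R, (∀ i, ∑ j, v j * M i j = 0) → v = 0) ∧
      ∀ b : ι → R, ∃ v : ι → R, ∀ i, ∑ j, v j * M i j = b i := by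
  classical
  constructor
  · intro v hv
    by_contra hne
    have hex : (Finset.univ.filter fun i => v i ≠ 0).Nonempty := by
      rw [Finset.filter_nonempty_iff]
      by_contra h
      push Not at h
      exact hne (funext fun i => h i (Finset.mem_univ i))
    obtain ⟨i, hi, hmax⟩ := Finset.exists_max_image _ μ hex
    rw [Finset.mem_filter] at hi
    have h1 := hv i
    rw [Finset.sum_eq_single i] at h1
    · exact hi.2 (by simpa using (hd i).mul_left_eq_zero.1 h1)
    · intro j _ hj
      by_cases hvj : v j = 0
      · rw [hvj, zero_mul]
      · by_contra h2
        have h3 := ht i j hj.symm (right_ne_zero_of_mul h2)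
        exact absurd (hmax j (Finset.mem_filter.2 ⟨Finset.mem_univ j, hvj⟩)) (not_le.2 h3)
    · simp
  · intro b
    -- The vector v solves the equations of the t highest possible weights; correcting those of the
    -- next weight does not disturb them.
    suffices H : ∀ t, ∃ v : ι → R, ∀ i, Finset.univ.sup μ + 1 ≤ μ i + t →
        ∑ j, v j * M i j = b i by
      obtain ⟨v, hv⟩ := H (Finset.univ.sup μ + 1)
      exact ⟨v, fun i => hv i (by omega)⟩
    intro t
    induction t with
    | zero =>
      refine ⟨0, fun i hi => ?_⟩
      have := Finset.le_sup (f := μ) (Finset.mem_univ i)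
      omega
    | succ t ih =>
      obtain ⟨v, hv⟩ := ih
      let u : ι → R := fun i => if Finset.univ.sup μ + 1 = μ i + (t + 1) then
        (b i - ∑ j, v j * M i j) * Ring.inverse (M i i) else 0
      refine ⟨v + u, fun i hi => ?_⟩
      have h1 : ∑ j, u j * M i j = u i * M i i := by
        refine Finset.sum_eq_single i (fun j _ hj => ?_) (by simp)
        by_cases hMij : M i j = 0
        · rw [hMij, mul_zero]
        · have h2 := ht i j hj.symm hMij
          have h3 : u j = 0 := if_neg (by omega)
          rw [h3, zero_mul]
      simp only [Pi.add_apply, add_mul, Finset.sum_add_distrib]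
      rw [h1]
      by_cases h4 : Finset.univ.sup μ + 1 = μ i + (t + 1)
      · have h5 : u i = (b i - ∑ j, v j * M i j) * Ring.inverse (M i i) := if_pos h4
        rw [h5, mul_assoc, Ring.inverse_mul_cancel _ (hd i)]
        ring
      · have h5 : u i = 0 := if_neg h4
        rw [h5, hv i (by omega)]
        ring

namespace NilHecke

open Equiv

/-- The number of letters in `S` both slots of which have position less than `t`. -/
def countBelow {n : ℕ} (S : Finset (Letter n)) (t : ℕ) : ℕ := (S.filter fun i => i.1 + 1 < t).card

/-- A weight making the pairing of squarefree monomials triangular. -/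
def countWeight {n : ℕ} (S : Finset (Letter n)) : ℕ := ∑ t ∈ Finset.range (n + 1), countBelow S t

/-! ### The weight that makes the pairing triangular. -/

section Count

variable {n : ℕ}

theorem countBelow_succ_of_mem {S : Finset (Letter n)} {i : Letter n} (hi : i ∈ S) :
    countBelow S (i.1 + 1 + 1) = countBelow S (i.1 + 1) + 1 := by
  have : (S.filter fun k => k.1 + 1 < i.1 + 1 + 1) =
      insert i (S.filter fun k => k.1 + 1 < i.1 + 1) := by
    ext k
    simp only [Finset.mem_filter, Finset.mem_insert]
    constructor
    · rintro ⟨h1, h2⟩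
      by_cases h3 : k = i
      · exact Or.inl h3
      · have : k.1 ≠ i.1 := fun h => h3 (Fin.ext h)
        exact Or.inr ⟨h1, by omega⟩
    · rintro (rfl | ⟨h1, h2⟩)
      · exact ⟨hi, by omega⟩
      · exact ⟨h1, by omega⟩
  rw [countBelow, this, Finset.card_insert_of_notMem (by simp)]
  rfl

theorem countBelow_succ_of_notMem {S : Finset (Letter n)} {t : ℕ} (ht : ∀ i ∈ S, i.1 + 1 ≠ t) :
    countBelow S (t + 1) = countBelow S t := by
  unfold countBelow
  congr 1
  refine Finset.filter_congr fun i hi => ?_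
  have := ht i hi
  omega

/-- The counts agree at every cut that separates no letter of T. At a cut through a letter of T,
going down by one lowers the count of T by one and that of S by at most one. So S dominates T
everywhere, and equality everywhere would determine the set. -/
theorem countWeight_lt {S T : Finset (Letter n)} (h : ∀ t ≤ n, (∀ i ∈ T, i.1 + 1 ≠ t) →
    countBelow S t = countBelow T t) (hne : S ≠ T) : countWeight T < countWeight S := by
  -- Descending induction on the cut t, starting from n, which separates no letter.
  have hle : ∀ d t, t + d = n → countBelow T t ≤ countBelow S t := by
    intro d
    induction d with
    | zero =>
      intro t ht
      exact (h t (by omega) fun i _ => by have := i.2; omega).ge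
    | succ d ih =>
      intro t ht
      by_cases hT : ∀ i ∈ T, i.1 + 1 ≠ t
      · exact (h t (by omega) hT).ge
      · push Not at hT
        obtain ⟨i, hi, rfl⟩ := hT
        have h1 := countBelow_succ_of_mem hi
        have h2 := ih (i.1 + 1 + 1) (by omega)
        have h3 : countBelow S (i.1 + 1 + 1) ≤ countBelow S (i.1 + 1) + 1 := by
          by_cases hS : i ∈ S
          · exact (countBelow_succ_of_mem hS).le
          · rw [countBelow_succ_of_notMem]
            · omega
            · intro k hk hki
              exact hS ((Fin.ext (by omega) : k = i) ▸ hk)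
        omega
  have hle' : ∀ t ∈ Finset.range (n + 1), countBelow T t ≤ countBelow S t := fun t ht =>
    hle (n - t) t (by have := Finset.mem_range.1 ht; omega)
  refine Finset.sum_lt_sum hle' ?_
  by_contra hcon
  push Not at hcon
  have heq : ∀ t, t ≤ n → countBelow S t = countBelow T t := fun t ht =>
    le_antisymm (hcon t (Finset.mem_range.2 (by omega))) (hle' t (Finset.mem_range.2 (by omega)))
  have key : ∀ (A B : Finset (Letter n)), (∀ t, t ≤ n → countBelow A t = countBelow B t) →
      A ⊆ B := by
    intro A B hAB i hi
    by_contra hiB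
    have h1 := countBelow_succ_of_mem hi
    have h2 : countBelow B (i.1 + 1 + 1) = countBelow B (i.1 + 1) :=
      countBelow_succ_of_notMem fun k hk hki => hiB ((Fin.ext (by omega) : k = i) ▸ hk)
    have h3 := hAB (i.1 + 1 + 1) (by have := i.2; omega)
    have h4 := hAB (i.1 + 1) (by have := i.2; omega)
    omega
  exact hne (Finset.Subset.antisymm (key S T heq) (key T S fun t ht => (heq t ht).symm))

end Count

/-! ### The pairing with squarefree monomials. -/

section Diagonal

variable {n : ℕ} {R : Type*} [CommRing R] [IsDomain R] (hn : (n.factorial : R) ≠ 0)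

/-- The product of the variables of the right slots of the letters in `S`. -/
def hiProd (R : Type*) [CommRing R] (S : Finset (Letter n)) : MvPolynomial (Fin n) R :=
  ∏ i ∈ S, MvPolynomial.X i.hi

theorem blockPerms_lt_iff {T : Finset (Letter n)} {t : ℕ} (hT : ∀ i ∈ T, i.1 + 1 ≠ t)
    {σ : Perm (Fin n)} (hσ : σ ∈ blockPerms T) (j : Fin n) : (σ j).1 < t ↔ j.1 < t := by
  obtain _ | t := t
  · simp
  · by_cases htn : t < n - 1
    · have h1 := mem_blockPerms.1 hσ ⟨t, htn⟩ (fun h => hT _ h rfl) j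
      simp only [Letter.lo, Fin.le_def] at h1
      omega
    · have h1 := (σ j).2
      have h2 := j.2
      constructor <;> intro _ <;> omega

/-- A scaling argument: the block permutations preserve the slots before the cut, so scaling those
variables makes the symmetrization homogeneous of degree the difference of the two counts. A nonzero
constant term forces this degree to be zero. -/
theorem countBelow_eq_of_phi_ne_zero {S T : Finset (Letter n)} {t : ℕ}
    (hT : ∀ i ∈ T, i.1 + 1 ≠ t) (h : phi hn T (hiProd R S) ≠ 0) :
    countBelow S t = countBelow T t := by
  -- The additional variable `none` is the scaling parameter; `z'` is the generic point and `y'` is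
  -- its rescaling before the cut.
  let B := MvPolynomial (Option (Fin n)) R
  let F := FractionRing B
  let e : Fin n → B := fun j => if j.1 < t then MvPolynomial.X none else 1
  let y' : Fin n → B := fun j => e j * MvPolynomial.X (some j)
  let z' : Fin n → B := fun j => MvPolynomial.X (some j)
  have hinj : Function.Injective (algebraMap B F) := IsFractionRing.injective B F
  have hz' : Function.Injective z' := (MvPolynomial.X_injective).comp (Option.some_injective _)
  have hy' : Function.Injective y' := by
    intro j k hjk
    have h1 := congrArg (MvPolynomial.aeval (R := R) fun o : Option (Fin n) =>
      o.elim (1 : MvPolynomial (Fin n) R) MvPolynomial.X) hjk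
    have he : ∀ j, MvPolynomial.aeval (R := R) (fun o : Option (Fin n) =>
        o.elim (1 : MvPolynomial (Fin n) R) MvPolynomial.X) (e j) = 1 := by
      intro j
      simp only [e]
      split_ifs <;> simp
    simp only [y', map_mul, he, MvPolynomial.aeval_X, Option.elim_some, one_mul] at h1
    exact MvPolynomial.X_injective h1
  let y : Fin n → F := fun j => algebraMap B F (y' j)
  let z : Fin n → F := fun j => algebraMap B F (z' j)
  have hy : Function.Injective y := hinj.comp hy'
  have hz : Function.Injective z := hinj.comp hz'
  let l : F := algebraMap B F (MvPolynomial.X none)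
  have hl : l ≠ 0 := by
    intro h0
    exact MvPolynomial.X_ne_zero (R := R) (none : Option (Fin n)) (hinj (by rw [map_zero]; exact h0))
  have hyz : ∀ j, y j = (if j.1 < t then l else 1) * z j := by
    intro j
    simp only [y, y', e, z, z', l, map_mul]
    split_ifs <;> simp
  have hprod : ∀ U : Finset (Letter n), ∏ i ∈ U, (if i.1 + 1 < t then l else 1) =
      l ^ countBelow U t := by
    intro U
    rw [← Finset.prod_filter, Finset.prod_const, countBelow]
  have main : MvPolynomial.aeval y (symm hn T T (hiProd R S)) * l ^ countBelow T t =
      l ^ countBelow S t * MvPolynomial.aeval z (symm hn T T (hiProd R S)) := by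
    rw [aeval_symm hn subset_rfl _ hy, aeval_symm hn subset_rfl _ hz, Finset.sum_mul,
      Finset.mul_sum]
    refine Finset.sum_congr rfl fun σ hσ => ?_
    have h1 : MvPolynomial.aeval (fun j => y (σ j)) (hiProd R S) =
        l ^ countBelow S t * MvPolynomial.aeval (fun j => z (σ j)) (hiProd R S) := by
      simp only [hiProd, map_prod, MvPolynomial.aeval_X]
      rw [← hprod, ← Finset.prod_mul_distrib]
      refine Finset.prod_congr rfl fun i _ => ?_
      rw [hyz]
      congr 1
      refine if_congr ?_ rfl rfl
      rw [blockPerms_lt_iff hT hσ]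
      rfl
    have h2 : ∏ i ∈ T, (y (σ i.lo) - y (σ i.hi)) =
        l ^ countBelow T t * ∏ i ∈ T, (z (σ i.lo) - z (σ i.hi)) := by
      rw [← hprod, ← Finset.prod_mul_distrib]
      refine Finset.prod_congr rfl fun i hi => ?_
      have h3 : (σ i.lo).1 < t ↔ i.1 + 1 < t := by
        rw [blockPerms_lt_iff hT hσ]
        have := hT i hi
        simp only [Letter.lo]
        omega
      have h4 : (σ i.hi).1 < t ↔ i.1 + 1 < t := by
        rw [blockPerms_lt_iff hT hσ]
        rfl
      rw [hyz, hyz, if_congr h3 rfl rfl, if_congr h4 rfl rfl, mul_sub]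
    have h4 : l ^ countBelow T t ≠ 0 := pow_ne_zero _ hl
    rw [h1, h2, mul_div_mul_comm, mul_right_comm, div_mul_cancel₀ _ h4]
  have toB : ∀ (u : Fin n → B) (p : MvPolynomial (Fin n) R),
      MvPolynomial.aeval (fun j => algebraMap B F (u j)) p =
        algebraMap B F (MvPolynomial.aeval u p) := by
    intro u p
    exact (MvPolynomial.aeval_algebraMap_apply F u p)
  have mainB : MvPolynomial.aeval y' (symm hn T T (hiProd R S)) *
      MvPolynomial.X none ^ countBelow T t = MvPolynomial.X none ^ countBelow S t *
        MvPolynomial.aeval z' (symm hn T T (hiProd R S)) := by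
    apply hinj
    rw [map_mul, map_mul, map_pow, map_pow, ← toB, ← toB]
    exact main
  -- Setting all variables except the scaling parameter to zero leaves a comparison of two monomials
  -- with the same nonzero coefficient.
  let ψ : B →ₐ[R] Polynomial R := MvPolynomial.aeval fun o : Option (Fin n) =>
      o.elim Polynomial.X 0
  have hψ : ∀ (u : Fin n → B), (∀ j, ψ (u j) = 0) → ∀ p : MvPolynomial (Fin n) R,
      ψ (MvPolynomial.aeval u p) = Polynomial.C (MvPolynomial.constantCoeff p) := by
    intro u hu p
    have h1 : ψ.comp (MvPolynomial.aeval u) = MvPolynomial.aeval (0 : Fin n → Polynomial R) := by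
      apply MvPolynomial.algHom_ext
      intro j
      simp [hu]
    have h2 := DFunLike.congr_fun h1 p
    rw [AlgHom.comp_apply, MvPolynomial.aeval_zero] at h2
    exact h2
  have h5 := congrArg ψ mainB
  have hψX : ∀ o, ψ (MvPolynomial.X o) = o.elim Polynomial.X 0 := fun o =>
    MvPolynomial.aeval_X _ _
  have h6 : ∀ j : Fin n, ψ (MvPolynomial.X (some j)) = 0 := fun j => hψX (some j)
  rw [map_mul, map_mul, map_pow, map_pow,
    hψ y' (fun j => by simp only [y', map_mul, h6, mul_zero]), hψ z' h6, hψX,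
    Option.elim_none, mul_comm (Polynomial.X ^ _)] at h5
  have h7 := congrArg (fun p => Polynomial.coeff p (countBelow T t)) h5
  simp only [Polynomial.coeff_C_mul_X_pow] at h7
  by_contra hne
  rw [if_pos trivial, if_neg (Ne.symm hne)] at h7
  exact h h7

/-- The left slot of the smallest letter is the first slot of its block, so cutting the block after
it amounts to fixing this slot. -/
theorem blockPerms_erase {T : Finset (Letter n)} {a : Letter n} (ha : a ∈ T)
    (hmin : ∀ i ∈ T, a ≤ i) :
    blockPerms (T.erase a) = (blockPerms T).filter fun σ => σ a.lo = a.lo := by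
  ext σ
  rw [Finset.mem_filter]
  have hlow : ∀ τ ∈ blockPerms T, ∀ j, (τ j).1 < a.1 ↔ j.1 < a.1 := fun τ hτ j =>
    blockPerms_lt_iff (fun i hi => by have := Fin.le_def.1 (hmin i hi); omega) hτ j
  constructor
  · intro hσ
    have h1 := blockPerms_mono (Finset.erase_subset a T) hσ
    refine ⟨h1, ?_⟩
    have h2 := (mem_blockPerms.1 hσ a (by simp) a.lo).2 le_rfl
    have h3 := (hlow σ h1 a.lo).not
    simp only [Letter.lo, Fin.le_def] at h2 h3 ⊢
    exact Fin.ext (by dsimp only; omega)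
  · rintro ⟨hσ, ha'⟩
    rw [mem_blockPerms]
    intro i hi j
    by_cases hia : i = a
    · subst hia
      have h2 := hlow σ hσ j
      have h3 : σ j = i.lo ↔ j = i.lo :=
        ⟨fun h => σ.injective (h.trans ha'.symm), fun h => by rw [h, ha']⟩
      rw [Fin.ext_iff, Fin.ext_iff] at h3
      simp only [Letter.lo, Fin.le_def] at h3 ⊢
      omega
    · exact mem_blockPerms.1 hσ i (fun h => hi (Finset.mem_erase.2 ⟨hia, h⟩)) j

/-- Let a be the smallest letter, and put x_{a.lo} = 0. If σ fixes this slot, the letter a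
contributes x / (0 - x) = -1 and the rest is the sum for T without a. Otherwise the variable set to
zero sits at the right slot of some letter of T and kills the numerator. -/
theorem phi_hiProd_self (T : Finset (Letter n)) :
    phi hn T (hiProd R T) = (-1) ^ T.card := by
  induction T using Finset.strongInduction with
  | H T ih =>
    rcases T.eq_empty_or_nonempty with rfl | hne
    · have h1 : symm hn ∅ ∅ (hiProd R ∅) = (1 : MvPolynomial (Fin n) R) := by
        apply eq_of_aeval_gen
        rw [aeval_symm hn subset_rfl _ gen_injective]
        have h2 : blockPerms (∅ : Finset (Letter n)) = {1} := by
          ext σ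
          rw [Finset.mem_singleton]
          constructor
          · intro hσ
            have h3 : ∀ t j, (σ j).1 < t ↔ j.1 < t := fun t j =>
              blockPerms_lt_iff (by simp) hσ j
            ext j
            have h4 := h3 j.1 j
            have h5 := h3 (j.1 + 1) j
            simp only [Perm.coe_one, id_eq]
            omega
          · rintro rfl
            simp [mem_blockPerms]
        rw [h2, Finset.sum_singleton]
        simp [hiProd]
      change MvPolynomial.constantCoeff (symm hn ∅ ∅ (hiProd R ∅)) = _
      rw [h1]
      simp
    · let a := T.min' hne
      have ha : a ∈ T := T.min'_mem hne
      have hmin : ∀ i ∈ T, a ≤ i := fun i hi => T.min'_le i hi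
      let A := MvPolynomial (Fin n) R
      let F := FractionRing A
      have hinj : Function.Injective (algebraMap A F) := IsFractionRing.injective A F
      -- The coordinates of this specialization are still distinct, and it does not change the
      -- constant coefficient.
      let x' : Fin n → A := fun j => if j = a.lo then 0 else MvPolynomial.X j
      have hx' : Function.Injective x' := by
        intro j k hjk
        simp only [x'] at hjk
        split_ifs at hjk with h1 h2 h2
        · exact h1.trans h2.symm
        · exact absurd hjk.symm (MvPolynomial.X_ne_zero _)
        · exact absurd hjk (MvPolynomial.X_ne_zero _)
        · exact MvPolynomial.X_injective hjk
      let x : Fin n → F := fun j => algebraMap A F (x' j)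
      have hx : Function.Injective x := hinj.comp hx'
      have hx0 : x a.lo = 0 := by simp [x, x']
      have hxne : ∀ j, j ≠ a.lo → x j ≠ 0 := fun j hj h => hj (hx (h.trans hx0.symm))
      have main : MvPolynomial.aeval x (symm hn T T (hiProd R T)) =
          -MvPolynomial.aeval x (symm hn (T.erase a) (T.erase a) (hiProd R (T.erase a))) := by
        rw [aeval_symm hn subset_rfl _ hx, aeval_symm hn subset_rfl _ hx, blockPerms_erase ha hmin,
          Finset.sum_filter, ← Finset.sum_neg_distrib]
        refine Finset.sum_congr rfl fun σ hσ => ?_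
        simp only [hiProd, map_prod, MvPolynomial.aeval_X]
        split_ifs with hσa
        · rw [← Finset.mul_prod_erase T _ ha, ← Finset.mul_prod_erase T _ ha, hσa, hx0]
          have h1 : x (σ a.hi) ≠ 0 := hxne _ fun h =>
            a.lo_ne_hi (σ.injective (hσa.trans h.symm))
          rw [zero_sub, mul_div_mul_comm, div_neg, div_self h1]
          ring
        · rw [neg_zero, div_eq_zero_iff]
          left
          have hj : σ (σ⁻¹ a.lo) = a.lo := σ.apply_symm_apply _
          set j := σ⁻¹ a.lo with hjdef
          -- The slot j holding the zero variable lies in the block of a but is not its first slot,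
          -- so the letter ending at j belongs to T.
          have hja : j ≠ a.lo := fun h => hσa (by rw [← h]; rw [hj, h])
          have h1 := blockPerms_lt_iff (t := a.1) (fun i hi => by
            have := Fin.le_def.1 (hmin i hi); omega) hσ j
          rw [hj] at h1
          have h2 : j.1 ≠ a.1 := fun h => hja (Fin.ext h)
          have h3 : a.1 < j.1 := by
            simp only [Letter.lo] at h1
            omega
          have hjn := j.2
          let i : Letter n := ⟨j.1 - 1, by omega⟩
          have hij : i.hi = j := Fin.ext (by simp only [Letter.hi, i]; omega)
          have hiT : i ∈ T := by
            by_contra hiT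
            have h4 := mem_blockPerms.1 hσ i hiT j
            rw [hj] at h4
            simp only [Letter.lo, Fin.le_def, i] at h4
            omega
          refine Finset.prod_eq_zero hiT ?_
          rw [hij, hj, hx0]
      have toA : ∀ p : A, MvPolynomial.aeval x p = algebraMap A F (MvPolynomial.aeval x' p) :=
        fun p => MvPolynomial.aeval_algebraMap_apply F x' p
      have mainA : MvPolynomial.aeval x' (symm hn T T (hiProd R T)) =
          -MvPolynomial.aeval x' (symm hn (T.erase a) (T.erase a) (hiProd R (T.erase a))) := by
        apply hinj
        rw [map_neg, ← toA, ← toA, main]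
      have hcc : ∀ p : A, MvPolynomial.constantCoeff (MvPolynomial.aeval x' p) =
          MvPolynomial.constantCoeff p := by
        intro p
        have h1 : (MvPolynomial.aeval (R := R) (0 : Fin n → R)).comp (MvPolynomial.aeval x') =
            MvPolynomial.aeval (0 : Fin n → R) := by
          apply MvPolynomial.algHom_ext
          intro j
          simp only [AlgHom.comp_apply, MvPolynomial.aeval_X, x']
          split_ifs <;> simp
        have h2 := DFunLike.congr_fun h1 p
        rwa [AlgHom.comp_apply, MvPolynomial.aeval_zero, MvPolynomial.aeval_zero] at h2
      have h1 := congrArg MvPolynomial.constantCoeff mainA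
      rw [map_neg, hcc, hcc] at h1
      change phi hn T (hiProd R T) = -phi hn (T.erase a) (hiProd R (T.erase a)) at h1
      rw [h1, ih _ (Finset.erase_ssubset ha), ← Finset.card_erase_add_one ha, pow_succ]
      ring

/-- Modulo the radical an element is given by its values under the functionals for the subsets of J.
On the squarefree monomials these form a triangular matrix with diagonal ±1, so the system is
solvable over any admissible R. -/
theorem good_phi (J : Finset (Letter n)) : Good (LinearMap.ker (phi hn J))
    (lam (R := R) J fun i => (MvPolynomial.X i.hi : MvPolynomial (Fin n) R)) := by
  have htri := triangular_system (fun T S : J.powerset => phi hn T.1 (hiProd R S.1))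
    (fun T => countWeight T.1) (fun T => by rw [phi_hiProd_self]; exact isUnit_one.neg.pow _)
    (fun T S hTS hne => countWeight_lt (fun t _ hT => countBelow_eq_of_phi_ne_zero hn hT hne)
      fun h => hTS (Subtype.ext h.symm))
  have hlam : ∀ (T : Finset (Letter n)) (v : J.powerset → R),
      phi hn T (lam J (fun i => (MvPolynomial.X i.hi : MvPolynomial (Fin n) R)) v) =
        ∑ S, v S * phi hn T (hiProd R S.1) := by
    intro T v
    rw [lam_apply, map_sum]
    simp only [map_smul, smul_eq_mul]
    rfl
  constructor
  · intro v hv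
    rw [mem_rad_phi_iff] at hv
    refine htri.1 v fun T => ?_
    rw [← hlam]
    exact hv T.1 (Finset.mem_powerset.1 T.2)
  · intro y
    obtain ⟨v, hv⟩ := htri.2 fun T => phi hn T.1 y
    refine ⟨v, ?_⟩
    rw [mem_rad_phi_iff]
    intro T hT
    rw [map_sub, hlam, hv ⟨T, Finset.mem_powerset.2 hT⟩, sub_self]

end Diagonal

end NilHecke

end Vinyl

end

noncomputable section

namespace Vinyl

namespace NilHecke

open Equiv

/-! ### Words without repeated letters, and the result for all words. -/

section Base

variable {n : ℕ} {R : Type*} [CommRing R] [IsDomain R]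

/-- The polynomials without constant term, as a submodule of the field of rational functions. -/
def noConst (n : ℕ) (R : Type*) [CommRing R] [IsDomain R] :
    Submodule R (FractionRing (MvPolynomial (Fin n) R)) :=
  Submodule.map (IsScalarTower.toAlgHom R (MvPolynomial (Fin n) R)
    (FractionRing (MvPolynomial (Fin n) R))).toLinearMap
    (LinearMap.ker (MvPolynomial.aeval (R := R) (fun _ : Fin n => (0 : R))).toLinearMap)

theorem mem_noConst {k : FractionRing (MvPolynomial (Fin n) R)} : k ∈ noConst n R ↔
    ∃ p : MvPolynomial (Fin n) R, algebraMap _ _ p = k ∧ MvPolynomial.eval (fun _ => 0) p = 0 := by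
  constructor
  · rintro ⟨p, hp, rfl⟩
    exact ⟨p, rfl, by simpa [MvPolynomial.aeval_eq_eval] using hp⟩
  · rintro ⟨p, rfl, hp⟩
    exact ⟨p, by simpa [MvPolynomial.aeval_eq_eval] using hp, rfl⟩

theorem algebraMap_mem_noConst {p : MvPolynomial (Fin n) R} :
    algebraMap _ (FractionRing (MvPolynomial (Fin n) R)) p ∈ noConst n R ↔
      MvPolynomial.constantCoeff p = 0 := by
  have hz : MvPolynomial.eval (fun _ => (0 : R)) p = MvPolynomial.constantCoeff p :=
    DFunLike.congr_fun MvPolynomial.eval_zero' p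
  rw [mem_noConst, ← hz]
  constructor
  · rintro ⟨q, hq, hq0⟩
    rwa [← IsFractionRing.injective (MvPolynomial (Fin n) R) _ hq]
  · intro h
    exact ⟨p, rfl, h⟩

variable {H : Type*} [Fintype H] [DecidableEq H] {nxt : Perm H}

omit [DecidableEq H] in
/-- The closed paths of a word without repetitions are constant. -/
theorem const_of_path {K : Type*} [Field K] {X : Fin n → K} {w : H → Option (Letter n)}
    (hw : ∀ h h' i, w h = some i → w h' = some i → h = h') {c : H → Perm (Fin n)}
    (hc : ∀ h, mat X (w h) (c h) (c (nxt h)) ≠ 0) (h : H) : c (nxt h) = c h := by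
  have key : ∀ (o : Option (Letter n)) (σ τ : Perm (Fin n)), mat X o σ τ ≠ 0 →
      τ = σ ∨ ∃ i, o = some i ∧ τ = σ * Equiv.swap i.lo i.hi := by
    intro o σ τ hne
    cases o with
    | none =>
      by_contra hcon
      push Not at hcon
      exact hne (Matrix.one_apply_ne hcon.1.symm)
    | some i =>
      by_contra hcon
      push Not at hcon
      refine hne ?_
      simp only [mat, dum, Matrix.of_apply]
      exact if_neg (not_or.2 ⟨hcon.1, hcon.2 i rfl⟩)
  rcases key _ _ _ (hc h) with h1 | ⟨i, hi, h1⟩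
  · exact h1
  · exfalso
    let x := c h i.hi
    -- Records whether the pigment x is to the left of the cut through the letter i. Only the slab
    -- with this letter can change it, and the changes around a cycle add up to zero.
    let φ : Perm (Fin n) → ℤ := fun σ => if σ⁻¹ x ≤ i.lo then 1 else 0
    have hx : (c h)⁻¹ x = i.hi := (c h).symm_apply_apply _
    have hx' : (c (nxt h))⁻¹ x = i.lo := by
      rw [h1, mul_inv_rev, Perm.mul_apply, hx, swap_inv, swap_apply_right]
    have hsum : ∑ g, (φ (c (nxt g)) - φ (c g)) = 0 := by
      rw [Finset.sum_sub_distrib, Equiv.sum_comp nxt (fun g => φ (c g)), sub_self]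
    rw [Finset.sum_eq_single h] at hsum
    · simp only [φ, hx, hx', le_refl, if_true] at hsum
      rw [if_neg] at hsum
      · norm_num at hsum
      · simp [Letter.lo, Letter.hi, Fin.le_def]
    · intro g _ hgh
      rw [sub_eq_zero]
      rcases key _ _ _ (hc g) with h2 | ⟨j, hj, h2⟩
      · rw [h2]
      · have hij : j ≠ i := fun e => hgh (hw g h i (e ▸ hj) hi)
        have hij' : j.1 ≠ i.1 := fun e => hij (Fin.ext e)
        simp only [φ]
        refine if_congr ?_ rfl rfl
        rw [h2, mul_inv_rev, Perm.mul_apply, swap_inv]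
        generalize (c g)⁻¹ x = y
        by_cases e1 : y = j.lo
        · rw [e1, swap_apply_left]
          simp only [Letter.lo, Letter.hi, Fin.le_def]
          omega
        · by_cases e2 : y = j.hi
          · rw [e2, swap_apply_right]
            simp only [Letter.lo, Letter.hi, Fin.le_def]
            omega
          · rw [swap_apply_of_ne_of_ne e1 e2]
    · simp

/-- The sum over closed paths reduces to constant ones, where every dumbbell contributes a diagonal
entry. This is the symmetrization over the whole symmetric group. -/
theorem form_of_injective {k : ℕ} (hn : (n.factorial : R) ≠ 0) {w : Fin (k + 1) → Option (Letter n)}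
    (hw : ∀ h h' i, w h = some i → w h' = some i → h = h')
    (y : MvPolynomial (Fin (k + 1) × Fin n) R) :
    form R (gen R) (up k) (fun h => mat (gen R) (w h)) y =
      MvPolynomial.aeval (gen (n := n) R)
        (symm hn (Finset.univ.filter fun i => ∃ h, w h = some i) Finset.univ
          (MvPolynomial.rename Prod.snd y)) := by
  rw [aeval_symm hn (Finset.subset_univ _) _ gen_injective, blockPerms_univ, form_apply, cyc]
  symm
  have hinj : Function.Injective fun (σ : Perm (Fin n)) (_ : Fin (k + 1)) => σ :=
    fun σ τ h => congrFun h 0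
  rw [← Finset.sum_subset (Finset.subset_univ (Finset.univ.map ⟨_, hinj⟩)), Finset.sum_map]
  · refine Finset.sum_congr rfl fun σ _ => ?_
    have h1 : evp R (gen (n := n) R) (fun _ : Fin (k + 1) => σ) y =
        MvPolynomial.aeval (fun j => gen (n := n) R (σ j)) (MvPolynomial.rename Prod.snd y) := by
      rw [MvPolynomial.aeval_rename]
      rfl
    have h2 : ∏ h, mat (gen (n := n) R) (w h) σ σ =
        (∏ i ∈ Finset.univ.filter (fun i => ∃ h, w h = some i),
          (gen R (σ i.lo) - gen R (σ i.hi)))⁻¹ := by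
      rw [← Finset.prod_inv_distrib]
      symm
      rw [← Finset.prod_filter_mul_prod_filter_not Finset.univ fun h => (w h).isSome]
      rw [Finset.prod_eq_one (s := Finset.univ.filter fun h => ¬(w h).isSome = true), mul_one]
      · refine Finset.prod_bij' (s := Finset.univ.filter (fun i => ∃ h, w h = some i))
          (t := Finset.univ.filter fun h => (w h).isSome = true)
          (fun i hi => (Finset.mem_filter.1 hi).2.choose)
          (fun h hh => (w h).get (Finset.mem_filter.1 hh).2) ?_ ?_ ?_ ?_ ?_
        · intro i hi
          have := (Finset.mem_filter.1 hi).2.choose_spec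
          simp [this]
        · intro h hh
          rw [Finset.mem_filter]
          exact ⟨Finset.mem_univ _, h, by simp⟩
        · intro i hi
          have := (Finset.mem_filter.1 hi).2.choose_spec
          simp [this]
        · intro h hh
          have hex : ∃ h', w h' = some ((w h).get (Finset.mem_filter.1 hh).2) := ⟨h, by simp⟩
          exact hw _ _ _ hex.choose_spec (by simp)
        · intro i hi
          have := (Finset.mem_filter.1 hi).2.choose_spec
          rw [this]
          simp [mat, dum]
      · intro h hh
        have : w h = none := by simpa using hh
        rw [this]
        simp [mat]
    simp only [Function.Embedding.coeFn_mk]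
    rw [h1, h2, div_eq_mul_inv, mul_comm]
  · intro c _ hc
    by_contra hne
    have h3 : ∀ h, mat (gen (n := n) R) (w h) (c h) (c (up k h)) ≠ 0 := fun h =>
      Finset.prod_ne_zero_iff.1 (left_ne_zero_of_mul hne) h (Finset.mem_univ h)
    have h4 := const_of_path hw h3
    have h5 : ∀ h, c h = c 0 := by
      intro h
      induction h using Fin.induction with
      | zero => rfl
      | succ i ih =>
        rw [← ih, ← h4 i.castSucc]
        congr 1
        simp
    exact hc (Finset.mem_map.2 ⟨c 0, Finset.mem_univ _, funext fun h => (h5 h).symm⟩)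

/-- As paths are constant, all heights can be identified. Passing from the full group to the blocks
of the letters present changes the constant term only by nonzero factors, so `good_phi` applies. -/
theorem goodWord_base {k : ℕ} (hn : (n.factorial : R) ≠ 0) {w : Fin (k + 1) → Option (Letter n)}
    (hw : ∀ h h' i, w h = some i → w h' = some i → h = h') :
    GoodWord (R := R) (gen R) (up k) (noConst n R) w := by
  set J : Finset (Letter n) := Finset.univ.filter fun i => ∃ h, w h = some i with hJ
  let e1 : {h // (w h).isSome} ↪ Fin (k + 1) := Function.Embedding.subtype _
  let e2 : {h // (w h).isSome} ↪ Letter n := ⟨fun h => (w h.1).get h.2, fun h h' e =>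
    Subtype.ext (hw _ _ _ (Option.some_get h.2).symm
      ((congrArg some e).symm ▸ (Option.some_get h'.2).symm))⟩
  have he2 : ∀ h, w h.1 = some (e2 h) := fun h => (Option.some_get h.2).symm
  have hsupp : wordSupp w = Finset.univ.map e1 := by
    ext h
    simp [mem_wordSupp, e1]
  have hJ' : J = Finset.univ.map e2 := by
    ext i
    simp only [hJ, Finset.mem_filter, Finset.mem_univ, true_and, Finset.mem_map]
    constructor
    · rintro ⟨h, hi⟩
      exact ⟨⟨h, by simp [hi]⟩, Option.some_injective _ ((he2 _).symm.trans hi)⟩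
    · rintro ⟨h, rfl⟩
      exact ⟨h.1, he2 h⟩
  have hg := good_phi hn J
  rw [hJ', good_lam_map, ← hJ'] at hg
  unfold GoodWord
  rw [hsupp, good_lam_map]
  have hphi : ∀ y, y ∈ ker (noConst n R) (gen R) (up k) (fun h => mat (gen R) (w h)) ↔
      MvPolynomial.rename Prod.snd y ∈ LinearMap.ker (phi hn J) := by
    intro y
    rw [mem_ker, form_of_injective hn hw, aeval_gen, algebraMap_mem_noConst,
      constantCoeff_symm_eq_zero_iff hn (Finset.subset_univ _), LinearMap.mem_ker]
  refine (good_transfer (MvPolynomial.rename Prod.snd) (fun y => (hphi y).symm) (fun a => ?_)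
    (fun v => ?_)).1 hg
  · refine ⟨MvPolynomial.rename (fun j => (0, j)) a, ?_⟩
    rw [MvPolynomial.rename_rename]
    have : Prod.snd ∘ (fun j : Fin n => ((0 : Fin (k + 1)), j)) = id := rfl
    rw [this, MvPolynomial.rename_id_apply, sub_self]
    exact zero_mem _
  · rw [map_lam]
    refine lam_sub_mem _ (fun h _ => ?_) _
    have h1 : w (e1 h) = some (e2 h) := he2 h
    rw [wordDeco_some h1, MvPolynomial.rename_X, sub_self]
    exact zero_mem _

theorem goodWord {k : ℕ} (hn : (n.factorial : R) ≠ 0) (w : Fin (k + 1) → Option (Letter n)) :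
    GoodWord (R := R) (gen R) (up k) (noConst n R) w := by
  refine goodWord_of_nodup gen_injective (fun w hw => goodWord_base hn ?_) w
  rw [List.reduceOption, List.Nodup, List.pairwise_filterMap, List.pairwise_ofFn] at hw
  intro h h' i hi hi'
  rcases lt_trichotomy h h' with hlt | heq | hlt
  · exact absurd rfl (hw hlt i hi i hi')
  · exact heq
  · exact absurd rfl (hw hlt i hi' i hi)

end Base

end NilHecke

end Vinyl

end

noncomputable section

namespace Vinyl

namespace NilHecke

open Equiv Matrix

/-! ### Slabs with several dumbbells -/

section Stack

variable {n : ℕ} {K : Type*} [Field K] {H : Type*} [Fintype H] [DecidableEq H]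

omit [Fintype H] [DecidableEq H] in
theorem stack_injective (nxt : Perm H) (q : ℕ) : Function.Injective fun x : H × Fin (q + 1) =>
    (if x.2 = Fin.last q then nxt x.1 else x.1, x.2 + 1) := by
  rintro ⟨h, i⟩ ⟨h', i'⟩ e
  simp only [Prod.mk.injEq, add_left_inj] at e
  obtain ⟨e1, rfl⟩ := e
  split_ifs at e1
  · rw [nxt.injective e1]
  · rw [e1]

/-- The cyclic order on the heights after a subdivision of each slab. -/
def stack (nxt : Perm H) (q : ℕ) : Perm (H × Fin (q + 1)) :=
  Equiv.ofBijective _ (Finite.injective_iff_bijective.1 (stack_injective nxt q))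

omit [DecidableEq H] in
theorem stack_last (nxt : Perm H) (q : ℕ) (h : H) :
    stack nxt q (h, Fin.last q) = (nxt h, 0) := by
  simp [stack]

omit [DecidableEq H] in
theorem stack_castSucc (nxt : Perm H) (q : ℕ) (h : H) (i : Fin q) :
    stack nxt q (h, i.castSucc) = (h, i.succ) := by
  simp [stack, Fin.castSucc_ne_last]

theorem ofFn_prod_apply {ι : Type*} [Fintype ι] [DecidableEq ι] {q : ℕ}
    (m : Fin (q + 1) → Matrix ι ι K) (σ τ : ι) :
    (List.ofFn m).prod σ τ = ∑ r : Fin q → ι, (∏ i : Fin q,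
      m i.castSucc (Fin.cons (α := fun _ => ι) σ r i.castSucc) (r i)) *
        m (Fin.last q) (Fin.cons (α := fun _ => ι) σ r (Fin.last q)) τ := by
  induction q generalizing σ with
  | zero => simp
  | succ q ih =>
    rw [List.ofFn_succ, List.prod_cons, Matrix.mul_apply,
      ← (Fin.consEquiv fun _ : Fin (q + 1) => ι).sum_comp, Fintype.sum_prod_type]
    refine Finset.sum_congr rfl fun ρ _ => ?_
    rw [ih, Finset.mul_sum]
    refine Finset.sum_congr rfl fun r _ => ?_
    rw [Fin.prod_univ_succ, mul_assoc]
    simp only [Fin.consEquiv_apply, Fin.castSucc_zero, Fin.cons_zero, Fin.cons_succ,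
      ← Fin.succ_castSucc, ← Fin.succ_last]

/-- When F looks only at the bottoms of the slabs, the sum over the inner heights gives the product
of the matrices of the sub-slabs. -/
theorem cyc_stack (nxt : Perm H) {q : ℕ} (m : H × Fin (q + 1) → Mat n K)
    (F : (H → Perm (Fin n)) → K) :
    cyc (stack nxt q) m (fun c => F fun h => c (h, 0)) =
      cyc nxt (fun h => (List.ofFn fun i => m (h, i)).prod) F := by
  rw [cyc, ← (Equiv.curry H (Fin (q + 1)) (Perm (Fin n))).symm.sum_comp,
    ← (Equiv.arrowCongr (Equiv.refl H)
      (Fin.consEquiv fun _ : Fin (q + 1) => Perm (Fin n))).sum_comp,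
    ← (Equiv.arrowProdEquivProdArrow H (fun _ => Perm (Fin n))
      (fun _ => Fin q → Perm (Fin n))).symm.sum_comp, Fintype.sum_prod_type, cyc]
  refine Finset.sum_congr rfl fun c _ => ?_
  simp only [ofFn_prod_apply]
  rw [Finset.prod_univ_sum, Fintype.piFinset_univ, Finset.sum_mul]
  refine Finset.sum_congr rfl fun r _ => ?_
  rw [Fintype.prod_prod_type]
  congr 1
  refine Finset.prod_congr rfl fun h _ => ?_
  rw [Fin.prod_univ_castSucc]
  simp only [stack_last, stack_castSucc]
  rfl

/-- The product of the matrices of the dumbbells of a subdivided slab. -/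
def slabMat (X : Fin n → K) {q : ℕ} (w : H × Fin (q + 1) → Option (Letter n)) (h : H) : Mat n K :=
  (List.ofFn fun i => mat X (w (h, i))).prod

/-- The path entry of a slab. -/
def entry (X : Fin n → K) (τ : Perm (Fin n)) (o : Option (Letter n)) : K :=
  o.elim 1 fun i => (X (τ i.lo) - X (τ i.hi))⁻¹

/-- Two permutations agree, up to exchanges of the two ends of dumbbells. -/
structure Near (l : List (Option (Letter n))) (σ τ : Perm (Fin n)) : Prop where
  eq : ∀ j, (∀ o ∈ l, j ∉ slots o) → τ j = σ j
  image_eq : ∀ o ∈ l, (slots o).image τ = (slots o).image σ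

theorem image_pair_eq_iff {α β : Type*} [DecidableEq β] {f g : α → β} {a b : α}
    (hf : f a ≠ f b) [DecidableEq α] :
    (({a, b} : Finset α).image f = ({a, b} : Finset α).image g) ↔
      (f a = g a ∧ f b = g b) ∨ (f a = g b ∧ f b = g a) := by
  rw [Finset.image_insert, Finset.image_singleton, Finset.image_insert, Finset.image_singleton]
  constructor
  · intro h
    have h1 : f a ∈ ({g a, g b} : Finset β) := h ▸ by simp
    have h2 : f b ∈ ({g a, g b} : Finset β) := h ▸ by simp
    simp only [Finset.mem_insert, Finset.mem_singleton] at h1 h2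
    rcases h1 with h1 | h1 <;> rcases h2 with h2 | h2
    · exact absurd (h1.trans h2.symm) hf
    · exact Or.inl ⟨h1, h2⟩
    · exact Or.inr ⟨h1, h2⟩
    · exact absurd (h1.trans h2.symm) hf
  · rintro (⟨h1, h2⟩ | ⟨h1, h2⟩)
    · rw [h1, h2]
    · rw [h1, h2, Finset.pair_comm]

theorem near_cons_none {l : List (Option (Letter n))} {σ τ : Perm (Fin n)} :
    Near (none :: l) σ τ ↔ Near l σ τ := by
  constructor
  · intro h
    refine ⟨fun j hj => h.eq j ?_, fun o ho => h.image_eq o (List.mem_cons_of_mem _ ho)⟩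
    intro o ho
    rcases List.mem_cons.1 ho with rfl | ho
    · simp [slots]
    · exact hj o ho
  · intro h
    refine ⟨fun j hj => h.eq j fun o ho => hj o (List.mem_cons_of_mem _ ho), fun o ho => ?_⟩
    rcases List.mem_cons.1 ho with rfl | ho
    · simp [slots]
    · exact h.image_eq o ho

theorem near_cons_some {l : List (Option (Letter n))} {i : Letter n}
    (hd : ∀ o ∈ l, Disjoint (slots (some i)) (slots o)) {σ τ : Perm (Fin n)} :
    Near (some i :: l) σ τ ↔ Near l σ τ ∨ Near l (σ * swap i.lo i.hi) τ := by
  have hj : ∀ j, j ∈ slots (some i) → ∀ o ∈ l, j ∉ slots o := fun j h1 o ho h2 =>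
    Finset.disjoint_left.1 (hd o ho) h1 h2
  have hlo : i.lo ∈ slots (some i) := by simp [slots]
  have hhi : i.hi ∈ slots (some i) := by simp [slots]
  have hsw : ∀ j, j ∉ slots (some i) → swap i.lo i.hi j = j := by
    intro j h
    simp only [slots, Finset.mem_insert, Finset.mem_singleton, not_or] at h
    exact swap_apply_of_ne_of_ne h.1 h.2
  have him : ∀ o ∈ l, (slots o).image (σ * swap i.lo i.hi) = (slots o).image σ := by
    intro o ho
    refine Finset.image_congr fun j h => ?_
    rw [Perm.mul_apply, hsw j (Finset.disjoint_right.1 (hd o ho) h)]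
  constructor
  · intro h
    have h1 := h.image_eq (some i) List.mem_cons_self
    rw [slots, image_pair_eq_iff (τ.injective.ne i.lo_ne_hi)] at h1
    rcases h1 with h1 | h1
    · left
      refine ⟨fun j h2 => ?_, fun o ho => h.image_eq o (List.mem_cons_of_mem _ ho)⟩
      by_cases h3 : j ∈ slots (some i)
      · simp only [slots, Finset.mem_insert, Finset.mem_singleton] at h3
        rcases h3 with rfl | rfl
        exacts [h1.1, h1.2]
      · refine h.eq j fun o ho => ?_
        rcases List.mem_cons.1 ho with rfl | ho
        exacts [h3, h2 o ho]
    · right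
      refine ⟨fun j h2 => ?_, fun o ho => ?_⟩
      · by_cases h3 : j ∈ slots (some i)
        · simp only [slots, Finset.mem_insert, Finset.mem_singleton] at h3
          rcases h3 with rfl | rfl
          · rw [Perm.mul_apply, swap_apply_left, h1.1]
          · rw [Perm.mul_apply, swap_apply_right, h1.2]
        · rw [Perm.mul_apply, hsw j h3]
          refine h.eq j fun o ho => ?_
          rcases List.mem_cons.1 ho with rfl | ho
          exacts [h3, h2 o ho]
      · rw [him o ho]
        exact h.image_eq o (List.mem_cons_of_mem _ ho)
  · intro h
    refine ⟨fun j h2 => ?_, fun o ho => ?_⟩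
    · have h3 := h2 _ List.mem_cons_self
      have h4 : ∀ o ∈ l, j ∉ slots o := fun o ho => h2 o (List.mem_cons_of_mem _ ho)
      rcases h with h | h
      · exact h.eq j h4
      · rw [h.eq j h4, Perm.mul_apply, hsw j h3]
    · rcases List.mem_cons.1 ho with rfl | ho
      · rw [slots, image_pair_eq_iff (τ.injective.ne i.lo_ne_hi)]
        rcases h with h | h
        · exact Or.inl ⟨h.eq _ (hj _ hlo), h.eq _ (hj _ hhi)⟩
        · right
          rw [h.eq _ (hj _ hlo), h.eq _ (hj _ hhi)]
          simp
      · rcases h with h | h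
        · exact h.image_eq o ho
        · rw [h.image_eq o ho, him o ho]

-- The dumbbells are disjoint, so each is either crossed straight or exchanged, and at most one
-- intermediate path leads from σ to τ. The entry of a dumbbell depends only on the pigments above
-- it, and these can be read off τ.
open Classical in
theorem prod_mat_apply {X : Fin n → K} {l : List (Option (Letter n))}
    (hl : l.Pairwise fun o o' => Disjoint (slots o) (slots o')) (σ τ : Perm (Fin n)) :
    (l.map (mat X)).prod σ τ = if Near l σ τ then (l.map (entry X τ)).prod else 0 := by
  induction l generalizing σ with
  | nil =>
    have : Near [] σ τ ↔ σ = τ := by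
      constructor
      · intro h
        ext j
        rw [h.eq j (by simp)]
      · rintro rfl
        exact ⟨fun _ _ => rfl, by simp⟩
    simp [this, Matrix.one_apply]
  | cons o l ih =>
    rw [List.pairwise_cons] at hl
    rw [List.map_cons, List.prod_cons, List.map_cons, List.prod_cons]
    cases o with
    | none => simp [mat, entry, ih hl.2, near_cons_none]
    | some i =>
      rw [Matrix.mul_apply]
      have hne : σ ≠ σ * swap i.lo i.hi := by
        intro e
        have := congrArg (fun ρ : Perm (Fin n) => ρ i.lo) e
        simp only [Perm.mul_apply, swap_apply_left] at this
        exact i.lo_ne_hi (σ.injective this)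
      rw [Finset.sum_eq_add σ (σ * swap i.lo i.hi) hne ?_ (by simp) (by simp)]
      · rw [ih hl.2, ih hl.2]
        have hj : ∀ j, j ∈ slots (some i) → ∀ o ∈ l, j ∉ slots o := fun j h1 o ho h2 =>
          Finset.disjoint_left.1 (hl.1 o ho) h1 h2
        have hlo : i.lo ∈ slots (some i) := by simp [slots]
        have hhi : i.hi ∈ slots (some i) := by simp [slots]
        have h0 : ∀ ρ : Perm (Fin n), ρ = σ ∨ ρ = σ * swap i.lo i.hi → Near l ρ τ →
            mat X (some i) σ ρ = entry X τ (some i) := by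
          intro ρ h1 h2
          simp only [mat, dum, Matrix.of_apply, if_pos h1, entry, Option.elim_some,
            h2.eq _ (hj _ hlo), h2.eq _ (hj _ hhi)]
        by_cases h1 : Near l σ τ <;> by_cases h2 : Near l (σ * swap i.lo i.hi) τ
        · exfalso
          have := (h1.eq _ (hj _ hlo)).symm.trans (h2.eq _ (hj _ hlo))
          simp only [Perm.mul_apply, swap_apply_left] at this
          exact i.lo_ne_hi (σ.injective this)
        · rw [if_pos h1, if_neg h2, if_pos ((near_cons_some hl.1).2 (Or.inl h1)), mul_zero,
            add_zero, h0 _ (Or.inl rfl) h1]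
        · rw [if_neg h1, if_pos h2, if_pos ((near_cons_some hl.1).2 (Or.inr h2)), mul_zero,
            zero_add, h0 _ (Or.inr rfl) h2]
        · rw [if_neg h1, if_neg h2, if_neg, mul_zero, mul_zero, add_zero]
          rw [near_cons_some hl.1]
          exact not_or.2 ⟨h1, h2⟩
      · intro ρ _ h
        simp [mat, dum, h.1, h.2]

variable {X : Fin n → K} {q : ℕ} {w : H × Fin (q + 1) → Option (Letter n)}

omit [Fintype H] [DecidableEq H] in
open Classical in
theorem slabMat_apply (hw : ∀ h i i', i ≠ i' → Disjoint (slots (w (h, i))) (slots (w (h, i'))))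
    (h : H) (σ τ : Perm (Fin n)) : slabMat X w h σ τ =
      if Near (List.ofFn fun i => w (h, i)) σ τ then ∏ i, entry X τ (w (h, i)) else 0 := by
  have h1 : (List.ofFn fun i => mat X (w (h, i))) = (List.ofFn fun i => w (h, i)).map (mat X) := by
    rw [List.map_ofFn]; rfl
  rw [slabMat, h1, prod_mat_apply, List.map_ofFn, List.prod_ofFn]
  · rfl
  · rw [List.pairwise_ofFn]
    exact fun i i' hii => hw h i i' hii.ne

variable {R : Type*} [CommRing R] [Algebra R K] {nxt : Perm H} {𝔪 : Submodule R K}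

/-- Each slot is touched at most once within a slab. So a variable at an inner height equals the one
at the bottom, if no dumbbell below touches its slot, and the one at the top otherwise. -/
theorem good_slabMat (hw : ∀ h i i', i ≠ i' → Disjoint (slots (w (h, i))) (slots (w (h, i'))))
    (hg : GoodWord (R := R) X (stack nxt q) 𝔪 w) :
    Good (ker 𝔪 X nxt (slabMat X w)) (lam (R := R) (wordSupp w)
      fun x => (w x).elim 1 fun i => var R (nxt x.1) i.hi) := by
  have hup : ∀ c : H × Fin (q + 1) → Perm (Fin n),
      (∀ x, mat X (w x) (c x) (c (stack nxt q x)) ≠ 0) → ∀ (h : H) (j : Fin n) (k : Fin (q + 1)),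
        (∀ i, k ≤ i → j ∉ slots (w (h, i))) → c (h, k) j = c (nxt h, 0) j := by
    intro c hc h j k
    induction k using Fin.reverseInduction with
    | last =>
      intro hk
      have := eq_of_mat_ne_zero (hc (h, Fin.last q)) (hk _ le_rfl)
      rw [stack_last] at this
      exact this.symm
    | cast k ih =>
      intro hk
      have := eq_of_mat_ne_zero (hc (h, k.castSucc)) (hk _ le_rfl)
      rw [stack_castSucc] at this
      rw [← this]
      exact ih fun i hi => hk i (Fin.castSucc_lt_succ.le.trans hi)
  have hdown : ∀ c : H × Fin (q + 1) → Perm (Fin n),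
      (∀ x, mat X (w x) (c x) (c (stack nxt q x)) ≠ 0) → ∀ (h : H) (j : Fin n) (k : Fin (q + 1)),
        (∀ i, i < k → j ∉ slots (w (h, i))) → c (h, k) j = c (h, 0) j := by
    intro c hc h j k
    induction k using Fin.induction with
    | zero => exact fun _ => rfl
    | succ k ih =>
      intro hk
      have := eq_of_mat_ne_zero (hc (h, k.castSucc)) (hk _ Fin.castSucc_lt_succ)
      rw [stack_castSucc] at this
      rw [this]
      exact ih fun i hi => hk i (hi.trans Fin.castSucc_lt_succ)
  let f := subHeight R (n := n) fun h : H => (h, (0 : Fin (q + 1)))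
  refine (good_transfer f (fun y => ?_) (fun a => ?_) (fun v => ?_)).1 hg
  · rw [mem_ker, mem_ker, form_apply, form_apply]
    have : (fun c => evp R X c (f y)) =
        fun c : H × Fin (q + 1) → Perm (Fin n) => evp R X (fun h => c (h, 0)) y := by
      funext c
      exact evp_subHeight R X _ c y
    rw [this, cyc_stack nxt (fun x => mat X (w x)) fun c => evp R X c y]
    rfl
  · suffices h : ∃ y z, a - (f y + 0 * f z) ∈ wordRad X (stack nxt q) 𝔪 w by
      obtain ⟨y, z, h⟩ := h
      rw [zero_mul, add_zero] at h
      exact ⟨y, h⟩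
    refine exists_sub_mem_of_generators f 0 (fun s => ?_) ⟨0, 0, by simp⟩ a
    obtain ⟨⟨h, k⟩, j⟩ := s
    by_cases hk : ∀ i, i < k → j ∉ slots (w (h, i))
    · refine ⟨var R h j, 0, mem_wordRad fun c hc => ?_⟩
      simp [f, hdown c hc h j k hk]
    · push Not at hk
      obtain ⟨i, hi, hj⟩ := hk
      refine ⟨var R (nxt h) j, 0, mem_wordRad fun c hc => ?_⟩
      have : c (h, k) j = c (nxt h, 0) j := by
        refine hup c hc h j k fun i' hi' => ?_
        exact Finset.disjoint_left.1 (hw h i i' (hi.trans_le hi').ne) hj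
      simp [f, this]
  · rw [map_lam]
    refine lam_sub_mem _ (fun x hx => ?_) _
    obtain ⟨h, k⟩ := x
    rw [mem_wordSupp, Option.isSome_iff_exists] at hx
    obtain ⟨i, hi⟩ := hx
    rw [wordDeco_some hi, hi, Option.elim_some, subHeight_X]
    refine mem_wordRad fun c hc => ?_
    have key : c (stack nxt q (h, k)) i.hi = c (nxt h, 0) i.hi := by
      induction k using Fin.lastCases with
      | last => rw [stack_last]
      | cast k =>
        rw [stack_castSucc]
        refine hup c hc h _ _ fun i' hi' => ?_
        refine Finset.disjoint_left.1 (hw h k.castSucc i' (Fin.castSucc_lt_succ.trans_le hi').ne) ?_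
        rw [hi]
        simp [slots]
    simp [key]

end Stack

/-- The pairs of a slab and a sub-slab, in lexicographic order, form a single cycle of slabs. -/
theorem goodWord_stack {n : ℕ} {R : Type*} [CommRing R] [IsDomain R] {N q : ℕ}
    (hn : (n.factorial : R) ≠ 0) (w : Fin (N + 1) × Fin (q + 1) → Option (Letter n)) :
    GoodWord (R := R) (gen R) (stack (up N) q) (noConst n R) w := by
  have hk : (N + 1) * (q + 1) = N * (q + 1) + q + 1 := by ring
  let φ : Fin (N + 1) × Fin (q + 1) ≃ Fin (N * (q + 1) + q + 1) :=
    finProdFinEquiv.trans (finCongr hk)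
  have hv : ∀ h i, (φ (h, i)).1 = i.1 + (q + 1) * h.1 := fun h i => rfl
  have hφ : ∀ x, up (N * (q + 1) + q) (φ x) = φ (stack (up N) q x) := by
    rintro ⟨h, i⟩
    have hu : ∀ (k : ℕ) (x : Fin (k + 1)), (up k x).1 = if x.1 = k then 0 else x.1 + 1 := by
      intro k x
      have : up k x = x + 1 := rfl
      rw [this, Fin.val_add_one]
      congr 1
      simp [Fin.ext_iff]
    refine Fin.ext ?_
    rw [hu, hv]
    induction i using Fin.lastCases with
    | last =>
      rw [stack_last, hv, hu]
      simp only [Fin.val_last, Fin.val_zero, zero_add]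
      have h2 := h.2
      by_cases h1 : h.1 = N
      · rw [if_pos h1, h1, if_pos (by ring), mul_zero]
      · rw [if_neg h1, if_neg, mul_add]
        · ring
        · have : (q + 1) * h.1 < (q + 1) * N := Nat.mul_lt_mul_of_pos_left (by omega) (by omega)
          intro e
          rw [mul_comm N] at e
          omega
    | cast i =>
      rw [stack_castSucc, hv, if_neg]
      · simp only [Fin.val_castSucc, Fin.val_succ]
        ring
      · have : (q + 1) * h.1 ≤ (q + 1) * N := Nat.mul_le_mul_left _ (by omega)
        simp only [Fin.val_castSucc]
        rw [mul_comm N]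
        have := i.2
        omega
  have h2 := (goodWord_reindex (𝔪 := noConst n R) (R := R) (X := gen R) φ hφ (fun x => w (φ.symm x))).1
    (goodWord hn _)
  simpa using h2

end NilHecke

end Vinyl

end

noncomputable section

namespace Vinyl

namespace NilHecke

/-! ### Removing decorations of doubled strands -/

section Descend

theorem sum_powerset_union {H M : Type*} [DecidableEq H] [AddCommMonoid M] {E S : Finset H}
    (h : Disjoint E S) (F : Finset H → M) : ∑ T ∈ (E ∪ S).powerset, F T =
      ∑ B ∈ E.powerset, ∑ C ∈ S.powerset, F (B ∪ C) := by
  rw [← Finset.sum_product']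
  symm
  refine Finset.sum_bij' (fun x _ => x.1 ∪ x.2) (fun T _ => (T ∩ E, T ∩ S)) ?_ ?_ ?_ ?_ ?_
  · rintro ⟨B, C⟩ hx
    simp only [Finset.mem_product, Finset.mem_powerset] at hx ⊢
    exact Finset.union_subset_union hx.1 hx.2
  · intro T _
    simp only [Finset.mem_product, Finset.mem_powerset]
    exact ⟨Finset.inter_subset_right, Finset.inter_subset_right⟩
  · rintro ⟨B, C⟩ hx
    simp only [Finset.mem_product, Finset.mem_powerset] at hx
    have h1 : B ∩ S = ∅ := Finset.disjoint_iff_inter_eq_empty.1 (h.mono_left hx.1)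
    have h2 : C ∩ E = ∅ := Finset.disjoint_iff_inter_eq_empty.1 (h.symm.mono_left hx.2)
    simp only [Finset.union_inter_distrib_right, h1, h2, Finset.inter_eq_left.2 hx.1,
      Finset.inter_eq_left.2 hx.2, Finset.union_empty, Finset.empty_union]
  · intro T hT
    rw [Finset.mem_powerset] at hT
    rw [← Finset.inter_union_distrib_left, Finset.inter_eq_left.2 hT]
  · intro _ _
    rfl

variable {R A P H : Type*} [CommRing R] [CommRing A] [Algebra R A] [CommRing P] [Algebra R P]
  [DecidableEq H]

/-- Modulo the radical A behaves like the algebra with basis the products of r over subsets of E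
with coefficients in P, on which the form reads the top coefficient. So the radical is computed
coefficientwise, and the family for E and S together splits accordingly. -/
theorem good_descend (χ : P →ₐ[R] A) {N : Submodule R A} {NP : Submodule R P} {E S : Finset H}
    (hES : Disjoint E S) {r : H → A} {d : H → P}
    (hspan : ∀ M : Submodule R A, (∀ a ∈ rad N, a ∈ M) →
      (∀ B ⊆ E, ∀ y, (∏ e ∈ B, r e) * χ y ∈ M) → ∀ a, a ∈ M)
    (htop : ∀ y, (∏ e ∈ E, r e) * χ y ∈ N ↔ y ∈ NP)
    (hlow : ∀ B ⊆ E, ∀ C ⊆ E, B ∪ C ≠ E → ∀ y, ((∏ e ∈ B, r e) * ∏ e ∈ C, r e) * χ y ∈ N)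
    (hd : ∀ s ∈ S, r s - χ (d s) ∈ rad N) (hg : Good N (lam (R := R) (E ∪ S) r)) :
    Good NP (lam (R := R) S d) := by
  have h1 : ∀ y, χ y ∈ rad N ↔ y ∈ rad NP := by
    intro y
    constructor
    · intro h z
      rw [← htop, map_mul, ← mul_assoc]
      exact h _
    · intro h a
      refine hspan (N.comap (LinearMap.mulRight R (χ y))) (fun a ha => ?_) (fun B hB z => ?_) a
      · rw [Submodule.mem_comap, LinearMap.mulRight_apply]
        exact mem_of_mem_rad (Ideal.mul_mem_right _ _ ha)
      · rw [Submodule.mem_comap, LinearMap.mulRight_apply, mul_assoc, ← map_mul]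
        by_cases hBE : B = E
        · rw [hBE, htop]
          exact h z
        · simpa using hlow B hB ∅ (Finset.empty_subset _) (by simpa using hBE) (z * y)
  -- Multiplying by the product over the complement of B moves the coefficient of B to the top.
  -- Coefficients of larger sets are already known to be in the radical, and the remaining ones pair
  -- to zero.
  have h2 : ∀ u : Finset H → P, ∑ B ∈ E.powerset, (∏ e ∈ B, r e) * χ (u B) ∈ rad N →
      ∀ B ⊆ E, u B ∈ rad NP := by
    intro u hu
    suffices h : ∀ k : ℕ, ∀ B ⊆ E, (E \ B).card = k → u B ∈ rad NP from
      fun B hB => h _ B hB rfl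
    intro k
    induction k using Nat.strong_induction_on with
    | _ k ih =>
      intro B hB hk z
      rw [← htop]
      have h3 := hu ((∏ e ∈ E \ B, r e) * χ z)
      rw [Finset.mul_sum, ← Finset.add_sum_erase _ _ (Finset.mem_powerset.2 hB)] at h3
      have h4 : (∏ e ∈ E \ B, r e) * χ z * ((∏ e ∈ B, r e) * χ (u B)) =
          (∏ e ∈ E, r e) * χ (z * u B) := by
        rw [← Finset.prod_sdiff hB, map_mul]
        ring
      rw [h4] at h3
      refine (N.add_mem_iff_left (N.sum_mem fun B' hB' => ?_)).1 h3
      rw [Finset.mem_erase, Finset.mem_powerset] at hB'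
      by_cases hs : B ⊆ B'
      · refine mem_of_mem_rad (Ideal.mul_mem_left _ _ (Ideal.mul_mem_left _ _ ((h1 _).2 ?_)))
        refine ih (E \ B').card ?_ B' hB'.2 rfl
        rw [← hk]
        refine Finset.card_lt_card ⟨Finset.sdiff_subset_sdiff le_rfl hs, fun h => hB'.1 ?_⟩
        refine (hs.antisymm fun e he => ?_).symm
        by_contra hne
        exact (Finset.mem_sdiff.1 (h (Finset.mem_sdiff.2 ⟨hB'.2 he, hne⟩))).2 he
      · have h5 := hlow (E \ B) Finset.sdiff_subset B' hB'.2 (fun h => hs fun e he => ?_)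
          (z * u B')
        · convert h5 using 1
          rw [map_mul]
          ring
        · have : e ∈ E \ B ∪ B' := by rw [h]; exact hB he
          rcases Finset.mem_union.1 this with h | h
          · exact absurd he (Finset.mem_sdiff.1 h).2
          · exact h
  have h3 : ∀ v : Finset H → R, ∑ C ∈ S.powerset, v C • ∏ e ∈ C, r e -
      χ (∑ C ∈ S.powerset, v C • ∏ e ∈ C, d e) ∈ rad N := by
    intro v
    rw [map_sum, ← Finset.sum_sub_distrib]
    refine Ideal.sum_mem _ fun C hC => ?_
    rw [map_smul, ← smul_sub, map_prod, Algebra.smul_def]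
    refine Ideal.mul_mem_left _ _ (Ideal.Quotient.eq.1 ?_)
    rw [map_prod, map_prod]
    exact Finset.prod_congr rfl fun e he => Ideal.Quotient.eq.2 (hd e (Finset.mem_powerset.1 hC he))
  rw [good_lam_iff] at hg ⊢
  obtain ⟨hinj, hsurj⟩ := hg
  constructor
  · intro v hv C hC
    have h4 := (Ideal.add_mem_iff_left _ ((h1 _).2 hv)).2 (h3 v)
    rw [sub_add_cancel] at h4
    have h5 := hinj (fun T => if T ⊆ S then v T else 0) ?_ C
      (hC.trans Finset.subset_union_right)
    · simpa [hC] using h5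
    · convert h4 using 1
      symm
      refine Finset.sum_subset_zero_on_sdiff
        (Finset.powerset_mono.2 Finset.subset_union_right) (fun T hT => ?_) (fun T hT => ?_)
      · rw [Finset.mem_sdiff, Finset.mem_powerset, Finset.mem_powerset] at hT
        simp [hT.2]
      · rw [Finset.mem_powerset] at hT
        simp [hT]
  · intro y
    obtain ⟨v, hv⟩ := hsurj (χ y)
    refine ⟨v, ?_⟩
    -- Expanding χ y in the large family and collecting the coefficient of each product over B; the
    -- one of the empty product expands y.
    let u : Finset H → P := fun B => ∑ C ∈ S.powerset, v (B ∪ C) • ∏ e ∈ C, d e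
    have h4 := h2 (fun B => (if B = ∅ then y else 0) - u B) ?_ ∅ (Finset.empty_subset _)
    · simpa [u] using h4
    · have h5 : ∑ B ∈ E.powerset, (∏ e ∈ B, r e) * χ (if B = ∅ then y else 0) = χ y := by
        rw [Finset.sum_eq_single ∅]
        · simp
        · intro B _ hB
          simp [hB]
        · intro h
          exact absurd (Finset.empty_mem_powerset _) h
      simp only [map_sub, mul_sub, Finset.sum_sub_distrib]
      rw [h5]
      rw [sum_powerset_union hES] at hv
      have h6 : ∑ B ∈ E.powerset, ∑ C ∈ S.powerset, v (B ∪ C) • ∏ e ∈ B ∪ C, r e -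
          ∑ B ∈ E.powerset, (∏ e ∈ B, r e) * χ (u B) ∈ rad N := by
        rw [← Finset.sum_sub_distrib]
        refine Ideal.sum_mem _ fun B hB => ?_
        have h7 : ∑ C ∈ S.powerset, v (B ∪ C) • ∏ e ∈ B ∪ C, r e =
            (∏ e ∈ B, r e) * ∑ C ∈ S.powerset, v (B ∪ C) • ∏ e ∈ C, r e := by
          rw [Finset.mul_sum]
          refine Finset.sum_congr rfl fun C hC => ?_
          rw [Finset.prod_union (hES.mono (Finset.mem_powerset.1 hB) (Finset.mem_powerset.1 hC)),
            mul_smul_comm]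
        rw [h7, ← mul_sub]
        exact Ideal.mul_mem_left _ _ (h3 fun C => v (B ∪ C))
      have := Ideal.add_mem _ hv h6
      rwa [sub_add_sub_cancel] at this

/-- The sum U of I and of the products of r times the image of χ contains 1. It is stable under χ
and, because of the quadratic relations, under each r, hence under all variables. -/
theorem mem_of_generators {σ : Type*} {I : Ideal (MvPolynomial σ R)}
    (χ : P →ₐ[R] MvPolynomial σ R) {E : Finset H} {r : H → MvPolynomial σ R}
    (hX : ∀ s, (∃ p, MvPolynomial.X s - χ p ∈ I) ∨
      ∃ e ∈ E, ∃ p p', MvPolynomial.X s - (χ p + r e * χ p') ∈ I)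
    (hr : ∀ e ∈ E, ∃ p p', r e * r e - (χ p + r e * χ p') ∈ I)
    (M : Submodule R (MvPolynomial σ R)) (hI : ∀ a ∈ I, a ∈ M)
    (hM : ∀ B ⊆ E, ∀ y, (∏ e ∈ B, r e) * χ y ∈ M) (a : MvPolynomial σ R) : a ∈ M := by
  let U : Submodule R (MvPolynomial σ R) := I.restrictScalars R ⊔
    Submodule.span R {a | ∃ B ⊆ E, ∃ y, a = (∏ e ∈ B, r e) * χ y}
  have hUM : U ≤ M := by
    refine sup_le hI (Submodule.span_le.2 ?_)
    rintro _ ⟨B, hB, y, rfl⟩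
    exact hM B hB y
  have hIU : ∀ a ∈ I, a ∈ U := fun a ha => Submodule.mem_sup_left ha
  have hU : ∀ B ⊆ E, ∀ y, (∏ e ∈ B, r e) * χ y ∈ U := fun B hB y =>
    Submodule.mem_sup_right (Submodule.subset_span ⟨B, hB, y, rfl⟩)
  have hmul : ∀ z, (∀ B ⊆ E, ∀ y, z * ((∏ e ∈ B, r e) * χ y) ∈ U) → ∀ u ∈ U, z * u ∈ U := by
    intro z hz
    suffices h : U ≤ U.comap (LinearMap.mulLeft R z) from fun u hu => h hu
    refine sup_le (fun b hb => hIU _ (I.mul_mem_left z hb)) (Submodule.span_le.2 ?_)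
    rintro _ ⟨B, hB, y, rfl⟩
    exact hz B hB y
  have hχ : ∀ p, ∀ u ∈ U, χ p * u ∈ U := by
    intro p
    refine hmul _ fun B hB y => ?_
    rw [mul_left_comm, ← map_mul]
    exact hU B hB _
  have hre : ∀ e ∈ E, ∀ u ∈ U, r e * u ∈ U := by
    intro e he
    refine hmul _ fun B hB y => ?_
    by_cases heB : e ∈ B
    · obtain ⟨p, p', h⟩ := hr e he
      have hB' : B.erase e ⊆ E := (Finset.erase_subset _ _).trans hB
      have h1 := U.add_mem (hIU _ (I.mul_mem_left ((∏ e ∈ B.erase e, r e) * χ y) h))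
        (U.add_mem (hU _ hB' (p * y)) (hU B hB (p' * y)))
      convert h1 using 1
      rw [← Finset.mul_prod_erase _ _ heB, map_mul, map_mul]
      ring
    · rw [← mul_assoc, ← Finset.prod_insert heB]
      exact hU _ (Finset.insert_subset he hB) y
  refine hUM ?_
  have h1 : (1 : MvPolynomial σ R) ∈ U := by simpa using hU ∅ (Finset.empty_subset _) 1
  induction a using MvPolynomial.induction_on with
  | C x =>
    have := U.smul_mem x h1
    rwa [Algebra.smul_def, mul_one] at this
  | add a b ha hb => exact U.add_mem ha hb
  | mul_X a s ha =>
    rw [mul_comm]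
    rcases hX s with ⟨p, h⟩ | ⟨e, he, p, p', h⟩
    · have := U.add_mem (hIU _ (I.mul_mem_right a h)) (hχ p a ha)
      convert this using 1
      ring
    · have := U.add_mem (hIU _ (I.mul_mem_right a h)) (U.add_mem (hχ p a ha)
        (hre e he _ (hχ p' a ha)))
      convert this using 1
      ring

end Descend

/-! ### Sums over paths with commuting exchanges. -/

section Flip

variable {α ι K : Type*} [DecidableEq ι] [CommRing K]

/-- A sum over a set with an action of exchanges factorizes. -/
theorem sum_prod_flip {E : Finset ι} (t : ι → α → α) (ht : ∀ i ∈ E, ∀ a, t i (t i a) = a)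
    (p : ι → α → Prop) [∀ i, DecidablePred (p i)]
    (hp : ∀ i ∈ E, ∀ k ∈ E, k ≠ i → ∀ a, p k (t i a) ↔ p k a)
    (G : ι → α → K) (hG : ∀ i ∈ E, ∀ k ∈ E, k ≠ i → ∀ a, G k (t i a) = G k a)
    (C : ι → K) (S : Finset α) (hS : ∀ i ∈ E, ∀ a ∈ S, t i a ∈ S)
    (hp' : ∀ i ∈ E, ∀ a ∈ S, p i (t i a) ↔ ¬p i a)
    (hC : ∀ i ∈ E, ∀ a ∈ S, G i a + G i (t i a) = C i) :
    ∑ a ∈ S, ∏ i ∈ E, G i a = ∑ a ∈ S with ∀ i ∈ E, p i a, ∏ i ∈ E, C i := by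
  induction E using Finset.induction_on generalizing S with
  | empty => simp
  | insert j E hj ih =>
    have hne : ∀ k ∈ E, k ≠ j := fun k hk e => hj (e ▸ hk)
    have hjm := Finset.mem_insert_self j E
    have hm : ∀ k ∈ E, k ∈ insert j E := fun k hk => Finset.mem_insert_of_mem hk
    have hinv : ∀ a, ∏ i ∈ E, G i (t j a) = ∏ i ∈ E, G i a := fun a =>
      Finset.prod_congr rfl fun k hk => hG j hjm k (hm k hk) (hne k hk) a
    have h1 : ∑ a ∈ S, ∏ i ∈ insert j E, G i a = C j * ∑ a ∈ S with p j a, ∏ i ∈ E, G i a := by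
      simp only [Finset.prod_insert hj]
      rw [← Finset.sum_filter_add_sum_filter_not S (p j)]
      have h2 : ∑ a ∈ S with ¬p j a, G j a * ∏ i ∈ E, G i a =
          ∑ a ∈ S with p j a, G j (t j a) * ∏ i ∈ E, G i a := by
        refine Finset.sum_bij' (fun a _ => t j a) (fun a _ => t j a) ?_ ?_ ?_ ?_ ?_
        · intro a ha
          rw [Finset.mem_filter] at ha ⊢
          exact ⟨hS j hjm a ha.1, (hp' j hjm a ha.1).2 ha.2⟩
        · intro a ha
          rw [Finset.mem_filter] at ha ⊢
          exact ⟨hS j hjm a ha.1, fun h => (hp' j hjm a ha.1).1 h ha.2⟩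
        · exact fun a _ => ht j hjm a
        · exact fun a _ => ht j hjm a
        · intro a _
          rw [ht j hjm, hinv]
      rw [h2, ← Finset.sum_add_distrib, Finset.mul_sum]
      refine Finset.sum_congr rfl fun a ha => ?_
      rw [← add_mul, hC j hjm a (Finset.mem_filter.1 ha).1]
    rw [h1, ih (fun i hi => ht i (hm i hi)) (fun i hi k hk => hp i (hm i hi) k (hm k hk))
      (fun i hi k hk => hG i (hm i hi) k (hm k hk)), Finset.filter_filter, Finset.mul_sum]
    · simp only [Finset.forall_mem_insert, Finset.prod_insert hj]
    · intro i hi a ha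
      rw [Finset.mem_filter] at ha ⊢
      exact ⟨hS i (hm i hi) a ha.1, (hp i (hm i hi) j hjm (hne i hi).symm a).2 ha.2⟩
    · exact fun i hi a ha => hp' i (hm i hi) a (Finset.mem_filter.1 ha).1
    · exact fun i hi a ha => hC i (hm i hi) a (Finset.mem_filter.1 ha).1

end Flip

end NilHecke

end Vinyl

end

noncomputable section

namespace Vinyl

open NilHecke

/-! ### Slots of strands -/

/-- The number of slots to the left of the `j`-th strand. -/
def off (L : List ℕ+) (j : ℕ) : ℕ := ((L.take j).map (fun a : ℕ+ => (a : ℕ))).sum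

@[simp] theorem off_zero (L : List ℕ+) : off L 0 = 0 := by simp [off]

theorem off_succ {L : List ℕ+} {j : ℕ} {a : ℕ+} (h : L[j]? = some a) :
    off L (j + 1) = off L j + a := by
  simp [off, List.take_add_one, h]

theorem off_mono (L : List ℕ+) : Monotone (off L) := by
  refine monotone_nat_of_le_succ fun j => ?_
  rcases h : L[j]? with _ | a
  · simp [off, List.take_add_one, h]
  · rw [off_succ h]
    omega

theorem off_cons_succ (a : ℕ+) (L : List ℕ+) (j : ℕ) : off (a :: L) (j + 1) = a + off L j := by
  simp [off]

theorem off_append_left {A : List ℕ+} (B : List ℕ+) {j : ℕ} (h : j ≤ A.length) :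
    off (A ++ B) j = off A j := by
  rw [off, off, List.take_append_of_le_length h]

theorem off_append_right (A B : List ℕ+) (j : ℕ) :
    off (A ++ B) (A.length + j) = off A A.length + off B j := by
  rw [off, off, off, List.take_length, List.take_append, List.take_of_length_le (by omega),
    Nat.add_sub_cancel_left, List.map_append, List.sum_append]

theorem off_length (L : List ℕ+) : off L L.length = (L.map (fun a : ℕ+ => (a : ℕ))).sum := by
  simp [off]

theorem length_le_off (L : List ℕ+) : L.length ≤ off L L.length := by
  induction L with
  | nil => simp
  | cons a L ih =>
    rw [List.length_cons, off_cons_succ]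
    have := a.pos
    omega

theorem off_succ_le {L : List ℕ+} {j : ℕ} {a : ℕ+} (h : L[j]? = some a) :
    off L j + a ≤ off L L.length := by
  rw [← off_succ h]
  exact off_mono L (List.getElem?_eq_some_iff.1 h).1

theorem exists_off_le {L : List ℕ+} {x : ℕ} (hx : x < off L L.length) :
    ∃ j < L.length, off L j ≤ x ∧ x < off L (j + 1) := by
  have hex : ∃ j, x < off L (j + 1) := ⟨L.length, hx.trans_le (off_mono L (by omega))⟩
  classical
  have h1 := Nat.find_spec hex
  have h2 : off L (Nat.find hex) ≤ x := by
    rcases h : Nat.find hex with _ | m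
    · simp
    · exact not_lt.1 (Nat.find_min hex (by omega))
  refine ⟨Nat.find hex, ?_, h2, h1⟩
  by_contra h3
  have := off_mono L (not_lt.1 h3)
  omega

/-- The intervals of different strands are disjoint, so a slot determines its strand. -/
theorem eq_of_off_le {L : List ℕ+} {x j k : ℕ} (hj : off L j ≤ x) (hj' : x < off L (j + 1))
    (hk : off L k ≤ x) (hk' : x < off L (k + 1)) : j = k := by
  rcases lt_trichotomy j k with h | h | h
  · have := off_mono L (show j + 1 ≤ k from h)
    omega
  · exact h
  · have := off_mono L (show k + 1 ≤ j from h)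
    omega

/-- The slots of the `j`-th strand. -/
def seg (n : ℕ) (L : List ℕ+) (j : ℕ) : Finset (Fin n) :=
  Finset.univ.filter fun x => off L j ≤ x ∧ x < off L (j + 1)

theorem mem_seg {n : ℕ} {L : List ℕ+} {j : ℕ} {x : Fin n} :
    x ∈ seg n L j ↔ off L j ≤ x ∧ x < off L (j + 1) := by
  simp [seg]

/-! ### Strands and dumbbells of a single slab. -/

namespace Piece

variable {p : Piece}

theorem off_of_isStrand {j k : ℕ} (h : p.IsStrand j k) : off p.bottom j = off p.top k := by
  cases p with
  | straight A => simp only [IsStrand] at h; subst h; rfl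
  | split A B a b =>
    rcases h with ⟨h, rfl⟩ | ⟨h, rfl⟩
    · simp [bottom, top, off_append_left _ h.le]
    · obtain ⟨m, rfl⟩ := Nat.exists_eq_add_of_lt h
      simp only [bottom, top, add_assoc, off_append_right]
      rw [off_cons_succ, show m + (1 + 1) = m + 1 + 1 from rfl, off_cons_succ, off_cons_succ,
        PNat.add_coe]
      omega
  | merge A B a b =>
    rcases h with ⟨h, rfl⟩ | ⟨h, h'⟩
    · simp [bottom, top, off_append_left _ h.le]
    · obtain ⟨m, rfl⟩ := Nat.exists_eq_add_of_lt h
      obtain rfl : k = A.length + m + 1 := by omega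
      rw [show A.length + 1 + m + 1 = A.length + (m + 1 + 1) by omega]
      simp only [bottom, top, add_assoc, off_append_right]
      rw [off_cons_succ, show m + (1 + 1) = m + 1 + 1 from rfl, off_cons_succ, off_cons_succ,
        PNat.add_coe]
      omega

theorem seg_of_isStrand (n : ℕ) {j k : ℕ} (h : p.IsStrand j k) :
    seg n p.bottom j = seg n p.top k := by
  have h1 := off_of_isStrand h
  have h2 := getElem?_of_isStrand h
  ext x
  rw [mem_seg, mem_seg, h1]
  rcases h3 : p.bottom[j]? with _ | a
  · have h4 : p.bottom.length ≤ j := List.getElem?_eq_none_iff.1 h3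
    have h5 : p.top.length ≤ k := List.getElem?_eq_none_iff.1 (h2 ▸ h3)
    have h6 : ∀ (L : List ℕ+) (j : ℕ), L.length ≤ j → off L (j + 1) = off L j := by
      intro L j h
      rw [off, off, List.take_of_length_le h, List.take_of_length_le (by omega)]
    rw [h6 _ _ h4, h6 _ _ h5, h1]
  · rw [off_succ h3, off_succ (h2 ▸ h3), h1]

theorem off_pos_of_isSplit (h : p.isSplit = true) : off p.bottom p.pos = off p.top p.pos ∧
    off p.bottom (p.pos + 1) = off p.top (p.pos + 1 + 1) := by
  cases p with
  | split A B a b =>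
    simp only [bottom, top, pos, add_assoc, off_append_right]
    simp only [off_append_left _ le_rfl, true_and]
    rw [show (1 : ℕ) = 0 + 1 from rfl, off_cons_succ, show 0 + 1 + (0 + 1) = 0 + 1 + 1 from rfl,
      off_cons_succ, off_cons_succ, PNat.add_coe]
    simp
  | straight A => simp [isSplit] at h
  | merge A B a b => simp [isSplit] at h

theorem off_pos_of_isMerge (h : p.isMerge = true) : off p.bottom p.pos = off p.top p.pos ∧
    off p.top (p.pos + 1) = off p.bottom (p.pos + 1 + 1) := by
  cases p with
  | merge A B a b =>
    simp only [bottom, top, pos, add_assoc, off_append_right]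
    simp only [off_append_left _ le_rfl, true_and]
    rw [show (1 : ℕ) = 0 + 1 from rfl, off_cons_succ, show 0 + 1 + (0 + 1) = 0 + 1 + 1 from rfl,
      off_cons_succ, off_cons_succ, PNat.add_coe]
    simp
  | straight A => simp [isMerge] at h
  | split A B a b => simp [isMerge] at h

theorem seg_of_isSplit (n : ℕ) (h : p.isSplit = true) :
    seg n p.bottom p.pos = seg n p.top p.pos ∪ seg n p.top (p.pos + 1) := by
  obtain ⟨h1, h2⟩ := off_pos_of_isSplit h
  have h3 := off_mono p.top (show p.pos ≤ p.pos + 1 by omega)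
  have h4 := off_mono p.top (show p.pos + 1 ≤ p.pos + 1 + 1 by omega)
  ext x
  simp only [mem_seg, Finset.mem_union]
  omega

theorem seg_of_isMerge (n : ℕ) (h : p.isMerge = true) :
    seg n p.top p.pos = seg n p.bottom p.pos ∪ seg n p.bottom (p.pos + 1) := by
  obtain ⟨h1, h2⟩ := off_pos_of_isMerge h
  have h3 := off_mono p.bottom (show p.pos ≤ p.pos + 1 by omega)
  have h4 := off_mono p.bottom (show p.pos + 1 ≤ p.pos + 1 + 1 by omega)
  ext x
  simp only [mem_seg, Finset.mem_union]
  omega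

theorem off_length_top (p : Piece) : off p.top p.top.length = off p.bottom p.bottom.length := by
  rw [off_length, off_length]
  cases p <;> simp [top, bottom] <;> ring

theorem top_cases {k : ℕ} (hk : k < p.top.length) :
    (∃ j < p.bottom.length, p.IsStrand j k) ∨
      (p.isSplit = true ∧ (k = p.pos ∨ k = p.pos + 1)) ∨ (p.isMerge = true ∧ k = p.pos) := by
  cases p with
  | straight A => exact Or.inl ⟨k, hk, rfl⟩
  | split A B a b =>
    simp only [top, bottom, IsStrand, isSplit, isMerge, pos, List.length_append,
      List.length_cons] at hk ⊢
    by_cases h1 : k < A.length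
    · exact Or.inl ⟨k, by omega, Or.inl ⟨h1, rfl⟩⟩
    · by_cases h2 : k ≤ A.length + 1
      · right; left; exact ⟨trivial, by omega⟩
      · exact Or.inl ⟨k - 1, by omega, Or.inr ⟨by omega, by omega⟩⟩
  | merge A B a b =>
    simp only [top, bottom, IsStrand, isSplit, isMerge, pos, List.length_append,
      List.length_cons] at hk ⊢
    by_cases h1 : k < A.length
    · exact Or.inl ⟨k, by omega, Or.inl ⟨h1, rfl⟩⟩
    · by_cases h2 : k = A.length
      · right; right; exact ⟨trivial, h2⟩
      · exact Or.inl ⟨k + 1, by omega, Or.inr ⟨by omega, by omega⟩⟩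

theorem ne_pos_of_isStrand {j k : ℕ} (h : p.IsStrand j k) (hs : p.isSplit = true) :
    k ≠ p.pos ∧ k ≠ p.pos + 1 := by
  cases p with
  | split A B a b =>
    simp only [IsStrand, pos] at h ⊢
    omega
  | straight A => simp [isSplit] at hs
  | merge A B a b => simp [isSplit] at hs

/-- The labels are `1` or `2`. -/
def IsElementary (p : Piece) : Prop :=
  (∀ a ∈ p.bottom, a = 1 ∨ a = 2) ∧ ∀ a ∈ p.top, a = 1 ∨ a = 2

/-- Labels are positive, so a sum that is at most 2 can only be 1 + 1. -/
theorem IsElementary.split (he : p.IsElementary) (h : p.isSplit = true) :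
    p.bottom[p.pos]? = some 2 ∧ p.top[p.pos]? = some 1 ∧ p.top[p.pos + 1]? = some 1 := by
  cases p with
  | split A B a b =>
    have h1 := he.1 (a + b) (by simp [bottom])
    have h2 : (a : ℕ) + b = 1 ∨ (a : ℕ) + b = 2 := by
      rcases h1 with h1 | h1
      · exact Or.inl (by rw [← PNat.add_coe, h1]; rfl)
      · exact Or.inr (by rw [← PNat.add_coe, h1]; rfl)
    have h3 := a.pos
    have h4 := b.pos
    have ha : a = 1 := PNat.coe_injective (by rw [PNat.one_coe]; omega)
    have hb : b = 1 := PNat.coe_injective (by rw [PNat.one_coe]; omega)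
    subst ha hb
    simp [bottom, top, pos]
    rfl
  | straight A => simp [isSplit] at h
  | merge A B a b => simp [isSplit] at h

theorem IsElementary.merge (he : p.IsElementary) (h : p.isMerge = true) :
    p.top[p.pos]? = some 2 := by
  cases p with
  | merge A B a b =>
    have h1 := he.2 (a + b) (by simp [top])
    have h3 := a.pos
    have h4 := b.pos
    have h2 : a + b ≠ 1 := fun e => by
      have : (a : ℕ) + b = 1 := by rw [← PNat.add_coe, e]; rfl
      omega
    simpa [top, pos] using h1.resolve_left h2
  | straight A => simp [isMerge] at h
  | split A B a b => simp [isMerge] at h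

/-- Is there a dumbbell at the `k`-th point at the top of a slab? -/
def IsLetter (p : Piece) (k : ℕ) : Prop :=
  p.top[k]? = some 2 ∨ (p.isSplit = true ∧ k = p.pos)

open Classical in
/-- The dumbbell at the `k`-th point at the top of a slab. -/
def letter (n : ℕ) (p : Piece) (k : ℕ) : Option (Letter n) :=
  -- The bound always holds when n is the number of slots, by `IsLetter.lt`; it is only there to
  -- form the letter.
  if h : p.IsLetter k ∧ off p.top k + 1 < n then some ⟨off p.top k, by omega⟩ else none

variable {n : ℕ} (hn : off p.top p.top.length = n)

include hn

theorem IsLetter.lt {k : ℕ} (h : p.IsLetter k) : off p.top k + 1 < n := by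
  subst hn
  rcases h with h | ⟨h, rfl⟩
  · have := off_succ_le h
    simp only [PNat.val_ofNat] at this
    omega
  · have h1 := pos_succ_lt_top_of_isSplit h
    have h2 := off_succ_le (List.getElem?_eq_getElem h1)
    rw [off_succ (List.getElem?_eq_getElem (Nat.lt_of_succ_lt h1))] at h2
    have h3 := (p.top[p.pos]'(Nat.lt_of_succ_lt h1)).pos
    have h4 := (p.top[p.pos + 1]).pos
    omega

theorem letter_eq_some {k : ℕ} (h : p.IsLetter k) :
    ∃ i : Letter n, p.letter n k = some i ∧ i.1 = off p.top k := by
  exact ⟨⟨off p.top k, by have := h.lt hn; omega⟩, dif_pos ⟨h, h.lt hn⟩, rfl⟩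

omit hn in
theorem isLetter_of_letter {k : ℕ} {i : Letter n} (h : p.letter n k = some i) :
    p.IsLetter k ∧ i.1 = off p.top k := by
  rw [letter] at h
  split_ifs at h with h1
  exact ⟨h1.1, (congrArg Fin.val (Option.some_injective _ h)).symm⟩

theorem mem_slots_letter {k : ℕ} {x : Fin n} : x ∈ slots (p.letter n k) ↔
    p.IsLetter k ∧ off p.top k ≤ x ∧ x < off p.top k + 2 := by
  constructor
  · intro hx
    rcases h : p.letter n k with _ | i
    · rw [h] at hx
      simp [slots] at hx
    · obtain ⟨h1, h2⟩ := isLetter_of_letter h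
      rw [h] at hx
      simp only [slots, Finset.mem_insert, Finset.mem_singleton, Letter.lo, Letter.hi,
        Fin.ext_iff] at hx
      exact ⟨h1, by omega, by omega⟩
  · rintro ⟨h1, h2, h3⟩
    obtain ⟨i, hi, hi'⟩ := letter_eq_some hn h1
    rw [hi]
    simp only [slots, Finset.mem_insert, Finset.mem_singleton, Letter.lo, Letter.hi, Fin.ext_iff]
    omega

theorem slots_letter_of_top {k : ℕ} (h : p.top[k]? = some 2) :
    slots (p.letter n k) = seg n p.top k := by
  ext x
  rw [mem_slots_letter hn, mem_seg, off_succ h]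
  exact ⟨fun h => h.2, fun h' => ⟨Or.inl h, h'⟩⟩

theorem slots_letter_of_isSplit (he : p.IsElementary) (h : p.isSplit = true) :
    slots (p.letter n p.pos) = seg n p.bottom p.pos := by
  ext x
  rw [mem_slots_letter hn, mem_seg, off_succ (he.split h).1, (off_pos_of_isSplit h).1]
  exact ⟨fun h => h.2, fun h' => ⟨Or.inr ⟨h, rfl⟩, h'⟩⟩

/-- The dumbbell of a split vertex covers two thin strands, and every other dumbbell fills one thick
strand. -/
theorem disjoint_slots_letter (he : p.IsElementary) {k k' : ℕ} (hk : k ≠ k') :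
    Disjoint (slots (p.letter n k)) (slots (p.letter n k')) := by
  rw [Finset.disjoint_left]
  intro x hx hx'
  rw [mem_slots_letter hn] at hx hx'
  obtain ⟨h1, h2, h3⟩ := hx
  obtain ⟨h1', h2', h3'⟩ := hx'
  have key : ∀ k k' : ℕ, p.top[k]? = some 2 → p.isSplit = true → k' = p.pos →
      off p.top k ≤ x → x.1 < off p.top k + 2 → off p.top k' ≤ x → x.1 < off p.top k' + 2 →
      False := by
    rintro k k' hk hs rfl g1 g2 g3 g4
    obtain ⟨s1, s2, s3⟩ := he.split hs
    have e1 := off_succ hk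
    have e2 := off_succ s2
    have e3 := off_succ s3
    simp only [PNat.val_ofNat] at e1 e2 e3
    have hmem : x.1 < off p.top (p.pos + 1) ∨ off p.top (p.pos + 1) ≤ x := lt_or_ge _ _
    rcases hmem with g | g
    · have := eq_of_off_le g1 (by omega) g3 g
      subst this
      rw [s2] at hk
      exact absurd hk (by decide)
    · have := eq_of_off_le g1 (by omega) g (by omega)
      subst this
      rw [s3] at hk
      exact absurd hk (by decide)
  rcases h1 with h1 | ⟨h1, h4⟩ <;> rcases h1' with h1' | ⟨h1', h4'⟩
  · have e1 := off_succ h1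
    have e2 := off_succ h1'
    simp only [PNat.val_ofNat] at e1 e2
    exact hk (eq_of_off_le h2 (by omega) h2' (by omega))
  · exact key _ _ h1 h1' h4' h2 h3 h2' h3'
  · exact key _ _ h1' h1 h4 h2' h3' h2 h3
  · exact hk (h4.trans h4'.symm)

open Equiv in
/-- In the presence of all the dumbbells of a slab, the sets of pigments on the strands are
compatible. -/
theorem near_letters_iff (he : p.IsElementary) {q : ℕ} (hq : p.top.length ≤ q)
    {σ τ : Perm (Fin n)} :
    Near (List.ofFn fun k : Fin q => p.letter n k) σ τ ↔
      (∀ j k, p.IsStrand j k → j < p.bottom.length →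
        (seg n p.bottom j).image σ = (seg n p.top k).image τ) ∧
      (p.isSplit = true → (seg n p.bottom p.pos).image σ =
        (seg n p.top p.pos).image τ ∪ (seg n p.top (p.pos + 1)).image τ) ∧
      (p.isMerge = true → (seg n p.top p.pos).image τ =
        (seg n p.bottom p.pos).image σ ∪ (seg n p.bottom (p.pos + 1)).image σ) := by
  have htop : ∀ k, k < p.top.length → p.top[k]? = some 1 ∨ p.top[k]? = some 2 := by
    intro k hk
    rw [List.getElem?_eq_getElem hk]
    rcases he.2 _ (List.getElem_mem hk) with h | h
    · exact Or.inl (by rw [h])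
    · exact Or.inr (by rw [h])
  have hmem : ∀ k, k < p.top.length →
      p.letter n k ∈ List.ofFn fun k : Fin q => p.letter n k := fun k hk =>
    List.mem_ofFn.2 ⟨⟨k, hk.trans_le hq⟩, rfl⟩
  constructor
  · intro h
    refine ⟨fun j k hjk hj => ?_, fun hs => ?_, fun hm => ?_⟩
    · rw [seg_of_isStrand n hjk]
      have hk : k < p.top.length := by
        by_contra hk
        have := getElem?_of_isStrand hjk
        rw [List.getElem?_eq_getElem hj, List.getElem?_eq_none (not_lt.1 hk)] at this
        exact absurd this (by simp)
      -- No dumbbell touches the slot of a thin strand going through, so its pigment is kept; on a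
      -- thick strand only the pair of pigments is kept.
      rcases htop k hk with h1 | h2
      · refine Finset.image_congr fun x hx => (h.eq x fun o ho hx' => ?_).symm
        obtain ⟨k', rfl⟩ := List.mem_ofFn.1 ho
        rw [Finset.mem_coe, mem_seg] at hx
        rw [mem_slots_letter hn] at hx'
        obtain ⟨h3, h4, h5⟩ := hx'
        rcases h3 with h3 | ⟨h3, h6⟩
        · have e1 := off_succ h3
          simp only [PNat.val_ofNat] at e1
          have := eq_of_off_le hx.1 hx.2 h4 (by omega)
          rw [this, h3] at h1
          exact absurd h1 (by decide)
        · obtain ⟨s1, s2, s3⟩ := he.split h3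
          have e2 := off_succ s2
          have e3 := off_succ s3
          simp only [PNat.val_ofNat, ← h6] at e2 e3
          have hne := ne_pos_of_isStrand hjk h3
          rw [← h6] at hne
          rcases lt_or_ge x.1 (off p.top (k' + 1)) with g | g
          · exact hne.1 (eq_of_off_le hx.1 hx.2 h4 g)
          · exact hne.2 (eq_of_off_le hx.1 hx.2 g (by omega))
      · rw [← slots_letter_of_top hn h2]
        exact (h.image_eq _ (hmem k hk)).symm
    · rw [← Finset.image_union, ← seg_of_isSplit n hs, ← slots_letter_of_isSplit hn he hs]
      exact (h.image_eq _ (hmem _ (Nat.lt_of_succ_lt (pos_succ_lt_top_of_isSplit hs)))).symm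
    · rw [← Finset.image_union, ← seg_of_isMerge n hm, ← slots_letter_of_top hn (he.merge hm)]
      exact h.image_eq _ (hmem _ (pos_lt_top_of_isMerge hm))
  · rintro ⟨h1, h2, h3⟩
    refine ⟨fun x hx => ?_, fun o ho => ?_⟩
    · obtain ⟨k, hk, hk1, hk2⟩ := exists_off_le (L := p.top) (x := x.1) (by rw [hn]; exact x.2)
      have hx1 := hx _ (hmem k hk)
      have hxk : x ∈ seg n p.top k := mem_seg.2 ⟨hk1, hk2⟩
      have hk3 : p.top[k]? = some 1 := (htop k hk).resolve_right fun e =>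
        hx1 (by rw [slots_letter_of_top hn e]; exact hxk)
      rcases top_cases hk with ⟨j, hj, hjk⟩ | ⟨hs, hk'⟩ | ⟨hm, rfl⟩
      · have h4 := h1 j k hjk hj
        have h5 : seg n p.top k = {x} := by
          have e1 := off_succ hk3
          simp only [PNat.val_ofNat] at e1
          ext y
          rw [mem_seg, Finset.mem_singleton, Fin.ext_iff]
          omega
        rw [seg_of_isStrand n hjk, h5, Finset.image_singleton, Finset.image_singleton] at h4
        exact (Finset.singleton_injective h4).symm
      · exfalso
        refine hx _ (hmem _ (Nat.lt_of_succ_lt (pos_succ_lt_top_of_isSplit hs))) ?_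
        rw [slots_letter_of_isSplit hn he hs, seg_of_isSplit n hs, Finset.mem_union]
        rcases hk' with rfl | rfl
        exacts [Or.inl hxk, Or.inr hxk]
      · rw [he.merge hm] at hk3
        exact absurd hk3 (by decide)
    · obtain ⟨k, rfl⟩ := List.mem_ofFn.1 ho
      rcases h : p.letter n k with _ | i
      · simp [slots]
      · rw [← h]
        obtain ⟨hl, -⟩ := isLetter_of_letter h
        rcases hl with hl | ⟨hs, hl⟩
        · have hk := (List.getElem?_eq_some_iff.1 hl).1
          rw [slots_letter_of_top hn hl]
          rcases top_cases hk with ⟨j, hj, hjk⟩ | ⟨hs, hk' | hk'⟩ | ⟨hm, hk'⟩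
          · rw [← h1 j k hjk hj, seg_of_isStrand n hjk]
          · rw [hk', (he.split hs).2.1] at hl
            exact absurd hl (by decide)
          · rw [hk', (he.split hs).2.2] at hl
            exact absurd hl (by decide)
          · rw [hk', h3 hm, seg_of_isMerge n hm, Finset.image_union]
        · rw [hl, slots_letter_of_isSplit hn he hs, h2 hs, seg_of_isSplit n hs,
            Finset.image_union]

end Piece

end Vinyl

end

noncomputable section

namespace Vinyl

open NilHecke

namespace VinylGraph

open Equiv

/-! ### Closed paths and colorings -/

variable {Γ : VinylGraph}

theorem off_bottom (i : Fin (Γ.n + 1)) :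
    off (Γ.piece i).bottom (Γ.piece i).bottom.length = Γ.level := by
  induction i using Fin.induction with
  | zero =>
    rw [off_length, level]
    induction (Γ.piece 0).bottom with
    | nil => simp
    | cons a L ih => simp_all
  | succ i ih =>
    rw [← ih, ← Piece.off_length_top (Γ.piece i.castSucc), Γ.glue i.castSucc, Fin.coeSucc_eq_succ]

theorem off_top (i : Fin (Γ.n + 1)) :
    off (Γ.piece i).top (Γ.piece i).top.length = Γ.level := by
  rw [Piece.off_length_top, off_bottom]

theorem IsElementary.piece (hΓ : Γ.IsElementary) (i : Fin (Γ.n + 1)) :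
    (Γ.piece i).IsElementary := by
  have h : ∀ i, ∀ a ∈ (Γ.piece i).bottom, a = 1 ∨ a = 2 := by
    intro i a ha
    obtain ⟨j, hj, rfl⟩ := List.getElem_of_mem ha
    rcases hΓ (Γ.edgeAt i j hj) with h | h
    · exact Or.inl (PNat.coe_injective h)
    · exact Or.inr (PNat.coe_injective h)
  refine ⟨h i, ?_⟩
  rw [Γ.glue i]
  exact h (i + 1)

/-- The slots of the strand through a point. -/
def segAt (p : Γ.Point) : Finset (Fin Γ.level) := seg Γ.level (Γ.piece p.1).bottom p.2

/-- The edge through a point. -/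
abbrev edgeOf (p : Γ.Point) : Γ.Edge := Quot.mk _ p

theorem off_succ_point (p : Γ.Point) : off (Γ.piece p.1).bottom (p.2 + 1) =
    off (Γ.piece p.1).bottom p.2 + Γ.label (edgeOf p) :=
  off_succ (List.getElem?_eq_getElem p.2.2)

theorem off_succ_point_le (p : Γ.Point) : off (Γ.piece p.1).bottom (p.2 + 1) ≤ Γ.level := by
  rw [← off_bottom p.1]
  exact off_mono _ p.2.2

theorem card_segAt (p : Γ.Point) : (segAt p).card = Γ.label (edgeOf p) := by
  have h1 := off_succ_point p
  have h2 := off_succ_point_le p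
  have h3 : (segAt p).map Fin.valEmbedding = Finset.Ico (off (Γ.piece p.1).bottom p.2)
      (off (Γ.piece p.1).bottom (p.2 + 1)) := by
    ext x
    simp only [Finset.mem_map, segAt, mem_seg, Fin.valEmbedding_apply, Finset.mem_Ico]
    constructor
    · rintro ⟨y, hy, rfl⟩
      exact hy
    · intro hx
      exact ⟨⟨x, by omega⟩, hx, rfl⟩
  rw [← Finset.card_map, h3, Nat.card_Ico]
  omega

theorem exists_mem_segAt (i : Fin (Γ.n + 1)) (x : Fin Γ.level) :
    ∃ j : Fin (Γ.piece i).bottom.length, x ∈ segAt (Γ := Γ) ⟨i, j⟩ := by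
  obtain ⟨j, hj, h⟩ := exists_off_le (L := (Γ.piece i).bottom) (x := x.1)
    (by rw [off_bottom]; exact x.2)
  exact ⟨⟨j, hj⟩, mem_seg.2 h⟩

theorem eq_of_mem_segAt {i : Fin (Γ.n + 1)} {x : Fin Γ.level}
    {j k : Fin (Γ.piece i).bottom.length} (hj : x ∈ segAt (Γ := Γ) ⟨i, j⟩)
    (hk : x ∈ segAt (Γ := Γ) ⟨i, k⟩) : j = k := by
  replace hj := mem_seg.1 hj
  replace hk := mem_seg.1 hk
  exact Fin.ext (eq_of_off_le hj.1 hj.2 hk.1 hk.2)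

/-- The sets of pigments along a path are the ones of a coloring. -/
def Compat (γ : Γ.Coloring) (c : Fin (Γ.n + 1) → Perm (Fin Γ.level)) : Prop :=
  ∀ p : Γ.Point, (segAt p).image (c p.1) = γ.1 (edgeOf p)

theorem Compat.unique {γ γ' : Γ.Coloring} {c : Fin (Γ.n + 1) → Perm (Fin Γ.level)}
    (h : Compat γ c) (h' : Compat γ' c) : γ = γ' := by
  refine Subtype.ext (funext fun e => ?_)
  obtain ⟨p, rfl⟩ := Quot.exists_rep e
  exact (h p).symm.trans (h' p)

theorem Compat.bottom {γ : Γ.Coloring} {c : Fin (Γ.n + 1) → Perm (Fin Γ.level)}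
    (h : Compat γ c) (i : Fin (Γ.n + 1)) (j : ℕ) (hj : j < (Γ.piece i).bottom.length) :
    (seg Γ.level (Γ.piece i).bottom j).image (c i) = γ.1 (Γ.edgeAt i j hj) :=
  h ⟨i, ⟨j, hj⟩⟩

theorem Compat.top {γ : Γ.Coloring} {c : Fin (Γ.n + 1) → Perm (Fin Γ.level)}
    (h : Compat γ c) (i : Fin (Γ.n + 1)) (j : ℕ) (hj : j < (Γ.piece i).top.length) :
    (seg Γ.level (Γ.piece i).top j).image (c (i + 1)) = γ.1 (Γ.edgeAbove i j hj) := by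
  rw [Γ.glue i]
  exact h.bottom (i + 1) j _

variable (Γ) in
/-- The dumbbells of a graph: one for each split vertex, and one for each thick strand at the top of
a slab. -/
def letters (x : Fin (Γ.n + 1) × Fin (Γ.level + 1)) : Option (Letter Γ.level) :=
  (Γ.piece x.1).letter Γ.level x.2

theorem length_top_le (i : Fin (Γ.n + 1)) : (Γ.piece i).top.length ≤ Γ.level + 1 :=
  (length_le_off _).trans (by rw [off_top]; omega)

/-- The local conditions at the slabs make the pigment sets of the strands constant along edges and
additive at vertices, which is exactly what a coloring requires. -/
theorem near_iff_exists_compat (hΓ : Γ.IsElementary) {c : Fin (Γ.n + 1) → Perm (Fin Γ.level)} :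
    (∀ h, Near (List.ofFn fun k => Γ.letters (h, k)) (c h) (c (h + 1))) ↔
      ∃ γ, Compat γ c := by
  have key := fun h => Piece.near_letters_iff (off_top h) (hΓ.piece h) (length_top_le h)
    (σ := c h) (τ := c (h + 1))
  constructor
  · intro hc
    replace hc := fun h => (key h).1 (hc h)
    have hj : ∀ p q : Γ.Point, Γ.Joined p q →
        (segAt p).image (c p.1) = (segAt q).image (c q.1) := by
      rintro ⟨i, j⟩ ⟨i', k⟩ ⟨rfl, h⟩
      have := (hc i).1 j k h j.2
      rw [Γ.glue i] at this
      exact this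
    let g : Γ.Edge → Finset (Fin Γ.level) := Quot.lift (fun p => (segAt p).image (c p.1)) hj
    have htop : ∀ i j hj, g (Γ.edgeAbove i j hj) =
        (seg Γ.level (Γ.piece i).top j).image (c (i + 1)) := by
      intro i j hj
      rw [Γ.glue i]
      rfl
    refine ⟨⟨g, ⟨fun e => ?_, fun v => ?_, fun v => ?_, fun i => ?_⟩⟩, fun p => rfl⟩
    · obtain ⟨p, rfl⟩ := Quot.exists_rep e
      exact (Finset.card_image_of_injective _ (c p.1).injective).trans (card_segAt p)
    · rw [SplitVertex.left, SplitVertex.right, htop, htop]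
      exact (hc v.1).2.1 v.2
    · rw [MergeVertex.upper, htop]
      exact (hc v.1).2.2 v.2
    · refine Finset.eq_univ_of_forall fun y => ?_
      obtain ⟨x, rfl⟩ := (c i).surjective y
      obtain ⟨j, hj⟩ := exists_mem_segAt i x
      exact Finset.mem_biUnion.2 ⟨j, Finset.mem_univ _, Finset.mem_image_of_mem _ hj⟩
  · rintro ⟨γ, hγ⟩ h
    refine (key h).2 ⟨fun j k hjk hj => ?_, fun hs => ?_, fun hm => ?_⟩
    · have hk : k < (Γ.piece h).top.length := by
        by_contra hk
        have := Piece.getElem?_of_isStrand hjk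
        rw [List.getElem?_eq_getElem hj, List.getElem?_eq_none (not_lt.1 hk)] at this
        exact absurd this (by simp)
      rw [hγ.bottom h j hj, hγ.top h k hk]
      exact congrArg γ.1 (Quot.sound ⟨rfl, hjk⟩)
    · rw [hγ.bottom h _ (Piece.pos_lt_bottom_of_isSplit hs), hγ.top h _
        (Nat.lt_of_succ_lt (Piece.pos_succ_lt_top_of_isSplit hs)), hγ.top h _
        (Piece.pos_succ_lt_top_of_isSplit hs)]
      exact γ.2.split ⟨h, hs⟩
    · rw [hγ.top h _ (Piece.pos_lt_top_of_isMerge hm), hγ.bottom h _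
        (Nat.lt_of_succ_lt (Piece.pos_succ_lt_bottom_of_isMerge hm)), hγ.bottom h _
        (Piece.pos_succ_lt_bottom_of_isMerge hm)]
      exact γ.2.merge ⟨h, hm⟩

/-! ### Substitution of slots -/

variable (Γ) in
/-- A point on an edge. -/
def rep (e : Γ.Edge) : Γ.Point := Quot.out e

theorem edgeOf_rep (e : Γ.Edge) : edgeOf (Γ.rep e) = e := Quot.out_eq e

theorem slot_lt (e : Γ.Edge) (k : Fin (Γ.label e)) :
    off (Γ.piece (Γ.rep e).1).bottom (Γ.rep e).2 + k < Γ.level := by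
  have h1 := off_succ_point (Γ.rep e)
  have h2 := off_succ_point_le (Γ.rep e)
  rw [edgeOf_rep] at h1
  have := k.2
  omega

/-- The slots of an edge at a point of it. -/
def slot (e : Γ.Edge) (k : Fin (Γ.label e)) : Fin Γ.level := ⟨_, slot_lt e k⟩

theorem slot_injective (e : Γ.Edge) : Function.Injective (slot e) := by
  intro k k' h
  simp only [slot, Fin.mk.injEq, Nat.add_left_cancel_iff] at h
  exact Fin.ext h

theorem image_slot (e : Γ.Edge) : Finset.univ.image (slot e) = segAt (Γ.rep e) := by
  refine Finset.eq_of_subset_of_card_le (fun x hx => ?_) ?_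
  · obtain ⟨k, -, rfl⟩ := Finset.mem_image.1 hx
    have h1 := off_succ_point (Γ.rep e)
    rw [edgeOf_rep] at h1
    rw [segAt, mem_seg]
    have := k.2
    simp only [slot]
    omega
  · rw [card_segAt, edgeOf_rep, Finset.card_image_of_injective _ (slot_injective e),
      Finset.card_univ, Fintype.card_fin]

/-- Substitution into a symmetric polynomial depends only on the set of variables used. -/
theorem rename_eq_of_image_eq {R : Type*} [CommRing R] {a : ℕ} {σ : Type*} [DecidableEq σ]
    {f : MvPolynomial (Fin a) R} (hf : f.IsSymmetric) {g g' : Fin a → σ}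
    (hg : Function.Injective g)
    (h : Finset.univ.image g = Finset.univ.image g') :
    MvPolynomial.rename g f = MvPolynomial.rename g' f := by
  have h1 : ∀ k, ∃ k', g' k' = g k := fun k => by
    have : g k ∈ Finset.univ.image g' := h ▸ Finset.mem_image_of_mem _ (Finset.mem_univ k)
    simpa using this
  choose π hπ using h1
  have hinj : Function.Injective π := fun k k' e => hg (by rw [← hπ, ← hπ, e])
  let τ : Perm (Fin a) := Equiv.ofBijective π (Finite.injective_iff_bijective.1 hinj)
  have : g = g' ∘ τ := funext fun k => (hπ k).symm
  rw [this, ← MvPolynomial.rename_rename, hf τ]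

variable (Γ) (R : Type*) [CommRing R]

/-- Substitution of the variables of the slots of a point on each edge, as a multilinear map. -/
def chiMulti : MultilinearMap R (fun e : Γ.Edge => SymPoly R (Γ.label e))
    (MvPolynomial (Fin (Γ.n + 1) × Fin Γ.level) R) :=
  (MultilinearMap.mkPiAlgebra R Γ.Edge _).compLinearMap fun e =>
    ((MvPolynomial.rename fun k => ((Γ.rep e).1, slot e k)).comp
      (MvPolynomial.symmetricSubalgebra (Fin (Γ.label e)) R).val).toLinearMap

variable {R} in
theorem chiMulti_apply (d : Γ.PreDecoration R) : Γ.chiMulti R d =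
    ∏ e, MvPolynomial.rename (fun k => ((Γ.rep e).1, slot e k))
      (d e : MvPolynomial (Fin (Γ.label e)) R) := rfl

/-- Substitution of the variables of the slots of a point on each edge. -/
def chi : Γ.DecoratedSpace R →ₐ[R] MvPolynomial (Fin (Γ.n + 1) × Fin Γ.level) R :=
  PiTensorProduct.liftAlgHom (Γ.chiMulti R) (by simp [chiMulti_apply])
    (fun d d' => by
      rw [chiMulti_apply, chiMulti_apply, chiMulti_apply, ← Finset.prod_mul_distrib]
      simp)

variable {R}

theorem chi_decorated (d : Γ.PreDecoration R) : Γ.chi R (decorated d) =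
    ∏ e, MvPolynomial.rename (fun k => ((Γ.rep e).1, slot e k))
      (d e : MvPolynomial (Fin (Γ.label e)) R) :=
  (PiTensorProduct.lift.tprod d).trans rfl

variable {Γ}

theorem image_slot_of_compat {γ : Γ.Coloring} {c : Fin (Γ.n + 1) → Perm (Fin Γ.level)}
    (h : Compat γ c) (e : Γ.Edge) :
    Finset.univ.image (fun k => c (Γ.rep e).1 (slot e k)) = γ.1 e := by
  have h1 := h (Γ.rep e)
  rw [edgeOf_rep, ← image_slot, Finset.image_image] at h1
  exact h1

variable [IsDomain R]

/-- The decorations are read at a chosen point of each edge. As they are symmetric, only the pigment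
set of the edge matters, and this is prescribed by the coloring. -/
theorem evp_chi {γ : Γ.Coloring} {c : Fin (Γ.n + 1) → Perm (Fin Γ.level)} (h : Compat γ c)
    (y : Γ.DecoratedSpace R) : evp R (gen (n := Γ.level) R) c (Γ.chi R y) =
      algebraMap (MvPolynomial (Fin Γ.level) R) (Γ.RatFun R) (γ.P R y) := by
  have key : (evp R (gen (n := Γ.level) R) c).toLinearMap ∘ₗ (Γ.chi R).toLinearMap =
      (IsScalarTower.toAlgHom R (MvPolynomial (Fin Γ.level) R) (Γ.RatFun R)).toLinearMap ∘ₗ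
        γ.P R := by
    refine LinearMap.ext_on (span_decorated R Γ) ?_
    rintro _ ⟨d, rfl⟩
    change evp R (gen R) c (Γ.chi R (decorated d)) = algebraMap _ _ (γ.P R (decorated d))
    rw [chi_decorated, Coloring.P_tprod, map_prod, map_prod]
    refine Finset.prod_congr rfl fun e _ => ?_
    rw [evp, MvPolynomial.aeval_rename, ← rename_eq_of_image_eq
      (g := fun k => c (Γ.rep e).1 (slot e k)) ((MvPolynomial.mem_symmetricSubalgebra _).1 (d e).2)
      ((c _).injective.comp (slot_injective e)),
      ← aeval_gen, MvPolynomial.aeval_rename]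
    · rfl
    · rw [image_slot_of_compat h]
      ext x
      simp only [Finset.mem_image, Finset.mem_univ, true_and]
      rw [← Finset.mem_coe, ← Finset.range_orderEmbOfFin (γ.1 e) (γ.2.card e)]
      rfl
  exact LinearMap.congr_fun key y

end VinylGraph

end Vinyl

end

noncomputable section

namespace Vinyl

open NilHecke

theorem seg_eq_singleton {n : ℕ} {L : List ℕ+} {j : ℕ} (h : L[j]? = some 1) {x : Fin n}
    (hx : x.1 = off L j) : seg n L j = {x} := by
  have := off_succ h
  simp only [PNat.val_ofNat] at this
  ext y
  rw [mem_seg, Finset.mem_singleton, Fin.ext_iff]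
  omega

theorem seg_eq_pair {n : ℕ} {L : List ℕ+} {j : ℕ} (h : L[j]? = some 2) {x y : Fin n}
    (hx : x.1 = off L j) (hy : y.1 = off L j + 1) : seg n L j = {x, y} := by
  have := off_succ h
  simp only [PNat.val_ofNat] at this
  ext z
  rw [mem_seg, Finset.mem_insert, Finset.mem_singleton, Fin.ext_iff, Fin.ext_iff]
  omega

theorem image_swap_eq {α : Type*} [DecidableEq α] {S : Finset α} {a b : α} (h : a ∈ S ↔ b ∈ S) :
    S.image (Equiv.swap a b) = S := by
  refine Finset.eq_of_subset_of_card_le (fun x hx => ?_)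
    (Finset.card_image_of_injective _ (Equiv.injective _)).ge
  obtain ⟨y, hy, rfl⟩ := Finset.mem_image.1 hx
  rcases eq_or_ne y a with rfl | h1
  · rw [Equiv.swap_apply_left]
    exact h.1 hy
  · rcases eq_or_ne y b with rfl | h2
    · rw [Equiv.swap_apply_right]
      exact h.2 hy
    · rwa [Equiv.swap_apply_of_ne_of_ne h1 h2]

namespace VinylGraph

open Equiv

/-! ### The trace form of a graph -/

variable (Γ : VinylGraph)

/-- The heights and positions of thick strands at the tops of the slabs. -/
def thick : Finset (Fin (Γ.n + 1) × Fin (Γ.level + 1)) :=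
  Finset.univ.filter fun x => (Γ.piece x.1).top[(x.2 : ℕ)]? = some 2

theorem pos_lt_of_split (v : Γ.SplitVertex) : (Γ.piece v.1).pos < Γ.level + 1 :=
  (Nat.lt_of_succ_lt (Piece.pos_succ_lt_top_of_isSplit v.2)).trans_le (length_top_le v.1)

/-- The heights and positions of the split vertices. -/
def splitPos : Γ.SplitVertex ↪ Fin (Γ.n + 1) × Fin (Γ.level + 1) :=
  ⟨fun v => (v.1, ⟨_, Γ.pos_lt_of_split v⟩), fun _ _ h => Subtype.ext (congrArg Prod.fst h)⟩

variable {Γ}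

theorem mem_thick {x : Fin (Γ.n + 1) × Fin (Γ.level + 1)} :
    x ∈ Γ.thick ↔ (Γ.piece x.1).top[(x.2 : ℕ)]? = some 2 := by
  simp [thick]

theorem letters_thick {x : Fin (Γ.n + 1) × Fin (Γ.level + 1)} (hx : x ∈ Γ.thick) :
    ∃ i : Letter Γ.level, Γ.letters x = some i ∧ i.1 = off (Γ.piece x.1).top x.2 :=
  Piece.letter_eq_some (off_top x.1) (Or.inl (mem_thick.1 hx))

theorem letters_splitPos (v : Γ.SplitVertex) :
    ∃ i : Letter Γ.level, Γ.letters (Γ.splitPos v) = some i ∧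
      i.1 = off (Γ.piece v.1).top (Γ.piece v.1).pos :=
  Piece.letter_eq_some (off_top v.1) (Or.inr ⟨v.2, rfl⟩)

theorem wordSupp_letters : wordSupp Γ.letters = Γ.thick ∪ Finset.univ.map Γ.splitPos := by
  ext x
  rw [mem_wordSupp, Option.isSome_iff_exists, Finset.mem_union, mem_thick]
  constructor
  · rintro ⟨i, hi⟩
    obtain ⟨h | ⟨h, h'⟩, -⟩ := Piece.isLetter_of_letter hi
    · exact Or.inl h
    · exact Or.inr (Finset.mem_map.2 ⟨⟨x.1, h⟩, Finset.mem_univ _, Prod.ext rfl (Fin.ext h'.symm)⟩)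
  · rintro (h | h)
    · obtain ⟨i, hi, -⟩ := letters_thick (mem_thick.2 h)
      exact ⟨i, hi⟩
    · obtain ⟨v, -, rfl⟩ := Finset.mem_map.1 h
      obtain ⟨i, hi, -⟩ := letters_splitPos v
      exact ⟨i, hi⟩

theorem disjoint_thick_splitPos (hΓ : Γ.IsElementary) :
    Disjoint Γ.thick (Finset.univ.map Γ.splitPos) := by
  rw [Finset.disjoint_left]
  intro x hx hx'
  obtain ⟨v, -, rfl⟩ := Finset.mem_map.1 hx'
  have h1 := mem_thick.1 hx
  have h2 := ((hΓ.piece v.1).split v.2).2.1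
  exact absurd (h2.symm.trans h1) (by decide)

theorem disjoint_letters (hΓ : Γ.IsElementary) (h : Fin (Γ.n + 1)) (i i' : Fin (Γ.level + 1))
    (hi : i ≠ i') : Disjoint (slots (Γ.letters (h, i))) (slots (Γ.letters (h, i'))) :=
  Piece.disjoint_slots_letter (off_top h) (hΓ.piece h) fun e => hi (Fin.ext e)

variable (Γ) in
/-- The exchange of the pigments in the two slots of a dumbbell, above it. -/
def flip (x : Fin (Γ.n + 1) × Fin (Γ.level + 1)) (c : Fin (Γ.n + 1) → Perm (Fin Γ.level)) :
    Fin (Γ.n + 1) → Perm (Fin Γ.level) :=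
  (Γ.letters x).elim c fun i => Function.update c (x.1 + 1) (c (x.1 + 1) * swap i.lo i.hi)

variable {x x' : Fin (Γ.n + 1) × Fin (Γ.level + 1)} {c : Fin (Γ.n + 1) → Perm (Fin Γ.level)}

theorem flip_flip : Γ.flip x (Γ.flip x c) = c := by
  rcases h : Γ.letters x with _ | i
  · simp [flip, h]
  · simp [flip, h, mul_assoc, swap_mul_self]

theorem flip_lo {i : Letter Γ.level} (hi : Γ.letters x = some i) :
    Γ.flip x c (x.1 + 1) i.lo = c (x.1 + 1) i.hi := by
  simp [flip, hi]

theorem flip_hi {i : Letter Γ.level} (hi : Γ.letters x = some i) :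
    Γ.flip x c (x.1 + 1) i.hi = c (x.1 + 1) i.lo := by
  simp [flip, hi]

theorem flip_apply_of_ne (hΓ : Γ.IsElementary) (hx : x ≠ x') {j : Fin Γ.level}
    (hj : j ∈ slots (Γ.letters x')) : Γ.flip x c (x'.1 + 1) j = c (x'.1 + 1) j := by
  rcases h : Γ.letters x with _ | i
  · simp [flip, h]
  · by_cases h1 : x'.1 = x.1
    · obtain ⟨a, b⟩ := x
      obtain ⟨a', b'⟩ := x'
      obtain rfl : a' = a := h1
      have hb : b ≠ b' := fun e => hx (by rw [e])
      have h2 := Finset.disjoint_right.1 (disjoint_letters hΓ a' b b' hb) hj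
      simp only [h, slots, Finset.mem_insert, Finset.mem_singleton, not_or] at h2
      simp [flip, h, swap_apply_of_ne_of_ne h2.1 h2.2]
    · simp [flip, h, h1]

/-- The two exchanged slots fill one thick strand, so no pigment set changes. This uses that x comes
from a thick strand and not from a split. -/
theorem Compat.flip {γ : Γ.Coloring} (hc : Compat γ c) (hx : x ∈ Γ.thick) :
    Compat γ (Γ.flip x c) := by
  obtain ⟨i, hi, hi'⟩ := letters_thick hx
  intro p
  rw [← hc p]
  obtain ⟨h, j⟩ := p
  by_cases h1 : h = x.1 + 1
  · subst h1
    have h2 : Γ.flip x c (x.1 + 1) = c (x.1 + 1) * swap i.lo i.hi := by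
      simp [VinylGraph.flip, hi]
    simp only [h2, Perm.coe_mul]
    rw [← Finset.image_image, image_swap_eq]
    have h3 := off_succ (mem_thick.1 hx)
    simp only [PNat.val_ofNat, Γ.glue x.1] at h3
    rw [Γ.glue x.1] at hi'
    change i.lo ∈ seg Γ.level (Γ.piece (x.1 + 1)).bottom j ↔
      i.hi ∈ seg Γ.level (Γ.piece (x.1 + 1)).bottom j
    rw [mem_seg, mem_seg]
    simp only [Letter.lo, Letter.hi]
    constructor
    · intro h4
      rw [eq_of_off_le h4.1 h4.2 (k := x.2) (by omega) (by omega)]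
      omega
    · intro h4
      rw [eq_of_off_le h4.1 h4.2 (k := x.2) (by omega) (by omega)]
      omega
  · have h2 : Γ.flip x c h = c h := by
      simp [VinylGraph.flip, hi, h1]
    simp only [h2]

/-! ### Sorted representatives of colorings. -/

section Sorted

variable (γ : Γ.Coloring)

theorem exists_sorted_perm (i : Fin (Γ.n + 1)) : ∃ σ : Perm (Fin Γ.level),
    ∀ (j : Fin (Γ.piece i).bottom.length) (k : Fin (Γ.label (edgeOf ⟨i, j⟩))) (x : Fin Γ.level),
      x.1 = off (Γ.piece i).bottom j + k →
        σ x = (γ.1 (edgeOf ⟨i, j⟩)).orderEmbOfFin (γ.2.card _) k := by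
  have h1 : ∀ x : Fin Γ.level, ∃ y : Fin Γ.level,
      ∀ (j : Fin (Γ.piece i).bottom.length) (k : Fin (Γ.label (edgeOf ⟨i, j⟩))),
      x.1 = off (Γ.piece i).bottom j + k →
        y = (γ.1 (edgeOf ⟨i, j⟩)).orderEmbOfFin (γ.2.card _) k := by
    intro x
    obtain ⟨j, hj⟩ := exists_mem_segAt i x
    replace hj := mem_seg.1 hj
    have h2 := off_succ_point (Γ := Γ) ⟨i, j⟩
    refine ⟨(γ.1 (edgeOf ⟨i, j⟩)).orderEmbOfFin (γ.2.card _)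
      ⟨x.1 - off (Γ.piece i).bottom j, by simp only at hj h2; omega⟩, fun j' k hk => ?_⟩
    have h3 := off_succ_point (Γ := Γ) ⟨i, j'⟩
    have h4 := k.2
    simp only at hj h3
    have h5 : j = j' := Fin.ext (eq_of_off_le hj.1 hj.2 (by omega) (by omega))
    subst h5
    congr 1
    exact Fin.ext (by simp only; omega)
  choose f hf using h1
  have hsurj : Function.Surjective f := by
    intro y
    have hy : y ∈ Finset.univ.biUnion fun j : Fin (Γ.piece i).bottom.length =>
        γ.1 (Γ.edgeAt i j j.2) := by
      rw [γ.2.height i]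
      exact Finset.mem_univ y
    obtain ⟨j, -, hj⟩ := Finset.mem_biUnion.1 hy
    have h2 : y ∈ Set.range ((γ.1 (edgeOf ⟨i, j⟩)).orderEmbOfFin (γ.2.card _)) := by
      rw [Finset.range_orderEmbOfFin]
      exact hj
    obtain ⟨k, hk⟩ := h2
    have h3 := off_succ_point (Γ := Γ) ⟨i, j⟩
    have h4 := off_succ_point_le (Γ := Γ) ⟨i, j⟩
    have h5 := k.2
    simp only at h3 h4
    exact ⟨⟨off (Γ.piece i).bottom j + k, by omega⟩, by rw [← hk]; exact hf _ j k rfl⟩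
  exact ⟨Equiv.ofBijective f (Finite.surjective_iff_bijective.1 hsurj), fun j k x hx => hf x j k hx⟩

/-- In each coloring there is a unique path that is increasing on the thick strands. -/
theorem existsUnique_sorted (hΓ : Γ.IsElementary) : ∃! c, Compat γ c ∧
    ∀ x ∈ Γ.thick, ∀ i, Γ.letters x = some i → c (x.1 + 1) i.lo < c (x.1 + 1) i.hi := by
  choose c hc using exists_sorted_perm γ
  have hcc : Compat γ c := by
    intro p
    refine Finset.eq_of_subset_of_card_le (fun y hy => ?_) ?_
    · obtain ⟨x, hx, rfl⟩ := Finset.mem_image.1 hy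
      replace hx := mem_seg.1 hx
      have h2 := off_succ_point p
      rw [hc p.1 p.2 ⟨x.1 - off (Γ.piece p.1).bottom p.2, by
        change _ < Γ.label (edgeOf p)
        omega⟩ x (by simp only; omega)]
      exact Finset.orderEmbOfFin_mem _ _ _
    · rw [γ.2.card, Finset.card_image_of_injective _ (c p.1).injective, card_segAt]
  have hcs : ∀ x ∈ Γ.thick, ∀ i, Γ.letters x = some i → c (x.1 + 1) i.lo < c (x.1 + 1) i.hi := by
    intro x hx i hi
    obtain ⟨i', hi', h1⟩ := letters_thick hx
    obtain rfl : i = i' := Option.some_injective _ (hi.symm.trans hi')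
    have h2 := mem_thick.1 hx
    rw [Γ.glue] at h2 h1
    obtain ⟨h3, h4⟩ := List.getElem?_eq_some_iff.1 h2
    have h5 : Γ.label (edgeOf ⟨x.1 + 1, ⟨x.2, h3⟩⟩) = 2 := by
      change (((Γ.piece (x.1 + 1)).bottom[(x.2 : ℕ)] : ℕ+) : ℕ) = 2
      rw [h4]
      rfl
    rw [hc _ ⟨x.2, h3⟩ ⟨0, by omega⟩ i.lo (by simp [Letter.lo, h1]),
      hc _ ⟨x.2, h3⟩ ⟨1, by omega⟩ i.hi (by simp [Letter.hi, h1])]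
    exact (Finset.orderEmbOfFin _ _).strictMono (by simp [Fin.lt_def])
  refine ⟨c, ⟨hcc, hcs⟩, fun c' hc' => ?_⟩
  obtain ⟨hcc', hcs'⟩ := hc'
  -- Every height is the top of some slab, where thin strands determine their pigment, and thick
  -- ones do so through the order on the pair.
  have key : ∀ h x, c' (h + 1) x = c (h + 1) x := by
    intro h x
    obtain ⟨k, hk, hx⟩ := exists_off_le (L := (Γ.piece h).top) (x := x.1)
      (by rw [off_top]; exact x.2)
    have h1 := (hcc'.top h k hk).trans (hcc.top h k hk).symm
    have h2 : (Γ.piece h).top[k]? = some ((Γ.piece h).top[k]) := List.getElem?_eq_getElem hk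
    rcases (hΓ.piece h).2 _ (List.getElem_mem hk) with h3 | h3
    · rw [h3] at h2
      have h4 := off_succ h2
      simp only [PNat.val_ofNat] at h4
      rw [seg_eq_singleton h2 (x := x) (by omega), Finset.image_singleton,
        Finset.image_singleton] at h1
      exact Finset.singleton_injective h1
    · rw [h3] at h2
      let z : Fin (Γ.n + 1) × Fin (Γ.level + 1) := (h, ⟨k, hk.trans_le (length_top_le h)⟩)
      have hz : z ∈ Γ.thick := mem_thick.2 h2
      obtain ⟨i, hi, hi'⟩ := letters_thick hz
      have h4 := off_succ h2
      simp only [PNat.val_ofNat] at h4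
      have hlo : i.lo.1 = off (Γ.piece h).top k := hi'
      have hhi : i.hi.1 = off (Γ.piece h).top k + 1 := congrArg (· + 1) hi'
      rw [seg_eq_pair h2 hlo hhi,
        image_pair_eq_iff ((c' (h + 1)).injective.ne i.lo_ne_hi)] at h1
      have h5 := hcs z hz i hi
      have h6 := hcs' z hz i hi
      rcases h1 with h1 | h1
      · have h7 : x = i.lo ∨ x = i.hi := by
          rw [Fin.ext_iff, Fin.ext_iff]
          omega
        rcases h7 with rfl | rfl
        exacts [h1.1, h1.2]
      · change c' (h + 1) i.lo < c' (h + 1) i.hi at h6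
        rw [h1.1, h1.2] at h6
        exact absurd h5 h6.not_gt
  funext h
  have := fun x => key (h - 1) x
  simp only [sub_add_cancel] at this
  exact Equiv.ext this

end Sorted

/-! ### The trace form as a sum over colorings. -/

section Form

variable {R : Type*} [CommRing R] [IsDomain R]

open Classical in
theorem slabMat_prod_eq_zero (hΓ : Γ.IsElementary) (h : ¬∃ γ, Compat γ c) :
    ∏ h, slabMat (gen (n := Γ.level) R) Γ.letters h (c h) (c (up Γ.n h)) = 0 := by
  rw [← near_iff_exists_compat hΓ, not_forall] at h
  obtain ⟨h, hh⟩ := h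
  refine Finset.prod_eq_zero (Finset.mem_univ h) ?_
  rw [slabMat_apply (disjoint_letters hΓ)]
  exact if_neg hh

theorem exists_compat_of_slabMat_ne_zero (hΓ : Γ.IsElementary)
    (h : ∀ h, slabMat (gen (n := Γ.level) R) Γ.letters h (c h) (c (up Γ.n h)) ≠ 0) :
    ∃ γ, Compat γ c := by
  by_contra hne
  exact Finset.prod_ne_zero_iff.2 (fun g _ => h g) (slabMat_prod_eq_zero (R := R) hΓ hne)

/-- The dumbbells of the split vertices contribute exactly the denominator of the evaluation; those
of thick strands are auxiliary. -/
theorem prod_entry_splitPos (hΓ : Γ.IsElementary) {γ : Γ.Coloring} (hc : Compat γ c) :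
    ∏ v : Γ.SplitVertex, entry (gen (n := Γ.level) R) (c (v.1 + 1)) (Γ.letters (Γ.splitPos v)) =
      (algebraMap (MvPolynomial (Fin Γ.level) R) (Γ.RatFun R) (γ.Q R))⁻¹ := by
  rw [Coloring.Q, map_prod, ← Finset.prod_inv_distrib]
  refine Finset.prod_congr rfl fun v _ => ?_
  obtain ⟨i, hi, hi'⟩ := letters_splitPos v
  obtain ⟨-, h1, h2⟩ := (hΓ.piece v.1).split v.2
  have h3 := off_succ h1
  simp only [PNat.val_ofNat] at h3
  have hl := hc.top v.1 _ (Nat.lt_of_succ_lt (Piece.pos_succ_lt_top_of_isSplit v.2))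
  have hr := hc.top v.1 _ (Piece.pos_succ_lt_top_of_isSplit v.2)
  rw [seg_eq_singleton h1 (x := i.lo) hi', Finset.image_singleton] at hl
  rw [seg_eq_singleton h2 (x := i.hi) (by rw [h3, ← hi']; rfl), Finset.image_singleton] at hr
  rw [SplitVertex.left, SplitVertex.right, ← hl, ← hr, Finset.prod_singleton,
    Finset.prod_singleton, map_sub, hi]
  rfl

theorem slabMat_prod (hΓ : Γ.IsElementary) {γ : Γ.Coloring} (hc : Compat γ c) :
    ∏ h, slabMat (gen (n := Γ.level) R) Γ.letters h (c h) (c (up Γ.n h)) =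
      (∏ x ∈ Γ.thick, entry (gen (n := Γ.level) R) (c (x.1 + 1)) (Γ.letters x)) *
      (algebraMap (MvPolynomial (Fin Γ.level) R) (Γ.RatFun R) (γ.Q R))⁻¹ := by
  classical
  have h1 : ∀ h, slabMat (gen (n := Γ.level) R) Γ.letters h (c h) (c (up Γ.n h)) =
      ∏ i, entry (gen (n := Γ.level) R) (c (h + 1)) (Γ.letters (h, i)) := by
    intro h
    rw [slabMat_apply (disjoint_letters hΓ)]
    exact if_pos ((near_iff_exists_compat hΓ).2 ⟨γ, hc⟩ h)
  have h2 : ∏ v : Γ.SplitVertex,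
      entry (gen (n := Γ.level) R) (c (v.1 + 1)) (Γ.letters (Γ.splitPos v)) =
      ∏ x ∈ Finset.univ.map Γ.splitPos,
        entry (gen (n := Γ.level) R) (c (x.1 + 1)) (Γ.letters x) := by
    rw [Finset.prod_map]
    rfl
  rw [Finset.prod_congr rfl fun h _ => h1 h, ← prod_entry_splitPos hΓ hc, h2,
    ← Fintype.prod_prod_type' fun h i =>
      entry (gen (n := Γ.level) R) (c (h + 1)) (Γ.letters (h, i)),
    ← Finset.prod_union (disjoint_thick_splitPos hΓ), ← wordSupp_letters]
  symm
  refine Finset.prod_subset (Finset.subset_univ _) fun x _ hx => ?_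
  rw [mem_wordSupp, Option.not_isSome_iff_eq_none] at hx
  rw [hx]
  rfl

open Classical in
/-- The trace form of a graph as a sum over the colorings. -/
theorem form_letters (hΓ : Γ.IsElementary) (y : MvPolynomial (Fin (Γ.n + 1) × Fin Γ.level) R) :
    form R (gen R) (up Γ.n) (slabMat (gen R) Γ.letters) y =
      ∑ γ : Γ.Coloring, (∑ c with Compat γ c,
        (∏ x ∈ Γ.thick, entry (gen (n := Γ.level) R) (c (x.1 + 1)) (Γ.letters x)) *
          evp R (gen R) c y) *
        (algebraMap (MvPolynomial (Fin Γ.level) R) (Γ.RatFun R) (γ.Q R))⁻¹ := by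
  rw [form_apply, cyc]
  simp only [Finset.sum_mul, Finset.sum_filter]
  rw [Finset.sum_comm]
  refine Finset.sum_congr rfl fun c _ => ?_
  by_cases h : ∃ γ, Compat γ c
  · obtain ⟨γ, hγ⟩ := h
    rw [slabMat_prod hΓ hγ, Finset.sum_eq_single γ]
    · rw [if_pos hγ]
      ring
    · intro γ' _ hne
      rw [if_neg fun h' : Compat γ' c => hne (h'.unique hγ), zero_mul]
    · intro h
      exact absurd (Finset.mem_univ _) h
  · rw [slabMat_prod_eq_zero hΓ h, zero_mul, Finset.sum_eq_zero]
    intro γ _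
    rw [if_neg fun h' => h ⟨γ, h'⟩, zero_mul]

theorem entry_flip_of_ne (hΓ : Γ.IsElementary) (hx : x ≠ x') :
    entry (gen (n := Γ.level) R) (Γ.flip x c (x'.1 + 1)) (Γ.letters x') =
      entry (gen (n := Γ.level) R) (c (x'.1 + 1)) (Γ.letters x') := by
  rcases h : Γ.letters x' with _ | i
  · simp only [entry, Option.elim_none]
  · have h1 := fun j => flip_apply_of_ne (c := c) (j := j) hΓ hx
    simp only [h, slots, Finset.mem_insert, Finset.mem_singleton] at h1
    simp only [entry, Option.elim_some, h1 _ (Or.inl rfl), h1 _ (Or.inr rfl)]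

theorem entry_flip (hx : x ∈ Γ.thick) :
    entry (gen (n := Γ.level) R) (Γ.flip x c (x.1 + 1)) (Γ.letters x) =
      -entry (gen (n := Γ.level) R) (c (x.1 + 1)) (Γ.letters x) := by
  obtain ⟨i, hi, -⟩ := letters_thick hx
  simp only [entry, hi, Option.elim_some, flip_lo hi, flip_hi hi]
  rw [← inv_neg, neg_sub]

/-- The trace form vanishes on the polynomials invariant under an exchange. -/
theorem form_eq_zero (hΓ : Γ.IsElementary) (hx : x ∈ Γ.thick)
    {y : MvPolynomial (Fin (Γ.n + 1) × Fin Γ.level) R}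
    (hy : ∀ γ c, Compat γ c → evp R (gen (n := Γ.level) R) (Γ.flip x c) y = evp R (gen R) c y) :
    form R (gen R) (up Γ.n) (slabMat (gen R) Γ.letters) y = 0 := by
  classical
  rw [form_letters hΓ]
  refine Finset.sum_eq_zero fun γ _ => ?_
  rw [Finset.sum_involution (fun c _ => Γ.flip x c), zero_mul]
  · intro c hc
    rw [hy γ c (Finset.mem_filter.1 hc).2, ← Finset.mul_prod_erase _ _ hx,
      ← Finset.mul_prod_erase _ _ hx, entry_flip hx, Finset.prod_congr rfl fun x' hx' =>
        entry_flip_of_ne hΓ (Finset.ne_of_mem_erase hx').symm]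
    ring
  · intro c _ _ h
    obtain ⟨i, hi, -⟩ := letters_thick hx
    have := flip_lo (c := c) hi
    rw [h] at this
    exact i.lo_ne_hi ((c _).injective this)
  · intro c hc
    rw [Finset.mem_filter] at hc ⊢
    exact ⟨Finset.mem_univ _, hc.2.flip hx⟩
  · intro c _
    exact flip_flip

variable (Γ R) in
/-- The variable of the right slot of a dumbbell, above it. -/
def rightVar (x : Fin (Γ.n + 1) × Fin (Γ.level + 1)) :
    MvPolynomial (Fin (Γ.n + 1) × Fin Γ.level) R :=
  (Γ.letters x).elim 1 fun i => var R (x.1 + 1) i.hi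

theorem evp_rightVar_flip (hΓ : Γ.IsElementary) (hx : x ≠ x') :
    evp R (gen (n := Γ.level) R) (Γ.flip x c) (Γ.rightVar R x') =
      evp R (gen R) c (Γ.rightVar R x') := by
  rcases h : Γ.letters x' with _ | i
  · simp [rightVar, h]
  · have h1 := fun j => flip_apply_of_ne (c := c) (j := j) hΓ hx
    simp only [h, slots, Finset.mem_insert, Finset.mem_singleton] at h1
    simp only [rightVar, h, Option.elim_some, evp_X, h1 _ (Or.inr rfl)]

/-- At a thick strand the two orders of the pigments contribute x_hi / (x_lo - x_hi) + x_lo / (x_hi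
- x_lo) = -1. So the paths over one coloring factorize, and one sorted path remains with weight (-1)
to the number of thick strands. -/
theorem form_prod_rightVar (hΓ : Γ.IsElementary) (y : Γ.DecoratedSpace R) :
    form R (gen R) (up Γ.n) (slabMat (gen R) Γ.letters)
      ((∏ x ∈ Γ.thick, Γ.rightVar R x) * Γ.chi R y) =
      (-1) ^ Γ.thick.card * Γ.evalInfty R y := by
  classical
  rw [form_letters hΓ, evalInfty_apply, Finset.mul_sum]
  refine Finset.sum_congr rfl fun γ _ => ?_
  let p : Fin (Γ.n + 1) × Fin (Γ.level + 1) → (Fin (Γ.n + 1) → Perm (Fin Γ.level)) → Prop :=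
    fun x c => ∀ i, Γ.letters x = some i → c (x.1 + 1) i.lo < c (x.1 + 1) i.hi
  let G : Fin (Γ.n + 1) × Fin (Γ.level + 1) → (Fin (Γ.n + 1) → Perm (Fin Γ.level)) →
      Γ.RatFun R := fun x c => entry (gen (n := Γ.level) R) (c (x.1 + 1)) (Γ.letters x) *
    evp R (gen R) c (Γ.rightVar R x)
  have h1 : ∑ c with Compat γ c,
      (∏ x ∈ Γ.thick, entry (gen (n := Γ.level) R) (c (x.1 + 1)) (Γ.letters x)) *
        evp R (gen R) c ((∏ x ∈ Γ.thick, Γ.rightVar R x) * Γ.chi R y) =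
      (∑ c with Compat γ c, ∏ x ∈ Γ.thick, G x c) *
        algebraMap (MvPolynomial (Fin Γ.level) R) (Γ.RatFun R) (γ.P R y) := by
    rw [Finset.sum_mul]
    refine Finset.sum_congr rfl fun c hc => ?_
    rw [map_mul, evp_chi (Finset.mem_filter.1 hc).2, map_prod, Finset.prod_mul_distrib]
    ring
  have h2 : ∑ c with Compat γ c, ∏ x ∈ Γ.thick, G x c = (-1) ^ Γ.thick.card := by
    rw [sum_prod_flip (E := Γ.thick) Γ.flip (fun _ _ _ => flip_flip) p ?_ G ?_ (fun _ => -1) _ ?_ ?_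
      ?_, Finset.sum_const, Finset.prod_const]
    · refine (congrArg (· • _) ?_).trans (one_smul ℕ _)
      obtain ⟨c, hc, hu⟩ := existsUnique_sorted γ hΓ
      rw [Finset.card_eq_one]
      refine ⟨c, Finset.ext fun c' => ?_⟩
      simp only [Finset.mem_filter, Finset.mem_univ, true_and, Finset.mem_singleton]
      exact ⟨hu c', fun h => h ▸ hc⟩
    · intro x _ k _ hk c
      refine forall_congr' fun i => imp_congr_right fun hi => ?_
      have h1 := fun j => flip_apply_of_ne (c := c) (j := j) hΓ hk.symm
      simp only [hi, slots, Finset.mem_insert, Finset.mem_singleton] at h1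
      rw [h1 _ (Or.inl rfl), h1 _ (Or.inr rfl)]
    · intro x _ k _ hk c
      simp only [G]
      rw [entry_flip_of_ne hΓ hk.symm, evp_rightVar_flip hΓ hk.symm]
    · intro x hx c hc
      rw [Finset.mem_filter] at hc ⊢
      exact ⟨Finset.mem_univ _, hc.2.flip hx⟩
    · intro x hx c _
      obtain ⟨i, hi, -⟩ := letters_thick hx
      have h3 : ∀ c, p x c ↔ c (x.1 + 1) i.lo < c (x.1 + 1) i.hi := by
        intro c
        constructor
        · exact fun h => h i hi
        · intro h i' hi'
          obtain rfl := Option.some_injective _ (hi.symm.trans hi')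
          exact h
      rw [h3, h3, flip_lo hi, flip_hi hi, not_lt]
      exact ⟨le_of_lt, fun h => lt_of_le_of_ne h fun e => i.lo_ne_hi ((c _).injective e).symm⟩
    · intro x hx c _
      obtain ⟨i, hi, -⟩ := letters_thick hx
      have h3 : gen R (c (x.1 + 1) i.lo) - gen (n := Γ.level) R (c (x.1 + 1) i.hi) ≠ 0 :=
        sub_ne_zero.2 fun e => i.lo_ne_hi ((c _).injective (gen_injective e))
      simp only [G]
      rw [entry_flip hx]
      simp only [entry, hi, Option.elim_some, rightVar, evp_X, flip_hi hi]
      field_simp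
      ring
  rw [h1, h2, div_eq_mul_inv]
  ring

end Form

end VinylGraph

end Vinyl

end

/-! ### Descent from the word of dumbbells to the graph. -/

noncomputable section

namespace Vinyl

open NilHecke

/-- The sum of the variables. -/
def sumVar (R : Type*) [CommRing R] (a : ℕ) : SymPoly R a :=
  ⟨∑ k, MvPolynomial.X k, (MvPolynomial.mem_symmetricSubalgebra _).2 fun e => by
    simpa using Equiv.sum_comp e fun k => (MvPolynomial.X k : MvPolynomial (Fin a) R)⟩

/-- The product of the variables. -/
def prodVar (R : Type*) [CommRing R] (a : ℕ) : SymPoly R a :=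
  ⟨∏ k, MvPolynomial.X k, (MvPolynomial.mem_symmetricSubalgebra _).2 fun e => by
    simpa using Equiv.prod_comp e fun k => (MvPolynomial.X k : MvPolynomial (Fin a) R)⟩

namespace VinylGraph

open Equiv

variable {R : Type*} [CommRing R] {Γ : VinylGraph}

open Classical in
/-- The graph with a single decorated edge. -/
def single (e : Γ.Edge) (f : SymPoly R (Γ.label e)) : Γ.DecoratedSpace R :=
  decorated (Function.update 1 e f)

theorem P_single (γ : Γ.Coloring) (e : Γ.Edge) (f : SymPoly R (Γ.label e)) :
    γ.P R (single e f) = MvPolynomial.rename ((γ.1 e).orderEmbOfFin (γ.2.card e))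
      (f : MvPolynomial (Fin (Γ.label e)) R) := by
  classical
  rw [single, Coloring.P_tprod, Finset.prod_eq_single e]
  · rw [Function.update_self]
  · intro e' _ he
    rw [Function.update_of_ne he]
    simp
  · simp

theorem P_single_sumVar (γ : Γ.Coloring) (e : Γ.Edge) :
    γ.P R (single e (sumVar R _)) = ∑ i ∈ γ.1 e, MvPolynomial.X i := by
  rw [P_single, sumVar, map_sum]
  simp only [MvPolynomial.rename_X]
  conv_rhs => rw [← Finset.image_orderEmbOfFin_univ (γ.1 e) (γ.2.card e)]
  rw [Finset.sum_image (Finset.orderEmbOfFin _ _).injective.injOn]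

theorem P_single_prodVar (γ : Γ.Coloring) (e : Γ.Edge) :
    γ.P R (single e (prodVar R _)) = ∏ i ∈ γ.1 e, MvPolynomial.X i := by
  rw [P_single, prodVar, map_prod]
  simp only [MvPolynomial.rename_X]
  conv_rhs => rw [← Finset.image_orderEmbOfFin_univ (γ.1 e) (γ.2.card e)]
  rw [Finset.prod_image (Finset.orderEmbOfFin _ _).injective.injOn]

variable [IsDomain R] {γ : Γ.Coloring} {c : Fin (Γ.n + 1) → Perm (Fin Γ.level)}

theorem evp_chi_sumVar (hc : Compat γ c) (e : Γ.Edge) :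
    evp R (gen (n := Γ.level) R) c (Γ.chi R (single e (sumVar R _))) =
      ∑ i ∈ γ.1 e, gen R i := by
  rw [evp_chi hc, P_single_sumVar, map_sum]
  rfl

theorem evp_chi_prodVar (hc : Compat γ c) (e : Γ.Edge) :
    evp R (gen (n := Γ.level) R) c (Γ.chi R (single e (prodVar R _))) =
      ∏ i ∈ γ.1 e, gen R i := by
  rw [evp_chi hc, P_single_prodVar, map_prod]
  rfl

theorem evp_rightVar {x : Fin (Γ.n + 1) × Fin (Γ.level + 1)} {i : Letter Γ.level}
    (hi : Γ.letters x = some i) :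
    evp R (gen (n := Γ.level) R) c (Γ.rightVar R x) = gen R (c (x.1 + 1) i.hi) := by
  simp [rightVar, hi]

/-- The pigments of a thick strand at the top of a slab. -/
theorem Compat.thick (hc : Compat γ c) {x : Fin (Γ.n + 1) × Fin (Γ.level + 1)}
    (hx : x ∈ Γ.thick) {i : Letter Γ.level} (hi : Γ.letters x = some i) :
    γ.1 (Γ.edgeAbove x.1 x.2 (List.getElem?_eq_some_iff.1 (mem_thick.1 hx)).1) =
      {c (x.1 + 1) i.lo, c (x.1 + 1) i.hi} := by
  obtain ⟨i', h1, h2⟩ := letters_thick hx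
  obtain rfl := Option.some_injective _ (hi.symm.trans h1)
  rw [← hc.top, seg_eq_pair (mem_thick.1 hx) (x := i.lo) (y := i.hi) h2 (congrArg (· + 1) h2),
    Finset.image_insert, Finset.image_singleton]

theorem mem_rad_graph (hΓ : Γ.IsElementary)
    {y : MvPolynomial (Fin (Γ.n + 1) × Fin Γ.level) R}
    (hy : ∀ γ c, Compat γ c → evp R (gen (n := Γ.level) R) c y = 0) :
    y ∈ rad (ker (noConst Γ.level R) (gen R) (up Γ.n) (slabMat (gen R) Γ.letters)) :=
  mem_rad_ker_of_forall fun c hc => by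
    obtain ⟨γ, hγ⟩ := exists_compat_of_slabMat_ne_zero hΓ hc
    exact hy γ c hγ

/-- The variable of a thin strand is a decoration of its edge. On a thick strand the left variable
is the sum, which is a decoration, minus the right variable. -/
theorem generators_graph (hΓ : Γ.IsElementary) (s : Fin (Γ.n + 1) × Fin Γ.level) :
    (∃ p, MvPolynomial.X s - Γ.chi R p ∈
      rad (ker (noConst Γ.level R) (gen R) (up Γ.n) (slabMat (gen R) Γ.letters))) ∨
    ∃ x ∈ Γ.thick, ∃ p p', MvPolynomial.X s - (Γ.chi R p + Γ.rightVar R x * Γ.chi R p') ∈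
      rad (ker (noConst Γ.level R) (gen R) (up Γ.n) (slabMat (gen R) Γ.letters)) := by
  obtain ⟨h, s⟩ := s
  obtain ⟨h, rfl⟩ : ∃ h', h = h' + 1 := ⟨h - 1, (sub_add_cancel _ _).symm⟩
  obtain ⟨k, hk, hs⟩ := exists_off_le (L := (Γ.piece h).top) (x := s.1)
    (by rw [off_top]; exact s.2)
  have h2 : (Γ.piece h).top[k]? = some ((Γ.piece h).top[k]) := List.getElem?_eq_getElem hk
  rcases (hΓ.piece h).2 _ (List.getElem_mem hk) with h3 | h3
  · left
    rw [h3] at h2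
    refine ⟨single (Γ.edgeAbove h k hk) (sumVar R _), mem_rad_graph hΓ fun γ c hc => ?_⟩
    have h4 := off_succ h2
    simp only [PNat.val_ofNat] at h4
    rw [map_sub, evp_chi_sumVar hc, ← hc.top h k hk,
      seg_eq_singleton h2 (x := s) (by omega), Finset.image_singleton, Finset.sum_singleton,
      evp_X, sub_self]
  · right
    rw [h3] at h2
    have hx : (h, ⟨k, hk.trans_le (length_top_le h)⟩) ∈ Γ.thick := mem_thick.2 h2
    refine ⟨_, hx, ?_⟩
    obtain ⟨i, hi, hi'⟩ := letters_thick hx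
    have h4 := off_succ h2
    simp only [PNat.val_ofNat] at h4
    have h7 : s = i.lo ∨ s = i.hi := by
      rw [Fin.ext_iff, Fin.ext_iff]
      simp only [Letter.lo, Letter.hi]
      simp only at hi'
      omega
    rcases h7 with rfl | rfl
    · refine ⟨single (Γ.edgeAbove h k hk) (sumVar R _), -1, mem_rad_graph hΓ fun γ c hc => ?_⟩
      rw [map_sub, map_add, map_mul, evp_chi_sumVar hc, evp_rightVar hi, hc.thick hx hi,
        Finset.sum_pair ((c _).injective.ne i.lo_ne_hi), evp_X]
      simp
    · refine ⟨0, 1, ?_⟩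
      simp [rightVar, hi]

/-- The right variable is a root of the quadratic polynomial whose coefficients are the symmetric
functions of the thick edge. -/
theorem rightVar_mul_self (hΓ : Γ.IsElementary) {x : Fin (Γ.n + 1) × Fin (Γ.level + 1)}
    (hx : x ∈ Γ.thick) : ∃ p p', Γ.rightVar R x * Γ.rightVar R x -
      (Γ.chi R p + Γ.rightVar R x * Γ.chi R p') ∈
        rad (ker (noConst Γ.level R) (gen R) (up Γ.n) (slabMat (gen R) Γ.letters)) := by
  obtain ⟨i, hi, -⟩ := letters_thick hx
  let e := Γ.edgeAbove x.1 x.2 (List.getElem?_eq_some_iff.1 (mem_thick.1 hx)).1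
  refine ⟨-single e (prodVar R _), single e (sumVar R _), mem_rad_graph hΓ fun γ c hc => ?_⟩
  have hne := (c (x.1 + 1)).injective.ne i.lo_ne_hi
  rw [map_sub, map_add, map_mul, map_mul, map_neg, map_neg, evp_chi_sumVar hc,
    evp_chi_prodVar hc, evp_rightVar hi, hc.thick hx hi, Finset.sum_pair hne,
    Finset.prod_pair hne]
  ring

/-- The squarefree monomials in the decorations of the right edges of the split vertices form a basis
modulo the radical. -/
theorem good_graph (hΓ : Γ.IsElementary) (hn : (Γ.level.factorial : R) ≠ 0) :
    Good ((noConst Γ.level R).comap (Γ.evalInfty R))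
      (lam (R := R) (Finset.univ : Finset Γ.SplitVertex) fun v => single v.right (sumVar R _)) := by
  classical
  have h1 := good_slabMat (disjoint_letters hΓ) (goodWord_stack hn Γ.letters)
  rw [wordSupp_letters] at h1
  -- Outside the positions of the split vertices the value 1 is a mere default.
  let d : Fin (Γ.n + 1) × Fin (Γ.level + 1) → Γ.DecoratedSpace R :=
    Function.extend Γ.splitPos (fun v => single v.right (sumVar R _)) 1
  have hd : ∀ v, d (Γ.splitPos v) = single v.right (sumVar R _) := fun v =>
    Γ.splitPos.injective.extend_apply _ _ v
  have h2 : Good ((noConst Γ.level R).comap (Γ.evalInfty R))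
      (lam (R := R) (Finset.univ.map Γ.splitPos) d) := by
    refine good_descend (Γ.chi R) (disjoint_thick_splitPos hΓ) (r := Γ.rightVar R) ?_ ?_ ?_ ?_ h1
    · exact mem_of_generators (Γ.chi R) (generators_graph hΓ) fun x hx => rightVar_mul_self hΓ hx
    · intro y
      rw [mem_ker, form_prod_rightVar hΓ, Submodule.mem_comap]
      rcases neg_one_pow_eq_or (Γ.RatFun R) Γ.thick.card with h | h
      · rw [h, one_mul]
      · rw [h, neg_one_mul, Submodule.neg_mem_iff]
    · intro B hB C hC hBC y
      -- A thick strand that occurs in neither product leaves the integrand invariant under its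
      -- exchange, so the trace vanishes.
      obtain ⟨x, hx, hx'⟩ : ∃ x ∈ Γ.thick, x ∉ B ∪ C := by
        by_contra hcon
        push Not at hcon
        exact hBC ((Finset.union_subset hB hC).antisymm hcon)
      rw [Finset.mem_union, not_or] at hx'
      rw [mem_ker, form_eq_zero hΓ hx]
      · exact Submodule.zero_mem _
      · intro γ c hc
        rw [map_mul, map_mul, map_mul, map_mul, map_prod, map_prod, map_prod, map_prod,
          evp_chi (hc.flip hx), evp_chi hc,
          Finset.prod_congr rfl fun x' hx'' =>
            evp_rightVar_flip (c := c) hΓ (ne_of_mem_of_not_mem hx'' hx'.1).symm,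
          Finset.prod_congr rfl fun x' hx'' =>
            evp_rightVar_flip (c := c) hΓ (ne_of_mem_of_not_mem hx'' hx'.2).symm]
    · intro x hx
      obtain ⟨v, -, rfl⟩ := Finset.mem_map.1 hx
      rw [hd]
      refine mem_rad_graph hΓ fun γ c hc => ?_
      obtain ⟨i, hi, hi'⟩ := letters_splitPos v
      obtain ⟨-, h3, h4⟩ := (hΓ.piece v.1).split v.2
      have h5 := off_succ h3
      simp only [PNat.val_ofNat] at h5
      have hr := hc.top v.1 _ (Piece.pos_succ_lt_top_of_isSplit v.2)
      rw [seg_eq_singleton h4 (x := i.hi) (by rw [h5, ← hi']; rfl), Finset.image_singleton] at hr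
      rw [map_sub, evp_rightVar hi, evp_chi_sumVar hc, SplitVertex.right, ← hr,
        Finset.sum_singleton]
      exact sub_self _
  rw [good_lam_map] at h2
  simpa only [hd] using h2

end VinylGraph

end Vinyl

end

noncomputable section

namespace Vinyl

open NilHecke

/-- A homogeneous component of q p is q times a component of p, or zero when the degree is too
small; neither has a constant term if p has none. -/
theorem exists_homogeneousComponent_mul {σ R : Type*} [CommRing R] {q : MvPolynomial σ R} {a : ℕ}
    (hq : q.IsHomogeneous a) (p : MvPolynomial σ R) (b : ℕ) :
    ∃ p' : MvPolynomial σ R, MvPolynomial.homogeneousComponent b (q * p) = q * p' ∧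
      (MvPolynomial.constantCoeff p = 0 → MvPolynomial.constantCoeff p' = 0) := by
  have h1 : MvPolynomial.homogeneousComponent b (q * p) =
      ∑ k ∈ Finset.range (p.totalDegree + 1),
        if b = a + k then q * MvPolynomial.homogeneousComponent k p else 0 := by
    conv_lhs => rw [← MvPolynomial.sum_homogeneousComponent p]
    rw [Finset.mul_sum, map_sum]
    refine Finset.sum_congr rfl fun k _ => ?_
    rw [MvPolynomial.homogeneousComponent_of_mem
      (hq.mul (MvPolynomial.homogeneousComponent_isHomogeneous k p))]
  refine ⟨∑ k ∈ Finset.range (p.totalDegree + 1),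
    if b = a + k then MvPolynomial.homogeneousComponent k p else 0, ?_, fun hp => ?_⟩
  · rw [h1, Finset.mul_sum]
    exact Finset.sum_congr rfl fun k _ => by split_ifs <;> simp
  · rw [map_sum]
    refine Finset.sum_eq_zero fun k _ => ?_
    split_ifs
    · rw [MvPolynomial.constantCoeff_eq, MvPolynomial.coeff_homogeneousComponent]
      rw [MvPolynomial.constantCoeff_eq] at hp
      split_ifs
      exacts [hp, rfl]
    · simp

namespace VinylGraph

/-! ### Homogeneous parts -/

variable (R : Type*) [CommRing R] (Γ : VinylGraph)

/-- The span of the homogeneous decorations of a given degree. -/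
def hpart (j : ℕ) : Submodule R (Γ.DecoratedSpace R) :=
  Submodule.span R {y | ∃ (d : Γ.PreDecoration R) (m : Γ.Edge → ℕ),
    (∀ e, (d e : MvPolynomial (Fin (Γ.label e)) R).IsHomogeneous (m e)) ∧ ∑ e, m e = j ∧
      y = decorated d}

variable {R Γ}

theorem decorated_mem_hpart {d : Γ.PreDecoration R} {m : Γ.Edge → ℕ}
    (hd : ∀ e, (d e : MvPolynomial (Fin (Γ.label e)) R).IsHomogeneous (m e)) :
    decorated d ∈ hpart R Γ (∑ e, m e) :=
  Submodule.subset_span ⟨d, m, hd, rfl, rfl⟩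

theorem decorated_mul_mem_hpart {d : Γ.PreDecoration R} {m : Γ.Edge → ℕ}
    (hd : ∀ e, (d e : MvPolynomial (Fin (Γ.label e)) R).IsHomogeneous (m e)) {j : ℕ}
    {y : Γ.DecoratedSpace R} (hy : y ∈ hpart R Γ j) :
    decorated d * y ∈ hpart R Γ (j + ∑ e, m e) := by
  suffices h : hpart R Γ j ≤
      (hpart R Γ (j + ∑ e, m e)).comap (LinearMap.mulLeft R (decorated d)) from h hy
  refine Submodule.span_le.2 ?_
  rintro _ ⟨d', m', hd', rfl, rfl⟩
  rw [SetLike.mem_coe, Submodule.mem_comap, LinearMap.mulLeft_apply, decorated_mul, add_comm,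
    ← Finset.sum_add_distrib]
  exact decorated_mem_hpart fun e => (hd e).mul (hd' e)

theorem P_isHomogeneous (γ : Γ.Coloring) {j : ℕ} {y : Γ.DecoratedSpace R}
    (hy : y ∈ hpart R Γ j) : (γ.P R y).IsHomogeneous j := by
  suffices h : hpart R Γ j ≤
      (MvPolynomial.homogeneousSubmodule (Fin Γ.level) R j).comap (γ.P R) from h hy
  refine Submodule.span_le.2 ?_
  rintro _ ⟨d, m, hd, rfl, rfl⟩
  rw [SetLike.mem_coe, Submodule.mem_comap, Coloring.P_tprod]
  exact MvPolynomial.IsHomogeneous.prod _ _ _ fun e _ => (hd e).rename_isHomogeneous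

theorem Q_isHomogeneous (γ : Γ.Coloring) : (γ.Q R).IsHomogeneous Γ.splitDegree := by
  have : Γ.splitDegree = ∑ v : Γ.SplitVertex, ∑ _i ∈ γ.1 v.left, ∑ _j ∈ γ.1 v.right, 1 := by
    simp [splitDegree, γ.2.card]
  rw [this]
  refine MvPolynomial.IsHomogeneous.prod _ _ _ fun v _ =>
    MvPolynomial.IsHomogeneous.prod _ _ _ fun i _ =>
      MvPolynomial.IsHomogeneous.prod _ _ _ fun j _ =>
        (MvPolynomial.isHomogeneous_X R i).sub (MvPolynomial.isHomogeneous_X R j)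

/-- The homogeneous components of a symmetric polynomial. -/
def symComponent {a : ℕ} (f : SymPoly R a) (m : ℕ) : SymPoly R a :=
  ⟨MvPolynomial.homogeneousComponent m f.1, (MvPolynomial.mem_symmetricSubalgebra _).2 fun e => by
    rw [MvPolynomial.rename_homogeneousComponent,
      (MvPolynomial.mem_symmetricSubalgebra _).1 f.2 e]⟩

theorem sum_symComponent {a : ℕ} (f : SymPoly R a) :
    ∑ m ∈ Finset.range (f.1.totalDegree + 1), symComponent f m = f := by
  refine Subtype.ext ?_
  rw [AddSubmonoidClass.coe_finsetSum]
  exact MvPolynomial.sum_homogeneousComponent f.1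

theorem span_isDecoration : Submodule.span R (decorated (R := R) (Γ := Γ) ''
    {d | IsDecoration d}) = ⊤ := by
  classical
  rw [← top_le_iff, ← span_decorated, Submodule.span_le]
  rintro _ ⟨d, rfl⟩
  suffices h : ∀ (F : Finset Γ.Edge) (d : Γ.PreDecoration R),
      (∀ e ∉ F, ∃ m, (d e : MvPolynomial (Fin (Γ.label e)) R).IsHomogeneous m) →
      decorated d ∈ Submodule.span R (decorated (R := R) (Γ := Γ) '' {d | IsDecoration d}) from
    h Finset.univ d fun e he => absurd (Finset.mem_univ e) he
  intro F
  induction F using Finset.induction_on with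
  | empty =>
    intro d hd
    exact Submodule.subset_span ⟨d, fun e => hd e (Finset.notMem_empty e), rfl⟩
  | insert e F _ ih =>
    intro d hd
    -- One edge at a time is replaced by the homogeneous components of its decoration.
    have h1 : decorated d = ∑ m ∈ Finset.range ((d e).1.totalDegree + 1),
        decorated (Function.update d e (symComponent (d e) m)) := by
      conv_lhs => rw [← Function.update_eq_self e d]
      conv_lhs => rw [← sum_symComponent (d e)]
      exact (PiTensorProduct.tprod R).map_update_sum _ _ _ _
    rw [h1]
    refine Submodule.sum_mem _ fun m _ => ih _ fun e' he' => ?_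
    by_cases h : e' = e
    · subst h
      rw [Function.update_self]
      exact ⟨m, MvPolynomial.homogeneousComponent_isHomogeneous m _⟩
    · rw [Function.update_of_ne h]
      exact hd e' (by simp [h, he'])

variable [IsDomain R]

theorem Q_ne_zero (hΓ : Γ.IsElementary) (γ : Γ.Coloring) : γ.Q R ≠ 0 := by
  obtain ⟨c, ⟨hc, -⟩, -⟩ := existsUnique_sorted γ hΓ
  have h1 := prod_entry_splitPos (R := R) hΓ hc
  intro h
  rw [h, map_zero, inv_zero, Finset.prod_eq_zero_iff] at h1
  obtain ⟨v, -, hv⟩ := h1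
  obtain ⟨i, hi, -⟩ := letters_splitPos v
  rw [hi, entry, Option.elim_some, inv_eq_zero, sub_eq_zero] at hv
  exact i.lo_ne_hi ((c _).injective (gen_injective hv))

/-- The product of the denominators of all colorings is a common homogeneous denominator. Degrees
can thus be compared on numerators, inside the polynomial ring. -/
theorem exists_numerator (hΓ : Γ.IsElementary) : ∃ (Q : MvPolynomial (Fin Γ.level) R) (a b : ℕ)
    (num : Γ.DecoratedSpace R →ₗ[R] MvPolynomial (Fin Γ.level) R), Q ≠ 0 ∧ Q.IsHomogeneous a ∧
      (∀ j, ∀ y ∈ hpart R Γ j, (num y).IsHomogeneous (j + b)) ∧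
      ∀ y, algebraMap (MvPolynomial (Fin Γ.level) R) (Γ.RatFun R) (num y) =
        algebraMap (MvPolynomial (Fin Γ.level) R) (Γ.RatFun R) Q * Γ.evalInfty R y := by
  classical
  refine ⟨∏ γ : Γ.Coloring, γ.Q R, ∑ _γ : Γ.Coloring, Γ.splitDegree,
    (Fintype.card Γ.Coloring - 1) * Γ.splitDegree,
    ∑ γ : Γ.Coloring, LinearMap.mulRight R (∏ γ' ∈ Finset.univ.erase γ, γ'.Q R) ∘ₗ γ.P R,
    Finset.prod_ne_zero_iff.2 fun γ _ => Q_ne_zero hΓ γ,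
    MvPolynomial.IsHomogeneous.prod _ _ _ fun γ _ => Q_isHomogeneous γ, fun j y hy => ?_,
    fun y => ?_⟩
  · rw [LinearMap.sum_apply]
    refine MvPolynomial.IsHomogeneous.sum _ _ _ fun γ _ => ?_
    refine (P_isHomogeneous γ hy).mul ?_
    have h := MvPolynomial.IsHomogeneous.prod (Finset.univ.erase γ) (fun γ' => γ'.Q R) _
      fun γ' _ => Q_isHomogeneous γ'
    rwa [Finset.sum_const, Finset.card_erase_of_mem (Finset.mem_univ γ), Finset.card_univ,
      smul_eq_mul] at h
  · rw [evalInfty_apply, LinearMap.sum_apply, map_sum, Finset.mul_sum]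
    refine Finset.sum_congr rfl fun γ _ => ?_
    have h : algebraMap (MvPolynomial (Fin Γ.level) R) (Γ.RatFun R) (γ.Q R) ≠ 0 := fun e =>
      Q_ne_zero hΓ γ (IsFractionRing.injective (MvPolynomial (Fin Γ.level) R) (Γ.RatFun R)
        (e.trans (map_zero _).symm))
    rw [LinearMap.comp_apply, LinearMap.mulRight_apply, map_mul,
      ← Finset.mul_prod_erase _ _ (Finset.mem_univ γ), map_mul]
    field_simp

/-- The elements whose evaluation is a polynomial without constant term. -/
abbrev evalKer (R : Type*) [CommRing R] [IsDomain R] (Γ : VinylGraph) :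
    Submodule R (Γ.DecoratedSpace R) :=
  (noConst Γ.level R).comap (Γ.evalInfty R)

/-- If the sum evaluates to a polynomial p, then its numerator is Q p. Taking the homogeneous
component in the degree of w j and cancelling Q shows that w j evaluates to a polynomial without
constant term. -/
theorem mem_evalKer_of_sum_mem (hΓ : Γ.IsElementary) {l : ℕ} {s : Finset ℕ}
    {w : ℕ → Γ.DecoratedSpace R} (hw : ∀ j, w j ∈ hpart R Γ (j + l))
    (h : ∑ j ∈ s, w j ∈ evalKer R Γ) {j : ℕ} (hj : j ∈ s) : w j ∈ evalKer R Γ := by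
  obtain ⟨Q, a, b, num, hQ, hQa, hb, hnum⟩ := exists_numerator (R := R) hΓ
  have inj := IsFractionRing.injective (MvPolynomial (Fin Γ.level) R) (Γ.RatFun R)
  obtain ⟨p, hp, hp0⟩ := mem_noConst.1 h
  have h1 : num (∑ j ∈ s, w j) = Q * p := inj (by rw [hnum, map_mul, hp])
  have h2 : MvPolynomial.homogeneousComponent (j + l + b) (num (∑ j ∈ s, w j)) = num (w j) := by
    rw [map_sum, map_sum, Finset.sum_eq_single j]
    · rw [MvPolynomial.homogeneousComponent_of_mem (hb _ _ (hw j)), if_pos rfl]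
    · intro k _ hk
      rw [MvPolynomial.homogeneousComponent_of_mem (hb _ _ (hw k)), if_neg (by omega)]
    · exact fun h => absurd hj h
  obtain ⟨p', hp', hc⟩ := exists_homogeneousComponent_mul hQa p (j + l + b)
  rw [h1, hp'] at h2
  have h3 : Γ.evalInfty R (w j) = algebraMap _ _ p' := by
    have h4 := hnum (w j)
    rw [← h2, map_mul] at h4
    exact (mul_left_cancel₀ (fun e => hQ (inj (e.trans (map_zero _).symm))) h4).symm
  rw [Submodule.mem_comap, h3, algebraMap_mem_noConst]
  refine hc ?_
  rw [← algebraMap_mem_noConst, hp]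
  exact h

theorem mem_rad_evalKer_iff {y : Γ.DecoratedSpace R} : y ∈ rad (evalKer R Γ) ↔
    ∀ d : Γ.PreDecoration R, IsDecoration d → decorated d * y ∈ evalKer R Γ := by
  constructor
  · exact fun h d _ => h _
  · intro h z
    suffices h' : ⊤ ≤ (evalKer R Γ).comap (LinearMap.mulRight R y) from h' Submodule.mem_top
    rw [← span_isDecoration, Submodule.span_le]
    rintro _ ⟨d, hd, rfl⟩
    exact h d hd

theorem mem_rad_evalKer_of_sum_mem (hΓ : Γ.IsElementary) {s : Finset ℕ}
    {w : ℕ → Γ.DecoratedSpace R} (hw : ∀ j, w j ∈ hpart R Γ j)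
    (h : ∑ j ∈ s, w j ∈ rad (evalKer R Γ)) {j : ℕ} (hj : j ∈ s) : w j ∈ rad (evalKer R Γ) := by
  rw [mem_rad_evalKer_iff]
  intro d hd
  choose m hm using hd
  refine mem_evalKer_of_sum_mem (w := fun j => decorated d * w j) (s := s) hΓ
    (fun j => decorated_mul_mem_hpart hm (hw j)) ?_ hj
  rw [← Finset.mul_sum]
  exact h _

/-- Both ideals test products for having a polynomial value without constant term; homogeneous
decorations suffice as test elements, since they span. -/
theorem mem_radical_iff {y : Γ.DecoratedSpace R} : y ∈ Γ.radical R ↔ y ∈ rad (evalKer R Γ) := by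
  rw [mem_rad_evalKer_iff]
  refine forall_congr' fun d => imp_congr_right fun _ => ?_
  rw [mul_comm, Submodule.mem_comap, mem_noConst]
  rfl

end VinylGraph

end Vinyl

end

noncomputable section

namespace Vinyl

open NilHecke

/-! ### Schur polynomials in one variable -/

theorem snd_eq_zero_of_rowLen {μ : YoungDiagram} (h : μ.rowLen 0 ≤ 1) (x : μ.cells) :
    x.1.2 = 0 := by
  have h1 : (0, x.1.2) ∈ μ := μ.up_left_mem (Nat.zero_le x.1.1) le_rfl x.2
  have := YoungDiagram.mem_iff_lt_rowLen.1 h1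
  omega

theorem fst_eq_zero_of_colLen {μ : YoungDiagram} (h : μ.colLen 0 ≤ 1) (x : μ.cells) :
    x.1.1 = 0 := by
  have h1 : (x.1.1, 0) ∈ μ := μ.up_left_mem le_rfl (Nat.zero_le x.1.2) x.2
  have := YoungDiagram.mem_iff_lt_colLen.1 h1
  omega

/-- A diagram with at most one column has exactly one filling by a single symbol, as the rows impose
no condition. -/
theorem schur_one_eq_pow (R : Type*) [CommRing R] {μ : YoungDiagram} (h : μ.rowLen 0 ≤ 1) :
    schur R 1 μ = MvPolynomial.X 0 ^ μ.cells.card := by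
  classical
  have hf : IsFilling μ fun _ => (0 : Fin 1) :=
    ⟨fun x y _ hxy => by
      rw [snd_eq_zero_of_rowLen h x, snd_eq_zero_of_rowLen h y] at hxy
      exact absurd hxy (lt_irrefl 0), fun _ _ _ _ => le_rfl⟩
  rw [schur, Fintype.sum_eq_single ⟨_, hf⟩ fun T hT => absurd (Subsingleton.elim _ _) hT]
  simp

/-- Only the empty diagram and the single box fit into a 1 × 1 square; they give 1 and the variable.
-/
theorem exists_schur_iff (R : Type*) [CommRing R] {a b : ℕ} (ha : a = 1) (hb : b = 1)
    {f : MvPolynomial (Fin a) R} :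
    (∃ μ ∈ diagrams a b, f = schur R a μ) ↔ f = 1 ∨ f = (sumVar R a).1 := by
  subst ha hb
  have hX : (sumVar R 1).1 = MvPolynomial.X 0 := by simp [sumVar]
  rw [hX]
  constructor
  · rintro ⟨μ, ⟨h1, h2⟩, rfl⟩
    rw [schur_one_eq_pow R h1]
    have hc : μ.cells.card ≤ 1 := by
      rw [Finset.card_le_one]
      intro x hx y hy
      exact Prod.ext
        ((fst_eq_zero_of_colLen h2 ⟨x, hx⟩).trans (fst_eq_zero_of_colLen h2 ⟨y, hy⟩).symm)
        ((snd_eq_zero_of_rowLen h1 ⟨x, hx⟩).trans (snd_eq_zero_of_rowLen h1 ⟨y, hy⟩).symm)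
    rcases Nat.le_one_iff_eq_zero_or_eq_one.1 hc with h | h
    · exact Or.inl (by rw [h, pow_zero])
    · exact Or.inr (by rw [h, pow_one])
  · have key : ∀ (μ : YoungDiagram), (∀ x ∈ μ, x = (0, 0)) → μ ∈ diagrams 1 1 := by
      intro μ h
      constructor
      · by_contra hc
        have := h (0, 1) (YoungDiagram.mem_iff_lt_rowLen.2 (by omega))
        simp at this
      · by_contra hc
        have := h (1, 0) (YoungDiagram.mem_iff_lt_colLen.2 (by omega))
        simp at this
    rintro (rfl | rfl)
    · have h := key ⊥ fun x hx => absurd hx (YoungDiagram.notMem_bot x)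
      exact ⟨⊥, h, by rw [schur_one_eq_pow R h.1]; simp⟩
    · let μ : YoungDiagram := ⟨{(0, 0)}, fun x y hxy hx => by
        simp only [Finset.coe_singleton, Set.mem_singleton_iff] at hx ⊢
        subst hx
        exact Prod.ext (Nat.le_zero.1 hxy.1) (Nat.le_zero.1 hxy.2)⟩
      have h : μ ∈ diagrams 1 1 := key μ fun x hx => by
        rw [← YoungDiagram.mem_cells] at hx
        exact Finset.mem_singleton.1 hx
      refine ⟨μ, h, ?_⟩
      rw [schur_one_eq_pow R h.1]
      simp [μ]

/-! ### The basis -/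

section Basis

variable {R A H : Type*} [CommRing R] [CommRing A] [Algebra R A] [Fintype H]

theorem linearIndependent_of_good {N J : Submodule R A} {ρ : H → A}
    (hJ : ∀ y, y ∈ J ↔ y ∈ rad N) (hg : Good N (lam (R := R) Finset.univ ρ)) :
    LinearIndependent R fun S : Finset H => J.mkQ (∏ h ∈ S, ρ h) := by
  rw [Fintype.linearIndependent_iff]
  intro v hv S
  refine (good_lam_iff.1 hg).1 v ?_ S (Finset.subset_univ S)
  rw [Finset.powerset_univ, ← hJ, ← Submodule.ker_mkQ J, LinearMap.mem_ker, map_sum, ← hv]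
  exact Finset.sum_congr rfl fun S _ => map_smul _ _ _

theorem exists_sub_mem_of_good {N : Submodule R A} {ρ : H → A}
    (hg : Good N (lam (R := R) Finset.univ ρ)) (y : A) :
    ∃ v : Finset H → R, y - ∑ S, v S • ∏ h ∈ S, ρ h ∈ rad N := by
  obtain ⟨v, hv⟩ := (good_lam_iff.1 hg).2 y
  exact ⟨v, by simpa only [Finset.powerset_univ] using hv⟩

end Basis

/-! ### The d.u.r. decorations as a homogeneous basis. -/

namespace VinylGraph

variable {R : Type*} [CommRing R] {Γ : VinylGraph}

theorem label_edgeAbove {i : Fin (Γ.n + 1)} {j : ℕ} {a : ℕ+} (h : (Γ.piece i).top[j]? = some a) :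
    Γ.label (Γ.edgeAbove i j (List.getElem?_eq_some_iff.1 h).1) = a := by
  have h1 := h
  rw [Γ.glue] at h1
  obtain ⟨h2, h3⟩ := List.getElem?_eq_some_iff.1 h1
  exact congrArg PNat.val h3

theorem label_left (hΓ : Γ.IsElementary) (v : Γ.SplitVertex) : Γ.label v.left = 1 :=
  label_edgeAbove ((hΓ.piece v.1).split v.2).2.1

theorem label_right (hΓ : Γ.IsElementary) (v : Γ.SplitVertex) : Γ.label v.right = 1 :=
  label_edgeAbove ((hΓ.piece v.1).split v.2).2.2

open Classical in
variable (R) in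
/-- The graph with a variable on the right edges of some split vertices. -/
def durDec (S : Finset Γ.SplitVertex) : Γ.PreDecoration R := fun e =>
  if ∃ v ∈ S, e = v.right then sumVar R _ else 1

theorem durDec_mem (hΓ : Γ.IsElementary) (S : Finset Γ.SplitVertex) :
    durDec R S ∈ Γ.DUR R := by
  constructor
  · intro v
    rw [exists_schur_iff R (label_right hΓ v) (label_left hΓ v), durDec]
    split_ifs
    exacts [Or.inr rfl, Or.inl rfl]
  · intro e he
    exact if_neg fun ⟨v, _, hv⟩ => he v hv

theorem exists_durDec_eq (hΓ : Γ.IsElementary) {d : Γ.PreDecoration R} (hd : d ∈ Γ.DUR R) :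
    ∃ S, durDec R S = d := by
  classical
  refine ⟨Finset.univ.filter fun v => d v.right = sumVar R _, funext fun e => ?_⟩
  rw [durDec]
  split_ifs with h
  · obtain ⟨v, hv, rfl⟩ := h
    exact (Finset.mem_filter.1 hv).2.symm
  · by_cases he : ∃ v : Γ.SplitVertex, e = v.right
    · obtain ⟨v, rfl⟩ := he
      have h1 := (exists_schur_iff R (label_right hΓ v) (label_left hΓ v)).1 (hd.1 v)
      rcases h1 with h1 | h1
      · exact (Subtype.ext h1).symm
      · exact absurd ⟨v, Finset.mem_filter.2 ⟨Finset.mem_univ v, Subtype.ext h1⟩, rfl⟩ h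
    · exact (hd.2 e fun v hv => he ⟨v, hv⟩).symm

theorem sumVar_isHomogeneous (a : ℕ) : (sumVar R a).1.IsHomogeneous 1 :=
  MvPolynomial.IsHomogeneous.sum _ _ _ fun k _ => MvPolynomial.isHomogeneous_X R k

theorem sumVar_ne_zero [Nontrivial R] {a : ℕ} (ha : a = 1) : (sumVar R a).1 ≠ 0 := by
  subst ha
  simp [sumVar, MvPolynomial.X_ne_zero]

variable [IsDomain R]

/-- Distinct split vertices have distinct right edges because the classes of their single-edge
decorations are distinct by linear independence. -/
theorem right_injective (hΓ : Γ.IsElementary) (hn : (Γ.level.factorial : R) ≠ 0) :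
    Function.Injective fun v : Γ.SplitVertex => v.right := by
  intro v v' h
  have h1 := (linearIndependent_of_good (fun y => mem_radical_iff) (good_graph hΓ hn)).injective
    (a₁ := {v}) (a₂ := {v'}) ?_
  · exact Finset.singleton_injective h1
  · simp only [Finset.prod_singleton]
    simp only at h
    rw [h]

/-- Since the right edges are distinct, no edge receives more than one factor. -/
theorem prod_single (hΓ : Γ.IsElementary) (hn : (Γ.level.factorial : R) ≠ 0)
    (S : Finset Γ.SplitVertex) :
    ∏ v ∈ S, single v.right (sumVar R _) = decorated (durDec R S) := by
  classical
  induction S using Finset.induction_on with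
  | empty =>
    have : durDec R (∅ : Finset Γ.SplitVertex) = 1 := by
      funext e
      simp [durDec]
    rw [this]
    rfl
  | insert v S hv ih =>
    rw [Finset.prod_insert hv, ih, single, decorated_mul]
    congr 1
    funext e
    rw [Pi.mul_apply, durDec, durDec]
    by_cases h : e = v.right
    · subst h
      rw [Function.update_self, if_neg, if_pos ⟨v, Finset.mem_insert_self v S, rfl⟩, mul_one]
      rintro ⟨v', hv', h⟩
      exact hv (right_injective hΓ hn h ▸ hv')
    · rw [Function.update_of_ne h, Pi.one_apply, one_mul]
      refine if_congr ?_ rfl rfl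
      constructor
      · rintro ⟨v', hv', h'⟩
        exact ⟨v', Finset.mem_insert_of_mem hv', h'⟩
      · rintro ⟨v', hv', h'⟩
        rcases Finset.mem_insert.1 hv' with rfl | hv'
        exacts [absurd h' h, ⟨v', hv', h'⟩]

omit [IsDomain R] in
open Classical in
theorem durDec_isHomogeneous (S : Finset Γ.SplitVertex) (e : Γ.Edge) :
    (durDec R S e : MvPolynomial (Fin (Γ.label e)) R).IsHomogeneous
      (if ∃ v ∈ S, e = v.right then 1 else 0) := by
  rw [durDec]
  split_ifs
  exacts [sumVar_isHomogeneous _, MvPolynomial.isHomogeneous_one _ _]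

open Classical in
theorem sum_ite_right (hΓ : Γ.IsElementary) (hn : (Γ.level.factorial : R) ≠ 0)
    (S : Finset Γ.SplitVertex) :
    ∑ e : Γ.Edge, (if ∃ v ∈ S, e = v.right then 1 else 0) = S.card := by
  rw [Finset.sum_boole, Nat.cast_id,
    ← Finset.card_image_of_injective S (right_injective (R := R) hΓ hn)]
  congr 1
  ext e
  simp only [Finset.mem_filter, Finset.mem_univ, true_and, Finset.mem_image]
  exact exists_congr fun v => and_congr_right fun _ => eq_comm

theorem degree_durDec (hΓ : Γ.IsElementary) (hn : (Γ.level.factorial : R) ≠ 0)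
    (S : Finset Γ.SplitVertex) : degree (durDec R S) = 2 * S.card - Γ.splitDegree := by
  classical
  rw [degree, ← sum_ite_right hΓ hn S, Nat.cast_sum]
  congr 2
  refine Finset.sum_congr rfl fun e _ => ?_
  rw [(durDec_isHomogeneous S e).totalDegree]
  by_cases h : ∃ v ∈ S, e = v.right
  · rw [show durDec R S e = sumVar R _ from if_pos h]
    obtain ⟨v, -, rfl⟩ := h
    exact sumVar_ne_zero (label_right hΓ v)
  · rw [show durDec R S e = 1 from if_neg h]
    exact one_ne_zero

/-- The homogeneous basis, indexed by the sets of split vertices. -/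
theorem isHomogeneousBasis_durDec (hΓ : Γ.IsElementary) (hn : (Γ.level.factorial : R) ≠ 0) :
    IsHomogeneousBasis (Γ.gradedPart R) (fun S : Finset Γ.SplitVertex => degree (durDec R S))
      (fun S => graphClass (durDec R S)) := by
  classical
  have hg := good_graph hΓ hn
  have hJ : ∀ y, y ∈ Γ.radical R ↔ y ∈ rad (evalKer R Γ) := fun y => mem_radical_iff
  have hli := linearIndependent_of_good hJ hg
  have hex := exists_sub_mem_of_good hg
  simp only [prod_single hΓ hn] at hli hex
  have hcl : ∀ (y : Γ.DecoratedSpace R) (v : Finset Γ.SplitVertex → R),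
      y - ∑ S, v S • decorated (durDec R S) ∈ rad (evalKer R Γ) →
      (Γ.radical R).mkQ y = ∑ S, v S • graphClass (durDec R S) := by
    intro y v h
    rw [← hJ, ← Submodule.ker_mkQ (Γ.radical R), LinearMap.mem_ker, map_sub, sub_eq_zero] at h
    rw [h, map_sum]
    exact Finset.sum_congr rfl fun S _ => map_smul _ _ _
  refine ⟨hli, ?_, fun k => le_antisymm ?_ ?_⟩
  · rw [← top_le_iff]
    rintro y -
    obtain ⟨y, rfl⟩ := Submodule.mkQ_surjective _ y
    obtain ⟨v, hv⟩ := hex y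
    rw [hcl y v hv]
    exact Submodule.sum_mem _ fun S _ =>
      Submodule.smul_mem _ _ (Submodule.subset_span (Set.mem_range_self S))
  · rw [Submodule.span_le]
    rintro _ ⟨S, hS, rfl⟩
    exact Submodule.subset_span ⟨_, ⟨fun e => ⟨_, durDec_isHomogeneous S e⟩, hS⟩, rfl⟩
  · rw [gradedPart, Submodule.span_le]
    rintro _ ⟨d, ⟨hd, hk⟩, rfl⟩
    rw [SetLike.mem_coe]
    -- A decoration with a zero factor has class zero, and its nominal degree carries no
    -- information, so it is set aside.
    by_cases h0 : ∃ e, d e = 0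
    · obtain ⟨e, he⟩ := h0
      have : graphClass d = 0 := by
        rw [graphClass]
        have h1 : decorated d = 0 := (PiTensorProduct.tprod R).map_coord_zero e he
        rw [h1, map_zero]
      rw [this]
      exact Submodule.zero_mem _
    · push Not at h0
      choose m hm using hd
      have hdeg : ∀ e, (d e : MvPolynomial (Fin (Γ.label e)) R).totalDegree = m e := fun e =>
        (hm e).totalDegree fun h => h0 e (Subtype.ext h)
      have hkm : k = 2 * ((∑ e, m e : ℕ) : ℤ) - Γ.splitDegree := by
        rw [← hk, degree, Nat.cast_sum]
        simp only [hdeg]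
      obtain ⟨v, hv⟩ := hex (decorated d)
      -- The degree j part of the relation that expands the decoration in the family.
      let w : ℕ → Γ.DecoratedSpace R := fun j => (if j = ∑ e, m e then decorated d else 0) -
        ∑ S with S.card = j, v S • decorated (durDec R S)
      have hw : ∀ j, w j ∈ hpart R Γ j := by
        intro j
        refine Submodule.sub_mem _ ?_ (Submodule.sum_mem _ fun S hS => Submodule.smul_mem _ _ ?_)
        · split_ifs with h
          · rw [h]
            exact decorated_mem_hpart hm
          · exact Submodule.zero_mem _
        · have := decorated_mem_hpart (durDec_isHomogeneous (R := R) S)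
          rwa [sum_ite_right hΓ hn, (Finset.mem_filter.1 hS).2] at this
      let s : Finset ℕ := Finset.range (max (∑ e, m e) (Fintype.card Γ.SplitVertex) + 1)
      have hs : ∀ S : Finset Γ.SplitVertex, S.card ∈ s := fun S => by
        have := S.card_le_univ
        simp only [s, Finset.mem_range]
        omega
      have hsum : ∑ j ∈ s, w j ∈ rad (evalKer R Γ) := by
        have h1 : ∑ j ∈ s, w j = decorated d - ∑ S, v S • decorated (durDec R S) := by
          rw [Finset.sum_sub_distrib, Finset.sum_ite_eq', if_pos,
            Finset.sum_fiberwise_of_maps_to fun S _ => hs S]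
          simp only [s, Finset.mem_range]
          omega
        rw [h1]
        exact hv
      -- In the other degrees the relation involves only members of the family, so linear
      -- independence makes their coefficients vanish.
      have hv0 : ∀ S, v S ≠ 0 → S.card = ∑ e, m e := by
        intro S hS
        by_contra hne
        have h1 := mem_rad_evalKer_of_sum_mem hΓ hw hsum (hs S)
        simp only [w, if_neg hne, zero_sub, Ideal.neg_mem_iff] at h1
        rw [← hJ, ← Submodule.ker_mkQ (Γ.radical R), LinearMap.mem_ker, map_sum] at h1
        have h2 := linearIndependent_iff'.1 hli (Finset.univ.filter fun S' => S'.card = S.card) v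
          ((Finset.sum_congr rfl fun S _ => (map_smul _ _ _).symm).trans h1) S (by simp)
        exact hS h2
      rw [graphClass, hcl _ v hv]
      refine Submodule.sum_mem _ fun S _ => ?_
      by_cases hS : v S = 0
      · rw [hS, zero_smul]
        exact Submodule.zero_mem _
      · refine Submodule.smul_mem _ _ (Submodule.subset_span ⟨S, ?_, rfl⟩)
        rw [Set.mem_ofPred_eq, degree_durDec hΓ hn, hv0 S hS, hkm]

/-- The d.u.r. set is reindexed by the sets of split vertices whose right edges carry the variable.
-/
theorem isDURGraph_of_factorial_ne_zero (hΓ : Γ.IsElementary)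
    (hn : (Γ.level.factorial : R) ≠ 0) : Γ.IsDURGraph R := by
  have h := isHomogeneousBasis_durDec hΓ hn
  have hinj : Function.Injective (durDec R (Γ := Γ)) := fun S S' e =>
    h.linearIndependent.injective (by simp only [e])
  let E : Finset Γ.SplitVertex ≃ Γ.DUR R := Equiv.ofBijective
    (fun S => ⟨durDec R S, durDec_mem hΓ S⟩)
    ⟨fun S S' e => hinj (congrArg Subtype.val e), fun d => by
      obtain ⟨S, hS⟩ := exists_durDec_eq hΓ d.2
      exact ⟨S, Subtype.ext hS⟩⟩
  have hE : (fun d : Γ.DUR R => graphClass d.1) ∘ E = fun S => graphClass (durDec R S) := rfl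
  refine ⟨?_, ?_, fun k => ?_⟩
  · rw [← linearIndependent_equiv E, hE]
    exact h.linearIndependent
  · rw [← E.surjective.range_comp, hE]
    exact h.span_eq_top
  · rw [← h.span_degree_eq k, ← hE, Set.image_comp]
    congr 2
    ext d
    constructor
    · intro hd
      obtain ⟨S, rfl⟩ := E.surjective d
      exact ⟨S, hd, rfl⟩
    · rintro ⟨S, hS, rfl⟩
      exact hS

end VinylGraph

/-- Bases and spans are preserved by extension of scalars. The tensor product is taken of the
integral state space, so no condition relating p and n enters. -/
theorem IsHomogeneousBasis.baseChange {R A M ι : Type*} [CommRing R] [CommRing A] [Algebra R A]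
    [AddCommGroup M] [Module R M] {𝒢 : ℤ → Submodule R M} {deg : ι → ℤ} {v : ι → M}
    (h : IsHomogeneousBasis 𝒢 deg v) :
    IsHomogeneousBasis (fun k => (𝒢 k).baseChange A) deg fun i => (1 : A) ⊗ₜ[R] v i := by
  let b : Module.Basis ι R M := Module.Basis.mk h.linearIndependent h.span_eq_top.ge
  have hb : (fun i => (1 : A) ⊗ₜ[R] v i) = b.baseChange A := by
    funext i
    rw [Module.Basis.baseChange_apply, Module.Basis.mk_apply]
  refine ⟨?_, ?_, fun k => ?_⟩
  · rw [hb]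
    exact (b.baseChange A).linearIndependent
  · rw [hb]
    exact (b.baseChange A).span_eq
  · rw [← h.span_degree_eq k, Submodule.baseChange_span, ← Set.image_comp]
    rfl

end Vinyl

end

theorem theorem1p1 (Γ : Vinyl.VinylGraph) (hΓ : Γ.IsElementary) :
    Γ.IsDURGraph ℤ ∧ Γ.IsDURGraph ℚ ∧
    (∀ (p : ℕ) [Fact p.Prime], Γ.level < p → Γ.IsDURGraph (ZMod p)) ∧
    (∀ (p : ℕ) [Fact p.Prime],
      Vinyl.IsHomogeneousBasis
        (fun k => (Γ.gradedPart ℤ k).baseChange (ZMod p))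
        (fun d : Γ.DUR ℤ => Vinyl.VinylGraph.degree d.1)
        (fun d : Γ.DUR ℤ =>
          ((1 : ZMod p) ⊗ₜ[ℤ] Vinyl.VinylGraph.graphClass d.1 :
            ZMod p ⊗[ℤ] Γ.StateSpace ℤ))) := by
  have hZ : Γ.IsDURGraph ℤ := Vinyl.VinylGraph.isDURGraph_of_factorial_ne_zero hΓ
    (Nat.cast_ne_zero.2 (Nat.factorial_ne_zero _))
  refine ⟨hZ, Vinyl.VinylGraph.isDURGraph_of_factorial_ne_zero hΓ
    (Nat.cast_ne_zero.2 (Nat.factorial_ne_zero _)), fun p hp hlt => ?_, fun p hp => ?_⟩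
  · refine Vinyl.VinylGraph.isDURGraph_of_factorial_ne_zero hΓ fun h => ?_
    -- A prime divides n! only if it is at most n.
    rw [ZMod.natCast_eq_zero_iff, hp.out.dvd_factorial] at h
    omega
  · exact hZ.baseChange
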